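/- For $k\ge 1$ let $CP(k)$ be the cocktail party graph, i.e. the complete multipartite graph $K_{2,\ldots,2}$ with $k$ classes of size $2$, and let $G+G'$ denote the disjoint union of the graphs $G$ and $G'$. Let $\mathcal H'$ be the set of all finite simple graphs without isolated vertices whose adjacency matrix has at most two eigenvalues (counted with multiplicity) different from $-2$ and $0$. A graph is determined by its adjacency spectrum if every finite simple graph whose adjacency matrix has the same eigenvalues with the same multiplicities is isomorphic to it. A graph $G\in\mathcal H'$ is not determined by its adjacency spectrum if and only if $G$ is isomorphic to one of the following: (i) the complete bipartite graph $K_{\ell,m}$ with $\ell\ge m\ge 1$, where $\ell m$ has a divisor $d$ with $m<d<\ell$; (ii) $G_4(k)=K_{1,4}+CP(k)$, $G_5(k+1,k)=CP(k+1)+CP(k)$, or $G_8(k,k)$, with $k\ge 2$, where $G_8(k,k)$ is obtained from $CP(k)+CP(k)$ by adding one new vertex adjacent to all other vertices; (iii) $G_3=K_{1,4}+K_{1,4}$, $G_5(4,2)=CP(4)+CP(2)$, the graph $G_{11}$, or the graph $G_{12}$, where $G_{11}$ and $G_{12}$ are the graphs with adjacency matrices $$ \left[\begin{array}{ccccccccc}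 0&0&0&0&0&1&1&0&0\\ 0&0&0&0&0&1&1&0&0\\ 0&0&0&0&0&0&0&1&1\\ 0&0&0&0&0&0&0&1&1\\ 0&0&0&0&0&1&1&1&1\\ 1&1&0&0&1&0&1&0&1\\ 1&1&0&0&1&1&0&1&0\\ 0&0&1&1&1&0&1&0&1\\ 0&0&1&1&1&1&0&1&0 \end{array}\right] \quad\text{and}\quad \left[\begin{array}{cccccccc} 0&0&0&0&0&0&1&0\\ 0&0&0&0&0&0&1&0\\ 0&0&0&0&0&0&0&1\\ 0&0&0&0&0&0&0&1\\ 0&0&0&0&0&0&1&1\\ 0&0&0&0&0&0&1&1\\ 1&1&0&0&1&1&0&1\\ 0&0&1&1&1&1&1&0 \end{array}\right], $$ respectively. -/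

import Mathlib

namespace TwoEig

open Classical in
/-- The adjacency spectrum of a finite graph: the multiset of eigenvalues of its adjacency
matrix, that is, the real roots of the characteristic polynomial with multiplicities. (The
matrix is real symmetric, so all its eigenvalues are real.) -/
noncomputable def adjSpectrum {V : Type*} [Fintype V] (G : SimpleGraph V) : Multiset ℝ :=
  (G.adjMatrix ℝ).charpoly.roots

/-- The class of finite graphs without isolated vertices whose adjacency matrix has at most two
eigenvalues, counted with multiplicity, different from `-2` and `0`. -/
def InH' {V : Type*} [Fintype V] (G : SimpleGraph V) : Prop :=
  ((adjSpectrum G).filter (fun x => x ≠ -2 ∧ x ≠ 0)).card ≤ 2 ∧ ∀ v, ∃ w, G.Adj v w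

/-- `G` is determined by its adjacency spectrum: every finite graph with the same spectrum
is isomorphic to `G`. -/
def IsDS {V : Type*} [Fintype V] (G : SimpleGraph V) : Prop :=
  ∀ (n : ℕ) (H : SimpleGraph (Fin n)), adjSpectrum H = adjSpectrum G → Nonempty (H ≃g G)

/-- The complete bipartite graph `K_{ℓ,m}`. -/
def K (l m : ℕ) : SimpleGraph (Fin l ⊕ Fin m) := completeBipartiteGraph (Fin l) (Fin m)

/-- The cocktail party graph: complete multipartite with `k` classes of size `2`. -/
def CP (k : ℕ) : SimpleGraph (Fin k × Fin 2) := SimpleGraph.completeEquipartiteGraph k 2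

/-- The cone over `G`: one new vertex, adjacent to all vertices of `G`. -/
def cone {V : Type*} (G : SimpleGraph V) : SimpleGraph (V ⊕ Unit) :=
  SimpleGraph.sum G ⊥ ⊔ completeBipartiteGraph V Unit

/-- `2 K_{1,4}`. -/
def G3 : SimpleGraph ((Fin 1 ⊕ Fin 4) ⊕ (Fin 1 ⊕ Fin 4)) := SimpleGraph.sum (K 1 4) (K 1 4)

/-- `K_{1,4} + CP(k)`. -/
def G4 (k : ℕ) : SimpleGraph ((Fin 1 ⊕ Fin 4) ⊕ (Fin k × Fin 2)) :=
  SimpleGraph.sum (K 1 4) (CP k)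

/-- `CP(k) + CP(ℓ)`. -/
def G5 (k l : ℕ) : SimpleGraph ((Fin k × Fin 2) ⊕ (Fin l × Fin 2)) :=
  SimpleGraph.sum (CP k) (CP l)

/-- The cone over `CP(k) + CP(ℓ)`. -/
def G8 (k l : ℕ) : SimpleGraph (((Fin k × Fin 2) ⊕ (Fin l × Fin 2)) ⊕ Unit) :=
  cone (G5 k l)

/-- The adjacency matrix of `G11`. -/
def M11 : Matrix (Fin 9) (Fin 9) ℕ :=
  !![0, 0, 0, 0, 0, 1, 1, 0, 0;
     0, 0, 0, 0, 0, 1, 1, 0, 0;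
     0, 0, 0, 0, 0, 0, 0, 1, 1;
     0, 0, 0, 0, 0, 0, 0, 1, 1;
     0, 0, 0, 0, 0, 1, 1, 1, 1;
     1, 1, 0, 0, 1, 0, 1, 0, 1;
     1, 1, 0, 0, 1, 1, 0, 1, 0;
     0, 0, 1, 1, 1, 0, 1, 0, 1;
     0, 0, 1, 1, 1, 1, 0, 1, 0]

/-- The adjacency matrix of `G12`. -/
def M12 : Matrix (Fin 8) (Fin 8) ℕ :=
  !![0, 0, 0, 0, 0, 0, 1, 0;
     0, 0, 0, 0, 0, 0, 1, 0;
     0, 0, 0, 0, 0, 0, 0, 1;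
     0, 0, 0, 0, 0, 0, 0, 1;
     0, 0, 0, 0, 0, 0, 1, 1;
     0, 0, 0, 0, 0, 0, 1, 1;
     1, 1, 0, 0, 1, 1, 0, 1;
     0, 0, 1, 1, 1, 1, 1, 0]

/-- The graph on `9` vertices with adjacency matrix `M11`. -/
def G11 : SimpleGraph (Fin 9) where
  Adj i j := M11 i j = 1
  symm := ⟨fun i j h => (congrFun (congrFun (show M11.transpose = M11 by decide) i) j).trans h⟩
  loopless := ⟨by show ∀ i, ¬ M11 i i = 1; decide⟩

/-- The graph on `8` vertices with adjacency matrix `M12`. -/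
def G12 : SimpleGraph (Fin 8) where
  Adj i j := M12 i j = 1
  symm := ⟨fun i j h => (congrFun (congrFun (show M12.transpose = M12 by decide) i) j).trans h⟩
  loopless := ⟨by show ∀ i, ¬ M12 i i = 1; decide⟩

end TwoEig

/-! ### Vertex vectors in the plane. -/

section
open scoped Classical
namespace TwoEig
open Finset

/-! Isolated vertices only contribute eigenvalues 0. A graph cospectral with G is therefore its core
(the nonisolated vertices) plus isolated vertices, and the core satisfies the same spectral
condition as G. It suffices to list all graphs of the class with their spectra and to look for
members of the list with the same nonzero eigenvalues.

The number of positive eigenvalues splits the class. A complete multipartite graph has at most one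
(`Eigenbasis.not_two_pos`); any other graph without isolated vertices has two
(`Eigenbasis.two_pos`), and then all further eigenvalues are -2 or 0.

Suppose there are two positive eigenvalues r and s. The matrix A² + 2A kills the eigenvalues 0 and
-2, so it is the Gram matrix of vectors in the plane, one for each vertex (`PD`). The squared length
of a vector is the degree; the inner product of two is the number of common neighbours, plus 2 for
adjacent vertices. Three vectors in the plane are dependent, so all 3 × 3 determinants vanish, and
these equations between small integers drive the classification. Further constraints are that
squared distances are nonnegative and that A + 2I is positive semidefinite.

If two vectors are orthogonal, all others are expanded in this orthogonal basis (`orth_expand`). A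
vertex nonadjacent to both then sees all or nothing of each of the two neighbourhoods (`orth_out`),
and solving the resulting equations gives `classify_orth`. If all inner products are positive, the
nonneighbours of a vertex cannot lie on both sides of it (`no_between`). Two vertices cross if they
are nonadjacent with nonparallel vectors; the sets R of crossing neighbours of a crossing pair
partition the vertices that are not common neighbours, and the sets belonging to vertices with
different vectors that cross a common vertex are nested (`nest`). A crossing pair with |R i| + |R q|
maximal then determines the graph (`classify_pos`). Without crossing pairs the graph is complete
multipartite.

In every family the eigenvectors for eigenvalues other than 0 and -2 come from a 2 × 2 matrix
(`TwoBlock`), whose trace and determinant give r + s = 2(M - 1) and rs = (M - 1)² - h. The invariant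
h is the square of (r - s)/2, so coincidences between families are equations between nearly equal
squares. Comparing also the numbers of vertices leaves exactly the exceptional graphs (`Fam.iso`),
and each of these has a smaller partner with the same positive eigenvalues (`Exceptional.not_isDS`).

For complete multipartite graphs the vanishing minors of A² + 2A leave complete bipartite graphs,
graphs with all classes but one of size 2, and the complete multipartite graph with class sizes 1,
1, 3 (`IsCM.classify`). The positive eigenvalue and the sum of the squared eigenvalues separate
them, except that complete bipartite graphs with equal products of class sizes share their nonzero
spectrum; this produces the divisor condition. -/

/-- The finset of neighbours of a vertex. -/
noncomputable def nb {V : Type*} [Fintype V] (G : SimpleGraph V) (i : V) : Finset V :=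
  univ.filter (G.Adj i)

/-- The number of common neighbours. -/
noncomputable def cn {V : Type*} [Fintype V] (G : SimpleGraph V) (i j : V) : ℕ :=
  (nb G i ∩ nb G j).card

@[simp] lemma mem_nb {V : Type*} [Fintype V] {G : SimpleGraph V} {i j : V} :
    j ∈ nb G i ↔ G.Adj i j := by simp [nb]

/-- A graph without isolated vertices whose matrix `A² + 2A` is the Gram matrix of vectors
`(a i, b i)` in the plane, where `a` and `b` are eigenvectors of `A`, and `A + 2I` is positive
semidefinite. -/
structure PD {V : Type*} [Fintype V] (G : SimpleGraph V) (r s : ℝ) where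
  a : V → ℝ
  b : V → ℝ
  gram : ∀ i j, a i * a j + b i * b j = (cn G i j : ℝ) + (if G.Adj i j then 2 else 0)
  eiga : ∀ i, ∑ j ∈ nb G i, a j = r * a i
  eigb : ∀ i, ∑ j ∈ nb G i, b j = s * b i
  psd : ∀ (k : ℕ) (f : Fin k → V) (c : Fin k → ℝ), 0 ≤ ∑ x, ∑ y, c x * c y *
    ((if G.Adj (f x) (f y) then 1 else 0) + (if f x = f y then 2 else 0))
  even : ∃ m : ℕ, r + s = 2 * m
  noiso : ∀ v, ∃ w, G.Adj v w
  rpos : 0 < r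
  spos : 0 < s
  nondeg : ∃ i j, a i * b j - b i * a j ≠ 0

/-- Three vectors in the plane are dependent, so their Gram determinant vanishes. Many of the
Diophantine equations below are instances of this. -/
lemma gram3 (a₁ b₁ a₂ b₂ a₃ b₃ : ℝ) {g₁₁ g₂₂ g₃₃ g₁₂ g₁₃ g₂₃ : ℝ}
    (h₁₁ : a₁ * a₁ + b₁ * b₁ = g₁₁) (h₂₂ : a₂ * a₂ + b₂ * b₂ = g₂₂)
    (h₃₃ : a₃ * a₃ + b₃ * b₃ = g₃₃) (h₁₂ : a₁ * a₂ + b₁ * b₂ = g₁₂)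
    (h₁₃ : a₁ * a₃ + b₁ * b₃ = g₁₃) (h₂₃ : a₂ * a₃ + b₂ * b₃ = g₂₃) :
    g₁₁ * g₂₂ * g₃₃ + 2 * g₁₂ * g₂₃ * g₁₃ - g₁₁ * g₂₃ ^ 2 - g₂₂ * g₁₃ ^ 2 - g₃₃ * g₁₂ ^ 2 = 0 := by
  subst_vars; ring

namespace PD

variable {V : Type*} [Fintype V] {G : SimpleGraph V} {r s : ℝ} (P : PD G r s)

/-- Inner product of the vectors of two vertices. -/
noncomputable def dot (i j : V) : ℝ := P.a i * P.a j + P.b i * P.b j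

/-- Determinant of the vectors of two vertices. -/
noncomputable def cr (i j : V) : ℝ := P.a i * P.b j - P.b i * P.a j

lemma dot_comm (i j : V) : P.dot i j = P.dot j i := by unfold dot; ring

lemma cr_swap (i j : V) : P.cr i j = - P.cr j i := by unfold cr; ring

@[simp] lemma cr_self (i : V) : P.cr i i = 0 := by unfold cr; ring

lemma cr_sq (i j : V) : P.cr i j ^ 2 = P.dot i i * P.dot j j - P.dot i j ^ 2 := by
  unfold cr dot; ring

lemma dot_self (i : V) : P.dot i i = (nb G i).card := by
  unfold dot; rw [P.gram]; simp [cn]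

lemma dot_adj {i j : V} (h : G.Adj i j) : P.dot i j = cn G i j + 2 := by
  unfold dot; rw [P.gram]; simp [h]

lemma dot_nadj {i j : V} (h : ¬ G.Adj i j) : P.dot i j = cn G i j := by
  unfold dot; rw [P.gram]; simp [h]

lemma deg_pos (P : PD G r s) (i : V) : 0 < (nb G i).card := by
  obtain ⟨w, hw⟩ := P.noiso i
  exact card_pos.2 ⟨w, by simpa using hw⟩

lemma dot_self_pos (i : V) : 0 < P.dot i i := by
  rw [P.dot_self]; exact_mod_cast P.deg_pos i

lemma dot_le_left {i j : V} (h : ¬ G.Adj i j) : P.dot i j ≤ P.dot i i := by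
  rw [P.dot_nadj h, P.dot_self]; exact_mod_cast card_le_card inter_subset_left

lemma dot_le_right {i j : V} (h : ¬ G.Adj i j) : P.dot i j ≤ P.dot j j := by
  rw [P.dot_nadj h, P.dot_self]; exact_mod_cast card_le_card inter_subset_right

/-- The vectors of two vertices agree. -/
def Same (i j : V) : Prop := P.a i = P.a j ∧ P.b i = P.b j

lemma Same.dot {P : PD G r s} {i j : V} (h : P.Same i j) (k : V) : P.dot i k = P.dot j k := by
  unfold PD.dot; rw [h.1, h.2]

lemma Same.symm {P : PD G r s} {i j : V} (h : P.Same i j) : P.Same j i := ⟨h.1.symm, h.2.symm⟩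

lemma Same.trans {P : PD G r s} {i j k : V} (h : P.Same i j) (h' : P.Same j k) : P.Same i k :=
  ⟨h.1.trans h'.1, h.2.trans h'.2⟩

lemma Same.refl (i : V) : P.Same i i := ⟨rfl, rfl⟩

lemma Same.card {P : PD G r s} {i j : V} (h : P.Same i j) : (nb G i).card = (nb G j).card := by
  have : P.dot i i = P.dot j j := by rw [h.dot, P.dot_comm, h.dot]
  rw [P.dot_self, P.dot_self] at this
  exact_mod_cast this

/-- This is the squared distance of the two vectors; with the Gram values inserted it becomes a
counting inequality, whose equality case is `same_of_dist`. -/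
lemma dist_nonneg (i j : V) : 0 ≤ P.dot i i + P.dot j j - 2 * P.dot i j := by
  unfold dot
  nlinarith [sq_nonneg (P.a i - P.a j), sq_nonneg (P.b i - P.b j)]

lemma same_of_dist {i j : V} (h : P.dot i i + P.dot j j - 2 * P.dot i j ≤ 0) : P.Same i j := by
  unfold dot at h
  have h1 : (P.a i - P.a j) ^ 2 = 0 := by
    nlinarith [sq_nonneg (P.a i - P.a j), sq_nonneg (P.b i - P.b j)]
  have h2 : (P.b i - P.b j) ^ 2 = 0 := by
    nlinarith [sq_nonneg (P.a i - P.a j), sq_nonneg (P.b i - P.b j)]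
  exact ⟨by nlinarith [pow_eq_zero_iff (two_ne_zero) |>.1 h1],
    by nlinarith [pow_eq_zero_iff (two_ne_zero) |>.1 h2]⟩

/-- Nonadjacent vertices with parallel vectors have the same vector. -/
lemma same_of_cr {i j : V} (h : ¬ G.Adj i j) (hc : P.cr i j = 0) : P.Same i j := by
  have h1 := P.cr_sq i j
  rw [hc] at h1
  have h2 := P.dot_le_left h
  have h3 := P.dot_le_right h
  have h4 := P.dot_self_pos i
  have h5 := P.dot_self_pos j
  have h6 : 0 ≤ P.dot i j := by rw [P.dot_nadj h]; positivity
  -- For parallel vectors the square of the inner product is the product of the squared lengths, and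
  -- for nonadjacent vertices the inner product is at most each of these. So all three numbers
  -- agree.
  have k1 : P.dot i i * P.dot j j ≤ P.dot i j * P.dot j j := by nlinarith
  have k2 : P.dot j j * P.dot i i ≤ P.dot i j * P.dot i i := by nlinarith
  have k3 := le_of_mul_le_mul_right k1 h5
  have k4 := le_of_mul_le_mul_right k2 h4
  apply P.same_of_dist
  linarith

lemma cr_of_same {i j : V} (h : P.Same i j) : P.cr i j = 0 := by
  unfold cr; rw [h.1, h.2]; ring

/-- Nonadjacent vertices with equal vectors have the same neighbours. -/
lemma nb_eq {i j : V} (h : ¬ G.Adj i j) (hs : P.Same i j) : nb G i = nb G j := by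
  have h1 : P.dot i j = P.dot i i := by rw [P.dot_comm i j, hs.symm.dot]
  have h2 : P.dot i j = P.dot j j := by rw [hs.dot]
  rw [P.dot_nadj h, P.dot_self, Nat.cast_inj] at h1 h2
  have e1 : nb G i ∩ nb G j = nb G i := eq_of_subset_of_card_le inter_subset_left h1.ge
  have e2 : nb G i ∩ nb G j = nb G j := eq_of_subset_of_card_le inter_subset_right h2.ge
  rw [← e1, e2]

/-- For equal vectors the inner product is the degree; adjacency accounts for 2 of it, so exactly
two neighbours are not shared. -/
lemma sdiff_card_same {i j : V} (h : G.Adj i j) (hs : P.Same i j) :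
    (nb G i \ nb G j).card = 2 := by
  have h1 : P.dot i j = P.dot i i := by rw [P.dot_comm i j, hs.symm.dot]
  rw [P.dot_adj h, P.dot_self] at h1
  have h2 := card_sdiff_add_card_inter (nb G i) (nb G j)
  have h3 : cn G i j + 2 = (nb G i).card := by exact_mod_cast h1
  unfold cn at h3
  omega

/-- Two adjacent vertices have distinct closed neighbourhoods. -/
lemma not_closed_twins (P : PD G r s) {i j : V} (h : G.Adj i j) (hn : nb G i \ {j} ⊆ nb G j \ {i})
    (hn' : nb G j \ {i} ⊆ nb G i \ {j}) : False := by
  have h1 := P.dist_nonneg i j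
  rw [P.dot_adj h, P.dot_self, P.dot_self] at h1
  have e := Subset.antisymm hn hn'
  have c1 : nb G i ∩ nb G j = nb G i \ {j} := by
    ext x
    have := congrArg (x ∈ ·) e
    simp only [mem_sdiff, mem_singleton, eq_iff_iff, mem_inter, mem_nb] at this ⊢
    constructor
    · rintro ⟨h1, h2⟩; exact ⟨h1, fun hx => by subst hx; exact G.loopless.irrefl _ h2⟩
    · intro hx; exact ⟨hx.1, (this.1 hx).1⟩
  have c2 : (nb G i \ {j}).card + 1 = (nb G i).card := by
    rw [sdiff_singleton_eq_erase, card_erase_add_one]; simpa using h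
  have c3 : (nb G j \ {i}).card + 1 = (nb G j).card := by
    rw [sdiff_singleton_eq_erase, card_erase_add_one]; simpa using h.symm
  -- With common degree δ there would be δ - 1 common neighbours, so the squared distance would be
  -- 2δ - 2(δ + 1) = -2.
  have h2 : cn G i j + 1 = (nb G i).card := by rw [cn, c1, c2]
  have h3 : cn G i j + 1 = (nb G j).card := by rw [cn, c1, e, c3]
  rw [← h2, ← h3] at h1
  push_cast at h1
  linarith

/-- The addition formula of the sine, scaled by the lengths: the angle from i to u passes through w.
-/
lemma cr_mul (i w u : V) :
    P.cr i u * P.dot w w = P.cr i w * P.dot w u + P.dot i w * P.cr w u := by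
  unfold cr dot; ring

/-- If all inner products are positive, then no vertex has nonneighbours on both sides. -/
lemma no_between (hpos : ∀ i j, 0 < P.dot i j) {i w u : V} (h1 : ¬ G.Adj w i) (h2 : ¬ G.Adj w u)
    (c1 : 0 < P.cr i w) (c2 : 0 < P.cr w u) : False := by
  have hD : 0 < P.cr i u := by
    have := P.cr_mul i w u
    have hw := hpos w w
    have : 0 < P.cr i u * P.dot w w := by
      rw [this]; exact add_pos (mul_pos c1 (hpos _ _)) (mul_pos (hpos _ _) c2)
    exact (pos_iff_pos_of_mul_pos this).2 hw
  -- By Cramer's rule, `cr i u` times the vector of w is `cr w u` times that of i plus `cr i w`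
  -- times that of u. The three identities pair this with i, u and w.
  have e1 : P.cr i u * P.dot w i = P.cr w u * P.dot i i + P.cr i w * P.dot i u := by
    unfold cr dot; ring
  have e2 : P.cr i u * P.dot w u = P.cr w u * P.dot i u + P.cr i w * P.dot u u := by
    unfold cr dot; ring
  have e3 : P.cr i u * P.dot w w = P.cr w u * P.dot w i + P.cr i w * P.dot w u := by
    unfold cr dot; ring
  have e4 := P.cr_sq i u
  have l1 := P.dot_le_left h1
  have l2 := P.dot_le_right h1
  have l3 := P.dot_le_left h2
  have l4 := P.dot_le_right h2
  have hτ := hpos i u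
  have hdi := hpos i i
  have hdu := hpos u u
  have hdw := hpos w w
  -- Both common neighbourhoods lie in N(w), and inclusion-exclusion there bounds the common
  -- neighbours of i and u from below.
  have hc : P.dot w i + P.dot w u - P.dot w w ≤ P.dot i u := by
    have k1 : (cn G i u : ℝ) ≤ P.dot i u := by
      unfold dot; rw [P.gram]; split_ifs <;> linarith
    rw [P.dot_nadj h1, P.dot_nadj h2, P.dot_self]
    refine le_trans ?_ k1
    have k2 : cn G w i + cn G w u ≤ (nb G w).card + cn G i u := by
      unfold cn
      have k3 := card_union_add_card_inter (nb G w ∩ nb G i) (nb G w ∩ nb G u)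
      have k4 : (nb G w ∩ nb G i ∪ nb G w ∩ nb G u).card ≤ (nb G w).card :=
        card_le_card (union_subset inter_subset_left inter_subset_left)
      have k5 : (nb G w ∩ nb G i ∩ (nb G w ∩ nb G u)).card ≤ (nb G i ∩ nb G u).card := by
        apply card_le_card; intro x; simp only [mem_inter]; tauto
      omega
    have : (cn G w i : ℝ) + cn G w u ≤ (nb G w).card + cn G i u := by exact_mod_cast k2
    linarith
  generalize P.cr i u = D at *
  generalize P.cr w u = ξ at *
  generalize P.cr i w = η at *
  generalize P.dot w i = p at *
  generalize P.dot w u = q at *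
  generalize P.dot i u = τ at *
  generalize P.dot i i = di at *
  generalize P.dot u u = du at *
  generalize P.dot w w = dw at *
  have f1 : η * τ ≤ (D - ξ) * di := by nlinarith
  have f2 : ξ * τ ≤ (D - η) * du := by nlinarith
  have f3 : D * (η * τ) ≤ D * ((D - ξ) * p) := by
    have : D * ((D - ξ) * p) = ξ * ((D - ξ) * di) + (D - ξ) * (η * τ) := by linear_combination (D - ξ) * e1
    nlinarith
  have f4 : D * (ξ * τ) ≤ D * ((D - η) * q) := by
    have : D * ((D - η) * q) = η * ((D - η) * du) + (D - η) * (ξ * τ) := by linear_combination (D - η) * e2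
    nlinarith
  have f3' := le_of_mul_le_mul_left f3 hD
  have f4' := le_of_mul_le_mul_left f4 hD
  have f5 : (ξ + η) * τ ≤ D * τ := by nlinarith
  have f6 := le_of_mul_le_mul_right f5 hτ
  have f7 : D * dw ≤ (ξ + η) * dw := by nlinarith
  have f8 := le_of_mul_le_mul_right f7 hdw
  -- So the vector of w lies on the segment between those of i and u. Then p = q = |w|², and the
  -- squared lengths of i and u are at most |w|² while their inner product is at least |w|², which
  -- contradicts D ≠ 0.
  have hDe : D = ξ + η := le_antisymm f8 f6
  have f9 : ξ * (dw - p) + η * (dw - q) = 0 := by rw [hDe] at e3; linarith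
  have g1 : p = dw := by
    have : 0 ≤ η * (dw - q) := mul_nonneg c1.le (by linarith)
    have : ξ * (dw - p) ≤ 0 := by linarith
    have := nonpos_of_mul_nonpos_right this c2
    linarith
  have g2 : q = dw := by
    rw [g1] at f9
    have : η * (dw - q) = 0 := by linarith
    rcases mul_eq_zero.1 this with h | h <;> linarith
  subst g1
  have g3 : p ≤ τ := by linarith
  have g4 : ξ * di ≤ ξ * p := by rw [hDe] at e1; nlinarith
  have g5 := le_of_mul_le_mul_left g4 c2
  have g6 : η * du ≤ η * p := by rw [hDe, g2] at e2; nlinarith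
  have g7 := le_of_mul_le_mul_left g6 c1
  have : 0 < D ^ 2 := by positivity
  nlinarith

end PD
end TwoEig
end

/-! ### Twins and crossing pairs. -/

section
open scoped Classical
namespace TwoEig
open Finset
namespace PD

variable {V : Type*} [Fintype V] {G : SimpleGraph V} {r s : ℝ} (P : PD G r s)

/-- Nonadjacent vertices with non-parallel vectors. -/
def Cross (i j : V) : Prop := ¬ G.Adj i j ∧ P.cr i j ≠ 0

/-- The vertices that are nonadjacent and non-parallel to `i`. -/
noncomputable def R (i : V) : Finset V := univ.filter (P.Cross i)

/-- The vertices that are nonadjacent and parallel to `i`; these are `i` and its twins. -/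
noncomputable def W (i : V) : Finset V := univ.filter fun j => ¬ G.Adj i j ∧ P.cr i j = 0

@[simp] lemma mem_R {i j : V} : j ∈ P.R i ↔ P.Cross i j := by simp [R]

@[simp] lemma mem_W {i j : V} : j ∈ P.W i ↔ ¬ G.Adj i j ∧ P.cr i j = 0 := by simp [W]

variable {P}

lemma Cross.symm {i j : V} (h : P.Cross i j) : P.Cross j i :=
  ⟨fun h' => h.1 h'.symm, by rw [P.cr_swap]; exact neg_ne_zero.2 h.2⟩

lemma Cross.ne {i j : V} (h : P.Cross i j) : i ≠ j := by
  rintro rfl; exact h.2 (P.cr_self _)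

variable (P)

lemma self_mem_W (i : V) : i ∈ P.W i := by simp

lemma W_pos (i : V) : 1 ≤ (P.W i).card := card_pos.2 ⟨i, P.self_mem_W i⟩

variable {P}

lemma same_of_mem_W {i j : V} (h : j ∈ P.W i) : P.Same i j := by
  rw [mem_W] at h; exact P.same_of_cr h.1 h.2

lemma nb_of_mem_W {i j : V} (h : j ∈ P.W i) : nb G i = nb G j :=
  P.nb_eq (P.mem_W.1 h).1 (same_of_mem_W h)

lemma mem_W_of_same {i j : V} (h : ¬ G.Adj i j) (hs : P.Same i j) : j ∈ P.W i :=
  P.mem_W.2 ⟨h, P.cr_of_same hs⟩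

lemma cr_congr {i j : V} (hs : P.Same i j) (k : V) : P.cr i k = P.cr j k := by
  unfold cr; rw [hs.1, hs.2]

lemma adj_of_W {i j k : V} (h : j ∈ P.W i) : G.Adj i k ↔ G.Adj j k := by
  rw [← mem_nb, ← mem_nb, nb_of_mem_W h]

lemma R_of_W {i j : V} (h : j ∈ P.W i) : P.R i = P.R j := by
  ext k; rw [mem_R, mem_R, Cross, Cross, adj_of_W h, cr_congr (same_of_mem_W h)]

lemma W_of_W {i j : V} (h : j ∈ P.W i) : P.W i = P.W j := by
  ext k; rw [mem_W, mem_W, adj_of_W h, cr_congr (same_of_mem_W h)]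

lemma W_disj (i : V) : Disjoint (P.W i) (P.R i) := by
  rw [disjoint_left]; intro k h1 h2
  exact (P.mem_R.1 h2).2 (P.mem_W.1 h1).2

lemma W_union (i : V) : P.W i ∪ P.R i = (nb G i)ᶜ := by
  ext k; simp only [mem_union, mem_W, mem_R, Cross, mem_compl, mem_nb]; tauto

lemma card_eq (i : V) : Fintype.card V = (nb G i).card + (P.W i).card + (P.R i).card := by
  have h := card_union_of_disjoint (W_disj (P := P) i)
  rw [W_union, card_compl] at h
  have := card_le_univ (nb G i)
  omega

lemma dot_self' (i : V) :
    P.dot i i = (Fintype.card V : ℝ) - (P.W i).card - (P.R i).card := by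
  rw [P.dot_self, card_eq (P := P) i]; push_cast; ring

lemma W_subset_R {i j : V} (h : P.Cross i j) : P.W j ⊆ P.R i := by
  intro k hk
  rw [mem_R]
  refine ⟨fun h' => h.1 ?_, ?_⟩
  · exact ((adj_of_W hk).2 h'.symm).symm
  · rw [P.cr_swap, ← cr_congr (same_of_mem_W hk), ← P.cr_swap]; exact h.2

/-- Count nonneighbours instead of neighbours. A twin of i is adjacent to j and vice versa, so the
common nonneighbours of i and j are exactly `R i ∩ R j`. -/
lemma dot_of_adj {i j : V} (h : G.Adj i j) : P.dot i j = (Fintype.card V : ℝ) + 2 - (P.W i).card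
    - (P.W j).card - (P.R i).card - (P.R j).card + (P.R i ∩ P.R j).card := by
  rw [P.dot_adj h]
  have e : (nb G i)ᶜ ∩ (nb G j)ᶜ = P.R i ∩ P.R j := by
    rw [← W_union (P := P), ← W_union (P := P)]
    ext k
    simp only [mem_inter, mem_union]
    constructor
    · rintro ⟨h1 | h1, h2⟩
      · exfalso
        have : G.Adj k j := (adj_of_W h1).1 h
        rcases h2 with h2 | h2
        · exact (P.mem_W.1 h2).1 this.symm
        · exact (P.mem_R.1 h2).1 this.symm
      · rcases h2 with h2 | h2
        · exfalso
          have : G.Adj k i := (adj_of_W h2).1 h.symm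
          exact (P.mem_R.1 h1).1 this.symm
        · exact ⟨h1, h2⟩
    · rintro ⟨h1, h2⟩; exact ⟨Or.inr h1, Or.inr h2⟩
  have h1 := card_union_add_card_inter (nb G i) (nb G j)
  have h2 := card_compl (nb G i ∪ nb G j)
  rw [compl_union, e] at h2
  have h3 := card_eq (P := P) i
  have h4 := card_eq (P := P) j
  have h5 := card_le_univ (nb G i ∪ nb G j)
  have : cn G i j + (P.W i).card + (P.W j).card + (P.R i).card + (P.R j).card =
      Fintype.card V + (P.R i ∩ P.R j).card := by unfold cn; omega
  have h6 : (cn G i j : ℝ) + (P.W i).card + (P.W j).card + (P.R i).card + (P.R j).card =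
      Fintype.card V + (P.R i ∩ P.R j).card := by exact_mod_cast this
  linarith

section pos
variable (hpos : ∀ i j, 0 < P.dot i j)
include hpos

/-- By `no_between`, all crossing neighbours of y lie on the same side of y. -/
lemma cross_flip {x y z : V} (h : P.Cross x y) (h' : P.Cross y z) (hc : 0 < P.cr x y) :
    0 < P.cr z y := by
  by_contra hn
  have h1 : P.cr y z ≠ 0 := h'.2
  rw [P.cr_swap] at hn
  have : 0 < P.cr y z := lt_of_le_of_ne (by linarith) (Ne.symm h1)
  exact P.no_between hpos (fun h0 => h.1 h0.symm) h'.1 hc this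

lemma cross_flip' {x y z : V} (h : P.Cross x y) (h' : P.Cross y z) (hc : P.cr x y < 0) :
    P.cr z y < 0 := by
  by_contra hn
  have h1 : P.cr z y ≠ 0 := h'.symm.2
  have h2 : 0 < P.cr z y := lt_of_le_of_ne (by linarith) (Ne.symm h1)
  have := cross_flip hpos h'.symm h.symm h2
  linarith

/-- A vertex nonadjacent to both ends of a crossing pair is a twin of one of them. -/
lemma nadj_both {i j w : V} (h : P.Cross i j) (h1 : ¬ G.Adj w i) (h2 : ¬ G.Adj w j) :
    w ∈ P.W i ∨ w ∈ P.W j := by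
  by_contra hn
  push Not at hn
  have c1 : P.Cross i w := ⟨fun h0 => h1 h0.symm, fun h0 => hn.1 (P.mem_W.2 ⟨fun h0 => h1 h0.symm, h0⟩)⟩
  have c2 : P.Cross j w := ⟨fun h0 => h2 h0.symm, fun h0 => hn.2 (P.mem_W.2 ⟨fun h0 => h2 h0.symm, h0⟩)⟩
  -- Otherwise i, j, w cross pairwise. Passing the sign of the determinant around this triangle by
  -- three flips returns it reversed.
  rcases lt_or_gt_of_ne h.2 with h3 | h3
  · have h4 := cross_flip' hpos h c2 h3
    have h7 := P.cr_swap w j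
    have h8 := P.cr_swap i j
    have h9 := cross_flip hpos c2 c1.symm (by linarith)
    have h11 := P.cr_swap w i
    have h12 := cross_flip' hpos c1.symm h (by linarith)
    linarith
  · have h4 := cross_flip hpos h c2 h3
    have h7 := P.cr_swap w j
    have h8 := P.cr_swap i j
    have h9 := cross_flip' hpos c2 c1.symm (by linarith)
    have h11 := P.cr_swap w i
    have h12 := cross_flip hpos c1.symm h (by linarith)
    linarith

lemma R_disj {i j : V} (h : P.Cross i j) : Disjoint (P.R i) (P.R j) := by
  rw [disjoint_left]
  intro w h1 h2
  rw [mem_R] at h1 h2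
  rcases nadj_both hpos h h1.symm.1 h2.symm.1 with h3 | h3
  · exact h1.2 (P.mem_W.1 h3).2
  · exact h2.2 (P.mem_W.1 h3).2

/-- A nonneighbour of i is a twin of i or crosses i, and a twin of i crosses j. Together with
`R_disj` this yields the count in `card_cross`. -/
lemma R_union {i j : V} (h : P.Cross i j) : P.R i ∪ P.R j = (nb G i ∩ nb G j)ᶜ := by
  ext w
  rw [compl_inter, ← W_union (P := P), ← W_union (P := P)]
  simp only [mem_union]
  constructor
  · tauto
  · rintro ((h1 | h1) | (h1 | h1))
    · exact Or.inr (W_subset_R h.symm h1)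
    · exact Or.inl h1
    · exact Or.inl (W_subset_R h h1)
    · exact Or.inr h1

lemma card_cross {i j : V} (h : P.Cross i j) :
    Fintype.card V = (P.R i).card + (P.R j).card + cn G i j := by
  have h1 := card_union_of_disjoint (R_disj hpos h)
  rw [R_union hpos h, card_compl] at h1
  have := card_le_univ (nb G i ∩ nb G j)
  unfold cn; omega

lemma dot_cross {i j : V} (h : P.Cross i j) :
    P.dot i j = (Fintype.card V : ℝ) - (P.R i).card - (P.R j).card := by
  rw [P.dot_nadj h.1, card_cross hpos h]; push_cast; ring

lemma cn_pos {i j : V} (h : ¬ G.Adj i j) : 1 ≤ cn G i j := by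
  have := hpos i j
  rw [P.dot_nadj h] at this
  exact_mod_cast this

/-- Crossing neighbours of the same vertex are adjacent or twins. -/
lemma adj_of_cross {j l i : V} (h1 : P.Cross j l) (h2 : P.Cross j i) (hw : l ∉ P.W i) :
    G.Adj l i := by
  by_contra hn
  rcases nadj_both hpos h2 h1.symm.1 hn with h | h
  · exact h1.2 (P.mem_W.1 h).2
  · exact hw h

lemma adj_of_cross' {j l i : V} (h1 : P.Cross j l) (h2 : P.Cross j i) (hw : ¬ P.Same l i) :
    G.Adj l i :=
  adj_of_cross hpos h1 h2 fun h => hw (same_of_mem_W h).symm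

end pos

/-- Structure of two adjacent vertices with the same vector. -/
lemma swap {i j : V} (h : G.Adj i j) (hs : P.Same i j) :
    (P.R i = P.R j ∧ (P.W i).card = 2 ∧ (P.W j).card = 2) ∨
    ((P.W i).card = 1 ∧ (P.W j).card = 1 ∧
      ∃ p q, p ≠ q ∧ P.Same p q ∧ P.R i \ P.R j = {q} ∧ P.R j \ P.R i = {p}) := by
  have exq : ∀ i j : V, G.Adj i j → P.Same i j → ∃ p, p ≠ j ∧ nb G i \ nb G j = {j, p} := by
    intro i j h hs
    have h1 := P.sdiff_card_same h hs
    have h2 : j ∈ nb G i \ nb G j := by simp [h]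
    have h3 : ((nb G i \ nb G j).erase j).card = 1 := by rw [card_erase_of_mem h2, h1]
    obtain ⟨p, hp⟩ := card_eq_one.1 h3
    refine ⟨p, ?_, ?_⟩
    · have : p ∈ (nb G i \ nb G j).erase j := by rw [hp]; simp
      exact (mem_erase.1 this).1
    · rw [← hp, insert_erase h2]
  obtain ⟨p, hpj, hp⟩ := exq i j h hs
  obtain ⟨q, hqi, hq⟩ := exq j i h.symm hs.symm
  have pm : G.Adj i p ∧ ¬ G.Adj j p := by
    have : p ∈ nb G i \ nb G j := by rw [hp]; simp
    simpa using this
  have qm : G.Adj j q ∧ ¬ G.Adj i q := by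
    have : q ∈ nb G j \ nb G i := by rw [hq]; simp
    simpa using this
  have hpi : p ≠ i := by rintro rfl; exact G.loopless.irrefl _ pm.1
  have hqj : q ≠ j := by rintro rfl; exact G.loopless.irrefl _ qm.1
  have hpq : p ≠ q := by rintro rfl; exact qm.2 pm.1
  -- counting common neighbours through the two differences
  have cnt : ∀ k : V, cn G i k + (({i, q} : Finset V) ∩ nb G k).card =
      cn G j k + (({j, p} : Finset V) ∩ nb G k).card := by
    intro k
    have e1 := card_sdiff_add_card_inter (nb G i ∩ nb G k) (nb G j)
    have e2 := card_sdiff_add_card_inter (nb G j ∩ nb G k) (nb G i)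
    have e3 : (nb G i ∩ nb G k) \ nb G j = {j, p} ∩ nb G k := by
      rw [← hp]; ext x; simp only [mem_sdiff, mem_inter]; tauto
    have e4 : (nb G j ∩ nb G k) \ nb G i = {i, q} ∩ nb G k := by
      rw [← hq]; ext x; simp only [mem_sdiff, mem_inter]; tauto
    have e5 : nb G i ∩ nb G k ∩ nb G j = nb G j ∩ nb G k ∩ nb G i := by
      ext x; simp only [mem_inter]; tauto
    rw [e3] at e1; rw [e4, ← e5] at e2
    unfold cn; omega
  have two : ∀ x y k : V, x ≠ y → (({x, y} : Finset V) ∩ nb G k).card =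
      (if G.Adj k x then 1 else 0) + (if G.Adj k y then 1 else 0) := by
    intro x y k hxy
    by_cases h1 : G.Adj k x <;> by_cases h2 : G.Adj k y <;>
      simp [insert_inter_of_mem, insert_inter_of_notMem, h1, h2, hxy]
  -- As p is adjacent to i but not to j, equal inner products with p give j two more common
  -- neighbours with p than i has; the comparison `cnt` accounts for this only if p and q are
  -- adjacent.
  have apq : G.Adj p q := by
    have h1 : P.dot i p = P.dot j p := hs.dot p
    rw [P.dot_adj pm.1, P.dot_nadj pm.2] at h1
    have h2 : cn G i p + 2 = cn G j p := by exact_mod_cast h1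
    have h3 := cnt p
    rw [two _ _ _ hqi.symm, two _ _ _ hpj.symm] at h3
    by_contra hn
    simp [pm.1.symm, hn] at h3
    omega
  -- A further vertex is seen alike by i and j, and then the same comparison shows that it is seen
  -- alike by p and q.
  have key : ∀ k, k ≠ i → k ≠ j → k ≠ p → k ≠ q → (G.Adj k p ↔ G.Adj k q) := by
    intro k h1 h2 h3 h4
    have h5 : G.Adj i k ↔ G.Adj j k := by
      have a1 : k ∉ nb G i \ nb G j := by rw [hp]; simp [h2, h3]
      have a2 : k ∉ nb G j \ nb G i := by rw [hq]; simp [h1, h4]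
      simp only [mem_sdiff, mem_nb] at a1 a2
      tauto
    have h6 : cn G i k = cn G j k := by
      have h7 : P.dot i k = P.dot j k := hs.dot k
      by_cases hk : G.Adj i k
      · rw [P.dot_adj hk, P.dot_adj (h5.1 hk)] at h7
        have : (cn G i k : ℝ) = cn G j k := by linarith
        exact_mod_cast this
      · rw [P.dot_nadj hk, P.dot_nadj (fun h => hk (h5.2 h))] at h7
        exact_mod_cast h7
    have h8 := cnt k
    rw [two _ _ _ hqi.symm, two _ _ _ hpj.symm, h6] at h8
    have h9 : G.Adj k i ↔ G.Adj k j := by rw [G.adj_comm k i, G.adj_comm k j]; exact h5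
    by_cases b1 : G.Adj k i <;> by_cases b2 : G.Adj k p <;> by_cases b3 : G.Adj k q <;>
      simp_all
  -- Apart from common neighbours, p has only i and q as neighbours, and q has only j and p. So the
  -- squared distance of p and q is at most 0.
  have spq : P.Same p q := by
    have d1 : nb G p = {i, q} ∪ (nb G p ∩ nb G q) := by
      ext k
      simp only [mem_union, mem_insert, mem_singleton, mem_inter, mem_nb]
      constructor
      · intro hk
        by_cases k1 : k = i; · tauto
        by_cases k2 : k = q; · tauto
        have k3 : k ≠ j := by rintro rfl; exact pm.2 hk.symm
        have k4 : k ≠ p := by rintro rfl; exact G.loopless.irrefl _ hk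
        exact Or.inr ⟨hk, ((key k k1 k3 k4 k2).1 hk.symm).symm⟩
      · rintro ((rfl | rfl) | hk)
        · exact pm.1.symm
        · exact apq
        · exact hk.1
    have d2 : nb G q = {j, p} ∪ (nb G p ∩ nb G q) := by
      ext k
      simp only [mem_union, mem_insert, mem_singleton, mem_inter, mem_nb]
      constructor
      · intro hk
        by_cases k1 : k = j; · tauto
        by_cases k2 : k = p; · tauto
        have k3 : k ≠ i := by rintro rfl; exact qm.2 hk.symm
        have k4 : k ≠ q := by rintro rfl; exact G.loopless.irrefl _ hk
        exact Or.inr ⟨((key k k3 k1 k2 k4).2 hk.symm).symm, hk⟩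
      · rintro ((rfl | rfl) | hk)
        · exact qm.1.symm
        · exact apq.symm
        · exact hk.2
    have c1 : (nb G p).card ≤ 2 + cn G p q := by
      have h1 := congrArg Finset.card d1
      have h2 := card_union_le {i, q} (nb G p ∩ nb G q)
      have h3 : ({i, q} : Finset V).card ≤ 2 := card_le_two
      unfold cn; omega
    have c2 : (nb G q).card ≤ 2 + cn G p q := by
      have h1 := congrArg Finset.card d2
      have h2 := card_union_le {j, p} (nb G p ∩ nb G q)
      have h3 : ({j, p} : Finset V).card ≤ 2 := card_le_two
      unfold cn; omega
    apply P.same_of_dist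
    rw [P.dot_self, P.dot_self, P.dot_adj apq]
    have c1' : ((nb G p).card : ℝ) ≤ 2 + cn G p q := by exact_mod_cast c1
    have c2' : ((nb G q).card : ℝ) ≤ 2 + cn G p q := by exact_mod_cast c2
    linarith
  have Wi : ∀ w, w ∈ P.W i → w = i ∨ w = q := by
    intro w hw
    by_contra hn
    push Not at hn
    have : w ∉ nb G j \ nb G i := by rw [hq]; simp [hn]
    have h1 := (P.mem_W.1 hw).1
    simp only [mem_sdiff, mem_nb, not_and, not_not] at this
    have h2 : G.Adj w j := (adj_of_W hw).1 h
    exact h1 (this h2.symm)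
  have Wj : ∀ w, w ∈ P.W j → w = j ∨ w = p := by
    intro w hw
    by_contra hn
    push Not at hn
    have : w ∉ nb G i \ nb G j := by rw [hp]; simp [hn]
    have h1 := (P.mem_W.1 hw).1
    simp only [mem_sdiff, mem_nb, not_and, not_not] at this
    have h2 : G.Adj w i := (adj_of_W hw).1 h.symm
    exact h1 (this h2.symm)
  have Rij : ∀ x, x ∈ P.R i → x ∉ P.R j → x = q := by
    intro x h1 h2
    rw [mem_R] at h1 h2
    have h3 : P.cr j x ≠ 0 := by rw [← cr_congr hs]; exact h1.2
    have h4 : G.Adj j x := by by_contra hn; exact h2 ⟨hn, h3⟩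
    have : x ∈ nb G j \ nb G i := by simp [h4, h1.1]
    rw [hq] at this
    simp only [mem_insert, mem_singleton] at this
    rcases this with rfl | rfl
    · exact absurd rfl h1.ne
    · rfl
  have Rji : ∀ x, x ∈ P.R j → x ∉ P.R i → x = p := by
    intro x h1 h2
    rw [mem_R] at h1 h2
    have h3 : P.cr i x ≠ 0 := by rw [cr_congr hs]; exact h1.2
    have h4 : G.Adj i x := by by_contra hn; exact h2 ⟨hn, h3⟩
    have : x ∈ nb G i \ nb G j := by simp [h4, h1.1]
    rw [hp] at this
    simp only [mem_insert, mem_singleton] at this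
    rcases this with rfl | rfl
    · exact absurd rfl h1.ne
    · rfl
  have hpR : p ∉ P.R i := fun h => (P.mem_R.1 h).1 pm.1
  have hqR : q ∉ P.R j := fun h => (P.mem_R.1 h).1 qm.1
  -- Either q is a twin of i and p a twin of j, or q crosses i and p crosses j; in the second case R
  -- i and R j differ by exchanging q for p.
  by_cases hc : P.cr i q = 0
  · left
    have hqW : q ∈ P.W i := P.mem_W.2 ⟨qm.2, hc⟩
    have siq := same_of_mem_W hqW
    have hpW : p ∈ P.W j := mem_W_of_same pm.2 (hs.symm.trans (siq.trans spq.symm))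
    refine ⟨?_, ?_, ?_⟩
    · ext x
      constructor
      · intro hx; by_contra hn
        have := Rij x hx hn; subst this
        exact (P.mem_R.1 hx).2 hc
      · intro hx; by_contra hn
        have := Rji x hx hn; subst this
        exact (P.mem_R.1 hx).2 (P.mem_W.1 hpW).2
    · have : P.W i = {i, q} := by
        ext w; simp only [mem_insert, mem_singleton]
        exact ⟨Wi w, by rintro (rfl | rfl); exacts [P.self_mem_W _, hqW]⟩
      rw [this, card_pair hqi.symm]
    · have : P.W j = {j, p} := by
        ext w; simp only [mem_insert, mem_singleton]
        exact ⟨Wj w, by rintro (rfl | rfl); exacts [P.self_mem_W _, hpW]⟩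
      rw [this, card_pair hpj.symm]
  · right
    have hqR' : q ∈ P.R i := P.mem_R.2 ⟨qm.2, hc⟩
    have hcp : P.cr j p ≠ 0 := by
      intro h0
      have := P.same_of_cr pm.2 h0
      exact hc (P.cr_of_same (hs.trans (this.trans spq)))
    have hpR' : p ∈ P.R j := P.mem_R.2 ⟨pm.2, hcp⟩
    refine ⟨?_, ?_, p, q, hpq, spq, ?_, ?_⟩
    · rw [card_eq_one]; refine ⟨i, ?_⟩
      ext w; simp only [mem_singleton]
      refine ⟨fun hw => ?_, by rintro rfl; exact P.self_mem_W _⟩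
      rcases Wi w hw with h | rfl
      · exact h
      · exact absurd (P.mem_W.1 hw).2 hc
    · rw [card_eq_one]; refine ⟨j, ?_⟩
      ext w; simp only [mem_singleton]
      refine ⟨fun hw => ?_, by rintro rfl; exact P.self_mem_W _⟩
      rcases Wj w hw with h | rfl
      · exact h
      · exact absurd (P.mem_W.1 hw).2 hcp
    · ext x; simp only [mem_sdiff, mem_singleton]
      exact ⟨fun h => Rij x h.1 h.2, by rintro rfl; exact ⟨hqR', hqR⟩⟩
    · ext x; simp only [mem_sdiff, mem_singleton]
      exact ⟨fun h => Rji x h.1 h.2, by rintro rfl; exact ⟨hpR', hpR⟩⟩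

lemma Same.W_card {i j : V} (hs : P.Same i j) : (P.W i).card = (P.W j).card := by
  by_cases h : G.Adj i j
  · rcases swap h hs with h | h <;> omega
  · rw [W_of_W (mem_W_of_same h hs)]

lemma Same.R_card {i j : V} (hs : P.Same i j) : (P.R i).card = (P.R j).card := by
  have h1 := card_eq (P := P) i
  have h2 := card_eq (P := P) j
  have := hs.W_card
  have := hs.card
  omega

lemma Same.R_eq {i j : V} (hs : P.Same i j) (h2 : (P.W i).card = 2) : P.R i = P.R j := by
  by_cases h : G.Adj i j
  · rcases swap h hs with h | h
    · exact h.1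
    · omega
  · exact R_of_W (mem_W_of_same h hs)

lemma Same.swap {i j : V} (hs : P.Same i j) (h1 : (P.W i).card = 1) (hij : i ≠ j) :
    G.Adj i j ∧ ∃ p q, p ≠ q ∧ P.Same p q ∧ P.R i \ P.R j = {q} ∧ P.R j \ P.R i = {p} := by
  have h : G.Adj i j := by
    by_contra hn
    have h3 := mem_W_of_same hn hs
    have : 1 < (P.W i).card := one_lt_card.2 ⟨i, P.self_mem_W i, j, h3, hij⟩
    omega
  refine ⟨h, ?_⟩
  rcases PD.swap h hs with h | h
  · omega
  · exact h.2.2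

end PD
end TwoEig
end

/-! ### Twin classes are small, and crossing sets are nested. -/

section
open scoped Classical
namespace TwoEig
open Finset
namespace PD

variable {V : Type*} [Fintype V] {G : SimpleGraph V} {r s : ℝ} {P : PD G r s}

/-- Otherwise the five vertices induce a complete bipartite graph with parts of sizes 3 and 2, and A
+ 2I takes the value -2 at the vector (1, 1, 1, -1, -1). -/
lemma clique_of_three {w w₁ w₂ w₃ h h' : V} (m₁ : w₁ ∈ P.W w) (m₂ : w₂ ∈ P.W w) (m₃ : w₃ ∈ P.W w)
    (n₁₂ : w₁ ≠ w₂) (n₁₃ : w₁ ≠ w₃) (n₂₃ : w₂ ≠ w₃) (a : G.Adj w h) (a' : G.Adj w h')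
    (hn : h ≠ h') : G.Adj h h' := by
  by_contra hc
  have e₁ := fun k => adj_of_W (k := k) m₁
  have e₂ := fun k => adj_of_W (k := k) m₂
  have e₃ := fun k => adj_of_W (k := k) m₃
  have b₁ := (P.mem_W.1 m₁).1
  have b₂ := (P.mem_W.1 m₂).1
  have b₃ := (P.mem_W.1 m₃).1
  have := P.psd 5 ![w₁, w₂, w₃, h, h'] ![1, 1, 1, -1, -1]
  have c₁ : h ≠ w₁ := by rintro rfl; exact b₁ a
  have c₂ : h ≠ w₂ := by rintro rfl; exact b₂ a
  have c₃ : h ≠ w₃ := by rintro rfl; exact b₃ a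
  have d₁ : h' ≠ w₁ := by rintro rfl; exact b₁ a'
  have d₂ : h' ≠ w₂ := by rintro rfl; exact b₂ a'
  have d₃ : h' ≠ w₃ := by rintro rfl; exact b₃ a'
  simp [Fin.sum_univ_five, ← e₁, ← e₂, ← e₃, b₁, b₂, b₃, a, a', hc, hn, hn.symm, n₁₂, n₁₃, n₂₃,
    n₁₂.symm, n₁₃.symm, n₂₃.symm, c₁, c₂, c₃, d₁, d₂, d₃, c₁.symm, c₂.symm, c₃.symm,
    d₁.symm, d₂.symm, d₃.symm, fun k => G.adj_comm h k, fun k => G.adj_comm h' k] at this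
  norm_num at this


/-- A vertex with a crossing neighbour has at most one twin. -/
lemma W_le_two (hpos : ∀ i j, 0 < P.dot i j) {w q : V} (hc : P.Cross w q) :
    (P.W w).card ≤ 2 := by
  by_contra hlt
  obtain ⟨w₁, w₂, w₃, m₁, m₂, m₃, n₁₂, n₁₃, n₂₃⟩ := two_lt_card_iff.1 (by omega : 2 < (P.W w).card)
  have e₁ := fun k => adj_of_W (k := k) m₁
  have e₂ := fun k => adj_of_W (k := k) m₂
  have e₃ := fun k => adj_of_W (k := k) m₃
  have b₁ := (P.mem_W.1 m₁).1
  have b₂ := (P.mem_W.1 m₂).1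
  have b₃ := (P.mem_W.1 m₃).1
  have ne : ∀ h, G.Adj w h → h ≠ w₁ ∧ h ≠ w₂ ∧ h ≠ w₃ := fun h a =>
    ⟨by rintro rfl; exact b₁ a, by rintro rfl; exact b₂ a, by rintro rfl; exact b₃ a⟩
  have hcl : ∀ h h', G.Adj w h → G.Adj w h' → h ≠ h' → G.Adj h h' := fun h h' a a' hn =>
    clique_of_three m₁ m₂ m₃ n₁₂ n₁₃ n₂₃ a a' hn
  obtain ⟨h, hh⟩ := card_pos.1 (cn_pos hpos hc.1)
  have ha : G.Adj w h := by simpa using (mem_inter.1 hh).1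
  have hq : G.Adj q h := by simpa using (mem_inter.1 hh).2
  by_cases h2 : ∃ h', G.Adj w h' ∧ h' ≠ h
  · obtain ⟨h', ha', hn⟩ := h2
    have hhh := hcl _ _ ha ha' hn.symm
    obtain ⟨c₁, c₂, c₃⟩ := ne h ha
    obtain ⟨d₁, d₂, d₃⟩ := ne h' ha'
    by_cases h3 : ∃ h'', G.Adj w h'' ∧ h'' ≠ h ∧ h'' ≠ h'
    · obtain ⟨k, ka, kn, kn'⟩ := h3
      have k1 := hcl _ _ ha ka kn.symm
      have k2 := hcl _ _ ha' ka kn'.symm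
      obtain ⟨f₁, f₂, f₃⟩ := ne k ka
      -- Three independent vertices joined to a triangle: the value of the form at this vector is
      -- -6.
      have := P.psd 6 ![w₁, w₂, w₃, h, h', k] ![3, 3, 3, -2, -2, -2]
      simp [Fin.sum_univ_six, ← e₁, ← e₂, ← e₃, b₁, b₂, b₃, ha, ha', ka, k1, k2, k1.symm, k2.symm,
        hhh.symm, hhh, hn, hn.symm, n₁₂, n₁₃, n₂₃, kn, kn', kn.symm, kn'.symm,
        n₁₂.symm, n₁₃.symm, n₂₃.symm, c₁, c₂, c₃, d₁, d₂, d₃, c₁.symm, c₂.symm, c₃.symm,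
        d₁.symm, d₂.symm, d₃.symm, f₁, f₂, f₃, f₁.symm, f₂.symm, f₃.symm,
        G.adj_comm h w₁, G.adj_comm h w₂, G.adj_comm h w₃, G.adj_comm h' w₁, G.adj_comm h' w₂,
        G.adj_comm h' w₃, G.adj_comm k w₁, G.adj_comm k w₂, G.adj_comm k w₃] at this
      norm_num at this
    -- Here the form has the value -2, or -6 if q is also adjacent to h'.
    · have := P.psd 6 ![w₁, w₂, w₃, h, h', q] ![2, 2, 2, -2, -2, 1]
      have g₁ : q ≠ w₁ := by rintro rfl; exact b₁ (by simpa using absurd (P.mem_W.1 m₁).2 hc.2)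
      have g₂ : q ≠ w₂ := by rintro rfl; exact b₁ (by simpa using absurd (P.mem_W.1 m₂).2 hc.2)
      have g₃ : q ≠ w₃ := by rintro rfl; exact b₁ (by simpa using absurd (P.mem_W.1 m₃).2 hc.2)
      have g₄ : q ≠ h := by rintro rfl; exact hc.1 ha
      have g₅ : q ≠ h' := by rintro rfl; exact hc.1 ha'
      simp [Fin.sum_univ_six, ← e₁, ← e₂, ← e₃, b₁, b₂, b₃, ha, ha', hq, hq.symm, hc.1,
        hhh.symm, hhh, hn, hn.symm, n₁₂, n₁₃, n₂₃,
        n₁₂.symm, n₁₃.symm, n₂₃.symm, c₁, c₂, c₃, d₁, d₂, d₃, c₁.symm, c₂.symm, c₃.symm,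
        d₁.symm, d₂.symm, d₃.symm, g₁, g₂, g₃, g₁.symm, g₂.symm, g₃.symm, g₄, g₅, g₄.symm, g₅.symm,
        G.adj_comm h w₁, G.adj_comm h w₂, G.adj_comm h w₃, G.adj_comm h' w₁, G.adj_comm h' w₂,
        G.adj_comm h' w₃, G.adj_comm q w₁, G.adj_comm q w₂, G.adj_comm q w₃,
        G.adj_comm q h'] at this
      by_cases hqh : G.Adj h' q <;> simp only [hqh, if_true, if_false] at this <;> linarith
  -- Now h is the only neighbour of w. Every nonneighbour of w shares a neighbour with w, so h is
  -- adjacent to all other vertices.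
  · push Not at h2
    have hnw : nb G w = {h} := by
      ext x; simp only [mem_nb, mem_singleton]
      exact ⟨h2 x, by rintro rfl; exact ha⟩
    have dom : ∀ x, x ≠ h → G.Adj h x := by
      intro x hx
      have hnx : ¬ G.Adj w x := fun h0 => hx (h2 x h0)
      obtain ⟨y, hy⟩ := card_pos.1 (cn_pos hpos hnx)
      rw [hnw, mem_inter, mem_singleton, mem_nb] at hy
      obtain ⟨rfl, hy⟩ := hy
      exact hy.symm
    -- The determinant of w, h and x leaves deg h = cn h x + 4, so a crossing neighbour x of w
    -- misses only itself and three twins.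
    have key : ∀ x, P.Cross w x → x ≠ h ∧ Fintype.card V = (nb G x).card + 4 := by
      intro x hx
      have hxh : x ≠ h := by rintro rfl; exact hx.1 ha
      refine ⟨hxh, ?_⟩
      have c1 : (nb G x ∩ nb G h).card + 1 = (nb G x).card := by
        have : nb G x ∩ nb G h = (nb G x).erase h := by
          ext y; simp only [mem_inter, mem_nb, mem_erase]
          exact ⟨fun hy => ⟨fun h0 => by subst h0; exact G.loopless.irrefl _ hy.2, hy.1⟩,
            fun hy => ⟨hy.2, dom y hy.1⟩⟩
        rw [this, card_erase_add_one]
        simpa using (dom x hxh).symm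
      have c2 : (nb G h).card + 1 = Fintype.card V := by
        have : nb G h = univ.erase h := by
          ext y; simp only [mem_nb, mem_erase, mem_univ, and_true]
          exact ⟨fun hy h0 => by subst h0; exact G.loopless.irrefl _ hy, dom y⟩
        rw [this, card_erase_add_one (mem_univ _), card_univ]
      have c3 : nb G w ∩ nb G x = {h} := by
        rw [hnw]; ext y; simp only [mem_inter, mem_singleton, mem_nb, and_iff_left_iff_imp]
        rintro rfl; exact (dom x hxh).symm
      have c4 : nb G w ∩ nb G h = ∅ := by
        rw [hnw]; ext y; simp only [mem_inter, mem_singleton, mem_nb, notMem_empty, iff_false]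
        rintro ⟨rfl, h0⟩; exact G.loopless.irrefl _ h0
      have g := gram3 (P.a w) (P.b w) (P.a h) (P.b h) (P.a x) (P.b x)
        (P.dot_self w) (P.dot_self h) (P.dot_self x) (P.dot_adj ha) (P.dot_nadj hx.1)
        (P.dot_adj (dom x hxh))
      have c1' : cn G h x + 1 = (nb G x).card := by rw [cn, inter_comm]; exact c1
      have d1 : cn G w h = 0 := by rw [cn, c4, card_empty]
      have d2 : cn G w x = 1 := by rw [cn, c3, card_singleton]
      have hcr : (1 : ℝ) * (nb G x).card - 1 ≠ 0 := by
        have := P.cr_sq w x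
        rw [P.dot_self, P.dot_self, P.dot_nadj hx.1, d2, hnw] at this
        intro h0
        apply hx.2
        simp only [card_singleton, Nat.cast_one] at this
        have : P.cr w x ^ 2 = 0 := by rw [this]; linarith
        simpa using this
      rw [d1, d2, hnw, card_singleton, ← c1'] at g
      rw [← c1'] at hcr ⊢
      rw [← c2]
      push_cast at g hcr
      have : (cn G h x : ℝ) * ((nb G h).card - cn G h x - 4) = 0 := by linear_combination g
      rcases mul_eq_zero.1 this with h0 | h0
      · exact absurd (by rw [h0]; ring) hcr
      · have : ((nb G h).card : ℝ) = (cn G h x + 4 : ℕ) := by push_cast; linarith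
        have : (nb G h).card = cn G h x + 4 := by exact_mod_cast this
        omega
    have nbx : ∀ x, P.Cross w x → nb G x = ({x, w₁, w₂, w₃} : Finset V)ᶜ := by
      intro x hx
      have hk := key x hx
      apply eq_of_subset_of_card_le
      · intro y hy
        rw [mem_nb] at hy
        simp only [mem_compl, mem_insert, mem_singleton, not_or]
        refine ⟨fun h0 => by subst h0; exact G.loopless.irrefl _ hy, ?_, ?_, ?_⟩
        · rintro rfl; exact hx.1 ((e₁ x).2 hy.symm)
        · rintro rfl; exact hx.1 ((e₂ x).2 hy.symm)
        · rintro rfl; exact hx.1 ((e₃ x).2 hy.symm)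
      · rw [card_compl]
        have x1 : x ∉ ({w₁, w₂, w₃} : Finset V) := by
          simp only [mem_insert, mem_singleton, not_or]
          exact ⟨by rintro rfl; exact hx.2 (P.mem_W.1 m₁).2, by rintro rfl; exact hx.2 (P.mem_W.1 m₂).2,
            by rintro rfl; exact hx.2 (P.mem_W.1 m₃).2⟩
        rw [card_insert_of_notMem x1, card_eq_three.2 ⟨w₁, w₂, w₃, n₁₂, n₁₃, n₂₃, rfl⟩]
        omega
    have h3 : ∃ y, G.Adj q y ∧ y ≠ h := by
      by_contra h4
      push Not at h4
      have : nb G q = {h} := by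
        ext x; simp only [mem_nb, mem_singleton]
        exact ⟨h4 x, by rintro rfl; exact hq⟩
      apply hc.2
      have c := P.cr_sq w q
      rw [P.dot_self, P.dot_self, P.dot_nadj hc.1, cn, this, hnw] at c
      simpa using c
    -- This second neighbour y of q also crosses w, and by the description of neighbourhoods q and y
    -- have equal closed neighbourhoods.
    obtain ⟨y, hy, hyh⟩ := h3
    have hwy : P.Cross w y := by
      have h5 : ¬ G.Adj w y := fun h0 => hyh (h2 y h0)
      refine ⟨h5, fun h0 => ?_⟩
      have := nb_of_mem_W (P.mem_W.2 ⟨h5, h0⟩)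
      rw [hnw] at this
      have h6 : q ∈ nb G y := by simpa using hy.symm
      rw [← this, mem_singleton] at h6
      subst h6
      exact hc.1 ha
    have t1 := nbx q hc
    have t2 := nbx y hwy
    refine P.not_closed_twins hy ?_ ?_
    · rw [t1, t2]; intro x
      simp only [mem_sdiff, mem_compl, mem_insert, mem_singleton]; tauto
    · rw [t1, t2]; intro x
      simp only [mem_sdiff, mem_compl, mem_insert, mem_singleton]; tauto

/-- After each quantity is written as its lower bound plus a nonnegative amount, the left side minus
the right side minus (A' + B') expands into nonnegative terms. So the left side is strictly larger.
-/
lemma cross_eq_aux {Y S A B A' B' m : ℤ} (hA : 0 ≤ A) (hB : 0 ≤ B) (hA' : A ≤ A') (hB' : B ≤ B')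
    (hm : 1 ≤ m) (hS : m + 1 ≤ S) (hY : A + B + m + 1 ≤ Y) (hp : 0 < A' + B')
    (h : Y * (S * (A' + B') + A' * B') = S * (A - B) ^ 2 + (A + m) ^ 2 * B' + (B + m) ^ 2 * A') :
    False := by
  obtain ⟨y, rfl⟩ := Int.le.dest hY
  obtain ⟨x, rfl⟩ := Int.le.dest hS
  obtain ⟨p, rfl⟩ := Int.le.dest hA'
  obtain ⟨q, rfl⟩ := Int.le.dest hB'
  obtain ⟨m, rfl⟩ := Int.le.dest hm
  lift A to ℕ using hA
  lift B to ℕ using hB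
  have : 0 < (A + p + (B + q) : ℤ) + (
    ((A + B + (1 + m) + 1 + y) * ((1 + m + 1 + x) * (A + p + (B + q)) + (A + p) * (B + q)) -
     ((1 + m + 1 + x) * (A - B) ^ 2 + (A + (1 + m)) ^ 2 * (B + q) + (B + (1 + m)) ^ 2 * (A + p)))
      - (A + p + (B + q))) := by
    apply add_pos_of_pos_of_nonneg hp
    ring_nf
    positivity
  linarith

/-- The relation between the numbers of crossing neighbours of two crossing neighbours of `q`. -/
lemma cross_eq (hpos : ∀ i j, 0 < P.dot i j) {q l i : V} (hl : P.Cross q l) (hi : P.Cross q i)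
    (hs : ¬ P.Same l i) {A B g κq κl κi : ℤ} (hA : A = (P.R i \ P.R l).card - 1)
    (hB : B = (P.R l \ P.R i).card - 1) (hg : g = (P.R i ∩ P.R l).card)
    (hq' : κq = (P.W q).card - 1) (hl' : κl = (P.W l).card - 1) (hi' : κi = (P.W i).card - 1) :
    (Fintype.card V - 1 - κq - (P.R q).card) *
      (((P.R q).card + g - κq - 1 - κl - κi) * (A + κl + (B + κi)) + (A + κl) * (B + κi)) =
    ((P.R q).card + g - κq - 1 - κl - κi) * (A - B) ^ 2 + (A + (g - κq)) ^ 2 * (B + κi) +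
      (B + (g - κq)) ^ 2 * (A + κl) ∧ 0 < A + κl + (B + κi) := by
  have hadj := adj_of_cross' hpos hl hi hs
  have e1 := card_sdiff_add_card_inter (P.R i) (P.R l)
  have e2 := card_sdiff_add_card_inter (P.R l) (P.R i)
  rw [inter_comm] at e2
  have e1' : ((P.R i).card : ℝ) = A + 1 + g := by
    have : ((P.R i).card : ℤ) = A + 1 + g := by rw [hA, hg]; push_cast [← e1]; ring
    exact_mod_cast this
  have e2' : ((P.R l).card : ℝ) = B + 1 + g := by
    have : ((P.R l).card : ℤ) = B + 1 + g := by rw [hB, hg]; push_cast [← e2]; ring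
    exact_mod_cast this
  have f1 : ((P.W q).card : ℝ) = κq + 1 := by rw [hq']; push_cast; ring
  have f2 : ((P.W l).card : ℝ) = κl + 1 := by rw [hl']; push_cast; ring
  have f3 : ((P.W i).card : ℝ) = κi + 1 := by rw [hi']; push_cast; ring
  have f4 : ((P.R l ∩ P.R i).card : ℝ) = g := by rw [hg, inter_comm]; push_cast; ring
  have d1 := P.dot_self' q
  have d2 := P.dot_self' l
  have d3 := P.dot_self' i
  have d4 := dot_cross hpos hl
  have d5 := dot_cross hpos hi
  have d6 := dot_of_adj (P := P) hadj
  have d7 : 0 < P.dot l l + P.dot i i - 2 * P.dot l i := by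
    by_contra hn; exact hs (P.same_of_dist (by linarith))
  rw [f1] at d1
  rw [f2, e2'] at d2
  rw [f3, e1'] at d3
  rw [e2'] at d4
  rw [e1'] at d5
  rw [f2, f3, f4, e1', e2'] at d6
  constructor
  · unfold dot at d1 d2 d3 d4 d5 d6
    generalize ((P.R q).card) = ρ at *
    -- The determinant of q, q - i and q - l; passing to differences keeps the entries short. The
    -- second claim is that the squared distance of l and i is positive.
    have := gram3 (P.a q) (P.b q) (P.a q - P.a i) (P.b q - P.b i) (P.a q - P.a l) (P.b q - P.b l)
      (g₁₁ := Fintype.card V - 1 - κq - ρ) (g₂₂ := (ρ + g - κq - 1 - κl - κi) + (A + κl))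
      (g₃₃ := (ρ + g - κq - 1 - κl - κi) + (B + κi)) (g₁₂ := A + (g - κq)) (g₁₃ := B + (g - κq))
      (g₂₃ := ρ + g - κq - 1 - κl - κi) (by linarith) (by linarith) (by linarith) (by linarith)
      (by linarith) (by linarith)
    have h2 : ((Fintype.card V : ℝ) - 1 - κq - ρ) *
      ((ρ + g - κq - 1 - κl - κi) * (A + κl + (B + κi)) + (A + κl) * (B + κi)) =
      (ρ + g - κq - 1 - κl - κi) * (A - B) ^ 2 + (A + (g - κq)) ^ 2 * (B + κi) +
      (B + (g - κq)) ^ 2 * (A + κl) := by linear_combination this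
    exact_mod_cast h2
  · rw [d2, d3, d6] at d7
    have : (0 : ℝ) < A + κl + (B + κi) := by linarith
    exact_mod_cast this

lemma W_disj_W {l i : V} (hs : ¬ P.Same l i) : Disjoint (P.W l) (P.W i) := by
  rw [disjoint_left]; intro x h1 h2
  exact hs ((same_of_mem_W h1).trans (same_of_mem_W h2).symm)

/-- The crossing neighbourhoods of two crossing neighbours of a vertex are nested. -/
lemma nest (hpos : ∀ i j, 0 < P.dot i j) {q l i : V} (hl : P.Cross q l) (hi : P.Cross q i)
    (hs : ¬ P.Same l i) : P.R l ⊆ P.R i ∨ P.R i ⊆ P.R l := by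
  by_contra hn
  push Not at hn
  have a1 : 1 ≤ (P.R l \ P.R i).card := card_pos.2 (sdiff_nonempty.2 hn.1)
  have a2 : 1 ≤ (P.R i \ P.R l).card := card_pos.2 (sdiff_nonempty.2 hn.2)
  -- If neither set contains the other, A and B are nonnegative. The other bounds needed are counts:
  -- W q lies in both crossing sets, W l and W i are disjoint subsets of R q, and R q is disjoint
  -- from R i ∪ R l.
  obtain ⟨h1, h2⟩ := cross_eq hpos hl hi hs rfl rfl rfl rfl rfl rfl
  have w1 := P.W_pos i
  have w2 := P.W_pos l
  have w3 : (P.W q).card ≤ (P.R i ∩ P.R l).card :=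
    card_le_card (subset_inter (W_subset_R hi.symm) (W_subset_R hl.symm))
  have w4 : (P.W l).card + (P.W i).card ≤ (P.R q).card := by
    rw [← card_union_of_disjoint (W_disj_W hs)]
    exact card_le_card (union_subset (W_subset_R hl) (W_subset_R hi))
  have w5 : (P.R q).card + ((P.R i \ P.R l).card + (P.R l \ P.R i).card + (P.R i ∩ P.R l).card)
      ≤ Fintype.card V := by
    have e1 : (P.R i ∪ P.R l).card =
        (P.R i \ P.R l).card + (P.R l \ P.R i).card + (P.R i ∩ P.R l).card := by
      have := card_union_add_card_inter (P.R i) (P.R l)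
      have e1 := card_sdiff_add_card_inter (P.R i) (P.R l)
      have e2 := card_sdiff_add_card_inter (P.R l) (P.R i)
      rw [inter_comm] at e2
      omega
    rw [← e1, ← card_union_of_disjoint]
    · exact card_le_univ _
    · exact disjoint_union_right.2 ⟨R_disj hpos hi, R_disj hpos hl⟩
  refine cross_eq_aux ?_ ?_ ?_ ?_ ?_ ?_ ?_ h2 h1 <;> omega

end PD
end TwoEig
end

/-! ### Model graphs, and maximal crossing pairs. -/

section
open scoped Classical
namespace TwoEig
open Finset

/-- `K_k □ K_2`. -/
def prism (k : ℕ) : SimpleGraph (Fin k × Fin 2) where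
  Adj x y := (x.1 = y.1 ∧ x.2 ≠ y.2) ∨ (x.1 ≠ y.1 ∧ x.2 = y.2)
  symm := ⟨fun x y h => h.imp (fun h => ⟨h.1.symm, h.2.symm⟩) (fun h => ⟨h.1.symm, h.2.symm⟩)⟩
  loopless := ⟨fun x h => by simp at h⟩

/-- Two cocktail party graphs, where half of the first one is joined to the second one. -/
def halfJoin (k l : ℕ) : SimpleGraph ((Fin k × Fin 2) ⊕ (Fin l × Fin 2)) where
  Adj x y := match x, y with
    | .inl a, .inl b => a.1 ≠ b.1
    | .inr a, .inr b => a.1 ≠ b.1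
    | .inl a, .inr _ => a.2 = 0
    | .inr _, .inl b => b.2 = 0
  symm := ⟨fun x y h => by rcases x with x | x <;> rcases y with y | y <;> simp_all [eq_comm]⟩
  loopless := ⟨fun x h => by rcases x with x | x <;> simp at h⟩

/-- The cocktail party graph with a further vertex joined to one vertex of each class. -/
def halfCone (k : ℕ) : SimpleGraph ((Fin k × Fin 2) ⊕ Unit) where
  Adj x y := match x, y with
    | .inl a, .inl b => a.1 ≠ b.1
    | .inr _, .inr _ => False
    | .inl a, .inr _ => a.2 = 0
    | .inr _, .inl b => b.2 = 0
  symm := ⟨fun x y h => by rcases x with x | x <;> rcases y with y | y <;> simp_all [eq_comm]⟩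
  loopless := ⟨fun x h => by rcases x with x | x <;> simp at h⟩

/-- Counting makes the surjection bijective, so adjacency may be checked knowing that different
labels name different vertices. -/
lemma iso_of_surj {V M : Type*} [Fintype V] [Fintype M] {G : SimpleGraph V} {H : SimpleGraph M}
    (f : M → V) (hf : Function.Surjective f) (hc : Fintype.card M ≤ Fintype.card V)
    (ha : Function.Injective f → ∀ x y, H.Adj x y ↔ G.Adj (f x) (f y)) : Nonempty (G ≃g H) := by
  have hb : Function.Bijective f := (Fintype.bijective_iff_surjective_and_card f).2
    ⟨hf, le_antisymm hc (Fintype.card_le_of_surjective f hf)⟩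
  refine ⟨RelIso.symm ⟨Equiv.ofBijective f hb, ?_⟩⟩
  intro x y
  exact (ha hb.1 x y).symm

/-- A finite set with an involution that swaps a predicate with its negation. -/
lemma pair_param {V : Type*} [Fintype V] (C : Finset V) (tw : V → V) (p : V → Prop)
    (h1 : ∀ j ∈ C, tw j ∈ C) (h2 : ∀ j ∈ C, tw (tw j) = j) (h3 : ∀ j ∈ C, (p (tw j) ↔ ¬ p j)) :
    ∃ (k : ℕ) (g : Fin k × Fin 2 → V), Function.Injective g ∧ (∀ v, v ∈ C ↔ ∃ x, g x = v) ∧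
      C.card = k * 2 ∧ ∀ a, p (g (a, 0)) ∧ g (a, 1) = tw (g (a, 0)) := by
  let D := C.filter p
  let e := D.equivFin.symm
  have he : ∀ a, (e a : V) ∈ C ∧ p (e a) := fun a => mem_filter.1 (e a).2
  let g : Fin D.card × Fin 2 → V := fun x => if x.2 = 0 then (e x.1 : V) else tw (e x.1)
  have g0 : ∀ a, g (a, 0) = e a := fun a => by simp [g]
  have g1 : ∀ a, g (a, 1) = tw (e a) := fun a => by simp [g]
  have gi : Function.Injective g := by
    rintro ⟨a, x⟩ ⟨b, y⟩ h
    have n : ∀ a b, (e a : V) ≠ tw (e b) := fun a b h0 => by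
      have := (h3 _ (he b).1)
      rw [← h0] at this
      exact this.1 (he a).2 (he b).2
    fin_cases x <;> fin_cases y <;> simp only [Fin.zero_eta, Fin.mk_one, g0, g1] at h
    · have := e.injective (Subtype.ext h); subst this; rfl
    · exact absurd h (n _ _)
    · exact absurd h.symm (n _ _)
    · have h4 := congrArg tw h
      rw [h2 _ (he a).1, h2 _ (he b).1] at h4
      have := e.injective (Subtype.ext h4); subst this; rfl
  have gr : ∀ v, v ∈ C ↔ ∃ x, g x = v := by
    intro v
    constructor
    · intro hv
      by_cases hp : p v
      · refine ⟨(D.equivFin ⟨v, by simp [D, hv, hp]⟩, 0), ?_⟩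
        rw [g0]; simp [e]
      · refine ⟨(D.equivFin ⟨tw v, by simp [D, h1 v hv, (h3 v hv).2 hp]⟩, 1), ?_⟩
        rw [g1]; simp [e, h2 v hv]
    · rintro ⟨⟨a, x⟩, rfl⟩
      fin_cases x
      · simpa [g] using (he a).1
      · simpa [g] using h1 _ (he a).1
  refine ⟨D.card, g, gi, gr, ?_, fun a => ⟨by rw [g0]; exact (he a).2, by rw [g1, g0]⟩⟩
  have : C = univ.image g := by ext v; rw [gr]; simp
  rw [this, card_image_of_injective _ gi, card_univ, Fintype.card_prod]
  simp

/-- This is `Mx.eqn` for a vertex i with a twin. For κ = 0 it reads (ρ + m - 2)(A(m + t - 2) - 1) =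
A(m - 1)², and comparing sizes leaves A = 1 and m ≤ 3. For κ = 1 it would require (ρ + m - 3)(m + t
- 1) = (m - 1)², where the left side is too large. -/
lemma twin_arith {A m t ρ κ : ℤ} (h1 : (A + m + t) * ((ρ + m - 1 - κ - 1) * (A + κ - 1 + 1) +
      (A + κ) * (1 - 1)) =
      (ρ + m - 1 - κ - 1) * (A + 1) ^ 2 + (A + m) ^ 2 * (1 - 1) + (m - 1) ^ 2 * (A + κ))
    (h2 : 0 < A + κ + 1 - 1) (h3 : 1 ≤ m) (h4 : 1 + κ + 2 ≤ ρ) (h5 : 0 ≤ A) (h6 : 1 ≤ t)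
    (h8 : κ = 0 ∨ κ = 1) :
    κ = 0 ∧ A = 1 ∧ ((m = 1 ∧ t = 2) ∨ (m = 3 ∧ t = 1 ∧ ρ = 3)) := by
  rcases h8 with rfl | rfl
  · refine ⟨rfl, ?_⟩
    have e : (ρ + m - 2) * (A * (m + t - 2) - 1) = A * (m - 1) ^ 2 := by linear_combination h1
    have hA1 : 1 ≤ A := by omega
    rcases eq_or_lt_of_le h3 with hm1 | hm1
    · rw [← hm1] at e
      have : (ρ - 1) * (A * (t - 1) - 1) = 0 := by linear_combination e
      rcases mul_eq_zero.1 this with h0 | h0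
      · omega
      · have h10 : A * (t - 1) = 1 := by linarith
        have := Int.eq_one_or_neg_one_of_mul_eq_one h10
        have hA' : A = 1 := by omega
        rw [hA'] at h10
        omega
    · obtain ⟨d, hd⟩ : ∃ d, d = m - 1 := ⟨_, rfl⟩
      have hd1 : 1 ≤ d := by omega
      have hm' : m = d + 1 := by omega
      subst hm'
      obtain ⟨x, hx⟩ : ∃ x, x = A * (d + 1 + t - 2) - 1 := ⟨_, rfl⟩
      rw [← hx] at e
      have hx1 : A * d - 1 ≤ x := by
        have : 0 ≤ A * (t - 1) := mul_nonneg h5 (by omega)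
        linarith
      have hm2 : 0 < A * d ^ 2 := by positivity
      have hx0 : 0 < x := by
        have : 0 < (ρ + (d + 1) - 2) * x := by rw [e]; simpa using hm2
        exact (pos_iff_pos_of_mul_pos this).1 (by omega)
      have hy : (d + 2) * x ≤ A * d ^ 2 := by
        have : (d + 2) * x ≤ (ρ + (d + 1) - 2) * x :=
          mul_le_mul_of_nonneg_right (by omega) hx0.le
        rw [e] at this; simpa using this
      have hz : (d + 2) * (A * d - 1) ≤ A * d ^ 2 := le_trans (by
        exact mul_le_mul_of_nonneg_left hx1 (by omega)) hy
      have hz' : 2 * (A * d) ≤ d + 2 := by linarith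
      have hAd : d ≤ A * d := le_mul_of_one_le_left (by omega) hA1
      have hAd' : A ≤ A * d := le_mul_of_one_le_right (by omega) hd1
      have hd2 : d = 1 ∨ d = 2 := by omega
      have hA2 : A = 1 := by rcases hd2 with rfl | rfl <;> omega
      subst hA2
      rcases hd2 with rfl | rfl
      · have hx2 : x = t - 1 := by linarith
        rw [hx2] at e hx0
        have : 3 * (t - 1) ≤ (ρ + (1 + 1) - 2) * (t - 1) :=
          mul_le_mul_of_nonneg_right (by omega) (by omega)
        rw [e] at this
        omega
      · have hx2 : x = t := by linarith
        rw [hx2] at e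
        have : 4 * t ≤ (ρ + (2 + 1) - 2) * t := mul_le_mul_of_nonneg_right (by omega) (by omega)
        rw [e] at this
        have ht : t = 1 := by omega
        subst ht
        exact ⟨rfl, Or.inr ⟨by norm_num, rfl, by linarith⟩⟩
  · exfalso
    have e : (A + 1) * ((ρ + m - 3) * (m + t - 1) - (m - 1) ^ 2) = 0 := by linear_combination h1
    rcases mul_eq_zero.1 e with h0 | h0
    · omega
    · have : m * m ≤ (ρ + m - 3) * (m + t - 1) :=
        mul_le_mul (by omega) (by omega) (by omega) (by omega)
      nlinarith

namespace PD

variable {V : Type*} [Fintype V] {G : SimpleGraph V} {r s : ℝ} {P : PD G r s}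

/-- A set of vertices with exactly one twin each, closed under twins. -/
lemma twin_param (C : Finset V) (h2 : ∀ j ∈ C, (P.W j).card = 2) (hW : ∀ j ∈ C, P.W j ⊆ C) :
    ∃ (k : ℕ) (g : Fin k × Fin 2 → V), Function.Injective g ∧ (∀ v, v ∈ C ↔ ∃ x, g x = v) ∧
      C.card = k * 2 ∧ ∀ x y, g y ∈ P.W (g x) ↔ x.1 = y.1 := by
  have ex : ∀ j, ∃ k, j ∈ C → k ≠ j ∧ P.W j = {j, k} := by
    intro j
    by_cases hj : j ∈ C
    · have h3 : ((P.W j).erase j).card = 1 := by rw [card_erase_of_mem (P.self_mem_W j), h2 j hj]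
      obtain ⟨k, hk⟩ := card_eq_one.1 h3
      refine ⟨k, fun _ => ⟨?_, ?_⟩⟩
      · have : k ∈ (P.W j).erase j := by rw [hk]; simp
        exact (mem_erase.1 this).1
      · rw [← hk, insert_erase (P.self_mem_W j)]
    · exact ⟨j, fun h => absurd h hj⟩
  choose tw htw using ex
  have m1 : ∀ j ∈ C, tw j ∈ P.W j := fun j hj => by rw [(htw j hj).2]; simp
  have c1 : ∀ j ∈ C, tw j ∈ C := fun j hj => hW j hj (m1 j hj)
  have c2 : ∀ j ∈ C, tw (tw j) = j := fun j hj => by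
    have e1 := W_of_W (m1 j hj)
    have e2 : j ∈ P.W (tw j) := by rw [← e1]; exact P.self_mem_W j
    rw [(htw _ (c1 j hj)).2] at e2
    simp only [mem_insert, mem_singleton] at e2
    rcases e2 with h | h
    · exact absurd h.symm (htw j hj).1
    · exact h.symm
  let e := Fintype.equivFin V
  obtain ⟨k, g, gi, gr, gc, gt⟩ := pair_param C tw (fun j => e j < e (tw j)) c1 c2 (fun j hj => by
    rw [c2 j hj, not_lt, le_iff_lt_or_eq, or_iff_left]
    exact fun h => (htw j hj).1 (e.injective h))
  refine ⟨k, g, gi, gr, gc, fun x y => ?_⟩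
  have hW : ∀ a, P.W (g (a, 0)) = {g (a, 0), g (a, 1)} := fun a => by
    rw [(htw _ ((gr _).2 ⟨_, rfl⟩)).2, (gt a).2]
  have hx : P.W (g x) = {g (x.1, 0), g (x.1, 1)} := by
    obtain ⟨a, x⟩ := x
    fin_cases x
    · exact hW a
    · have : g (a, 1) ∈ P.W (g (a, 0)) := by rw [hW]; simp
      rw [← hW, W_of_W this]; rfl
  rw [hx]
  obtain ⟨b, y⟩ := y
  simp only [mem_insert, mem_singleton, gi.eq_iff, Prod.mk.injEq]
  fin_cases y <;> simp [eq_comm]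

lemma nadj_iff {x y : V} : ¬ G.Adj x y ↔ y ∈ P.W x ∨ y ∈ P.R x := by
  rw [mem_W, mem_R, Cross]; tauto

/-- The nonnegative squared distance of two adjacent vertices, expressed by twins and crossing sets;
`same_of_le` is the equality case. -/
lemma adj_ge {x y : V} (P : PD G r s) (h : G.Adj x y) :
    2 * (P.R x ∩ P.R y).card + 4 ≤ (P.R x).card + (P.R y).card + (P.W x).card + (P.W y).card := by
  have h1 := P.dist_nonneg x y
  rw [dot_self', dot_self', dot_of_adj h] at h1
  have : (2 * (P.R x ∩ P.R y).card + 4 : ℝ) ≤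
    (P.R x).card + (P.R y).card + (P.W x).card + (P.W y).card := by linarith
  exact_mod_cast this

lemma same_of_le {x y : V} (P : PD G r s) (h : G.Adj x y) (h' : (P.R x).card + (P.R y).card +
    (P.W x).card + (P.W y).card ≤ 2 * (P.R x ∩ P.R y).card + 4) : P.Same x y := by
  apply P.same_of_dist
  rw [dot_self', dot_self', dot_of_adj h]
  have : ((P.R x).card + (P.R y).card + (P.W x).card + (P.W y).card : ℝ) ≤
    2 * (P.R x ∩ P.R y).card + 4 := by exact_mod_cast h'
  linarith

lemma W_eq_singleton {x : V} (h : (P.W x).card = 1) : P.W x = {x} := by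
  obtain ⟨y, hy⟩ := card_eq_one.1 h
  have := P.self_mem_W x
  rw [hy, mem_singleton] at this
  rw [hy, this]

lemma mem_R_comm {x y : V} : x ∈ P.R y ↔ y ∈ P.R x := by
  rw [mem_R, mem_R]; exact ⟨Cross.symm, Cross.symm⟩

/-- A crossing pair with as many crossing neighbours as possible. -/
structure Mx (P : PD G r s) (i q : V) : Prop where
  cross : P.Cross i q
  max : ∀ j k, P.Cross j k → (P.R j).card + (P.R k).card ≤ (P.R i).card + (P.R q).card

lemma Mx.symm {i q : V} (h : P.Mx i q) : P.Mx q i :=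
  ⟨h.cross.symm, fun j k hjk => by have := h.max j k hjk; omega⟩

lemma Mx.of_same {i q i' q' : V} (h : P.Mx i q) (hi : P.Same i i') (hq : P.Same q q')
    (hc : P.Cross i' q') : P.Mx i' q' :=
  ⟨hc, fun j k hjk => by rw [← hi.R_card, ← hq.R_card]; exact h.max j k hjk⟩

section pos
variable (hpos : ∀ i j, 0 < P.dot i j)
include hpos

/-- Of the two nestings, maximality permits only this one. Equal crossing sets would make the
squared distance nonpositive, because twin classes have at most two members. -/
lemma Mx.ssub {i q l : V} (h : P.Mx i q) (hl : P.Cross q l) (hs : ¬ P.Same l i) :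
    P.R l ⊂ P.R i := by
  have hle : (P.R l).card ≤ (P.R i).card := by have := h.max q l hl; omega
  have hsub : P.R l ⊆ P.R i := by
    rcases nest hpos hl h.cross.symm hs with h1 | h1
    · exact h1
    · exact (eq_of_subset_of_card_le h1 hle).ge
  refine hsub.ssubset_of_ne fun he => hs ?_
  refine P.same_of_le (adj_of_cross' hpos hl h.cross.symm hs) ?_
  have := W_le_two hpos hl.symm
  have := W_le_two hpos h.cross
  rw [he, inter_self]; omega

/-- The numerical consequences for a crossing neighbour of one end of a maximal crossing pair. -/
lemma Mx.eqn {i q l : V} (h : P.Mx i q) (hl : P.Cross q l) (hs : ¬ P.Same l i)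
    {A m κq κl κi t ρq : ℤ} (hA : A = (P.R i).card - (P.R l).card - 1)
    (hm : m = (P.R l).card - κq) (hq' : κq = (P.W q).card - 1) (hl' : κl = (P.W l).card - 1)
    (hi' : κi = (P.W i).card - 1) (ht : t = cn G i q) (hρ : ρq = (P.R q).card) :
    (A + m + t) * ((ρq + m - 1 - κl - κi) * (A + κl - 1 + κi) + (A + κl) * (κi - 1)) =
      (ρq + m - 1 - κl - κi) * (A + 1) ^ 2 + (A + m) ^ 2 * (κi - 1) + (m - 1) ^ 2 * (A + κl) ∧
    0 < A + κl + κi - 1 ∧ 1 ≤ m ∧ κi + κl + 2 ≤ ρq ∧ 0 ≤ A ∧ 1 ≤ t ∧ (κq = 0 ∨ κq = 1) ∧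
    (κl = 0 ∨ κl = 1) ∧ (κi = 0 ∨ κi = 1) := by
  have hss := h.ssub hpos hl hs
  have hlt := card_lt_card hss
  have g1 : (P.R l \ P.R i).card = 0 := by rw [card_eq_zero, sdiff_eq_empty_iff_subset]; exact hss.1
  have g2 : P.R i ∩ P.R l = P.R l := inter_eq_right.2 hss.1
  have g3 := card_sdiff_add_card_inter (P.R i) (P.R l)
  rw [g2] at g3
  -- Nesting makes the parameter B equal to -1, and `card_cross` for the pair i, q replaces the
  -- number of vertices by t.
  obtain ⟨h1, h2⟩ := cross_eq hpos hl h.cross.symm hs rfl rfl rfl rfl rfl rfl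
  rw [g1, g2] at h1
  rw [g1] at h2
  have e1 : (((P.R i \ P.R l).card : ℕ) : ℤ) - 1 = A := by omega
  rw [e1, ← hq', ← hl', ← hi', ← hρ] at h1
  rw [e1, ← hl', ← hi'] at h2
  have c1 := card_cross hpos h.cross
  have e2 : (Fintype.card V : ℤ) - 1 - κq - ρq = A + m + t := by omega
  have e3 : (((P.R l).card : ℕ) : ℤ) = m + κq := by omega
  rw [e2, e3] at h1
  have w3 : (P.W q).card ≤ (P.R l).card := card_le_card (W_subset_R hl.symm)
  have w4 : (P.W l).card + (P.W i).card ≤ (P.R q).card := by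
    rw [← card_union_of_disjoint (W_disj_W hs)]
    exact card_le_card (union_subset (W_subset_R hl) (W_subset_R h.cross.symm))
  have a1 := W_le_two hpos hl
  have a2 := W_le_two hpos hl.symm
  have a3 := W_le_two hpos h.cross
  have b1 := P.W_pos q
  have b2 := P.W_pos l
  have b3 := P.W_pos i
  have c2 := cn_pos hpos h.cross.1
  refine ⟨?_, by push_cast at h2; linarith, by omega, by omega, by omega, by omega, by omega,
    by omega, by omega⟩
  push_cast at h1
  linear_combination h1

lemma Mx.of_twin {i q l : V} (h : P.Mx i q) (hl : P.Cross q l) (hs : ¬ P.Same l i)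
    (hi : (P.W i).card = 2) : (P.W l).card = 1 ∧ (P.R i).card = (P.R l).card + 2 ∧
      (((P.R l).card = (P.W q).card ∧ cn G i q = 2) ∨
        ((P.R l).card = (P.W q).card + 2 ∧ cn G i q = 1 ∧ (P.R q).card = 3)) := by
  obtain ⟨h1, h2, h3, h4, h5, h6, h7, h8, h9⟩ := h.eqn hpos hl hs rfl rfl rfl rfl rfl rfl rfl
  have hκ : (((P.W i).card : ℕ) : ℤ) - 1 = 1 := by omega
  have hWl := P.W_pos l
  rw [hκ] at h1 h2 h4
  obtain ⟨A, hA⟩ : ∃ A : ℤ, A = (P.R i).card - (P.R l).card - 1 := ⟨_, rfl⟩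
  obtain ⟨m, hm⟩ : ∃ m : ℤ, m = (P.R l).card - ((P.W q).card - 1) := ⟨_, rfl⟩
  obtain ⟨t, ht⟩ : ∃ t : ℤ, t = cn G i q := ⟨_, rfl⟩
  obtain ⟨ρ, hρ⟩ : ∃ ρ : ℤ, ρ = (P.R q).card := ⟨_, rfl⟩
  obtain ⟨κ, hk⟩ : ∃ κ : ℤ, κ = (P.W l).card - 1 := ⟨_, rfl⟩
  rw [← hA, ← hm, ← ht, ← hρ, ← hk] at h1
  rw [← hA, ← hk] at h2
  rw [← hm] at h3
  rw [← hρ, ← hk] at h4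
  rw [← hA] at h5
  rw [← ht] at h6
  rw [← hk] at h8
  have := twin_arith h1 h2 h3 h4 h5 h6 h8
  omega

end pos
end PD
end TwoEig
end

/-! ### A maximal pair with a twin: the half joins. -/

section
open scoped Classical
namespace TwoEig
open Finset

/-- The vertices `u₀ a` form the half of the first cocktail party graph that is joined to the second
one, and `u₁ a` are their partners. -/
lemma halfJoin_iso {V : Type*} [Fintype V] {G : SimpleGraph V} {n k : ℕ} (u₀ u₁ : Fin n → V)
    (g : Fin k × Fin 2 → V)
    (n₀ : ∀ a v, ¬ G.Adj (u₀ a) v ↔ v = u₀ a ∨ v = u₁ a)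
    (n₁ : ∀ a v, ¬ G.Adj (u₁ a) v ↔ v = u₁ a ∨ v = u₀ a ∨ ∃ x, g x = v)
    (n₂ : ∀ x v, ¬ G.Adj (g x) v ↔ (∃ y, g y = v ∧ x.1 = y.1) ∨ ∃ a, v = u₁ a)
    (hs : ∀ v, (∃ a, v = u₀ a) ∨ (∃ a, v = u₁ a) ∨ ∃ x, g x = v)
    (hc : n * 2 + k * 2 ≤ Fintype.card V) : Nonempty (G ≃g halfJoin n k) := by
  let f : (Fin n × Fin 2) ⊕ (Fin k × Fin 2) → V :=
    Sum.elim (fun x => if x.2 = 0 then u₀ x.1 else u₁ x.1) g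
  have f0 : ∀ a, u₀ a = f (.inl (a, 0)) := fun a => by simp [f]
  have f1 : ∀ a, u₁ a = f (.inl (a, 1)) := fun a => by simp [f]
  have f2 : ∀ x, g x = f (.inr x) := fun a => by simp [f]
  refine iso_of_surj f ?_ (by simpa using hc) ?_
  · intro v
    rcases hs v with ⟨a, rfl⟩ | ⟨a, rfl⟩ | ⟨x, rfl⟩
    exacts [⟨_, (f0 a).symm⟩, ⟨_, (f1 a).symm⟩, ⟨_, (f2 x).symm⟩]
  · intro hf x y
    rw [← not_iff_not]
    simp only [f0, f1, f2] at n₀ n₁ n₂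
    rcases x with ⟨a, x⟩ | x
    · fin_cases x
      · refine Iff.trans ?_ (n₀ a (f y)).symm
        rw [hf.eq_iff, hf.eq_iff]
        rcases y with ⟨b, y⟩ | y
        · fin_cases y <;> simp [halfJoin, eq_comm]
        · simp [halfJoin]
      · refine Iff.trans ?_ (n₁ a (f y)).symm
        simp only [hf.eq_iff]
        rcases y with ⟨b, y⟩ | y
        · fin_cases y <;> simp [halfJoin, eq_comm]
        · simp [halfJoin]
    · refine Iff.trans ?_ (n₂ x (f y)).symm
      simp only [hf.eq_iff]
      rcases y with ⟨b, y⟩ | y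
      · fin_cases y <;> simp [halfJoin]
      · simp [halfJoin]

namespace PD

variable {V : Type*} [Fintype V] {G : SimpleGraph V} {r s : ℝ} {P : PD G r s}

section pos
variable (hpos : ∀ i j, 0 < P.dot i j)
include hpos

/-- In the second alternative of `of_twin`, R q consists of l and the twins of i. A vertex of R l
outside W q then has the crossing set R q, which forces q to have a twin; applying `of_twin` from
the other end contradicts the counts. -/
lemma Mx.twin_cases {i q l : V} (h : P.Mx i q) (hl : P.Cross q l) (hs : ¬ P.Same l i)
    (hi : (P.W i).card = 2) : (P.W l).card = 1 ∧ (P.R i).card = (P.R l).card + 2 ∧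
      (P.R l).card = (P.W q).card ∧ cn G i q = 2 := by
  obtain ⟨h1, h2, h3⟩ := h.of_twin hpos hl hs hi
  refine ⟨h1, h2, h3.resolve_right ?_⟩
  rintro ⟨h4, h5, h6⟩
  have hW : P.W i ⊆ P.R q := W_subset_R h.cross.symm
  have hlW : l ∉ P.W i := fun h0 => hs (same_of_mem_W h0).symm
  have hRq : P.R q = insert l (P.W i) := by
    refine (eq_of_subset_of_card_le ?_ ?_).symm
    · exact insert_subset (P.mem_R.2 hl) hW
    · rw [card_insert_of_notMem hlW]; omega
  obtain ⟨y, hy⟩ : (P.R l \ P.W q).Nonempty := by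
    rw [← card_pos]
    have := le_card_sdiff (P.W q) (P.R l)
    omega
  rw [mem_sdiff] at hy
  have hyi : y ∈ P.R i := (h.ssub hpos hl hs).1 hy.1
  have hsub : P.R q ⊆ P.R y := by
    rw [hRq]
    refine insert_subset (mem_R_comm.1 hy.1) ?_
    exact W_subset_R (P.mem_R.1 hyi).symm
  have hyq : P.Same y q := by
    by_contra hn
    have := card_lt_card (h.symm.ssub hpos (P.mem_R.1 hyi) hn)
    have := card_le_card hsub
    omega
  have hRy : P.R q = P.R y := eq_of_subset_of_card_le hsub hyq.R_card.le
  have hadj : G.Adj q y := by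
    by_contra hn
    exact hy.2 (mem_W_of_same hn hyq.symm)
  have hWq : (P.W q).card = 2 := by
    rcases PD.swap hadj hyq.symm with h0 | ⟨_, _, p, p', _, _, h0, _⟩
    · exact h0.2.1
    · rw [hRy] at h0; simp at h0
  obtain ⟨z, hz⟩ : (P.R i \ P.R l).Nonempty := by
    rw [← card_pos]
    have := le_card_sdiff (P.R l) (P.R i)
    omega
  rw [mem_sdiff] at hz
  have hzc := P.mem_R.1 hz.1
  by_cases hzq : P.Same z q
  · have := hzq.symm.R_eq hWq
    exact hz.2 (mem_R_comm.1 (this ▸ P.mem_R.2 hl))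
  · obtain ⟨k1, k2, k3⟩ := h.symm.of_twin hpos hzc hzq hWq
    have : cn G q i = cn G i q := by unfold cn; rw [inter_comm]
    omega

/-- A maximal crossing pair whose first vertex has a twin, and whose second one has a crossing
neighbour with a different vector. -/
lemma Mx.iso_halfJoin {i q l : V} (h : P.Mx i q) (hl : P.Cross q l) (hs : ¬ P.Same l i)
    (hi : (P.W i).card = 2) : ∃ k, 1 ≤ k ∧ Nonempty (G ≃g halfJoin 3 k) := by
  obtain ⟨h1, h2, h3, h4⟩ := h.twin_cases hpos hl hs hi
  have hss := (h.ssub hpos hl hs).1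
  have hRl : P.R l = P.W q := (eq_of_subset_of_card_le (W_subset_R hl.symm) h3.le).symm
  -- Another such j would be adjacent to l, have the same crossing set W q and no twin, so the
  -- squared distance would be -2.
  have uniq : ∀ j, j ∈ P.R q → ¬ P.Same j i → j = l := by
    intro j hj hjs
    obtain ⟨k1, k2, k3, k4⟩ := h.twin_cases hpos (P.mem_R.1 hj) hjs hi
    by_contra hn
    have hadj : G.Adj j l := by
      refine adj_of_cross hpos (P.mem_R.1 hj) hl fun h0 => hn ?_
      rw [W_eq_singleton h1] at h0; simpa using h0
    have hRj : P.R j = P.W q :=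
      (eq_of_subset_of_card_le (W_subset_R (P.mem_R.1 hj).symm) k3.le).symm
    have := P.adj_ge hadj
    rw [hRj, hRl, inter_self] at this
    omega
  have Rj : ∀ j, j ∈ P.R q → j ≠ l → P.R j = P.R i := by
    intro j hj hjl
    have : P.Same i j := by
      by_contra hn; exact hjl (uniq j hj fun h0 => hn h0.symm)
    exact (this.R_eq hi).symm
  -- A vertex z with another vector would have R z = R q \ {l}. The positivity in `Mx.eqn`, read
  -- from the other end, then requires twins of both q and z, which `of_twin` excludes.
  have zs : ∀ z, z ∈ P.R i → z ∉ P.R l → P.Same q z := by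
    intro z hz hzl
    by_contra hn
    have hn' : ¬ P.Same z q := fun h0 => hn h0.symm
    have hzq := h.symm.ssub hpos (P.mem_R.1 hz) hn'
    have hRz : P.R z = P.R q \ {l} := by
      apply Subset.antisymm
      · intro x hx
        rw [mem_sdiff, mem_singleton]
        exact ⟨hzq.1 hx, by rintro rfl; exact hzl (mem_R_comm.1 hx)⟩
      · intro x hx
        rw [mem_sdiff, mem_singleton] at hx
        rw [mem_R_comm, Rj x hx.1 hx.2]; exact hz
    have hc : (P.R z).card + 1 = (P.R q).card := by
      rw [hRz, sdiff_singleton_eq_erase, card_erase_add_one (P.mem_R.2 hl)]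
    obtain ⟨e1, e2, e3, e4, e5, e6, e7, e8, e9⟩ :=
      h.symm.eqn hpos (P.mem_R.1 hz) hn' rfl rfl rfl rfl rfl rfl rfl
    have hq2 : (P.W q).card = 2 := by omega
    have := (h.symm.of_twin hpos (P.mem_R.1 hz) hn' hq2).1
    omega
  have hcard : (P.R i \ P.R l).card = 2 := by
    have := card_sdiff_add_card_inter (P.R i) (P.R l)
    rw [inter_eq_right.2 hss] at this; omega
  obtain ⟨z₁, z₂, hz, hzz⟩ := card_eq_two.1 hcard
  have m1 : z₁ ∈ P.R i ∧ z₁ ∉ P.R l := by rw [← mem_sdiff, hzz]; simp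
  have m2 : z₂ ∈ P.R i ∧ z₂ ∉ P.R l := by rw [← mem_sdiff, hzz]; simp
  have s1 := zs _ m1.1 m1.2
  have s2 := zs _ m2.1 m2.2
  have hlq : l ∈ P.R q := P.mem_R.2 hl
  have hq1 : (P.W q).card = 1 := by
    by_contra hn
    have hq2 : (P.W q).card = 2 := by
      have := P.W_pos q; have := W_le_two hpos hl; omega
    exact m1.2 (mem_R_comm.1 ((s1.R_eq hq2) ▸ hlq))
  have hWq := W_eq_singleton hq1
  rw [hWq] at hRl
  have hqz : ∀ z, z ∉ P.R l → q ≠ z := by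
    rintro z hz rfl; exact hz (by rw [hRl]; simp)
  -- the third vector class
  have part : ∀ z, z ∈ P.R i → z ∉ P.R l → ∃ p, P.Same l p ∧ P.R q \ P.R z = {l} ∧
      P.R z \ P.R q = {p} := by
    intro z hz hzl
    obtain ⟨_, p, p', hp, hpp, e1, e2⟩ := (zs z hz hzl).swap hq1 (hqz z hzl)
    have : l ∈ P.R q \ P.R z := mem_sdiff.2 ⟨hlq, fun h0 => hzl (mem_R_comm.1 h0)⟩
    rw [e1, mem_singleton] at this
    subst this
    exact ⟨p, hpp.symm, e1, e2⟩
  obtain ⟨p₁, a1, b1, c1⟩ := part z₁ m1.1 m1.2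
  obtain ⟨p₂, a2, b2, c2⟩ := part z₂ m2.1 m2.2
  have Rz : ∀ z p, P.R q \ P.R z = {l} → P.R z \ P.R q = {p} → ∀ x, x ∈ P.R z ↔
      x = p ∨ (x ∈ P.R q ∧ x ≠ l) := by
    intro z p e1 e2 x
    have f1 := congrArg (x ∈ ·) e1
    have f2 := congrArg (x ∈ ·) e2
    simp only [mem_sdiff, mem_singleton, eq_iff_iff] at f1 f2
    tauto
  have hz1 := Rz _ _ b1 c1
  have hz2 := Rz _ _ b2 c2
  have one : ∀ p, P.Same l p → ∀ z, z ∈ P.R p → ∀ v, ¬ G.Adj p v ↔ v = p ∨ v = z := by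
    intro p hp z hz v
    have hW : P.W p = {p} := W_eq_singleton (by rw [← hp.W_card, h1])
    have hR : P.R p = {z} := by
      refine (eq_of_subset_of_card_le (by simpa using hz) ?_).symm
      rw [← hp.R_card, hRl]; simp
    rw [nadj_iff (P := P), hW, hR, mem_singleton, mem_singleton]
  have n0 := one l (Same.refl P l) q (mem_R_comm.1 hlq)
  have n1 := one p₁ a1 z₁ (mem_R_comm.1 ((hz1 p₁).2 (Or.inl rfl)))
  have n2 := one p₂ a2 z₂ (mem_R_comm.1 ((hz2 p₂).2 (Or.inl rfl)))
  have hpp : p₁ ≠ p₂ := by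
    rintro rfl
    have e := (n1 z₂).1 (nadj_iff.2 (Or.inr (mem_R_comm.1 ((hz2 p₁).2 (Or.inl rfl)))))
    rcases e with rfl | e
    · have := (hz2 z₂).2 (Or.inl rfl)
      exact (P.mem_R.1 this).ne rfl
    · exact hz e.symm
  let C := P.R q \ {l}
  have memC : ∀ x, x ∈ C ↔ x ∈ P.R q ∧ x ≠ l := fun x => by simp [C]
  have Csame : ∀ j ∈ C, P.Same j i := fun j hj => by
    by_contra hn; exact ((memC j).1 hj).2 (uniq j ((memC j).1 hj).1 hn)
  obtain ⟨k, g, gi, gr, gc, gw⟩ := twin_param C (P := P)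
    (fun j hj => by rw [(Csame j hj).W_card, hi])
    (fun j hj x hx => by
      have hxq : x ∈ P.R q := W_subset_R (P.mem_R.1 ((memC j).1 hj).1) hx
      refine (memC x).2 ⟨hxq, ?_⟩
      rintro rfl
      exact hs ((same_of_mem_W hx).symm.trans (Csame j hj)))
  have iC : i ∈ C := (memC i).2 ⟨P.mem_R.2 h.cross.symm, by rintro rfl; exact hs (Same.refl P _)⟩
  have hRi : ∀ v, v ∈ P.R i ↔ v = q ∨ v = z₁ ∨ v = z₂ := by
    intro v
    have f1 := congrArg (v ∈ ·) hzz
    have f2 := @hss v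
    rw [hRl] at f1 f2
    simp only [mem_sdiff, mem_singleton, eq_iff_iff, mem_insert] at f1 f2
    tauto
  refine ⟨k, ?_, halfJoin_iso ![l, p₁, p₂] ![q, z₁, z₂] g ?_ ?_ ?_ ?_ ?_⟩
  · obtain ⟨⟨a, _⟩, _⟩ := (gr i).1 iC
    exact a.pos
  · intro a v
    fin_cases a
    exacts [n0 v, n1 v, n2 v]
  · have key : ∀ z p, P.Same q z → (∀ x, x ∈ P.R z ↔ x = p ∨ (x ∈ P.R q ∧ x ≠ l)) →
        ∀ v, ¬ G.Adj z v ↔ v = z ∨ v = p ∨ ∃ x, g x = v := by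
      intro z p hz hR v
      rw [nadj_iff (P := P), W_eq_singleton (by rw [← hz.W_card, hq1]), hR, mem_singleton, ← gr,
        memC]
    intro a v
    fin_cases a
    · refine key q l (Same.refl P q) (fun x => ?_) v
      by_cases hx : x = l
      · subst hx; simpa using hlq
      · simp [hx]
    · exact key z₁ p₁ s1 hz1 v
    · exact key z₂ p₂ s2 hz2 v
  · intro x v
    have hx : g x ∈ C := (gr _).2 ⟨x, rfl⟩
    rw [nadj_iff (P := P), Rj _ ((memC _).1 hx).1 ((memC _).1 hx).2, hRi]
    simp only [Fin.exists_fin_succ, IsEmpty.exists_iff, Matrix.cons_val_zero, Matrix.cons_val_succ,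
      or_false]
    refine or_congr ?_ Iff.rfl
    constructor
    · intro hv
      have hv' : v ∈ C := by
        refine (memC v).2 ⟨W_subset_R (P.mem_R.1 ((memC _).1 hx).1) hv, ?_⟩
        rintro rfl
        exact hs ((same_of_mem_W hv).symm.trans (Csame _ hx))
      obtain ⟨y, rfl⟩ := (gr v).1 hv'
      exact ⟨y, rfl, (gw x y).1 hv⟩
    · rintro ⟨y, rfl, hy⟩; exact (gw x y).2 hy
  · intro v
    simp only [Fin.exists_fin_succ, IsEmpty.exists_iff, Matrix.cons_val_zero, Matrix.cons_val_succ,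
      or_false]
    by_cases hvi : v ∈ P.R i
    · exact Or.inr (Or.inl ((hRi v).1 hvi))
    by_cases hvq : v ∈ P.R q
    · by_cases hvl : v = l
      · exact Or.inl (Or.inl hvl)
      · exact Or.inr (Or.inr ((gr v).1 ((memC v).2 ⟨hvq, hvl⟩)))
    -- The vertices outside R i and R q are the two common neighbours of i and q, and these are the
    -- partners of z₁ and z₂.
    · have hT : nb G i ∩ nb G q = {p₁, p₂} := by
        refine (eq_of_subset_of_card_le ?_ ?_).symm
        · have : ∀ p z, P.Same l p → z ∈ P.R p → z ≠ q → G.Adj i p ∧ G.Adj q p := by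
            intro p z hp hz hzq
            have hn := one p hp z hz
            constructor
            · by_contra h0
              rcases (hn i).1 (fun h' => h0 h'.symm) with rfl | rfl
              · exact hs hp
              · rcases (hRi p).1 (mem_R_comm.1 hz) with rfl | rfl | rfl
                · exact hl.2 (P.cr_of_same hp.symm)
                · exact hl.2 (P.cr_of_same (s1.trans hp.symm))
                · exact hl.2 (P.cr_of_same (s2.trans hp.symm))
            · by_contra h0
              rcases (hn q).1 (fun h' => h0 h'.symm) with rfl | rfl
              · exact hl.2 (P.cr_of_same hp.symm)
              · exact hzq rfl
          have t1 := this p₁ z₁ a1 (mem_R_comm.1 ((hz1 p₁).2 (Or.inl rfl))) (hqz _ m1.2).symm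
          have t2 := this p₂ z₂ a2 (mem_R_comm.1 ((hz2 p₂).2 (Or.inl rfl))) (hqz _ m2.2).symm
          intro x hx
          simp only [mem_insert, mem_singleton] at hx
          rw [mem_inter, mem_nb, mem_nb]
          rcases hx with rfl | rfl
          exacts [t1, t2]
        · rw [card_pair hpp]; exact h4.le
      have hv : v ∈ nb G i ∩ nb G q := by
        have := R_union hpos h.cross
        have h5 : v ∉ (nb G i ∩ nb G q)ᶜ := by rw [← this]; simp [hvi, hvq]
        simpa using h5
      rw [hT] at hv
      simp only [mem_insert, mem_singleton] at hv
      exact Or.inl (Or.inr hv)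
  · have e1 := card_cross hpos h.cross
    have e2 : C.card + 1 = (P.R q).card := by
      simp only [C]; rw [sdiff_singleton_eq_erase, card_erase_add_one hlq]
    omega

end pos
end PD
end TwoEig
end

/-! ### A maximal pair with a twin: cones over two cocktail party graphs. -/

section
open scoped Classical
namespace TwoEig
open Finset

@[simp] lemma CP_adj {k : ℕ} {x y : Fin k × Fin 2} : (CP k).Adj x y ↔ x.1 ≠ y.1 := by
  simp [CP, SimpleGraph.completeEquipartiteGraph]

@[simp] lemma cone_adj_inl {V : Type*} [Fintype V] {G : SimpleGraph V} {x y : V} :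
    (cone G).Adj (.inl x) (.inl y) ↔ G.Adj x y := by
  simp [cone]

@[simp] lemma cone_adj_inl_inr {V : Type*} [Fintype V] {G : SimpleGraph V} {x : V} {y : Unit} :
    (cone G).Adj (.inl x) (.inr y) := by
  simp [cone]

@[simp] lemma cone_adj_inr_inl {V : Type*} [Fintype V] {G : SimpleGraph V} {x : V} {y : Unit} :
    (cone G).Adj (.inr y) (.inl x) := by
  simp [cone]

lemma G8_iso {V : Type*} [Fintype V] {G : SimpleGraph V} {k l : ℕ} (g : Fin k × Fin 2 → V)
    (g' : Fin l × Fin 2 → V) (w : V)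
    (n₁ : ∀ x y, G.Adj (g x) (g y) ↔ x.1 ≠ y.1) (n₂ : ∀ x y, G.Adj (g' x) (g' y) ↔ x.1 ≠ y.1)
    (n₃ : ∀ x y, ¬ G.Adj (g x) (g' y)) (n₄ : ∀ x, G.Adj (g x) w) (n₅ : ∀ x, G.Adj (g' x) w)
    (hs : ∀ v, (∃ x, g x = v) ∨ (∃ x, g' x = v) ∨ v = w)
    (hc : k * 2 + l * 2 + 1 ≤ Fintype.card V) : Nonempty (G ≃g G8 k l) := by
  refine iso_of_surj (Sum.elim (Sum.elim g g') fun _ => w) ?_ (by simpa using hc) ?_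
  · intro v
    rcases hs v with ⟨x, rfl⟩ | ⟨x, rfl⟩ | rfl
    exacts [⟨.inl (.inl x), rfl⟩, ⟨.inl (.inr x), rfl⟩, ⟨.inr (), rfl⟩]
  · rintro - ((x | x) | x) ((y | y) | y) <;>
      simp [G8, G5, n₁, n₂, n₃, n₄, n₅, (n₄ _).symm, (n₅ _).symm, fun x y => mt (G.adj_symm (u := g' x) (v := g y)) (n₃ y x)]

namespace PD

variable {V : Type*} [Fintype V] {G : SimpleGraph V} {r s : ℝ} {P : PD G r s}

section pos
variable (hpos : ∀ i j, 0 < P.dot i j)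
include hpos

/-- Any z in R i other than q would satisfy R q ⊆ R z, so R i = {q}. For a common neighbour τ of i
and q, the determinant becomes (ρ - 2)((t + 3 - x - y)(x + y - 1) - 1) = 0 with ρ = |R q|, t = cn i
q, x = |W τ|, y = |R τ|. The first factor is nonzero because i and q are not parallel, the second
because q and τ have positive inner product. -/
lemma Mx.no_twin {i q : V} (h : P.Mx i q) (hi : (P.W i).card = 2) (hq : (P.W q).card = 1)
    (hall : ∀ j, P.Cross q j → P.Same i j) : False := by
  have Rj : ∀ j, P.Cross q j → P.R j = P.R i := fun j hj => ((hall j hj).R_eq hi).symm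
  have hRi : P.R i = {q} := by
    rw [eq_singleton_iff_unique_mem]
    refine ⟨P.mem_R.2 h.cross, fun z hz => ?_⟩
    by_contra hzq
    have hsub : P.R q ⊆ P.R z := fun j hj => by
      rw [mem_R_comm, Rj j (P.mem_R.1 hj)]; exact hz
    by_cases hs : P.Same q z
    · obtain ⟨_, p, p', _, _, h0, _⟩ := hs.swap hq (Ne.symm hzq)
      rw [sdiff_eq_empty_iff_subset.2 hsub] at h0
      simp at h0
    · have := card_lt_card (h.symm.ssub hpos (P.mem_R.1 hz) fun h0 => hs h0.symm)
      have := card_le_card hsub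
      omega
  obtain ⟨τ, hτ⟩ := card_pos.1 (cn_pos hpos h.cross.1)
  simp only [mem_inter, mem_nb] at hτ
  have c1 : (P.R i ∩ P.R τ).card = 0 := by
    rw [card_eq_zero, hRi, singleton_inter_of_notMem]
    exact fun h0 => (P.mem_R.1 h0).1 hτ.2.symm
  have c2 : (P.R q ∩ P.R τ).card = 0 := by
    rw [card_eq_zero, eq_empty_iff_forall_notMem]
    intro j hj
    rw [mem_inter] at hj
    have := Rj j (P.mem_R.1 hj.1)
    have h2 := mem_R_comm.1 hj.2
    rw [this, hRi, mem_singleton] at h2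
    subst h2
    exact G.loopless.irrefl _ hτ.2
  have d1 := P.dot_self' i
  have d2 := P.dot_self' q
  have d3 := P.dot_self' τ
  have d4 := dot_cross hpos h.cross
  have d5 := dot_of_adj (P := P) hτ.1
  have d6 := dot_of_adj (P := P) hτ.2
  have d7 := P.cr_sq i q
  have d8 := hpos q τ
  have d9 := hpos i q
  rw [c1, hi] at d5
  rw [c2, hq] at d6
  rw [hi] at d1
  rw [hq] at d2
  have hρi : (P.R i).card = 1 := by rw [hRi]; rfl
  rw [hρi] at d1 d4 d5
  have hcr : 0 < P.cr i q ^ 2 := by have := h.cross.2; positivity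
  have cc := card_cross hpos h.cross
  rw [hρi] at cc
  rw [d7, d1, d2, d4] at hcr
  rw [d6] at d8
  rw [d4] at d9
  unfold dot at d1 d2 d3 d4 d5 d6
  have g := gram3 _ _ _ _ _ _ d1 d2 d3 d4 d5 d6
  generalize ((P.R q).card) = ρ at *
  generalize (Fintype.card V) = n at *
  generalize ((P.W τ).card) = x at *
  generalize ((P.R τ).card) = y at *
  generalize cn G i q = t at *
  subst cc
  push_cast at g hcr d8 d9
  have f1 : ((ρ : ℝ) - 2) * ((t + 3 - x - y) * (x + y - 1) - 1) = 0 := by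
    linear_combination g
  rcases mul_eq_zero.1 f1 with h0 | h0
  · nlinarith
  · have h1 : ((t : ℤ) + 3 - x - y) * (x + y - 1) = 1 := by
      have : ((t : ℝ) + 3 - x - y) * (x + y - 1) = 1 := by linarith
      exact_mod_cast this
    have h2 : (0 : ℤ) < t + 2 - x - y := by
      have : (0 : ℝ) < t + 2 - x - y := by linarith
      exact_mod_cast this
    have := Int.eq_one_or_neg_one_of_mul_eq_one h1
    omega

/-- All vertices in R q have the crossing set R i and one twin each, and conversely. So R q and R i
are cocktail party graphs without edges between them. The determinant of i, q and a common neighbour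
shows that there is only one common neighbour. -/
lemma Mx.iso_G8 {i q : V} (h : P.Mx i q) (hi : (P.W i).card = 2) (hq : (P.W q).card = 2)
    (hall : ∀ j, P.Cross q j → P.Same i j) (hall' : ∀ j, P.Cross i j → P.Same q j) :
    ∃ k l, 1 ≤ k ∧ 1 ≤ l ∧ Nonempty (G ≃g G8 k l) := by
  have Rj : ∀ j, P.Cross q j → P.R j = P.R i := fun j hj => ((hall j hj).R_eq hi).symm
  have Rz : ∀ j, P.Cross i j → P.R j = P.R q := fun j hj => ((hall' j hj).R_eq hq).symm
  have one : cn G i q = 1 := by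
    obtain ⟨τ, hτ⟩ := card_pos.1 (cn_pos hpos h.cross.1)
    simp only [mem_inter, mem_nb] at hτ
    have c1 : (P.R i ∩ P.R τ).card = 0 := by
      rw [card_eq_zero, eq_empty_iff_forall_notMem]
      intro j hj
      rw [mem_inter] at hj
      have h2 := mem_R_comm.1 hj.2
      rw [Rz j (P.mem_R.1 hj.1)] at h2
      exact (P.mem_R.1 h2).1 hτ.2
    have c2 : (P.R q ∩ P.R τ).card = 0 := by
      rw [card_eq_zero, eq_empty_iff_forall_notMem]
      intro j hj
      rw [mem_inter] at hj
      have h2 := mem_R_comm.1 hj.2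
      rw [Rj j (P.mem_R.1 hj.1)] at h2
      exact (P.mem_R.1 h2).1 hτ.1
    have c3 : (P.W τ).card + (P.R τ).card ≤ cn G i q := by
      rw [← card_union_of_disjoint (W_disj τ), W_union]
      apply card_le_card
      intro x hx
      rw [mem_compl, mem_nb] at hx
      have hx' : x ∉ P.R i ∪ P.R q := by
        rw [mem_union]
        have hWR := (nadj_iff (P := P)).1 fun h' => hx (G.adj_symm h')
        rintro (h0 | h0)
        · rw [Rz x (P.mem_R.1 h0)] at hWR
          rcases hWR with h1 | h1
          · have := W_subset_R (P.mem_R.1 h0) h1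
            exact (P.mem_R.1 this).1 hτ.1
          · exact (P.mem_R.1 h1).1 hτ.2
        · rw [Rj x (P.mem_R.1 h0)] at hWR
          rcases hWR with h1 | h1
          · have := W_subset_R (P.mem_R.1 h0) h1
            exact (P.mem_R.1 this).1 hτ.2
          · exact (P.mem_R.1 h1).1 hτ.1
      rw [R_union hpos h.cross] at hx'
      simpa using hx'
    have d1 := P.dot_self' i
    have d2 := P.dot_self' q
    have d3 := P.dot_self' τ
    have d4 := dot_cross hpos h.cross
    have d5 := dot_of_adj (P := P) hτ.1
    have d6 := dot_of_adj (P := P) hτ.2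
    have d7 := P.cr_sq i q
    rw [c1, hi] at d5
    rw [c2, hq] at d6
    rw [hi] at d1
    rw [hq] at d2
    have hcr : 0 < P.cr i q ^ 2 := by have := h.cross.2; positivity
    have cc := card_cross hpos h.cross
    have b1 : 2 ≤ (P.R i).card := hq ▸ card_le_card (W_subset_R h.cross)
    have b2 : 2 ≤ (P.R q).card := hi ▸ card_le_card (W_subset_R h.cross.symm)
    have b3 := P.W_pos τ
    have b4 := cn_pos hpos h.cross.1
    rw [d7, d1, d2, d4] at hcr
    unfold dot at d1 d2 d3 d4 d5 d6
    have g := gram3 _ _ _ _ _ _ d1 d2 d3 d4 d5 d6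
    generalize ((P.R q).card) = ρ at *
    generalize ((P.R i).card) = σ at *
    generalize (Fintype.card V) = n at *
    generalize hu : (P.W τ).card = x at *
    generalize ((P.R τ).card) = y at *
    generalize cn G i q = t at *
    subst cc
    obtain ⟨p, rfl⟩ := Nat.exists_eq_add_of_le b1
    obtain ⟨p', rfl⟩ := Nat.exists_eq_add_of_le b2
    obtain ⟨e, rfl⟩ := Nat.exists_eq_add_of_le c3
    generalize hz : x + y = z at *
    have hz' : (z : ℝ) = x + y := by rw [← hz]; push_cast; ring
    push_cast at g hcr
    have hs : (0 : ℝ) < p + p' := by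
      by_contra hn
      have h1 : (0 : ℝ) ≤ p := by positivity
      have h2 : (0 : ℝ) ≤ p' := by positivity
      have h3 : (p : ℝ) = 0 := by linarith
      have h4 : (p' : ℝ) = 0 := by linarith
      rw [h3, h4] at hcr
      linarith
    have f1 : (4 * (z + e : ℝ) - 3 * (e + 1) - 1) * ((z + e) * (p + p') + p * p') =
        (e + 2 - 2 * (z + e)) ^ 2 * (p + p') := by
      have hy : (y : ℝ) = z - x := by linarith
      rw [hy] at g
      linear_combination g
    have hz1 : (1 : ℝ) ≤ z := by exact_mod_cast (by omega : 1 ≤ z)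
    have he : (0 : ℝ) ≤ e := by positivity
    have f2 : (4 * (z + e : ℝ) - 3 * (e + 1) - 1) * ((z + e) * (p + p')) ≤
        (e + 2 - 2 * (z + e)) ^ 2 * (p + p') := by
      rw [← f1]
      apply mul_le_mul_of_nonneg_left _ (by linarith)
      have : (0 : ℝ) ≤ p * p' := by positivity
      linarith
    have f3 : (4 * (z + e : ℝ) - 3 * (e + 1) - 1) * (z + e) ≤ (e + 2 - 2 * (z + e)) ^ 2 := by
      rw [← mul_assoc] at f2
      exact le_of_mul_le_mul_right f2 hs
    -- Here z = |W τ| + |R τ| ≥ 1 and cn i q = z + e. The inequality forces e = 0 and then z = 1.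
    have f4 : (z + e) * (e + 4 : ℤ) ≤ (e + 2) ^ 2 := by
      have : ((z + e) * (e + 4) : ℝ) ≤ (e + 2) ^ 2 := by linarith
      exact_mod_cast this
    have h1 : (1 : ℤ) ≤ z := by omega
    have h2 : (0 : ℤ) ≤ e := by omega
    have he0 : (e : ℤ) = 0 := by nlinarith
    rw [he0] at f4
    omega
  obtain ⟨τ, hτ⟩ := card_eq_one.1 one
  have hWq : ∀ j ∈ P.R q, P.W j ⊆ P.R q := fun j hj => W_subset_R (P.mem_R.1 hj)
  have hWi : ∀ j ∈ P.R i, P.W j ⊆ P.R i := fun j hj => W_subset_R (P.mem_R.1 hj)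
  obtain ⟨k, g, gi, gr, gc, gw⟩ := twin_param (P.R q) (P := P)
    (fun j hj => by rw [← (hall j (P.mem_R.1 hj)).W_card, hi]) hWq
  obtain ⟨l, g', gi', gr', gc', gw'⟩ := twin_param (P.R i) (P := P)
    (fun j hj => by rw [← (hall' j (P.mem_R.1 hj)).W_card, hq]) hWi
  have hd := disjoint_left.1 (R_disj hpos h.cross)
  have hg : ∀ x, g x ∈ P.R q := fun x => (gr _).2 ⟨x, rfl⟩
  have hg' : ∀ x, g' x ∈ P.R i := fun x => (gr' _).2 ⟨x, rfl⟩
  have hτ' : τ ∈ nb G i ∩ nb G q := by rw [hτ]; simp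
  simp only [mem_inter, mem_nb] at hτ'
  refine ⟨k, l, ?_, ?_, G8_iso g g' τ ?_ ?_ ?_ ?_ ?_ ?_ ?_⟩
  · obtain ⟨⟨a, _⟩, _⟩ := (gr i).1 (P.mem_R.2 h.cross.symm)
    exact a.pos
  · obtain ⟨⟨a, _⟩, _⟩ := (gr' q).1 (P.mem_R.2 h.cross)
    exact a.pos
  · intro x y
    rw [← not_iff_not, nadj_iff (P := P), gw, Rj _ (P.mem_R.1 (hg x)), not_not, or_iff_left]
    exact fun h0 => hd h0 (hg y)
  · intro x y
    rw [← not_iff_not, nadj_iff (P := P), gw', Rz _ (P.mem_R.1 (hg' x)), not_not, or_iff_left]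
    exact fun h0 => hd (hg' y) h0
  · intro x y
    rw [nadj_iff (P := P), Rj _ (P.mem_R.1 (hg x))]
    exact Or.inr (hg' y)
  · intro x
    by_contra hn
    rcases (nadj_iff (P := P)).1 hn with h0 | h0
    · exact (P.mem_R.1 (hWq _ (hg x) h0)).1 hτ'.2
    · rw [Rj _ (P.mem_R.1 (hg x))] at h0
      exact (P.mem_R.1 h0).1 hτ'.1
  · intro x
    by_contra hn
    rcases (nadj_iff (P := P)).1 hn with h0 | h0
    · exact (P.mem_R.1 (hWi _ (hg' x) h0)).1 hτ'.1
    · rw [Rz _ (P.mem_R.1 (hg' x))] at h0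
      exact (P.mem_R.1 h0).1 hτ'.2
  · intro v
    rw [← gr, ← gr']
    by_cases h1 : v ∈ P.R i
    · exact Or.inr (Or.inl h1)
    by_cases h2 : v ∈ P.R q
    · exact Or.inl h2
    · right; right
      have : v ∉ P.R i ∪ P.R q := by simp [h1, h2]
      rw [R_union hpos h.cross, hτ] at this
      simpa using this
  · have := card_cross hpos h.cross
    omega

/-- A maximal crossing pair whose first vertex has a twin. -/
lemma Mx.iso_of_twin {i q : V} (h : P.Mx i q) (hi : (P.W i).card = 2) :
    (∃ k, 1 ≤ k ∧ Nonempty (G ≃g halfJoin 3 k)) ∨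
      ∃ k l, 1 ≤ k ∧ 1 ≤ l ∧ Nonempty (G ≃g G8 k l) := by
  by_cases h1 : ∀ j, P.Cross q j → P.Same i j
  · rcases eq_or_lt_of_le (P.W_pos q) with hq | hq
    · exact (h.no_twin hpos hi hq.symm h1).elim
    have hq2 : (P.W q).card = 2 := by have := W_le_two hpos h.cross.symm; omega
    by_cases h2 : ∀ j, P.Cross i j → P.Same q j
    · exact Or.inr (h.iso_G8 hpos hi hq2 h1 h2)
    · push Not at h2
      obtain ⟨l, hl, hs⟩ := h2
      exact Or.inl (h.symm.iso_halfJoin hpos hl (fun h0 => hs h0.symm) hq2)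
  · push Not at h1
    obtain ⟨l, hl, hs⟩ := h1
    exact Or.inl (h.iso_halfJoin hpos hl (fun h0 => hs h0.symm) hi)

end pos
end PD
end TwoEig
end

/-! ### Maximal pairs without twins: the two-sided case is impossible. -/

section
open scoped Classical
namespace TwoEig
open Finset

/-- The matrix of inner products between two triples of plane vectors has rank at most two. -/
lemma det3_gram (a₁ b₁ a₂ b₂ a₃ b₃ c₁ d₁ c₂ d₂ c₃ d₃ : ℝ)
    {g₁₁ g₁₂ g₁₃ g₂₁ g₂₂ g₂₃ g₃₁ g₃₂ g₃₃ : ℝ}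
    (h₁₁ : a₁ * c₁ + b₁ * d₁ = g₁₁) (h₁₂ : a₁ * c₂ + b₁ * d₂ = g₁₂)
    (h₁₃ : a₁ * c₃ + b₁ * d₃ = g₁₃) (h₂₁ : a₂ * c₁ + b₂ * d₁ = g₂₁)
    (h₂₂ : a₂ * c₂ + b₂ * d₂ = g₂₂) (h₂₃ : a₂ * c₃ + b₂ * d₃ = g₂₃)
    (h₃₁ : a₃ * c₁ + b₃ * d₁ = g₃₁) (h₃₂ : a₃ * c₂ + b₃ * d₂ = g₃₂)
    (h₃₃ : a₃ * c₃ + b₃ * d₃ = g₃₃) :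
    g₁₁ * (g₂₂ * g₃₃ - g₂₃ * g₃₂) - g₁₂ * (g₂₁ * g₃₃ - g₂₃ * g₃₁) +
      g₁₃ * (g₂₁ * g₃₂ - g₂₂ * g₃₁) = 0 := by
  subst_vars; ring

/-- For κ = κ' = 0 the equations make B - 1 and B' - 1 divide each other, and then divide 1. In the
other cases they contradict the lower bounds on ρ and ρ'. -/
lemma two_sided_arith {B B' κ κ' ρ ρ' : ℤ} (hκ : κ = 0 ∨ κ = 1) (hκ' : κ' = 0 ∨ κ' = 1)
    (hE : 1 ≤ B - 1 + κ) (hE' : 1 ≤ B' - 1 + κ') (h1 : B + 2 ≤ ρ) (h2 : B' + 2 ≤ ρ')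
    (hd : (κ + κ') ^ 2 < (B - 1 + κ) * (B' - 1 + κ'))
    (e1 : (ρ' - 1) * ((B - 1 + κ) * (B' - 1 + κ') - (κ + κ') ^ 2) =
      -(1 - κ) * (-(κ + κ') * (B' + κ') + (B' - 1 + κ') * (B + κ)) +
        (B' + 1) * ((B - 1 + κ) * (B' + κ') - (κ + κ') * (B + κ)))
    (e2 : (ρ - 1) * ((B - 1 + κ) * (B' - 1 + κ') - (κ + κ') ^ 2) =
      (B + 1) * (-(κ + κ') * (B' + κ') + (B' - 1 + κ') * (B + κ)) -
        (1 - κ') * ((B - 1 + κ) * (B' + κ') - (κ + κ') * (B + κ))) :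
    κ = 0 ∧ κ' = 0 ∧ B = 2 ∧ B' = 2 ∧ ρ = 5 ∧ ρ' = 5 := by
  rcases hκ with rfl | rfl <;> rcases hκ' with rfl | rfl
  · obtain ⟨x, rfl⟩ : ∃ x, B = x + 1 := ⟨B - 1, by ring⟩
    obtain ⟨y, rfl⟩ : ∃ y, B' = y + 1 := ⟨B' - 1, by ring⟩
    have hx : 1 ≤ x := by linarith
    have hy : 1 ≤ y := by linarith
    have d1 : x ∣ y := ⟨(y + 2) * (y + 1) - y - (ρ' - 1) * y, by linear_combination e1⟩
    have d2 : y ∣ x := ⟨(x + 2) * (x + 1) - x - (ρ - 1) * x, by linear_combination e2⟩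
    have hxy : x = y := le_antisymm (Int.le_of_dvd (by omega) d1) (Int.le_of_dvd (by omega) d2)
    subst hxy
    have e3 : x * ((ρ' - 1) * x - (x + 1) ^ 2) = 0 := by linear_combination e1
    have e4 : (ρ' - 1) * x - (x + 1) ^ 2 = 0 := by
      rcases mul_eq_zero.1 e3 with h | h
      · omega
      · exact h
    have d3 : x ∣ 1 := ⟨ρ' - 1 - x - 2, by linear_combination -e4⟩
    have hx1 : x = 1 := le_antisymm (Int.le_of_dvd (by omega) d3) hx
    subst hx1
    refine ⟨rfl, rfl, rfl, rfl, by linarith, by linarith⟩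
  · exfalso
    have : ((B - 1) * B' - 1) * (ρ' - 1 - B') = 0 := by linear_combination e1
    rcases mul_eq_zero.1 this with h | h <;> linarith
  · exfalso
    have : (B * (B' - 1) - 1) * (ρ - 1 - B) = 0 := by linear_combination e2
    rcases mul_eq_zero.1 this with h | h <;> linarith
  · exfalso
    have hp : 0 < B * B' - 4 := by linarith
    have e3 : (ρ' - 1) * (B * B' - 4) = (B' + 1) * (B * B' - B - 2) := by linear_combination e1
    have e4 : (ρ - 1) * (B * B' - 4) = (B + 1) * (B * B' - B' - 2) := by linear_combination e2
    have f3 : (B' + 1) * (B * B' - 4) ≤ (B' + 1) * (B * B' - B - 2) := by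
      rw [← e3]; exact mul_le_mul_of_nonneg_right (by linarith) hp.le
    have f4 : (B + 1) * (B * B' - 4) ≤ (B + 1) * (B * B' - B' - 2) := by
      rw [← e4]; exact mul_le_mul_of_nonneg_right (by linarith) hp.le
    have g3 := le_of_mul_le_mul_left f3 (by linarith)
    have g4 := le_of_mul_le_mul_left f4 (by linarith)
    have : B = 1 ∨ B = 2 := by omega
    have : B' = 1 ∨ B' = 2 := by omega
    rcases ‹B = 1 ∨ B = 2› with rfl | rfl <;> rcases ‹B' = 1 ∨ B' = 2› with rfl | rfl <;> omega

namespace PD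

variable {V : Type*} [Fintype V] {G : SimpleGraph V} {r s : ℝ} {P : PD G r s}

lemma dot_int (P : PD G r s) (i j : V) : ∃ m : ℤ, P.dot i j = m := by
  unfold dot; rw [P.gram]
  by_cases h : G.Adj i j
  · exact ⟨cn G i j + 2, by simp [h]⟩
  · exact ⟨cn G i j, by simp [h]⟩

/-- The row sum of A² + 2A at u, where walks of length two are counted by their middle vertex. -/
lemma sum_dot (P : PD G r s) (u : V) :
    ∑ w, P.dot u w = ∑ j ∈ nb G u, P.dot j j + 2 * P.dot u u := by
  have h1 : ∀ w, P.dot u w = ∑ j ∈ nb G u, (if G.Adj j w then (1 : ℝ) else 0) +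
      (if w ∈ nb G u then 2 else 0) := by
    intro w
    have : cn G u w = ((nb G u).filter fun x => G.Adj x w).card := by
      unfold cn; congr 1; ext x; simp [G.adj_comm x w]
    unfold dot
    rw [P.gram, Finset.sum_boole, this]
    simp
  rw [sum_congr rfl fun w _ => h1 w, sum_add_distrib]
  congr 1
  · rw [sum_comm]
    exact sum_congr rfl fun j _ => by rw [Finset.sum_boole, dot_self]; rfl
  · rw [Finset.sum_ite_mem, univ_inter, sum_const, dot_self, nsmul_eq_mul, mul_comm]

section pos
variable (hpos : ∀ i j, 0 < P.dot i j)
include hpos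

lemma Mx.dot_nested {i q l : V} (h : P.Mx i q) (hl : P.Cross q l) (hs : ¬ P.Same l i) :
    P.dot i l = Fintype.card V + 2 - (P.W i).card - (P.W l).card - (P.R i).card := by
  rw [dot_of_adj (adj_of_cross' hpos hl h.cross.symm hs).symm,
    inter_eq_right.2 (h.ssub hpos hl hs).1]
  ring

/-- As z is not in R l, the vertices l and z are adjacent, with disjoint crossing sets. The pairings
among l - i, z - q and i - q, and those of i and q with these differences, depend only on B, B', κ,
κ' and the sizes of R l and R z; the determinants are the equations of `two_sided_arith`. A third
determinant gives the number of common neighbours. -/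
lemma Mx.two_sided_params {i q l z : V} (h : P.Mx i q) (hi : (P.W i).card = 1)
    (hq : (P.W q).card = 1) (hl : P.Cross q l) (hls : ¬ P.Same l i) (hz : P.Cross i z)
    (hzs : ¬ P.Same z q) (hlz : z ∉ P.R l) :
    (P.R i).card = 5 ∧ (P.R q).card = 5 ∧ cn G i q = 6 := by
  have sl := h.ssub hpos hl hls
  have sz := h.symm.ssub hpos hz hzs
  have hadj : G.Adj l z := by
    by_contra hn
    rcases (nadj_iff (P := P)).1 hn with h0 | h0
    · have := R_of_W h0
      have h1 : q ∈ P.R z := this ▸ P.mem_R.2 hl.symm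
      exact disjoint_left.1 (R_disj hpos hz) (P.mem_R.2 h.cross) h1
    · exact hlz h0
  have c0 : (P.R l ∩ P.R z).card = 0 := by
    rw [card_eq_zero, ← disjoint_iff_inter_eq_empty]
    exact disjoint_of_subset_left sl.1 (disjoint_of_subset_right sz.1 (R_disj hpos h.cross))
  have dii := P.dot_self' i
  have dqq := P.dot_self' q
  have dll := P.dot_self' l
  have dzz := P.dot_self' z
  have diq := dot_cross hpos h.cross
  have dql := dot_cross hpos hl
  have diz := dot_cross hpos hz
  have dil := h.dot_nested hpos hl hls
  have dqz := h.symm.dot_nested hpos hz hzs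
  have dlz := dot_of_adj (P := P) hadj
  have cc := card_cross hpos h.cross
  have l1 := card_lt_card sl
  have l2 := card_lt_card sz
  have p1 : 1 ≤ (P.R l).card := card_pos.2 ⟨q, P.mem_R.2 hl.symm⟩
  have p2 : 1 ≤ (P.R z).card := card_pos.2 ⟨i, P.mem_R.2 hz.symm⟩
  have w1 := P.W_pos l
  have w2 := P.W_pos z
  have w3 := W_le_two hpos hl.symm
  have w4 := W_le_two hpos hz.symm
  have E1 : 0 < P.dot l l + P.dot i i - 2 * P.dot l i := by
    by_contra hn; exact hls (P.same_of_dist (by linarith))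
  have E2 : 0 < P.dot z z + P.dot q q - 2 * P.dot z q := by
    by_contra hn; exact hzs (P.same_of_dist (by linarith))
  rw [c0] at dlz
  rw [hi] at dii dil
  rw [hq] at dqq dqz
  rw [dll, dii, P.dot_comm, dil] at E1
  rw [dzz, dqq, P.dot_comm, dqz] at E2
  unfold dot at dii dqq dll dzz diq dql diz dil dqz dlz
  obtain ⟨B, hB⟩ : ∃ B, (P.R i).card = (P.R l).card + B + 1 :=
    ⟨(P.R i).card - (P.R l).card - 1, by omega⟩
  obtain ⟨B', hB'⟩ : ∃ B', (P.R q).card = (P.R z).card + B' + 1 :=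
    ⟨(P.R q).card - (P.R z).card - 1, by omega⟩
  obtain ⟨κ, hκ⟩ : ∃ κ, (P.W l).card = κ + 1 := ⟨(P.W l).card - 1, by omega⟩
  obtain ⟨κ', hκ'⟩ : ∃ κ, (P.W z).card = κ + 1 := ⟨(P.W z).card - 1, by omega⟩
  rw [hB, hB'] at cc ⊢
  rw [hB, hB'] at diq
  rw [hB] at dii dil diz E1
  rw [hB'] at dqq dqz dql E2
  rw [hκ] at dil dll dlz w3 E1
  rw [hκ'] at dqz dzz dlz w4 E2
  generalize (P.R l).card = x at *
  generalize (P.R z).card = y at *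
  generalize (P.W l).card = wl at *
  generalize (P.W z).card = wz at *
  generalize Fintype.card V = n at *
  generalize cn G i q = t at *
  subst cc
  push_cast at dii dqq dll dzz diq dql diz dil dqz dlz E1 E2
  have E1' : (0 : ℝ) < B - 1 + κ := by linarith
  have E2' : (0 : ℝ) < B' - 1 + κ' := by linarith
  set e₁ := P.a l - P.a i
  set e₁' := P.b l - P.b i
  set e₂ := P.a z - P.a q
  set e₂' := P.b z - P.b q
  set f := P.a i - P.a q
  set f' := P.b i - P.b q
  have g11 : e₁ * e₁ + e₁' * e₁' = B - 1 + κ := by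
    simp only [e₁, e₁']; linear_combination dll + dii - 2 * dil
  have g22 : e₂ * e₂ + e₂' * e₂' = B' - 1 + κ' := by
    simp only [e₂, e₂']; linear_combination dzz + dqq - 2 * dqz
  have g12 : e₁ * e₂ + e₁' * e₂' = -(κ + κ') := by
    simp only [e₁, e₁', e₂, e₂']; linear_combination dlz - dql - diz + diq
  have g21 : e₂ * e₁ + e₂' * e₁' = -(κ + κ') := by linarith
  have gf1 : e₁ * f + e₁' * f' = -(B + κ) := by
    simp only [e₁, e₁', f, f']; linear_combination dil - dql - dii + diq
  have gf2 : e₂ * f + e₂' * f' = B' + κ' := by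
    simp only [e₂, e₂', f, f']; linear_combination diz - dqz - diq + dqq
  have gi1 : P.a i * e₁ + P.b i * e₁' = 1 - κ := by
    simp only [e₁, e₁']; linear_combination dil - dii
  have gi2 : P.a i * e₂ + P.b i * e₂' = B' + 1 := by
    simp only [e₂, e₂']; linear_combination diz - diq
  have gq1 : P.a q * e₁ + P.b q * e₁' = B + 1 := by
    simp only [e₁, e₁']; linear_combination dql - diq
  have gq2 : P.a q * e₂ + P.b q * e₂' = 1 - κ' := by
    simp only [e₂, e₂']; linear_combination dqz - dqq
  have gif : P.a i * f + P.b i * f' = y + B' := by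
    simp only [f, f']; linear_combination dii - diq
  have gqf : P.a q * f + P.b q * f' = -(x + B) := by
    simp only [f, f']; linear_combination diq - dqq
  have k1 := det3_gram _ _ _ _ _ _ _ _ _ _ _ _ g11 g12 gf1 g21 g22 gf2 gi1 gi2 gif
  have k2 := det3_gram _ _ _ _ _ _ _ _ _ _ _ _ g11 g12 gf1 g21 g22 gf2 gq1 gq2 gqf
  have k3 := det3_gram _ _ _ _ _ _ _ _ _ _ _ _ g11 g12
    (by linarith [gq1] : e₁ * P.a q + e₁' * P.b q = B + 1) g21 g22
    (by linarith [gq2] : e₂ * P.a q + e₂' * P.b q = 1 - κ') gi1 gi2 diq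
  have hκ1 : κ = 0 ∨ κ = 1 := by omega
  have hκ2 : κ' = 0 ∨ κ' = 1 := by omega
  -- The differences l - i and z - q are independent: otherwise pairing with i gives (B - 1 + κ)(B'
  -- + 1) = -(κ + κ')(1 - κ), a positive number equal to a nonpositive one.
  have hd : (κ + κ' : ℝ) ^ 2 < (B - 1 + κ) * (B' - 1 + κ') := by
    have hD : (e₁ * e₂' - e₁' * e₂) ^ 2 = (B - 1 + κ) * (B' - 1 + κ') - (κ + κ' : ℝ) ^ 2 := by
      rw [← g11, ← g22]; linear_combination -(e₁ * e₂ + e₁' * e₂' - (κ + κ')) * g12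
    by_contra hn
    have hz0 : e₁ * e₂' - e₁' * e₂ = 0 := by
      have : (e₁ * e₂' - e₁' * e₂) ^ 2 = 0 := le_antisymm (by linarith) (sq_nonneg _)
      simpa using this
    have h3 : (B - 1 + κ) * (B' + 1 : ℝ) = -(κ + κ') * (1 - κ) := by
      rw [← g11, ← gi2, ← g12, ← gi1]
      linear_combination (P.b i * e₁ - P.a i * e₁') * hz0
    have h4 : 0 < (B - 1 + κ) * (B' + 1 : ℝ) := by positivity
    rw [h3] at h4
    rcases hκ1 with rfl | rfl
    · have : (0 : ℝ) ≤ κ' := by positivity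
      push_cast at h4
      linarith
    · norm_num at h4
  have := two_sided_arith (B := B) (B' := B') (κ := κ) (κ' := κ') (ρ := x + B + 1)
    (ρ' := y + B' + 1) (by omega) (by omega)
    (by have : (0 : ℤ) < B - 1 + κ := by exact_mod_cast E1'
        omega)
    (by have : (0 : ℤ) < B' - 1 + κ' := by exact_mod_cast E2'
        omega) (by omega) (by omega) (by exact_mod_cast hd)
    (by have : ((y : ℝ) + B' + 1 - 1) * ((B - 1 + κ) * (B' - 1 + κ') - (κ + κ') ^ 2) =
          -(1 - κ) * (-(κ + κ') * (B' + κ') + (B' - 1 + κ') * (B + κ)) +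
          (B' + 1) * ((B - 1 + κ) * (B' + κ') - (κ + κ') * (B + κ)) := by linear_combination k1
        exact_mod_cast this)
    (by have : ((x : ℝ) + B + 1 - 1) * ((B - 1 + κ) * (B' - 1 + κ') - (κ + κ') ^ 2) =
          (B + 1) * (-(κ + κ') * (B' + κ') + (B' - 1 + κ') * (B + κ)) -
          (1 - κ') * ((B - 1 + κ) * (B' + κ') - (κ + κ') * (B + κ)) := by linear_combination -k2
        exact_mod_cast this)
  obtain ⟨rfl, rfl, h3, h4, h5, h6⟩ : κ = 0 ∧ κ' = 0 ∧ B = 2 ∧ B' = 2 ∧ x = 2 ∧ y = 2 := by omega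
  subst h3 h4 h5 h6
  refine ⟨rfl, rfl, ?_⟩
  have : (t : ℝ) = 6 := by push_cast at k3; linarith
  exact_mod_cast this

lemma Mx.two_sided_other {i q l : V} (h : P.Mx i q) (hi : (P.W i).card = 1)
    (hq : (P.W q).card = 1) (h5 : (P.R i).card = 5) (h5' : (P.R q).card = 5) (h6 : cn G i q = 6)
    (hl : P.Cross q l) (hls : ¬ P.Same l i) : (P.R l).card = 2 ∧ (P.W l).card = 1 := by
  obtain ⟨e1, e2, e3, e4, e5, e6, e7, e8, e9⟩ := h.eqn hpos hl hls rfl rfl rfl rfl rfl rfl rfl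
  have w1 := P.W_pos l
  have w2 := W_le_two hpos hl.symm
  have p1 : 1 ≤ (P.R l).card := card_pos.2 ⟨q, P.mem_R.2 hl.symm⟩
  rw [h5] at e1 e2 e5
  rw [h5', h6, hi, hq] at e1
  generalize (P.R l).card = x at *
  generalize (P.W l).card = w at *
  have hx : x ≤ 4 := by omega
  interval_cases x <;> interval_cases w <;>
    first | exact ⟨rfl, rfl⟩ | (exfalso; norm_num at e1)

/-- All numbers are now fixed: there are 16 vertices, |R i| = |R q| = 5, and i, q have six common
neighbours. Add the row sums of A² + 2A at i and q. The ten vertices of R i ∪ R q contribute at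
least 60, whereas the common neighbours together with the degrees of i and q yield at most 36 + 10 +
10. -/
lemma Mx.no_two_sided {i q : V} (h : P.Mx i q) (hi : (P.W i).card = 1)
    (hq : (P.W q).card = 1) (h1 : ∃ l, P.Cross q l ∧ ¬ P.Same l i)
    (h2 : ∃ z, P.Cross i z ∧ ¬ P.Same z q) : False := by
  -- Some y in R i lies outside R l. It serves as z unless it has the vector of q; in that case the
  -- pair i, y is maximal too, and the given z avoids R l.
  obtain ⟨l, z, hl, hls, hz, hzs, hlz⟩ : ∃ l z, P.Cross q l ∧ ¬ P.Same l i ∧ P.Cross i z ∧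
      ¬ P.Same z q ∧ z ∉ P.R l := by
    obtain ⟨l, hl, hls⟩ := h1
    obtain ⟨z, hz, hzs⟩ := h2
    obtain ⟨y, hy, hy'⟩ := exists_of_ssubset (h.ssub hpos hl hls)
    by_cases hyq : P.Same y q
    · refine ⟨l, z, hl, hls, hz, hzs, fun hzl => ?_⟩
      have hm : P.Mx i y := h.of_same (Same.refl P i) hyq.symm (P.mem_R.1 hy)
      have := (hm.symm.ssub hpos hz fun h0 => hzs (h0.trans hyq)).1 (mem_R_comm.1 hzl)
      exact hy' (mem_R_comm.1 this)
    · exact ⟨l, y, hl, hls, P.mem_R.1 hy, hyq, hy'⟩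
  obtain ⟨h5, h5', h6⟩ := h.two_sided_params hpos hi hq hl hls hz hzs hlz
  have h6' : cn G q i = 6 := by rw [← h6]; unfold cn; rw [inter_comm]
  have cc := card_cross hpos h.cross
  rw [h5, h5', h6] at cc
  have hn : (Fintype.card V : ℝ) = 16 := by rw [cc]; norm_num
  have dii := P.dot_self' i
  have dqq := P.dot_self' q
  have diq := dot_cross hpos h.cross
  rw [hn, hi, h5] at dii
  rw [hn, hq, h5'] at dqq
  rw [hn, h5, h5'] at diq
  norm_num at dii dqq diq
  have typ : ∀ w, P.Cross q w → ¬ P.Same w i → P.dot w w = 13 ∧ P.dot i w = 11 ∧ P.dot q w = 9 := by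
    intro w hw hws
    obtain ⟨a1, a2⟩ := h.two_sided_other hpos hi hq h5 h5' h6 hw hws
    have b1 := P.dot_self' w
    have b2 := h.dot_nested hpos hw hws
    have b3 := dot_cross hpos hw
    rw [hn, a1, a2] at b1
    rw [hn, a2, hi, h5] at b2
    rw [hn, a1, h5'] at b3
    norm_num at b1 b2 b3
    exact ⟨b1, b2, b3⟩
  have typ' : ∀ w, P.Cross i w → ¬ P.Same w q → P.dot w w = 13 ∧ P.dot q w = 11 ∧ P.dot i w = 9 := by
    intro w hw hws
    obtain ⟨a1, a2⟩ := h.symm.two_sided_other hpos hq hi h5' h5 h6' hw hws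
    have b1 := P.dot_self' w
    have b2 := h.symm.dot_nested hpos hw hws
    have b3 := dot_cross hpos hw
    rw [hn, a1, a2] at b1
    rw [hn, a2, hq, h5'] at b2
    rw [hn, a1, h5] at b3
    norm_num at b1 b2 b3
    exact ⟨b1, b2, b3⟩
  -- every common neighbour
  have hT : ∀ τ ∈ nb G i ∩ nb G q, 2 * P.dot τ τ - P.dot i τ - P.dot q τ ≤ 6 := by
    intro τ hτ
    simp only [mem_inter, mem_nb] at hτ
    have d1 := P.dot_self' τ
    have d2 := dot_of_adj (P := P) hτ.1
    have d3 := dot_of_adj (P := P) hτ.2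
    rw [hn, hi, h5] at d2
    rw [hn, hq, h5'] at d3
    rw [hn] at d1
    obtain ⟨m1, e1⟩ := P.dot_int l τ
    obtain ⟨m2, e2⟩ := P.dot_int z τ
    obtain ⟨t1, t2, t3⟩ := typ l hl hls
    obtain ⟨t1', t2', t3'⟩ := typ' z hz hzs
    -- Pairing with i and q shows 5(i + q) = 4(l + z) for the vectors. Hence 4 divides the sum of
    -- the inner products of τ with i and q.
    have lin : 5 * (P.dot i τ + P.dot q τ) = 4 * (P.dot l τ + P.dot z τ) := by
      have : P.cr i q ≠ 0 := h.cross.2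
      have k1 : ∀ k, P.dot i k = P.a i * P.a k + P.b i * P.b k := fun k => rfl
      have k2 : ∀ k, P.dot q k = P.a q * P.a k + P.b q * P.b k := fun k => rfl
      rw [k1] at t2 t3' dii diq
      rw [k2] at t3 t2' dqq
      have a1 : P.cr i q * (5 * (P.a i + P.a q) - 4 * (P.a l + P.a z)) = 0 := by
        unfold cr
        linear_combination 5 * P.b q * dii + 5 * P.b q * diq - 4 * P.b q * t2 - 4 * P.b q * t3' -
          5 * P.b i * diq - 5 * P.b i * dqq + 4 * P.b i * t3 + 4 * P.b i * t2'
      have a2 : P.cr i q * (5 * (P.b i + P.b q) - 4 * (P.b l + P.b z)) = 0 := by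
        unfold cr
        linear_combination -5 * P.a q * dii - 5 * P.a q * diq + 4 * P.a q * t2 + 4 * P.a q * t3' +
          5 * P.a i * diq + 5 * P.a i * dqq - 4 * P.a i * t3 - 4 * P.a i * t2'
      have b1 := (mul_eq_zero.1 a1).resolve_left this
      have b2 := (mul_eq_zero.1 a2).resolve_left this
      unfold dot
      linear_combination P.a τ * b1 + P.b τ * b2
    rw [e1, e2] at lin
    have g : P.dot τ τ * 64 + 12 * P.dot i τ * P.dot q τ - 10 * P.dot i τ ^ 2 -
        10 * P.dot q τ ^ 2 = 0 := by
      have := gram3 _ _ _ _ _ _ dii dqq (rfl : P.a τ * P.a τ + P.b τ * P.b τ = P.dot τ τ) diq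
        (rfl : P.a i * P.a τ + P.b i * P.b τ = P.dot i τ)
        (rfl : P.a q * P.a τ + P.b q * P.b τ = P.dot q τ)
      unfold dot; linear_combination this
    rw [d2, d3] at lin g
    rw [d1] at g
    rw [d1, d2, d3]
    generalize (P.W τ).card = x at *
    generalize (P.R τ).card = y at *
    generalize (P.R i ∩ P.R τ).card = a at *
    generalize (P.R q ∩ P.R τ).card = b at *
    have lin' : (5 * ((16 + 2 - 1 - x - 5 - y + a) + (16 + 2 - 1 - x - 5 - y + b)) : ℤ)
      = 4 * (m1 + m2) := by
      have : (5 * ((16 + 2 - 1 - x - 5 - y + a) + (16 + 2 - 1 - x - 5 - y + b)) : ℝ)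
        = 4 * (m1 + m2) := by push_cast at lin; linarith
      exact_mod_cast this
    -- If a = b = 0, the determinant makes an integer square equal to 48. Otherwise a + b is even by
    -- the divisibility, hence at least 2.
    rcases Nat.eq_zero_or_pos (a + b) with h0 | h0
    · exfalso
      obtain ⟨rfl, rfl⟩ : a = 0 ∧ b = 0 := by omega
      obtain ⟨p, hp⟩ : ∃ p : ℤ, p = 12 - x - y := ⟨_, rfl⟩
      have hp' : (p : ℝ) = 12 - x - y := by rw [hp]; push_cast; ring
      have : (p - 4) ^ 2 = 48 := by
        have : ((p : ℝ) - 4) ^ 2 = 48 := by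
          rw [hp']; push_cast at g; linear_combination (-1/8) * g
        exact_mod_cast this
      obtain ⟨w, hw⟩ : ∃ w : ℤ, w = p - 4 := ⟨_, rfl⟩
      rw [← hw] at this
      have b1 : w ≤ 7 := by nlinarith
      have b2 : -7 ≤ w := by nlinarith
      interval_cases w <;> omega
    · have : 2 ≤ a + b := by omega
      have : (2 : ℝ) ≤ a + b := by exact_mod_cast this
      push_cast; linarith
  have hdis := R_disj hpos h.cross
  have split : ∀ f : V → ℝ, ∑ w, f w = ∑ w ∈ P.R i, f w + ∑ w ∈ P.R q, f w +
      ∑ w ∈ nb G i ∩ nb G q, f w := by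
    intro f
    rw [← sum_union hdis, R_union hpos h.cross, sum_compl_add_sum]
  have nbi : ∀ i q, P.Mx i q → (P.W i).card = 1 → ∀ f : V → ℝ, ∑ w ∈ nb G i, f w =
      ∑ w ∈ P.R q, f w - f i + ∑ w ∈ nb G i ∩ nb G q, f w := by
    intro i q h hi f
    have e : nb G i = (P.R q).erase i ∪ (nb G i ∩ nb G q) := by
      ext w
      simp only [mem_union, mem_erase, mem_inter, mem_nb]
      constructor
      · intro hw
        by_cases hqw : G.Adj q w
        · exact Or.inr ⟨hw, hqw⟩
        · rcases (nadj_iff (P := P)).1 hqw with h0 | h0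
          · exact absurd hw (P.mem_R.1 (W_subset_R h.cross h0)).1
          · exact Or.inl ⟨fun h1 => by subst h1; exact G.loopless.irrefl _ hw, h0⟩
      · rintro (⟨h0, h1⟩ | h0)
        · by_contra hn
          rcases (nadj_iff (P := P)).1 hn with h2 | h2
          · rw [W_eq_singleton hi, mem_singleton] at h2; exact h0 h2
          · exact disjoint_left.1 (R_disj hpos h.cross) h2 h1
        · exact h0.1
    rw [e, sum_union, ← e]
    · rw [← sum_erase_add _ _ (P.mem_R.2 h.cross.symm)]; ring
    · rw [disjoint_left]
      intro w hw hw'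
      exact (P.mem_R.1 (mem_erase.1 hw).2).1 (mem_nb.1 (mem_inter.1 hw').2)
  have s1 := P.sum_dot i
  have s2 := P.sum_dot q
  rw [split, nbi i q h hi] at s1
  rw [split, nbi q i h.symm hq, inter_comm (nb G q)] at s2
  have low1 : ∑ w ∈ P.R q, (P.dot i w + P.dot q w - P.dot w w) ≥ 30 := by
    have : ∑ w ∈ P.R q, (6 : ℝ) ≤ ∑ w ∈ P.R q, (P.dot i w + P.dot q w - P.dot w w) := by
      apply sum_le_sum
      intro w hw
      by_cases hs : P.Same w i
      · rw [hs.dot, P.dot_comm i w, P.dot_comm q w, hs.dot, hs.dot, dii, diq]; norm_num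
      · obtain ⟨a1, a2, a3⟩ := typ w (P.mem_R.1 hw) hs
        rw [a1, a2, a3]; norm_num
    rw [sum_const, h5', nsmul_eq_mul] at this
    push_cast at this
    linarith
  have low2 : ∑ w ∈ P.R i, (P.dot i w + P.dot q w - P.dot w w) ≥ 30 := by
    have : ∑ w ∈ P.R i, (6 : ℝ) ≤ ∑ w ∈ P.R i, (P.dot i w + P.dot q w - P.dot w w) := by
      apply sum_le_sum
      intro w hw
      by_cases hs : P.Same w q
      · rw [hs.dot, P.dot_comm i w, P.dot_comm q w, hs.dot, hs.dot, P.dot_comm q i, dqq, diq]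
        norm_num
      · obtain ⟨a1, a2, a3⟩ := typ' w (P.mem_R.1 hw) hs
        rw [a1, a2, a3]; norm_num
    rw [sum_const, h5, nsmul_eq_mul] at this
    push_cast at this
    linarith
  have up : ∑ w ∈ nb G i ∩ nb G q, (2 * P.dot w w - P.dot i w - P.dot q w) ≤ 36 := by
    have := sum_le_sum hT
    unfold cn at h6
    rw [sum_const, h6, nsmul_eq_mul] at this
    push_cast at this
    linarith
  simp only [sum_add_distrib, sum_sub_distrib, ← mul_sum] at low1 low2 up
  linarith

end pos
end PD
end TwoEig
end

/-! ### Maximal pairs without twins: the one-sided case. -/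

section
open scoped Classical
namespace TwoEig
open Finset

lemma prism_iso {V : Type*} [Fintype V] {G : SimpleGraph V} (Z : Finset V) (c : V → V)
    (n₀ : ∀ x ∈ Z, ∀ v, ¬ G.Adj x v ↔ v = x ∨ ∃ y ∈ Z, y ≠ x ∧ v = c y)
    (n₁ : ∀ x ∈ Z, ∀ v, ¬ G.Adj (c x) v ↔ v = c x ∨ (v ∈ Z ∧ v ≠ x))
    (hs : ∀ v, v ∈ Z ∨ ∃ x ∈ Z, v = c x) (hc : Z.card * 2 ≤ Fintype.card V) :
    Nonempty (G ≃g prism Z.card) := by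
  let e := Z.equivFin.symm
  let f : Fin Z.card × Fin 2 → V := fun x => if x.2 = 0 then (e x.1 : V) else c (e x.1)
  have f0 : ∀ a, (e a : V) = f (a, 0) := fun a => by simp [f]
  have f1 : ∀ a, c (e a) = f (a, 1) := fun a => by simp [f]
  have ez : ∀ x ∈ Z, ∃ a, x = e a := fun x hx => ⟨Z.equivFin ⟨x, hx⟩, by simp [e]⟩
  have em : ∀ a, (e a : V) ∈ Z := fun a => (e a).2
  refine iso_of_surj f ?_ (by simpa using hc) ?_
  · intro v
    rcases hs v with h | ⟨x, h, rfl⟩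
    · obtain ⟨a, rfl⟩ := ez v h; exact ⟨_, (f0 a).symm⟩
    · obtain ⟨a, rfl⟩ := ez x h; exact ⟨_, (f1 a).symm⟩
  · rintro hf ⟨a, x⟩ ⟨b, y⟩
    have mz : ∀ b : Fin Z.card, ∀ y : Fin 2, f (b, y) ∈ Z ↔ y = 0 := by
      intro b y
      fin_cases y
      · simp [← f0]
      · simp only [Fin.mk_one, one_ne_zero, iff_false]
        intro h0
        obtain ⟨a, ha⟩ := ez _ h0
        rw [f0] at ha
        simpa using hf ha
    rw [← not_iff_not]
    fin_cases x <;> simp only [Fin.zero_eta, Fin.mk_one]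
    · rw [← f0 a, n₀ _ (em a)]
      have k : (∃ z ∈ Z, z ≠ e a ∧ f (b, y) = c z) ↔ b ≠ a ∧ y = 1 := by
        constructor
        · rintro ⟨z, hz, h1, h2⟩
          obtain ⟨a', rfl⟩ := ez z hz
          rw [f1] at h2
          have := hf h2
          simp only [Prod.mk.injEq] at this
          refine ⟨?_, this.2⟩
          rintro rfl; rw [this.1] at h1; exact h1 rfl
        · rintro ⟨h1, rfl⟩
          exact ⟨e b, em b, fun h0 => h1 (e.injective (Subtype.ext h0)), (f1 b).symm⟩
      rw [k, f0, hf.eq_iff]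
      simp only [prism, Prod.mk.injEq]
      fin_cases y <;> simp [eq_comm]
    · rw [← f1 a, n₁ _ (em a), mz, f1, f0, hf.eq_iff, Ne, hf.eq_iff]
      simp only [prism, Prod.mk.injEq]
      fin_cases y <;> simp [eq_comm]

lemma halfCone_iso {V : Type*} [Fintype V] {G : SimpleGraph V} {n : ℕ} (X : Finset V)
    (hX : X.card = n) (y : V → V) (q : V)
    (n₀ : ∀ x ∈ X, ∀ v, ¬ G.Adj (y x) v ↔ v = y x ∨ v = x)
    (n₁ : ∀ x ∈ X, ∀ v, ¬ G.Adj x v ↔ v = x ∨ v = q ∨ v = y x)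
    (n₂ : ∀ v, ¬ G.Adj q v ↔ v = q ∨ v ∈ X)
    (hs : ∀ v, v ∈ X ∨ (∃ x ∈ X, v = y x) ∨ v = q) (hc : n * 2 + 1 ≤ Fintype.card V) :
    Nonempty (G ≃g halfCone n) := by
  subst hX
  let e := X.equivFin.symm
  let f : (Fin X.card × Fin 2) ⊕ Unit → V :=
    Sum.elim (fun x => if x.2 = 0 then y (e x.1) else (e x.1 : V)) fun _ => q
  have f0 : ∀ a, y (e a) = f (.inl (a, 0)) := fun a => by simp [f]
  have f1 : ∀ a, (e a : V) = f (.inl (a, 1)) := fun a => by simp [f]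
  have f2 : q = f (.inr ()) := by simp [f]
  have ez : ∀ x ∈ X, ∃ a, x = e a := fun x hx => ⟨X.equivFin ⟨x, hx⟩, by simp [e]⟩
  have em : ∀ a, (e a : V) ∈ X := fun a => (e a).2
  refine iso_of_surj f ?_ (by simpa using hc) ?_
  · intro v
    rcases hs v with h | ⟨x, h, rfl⟩ | h
    · obtain ⟨a, rfl⟩ := ez v h; exact ⟨_, (f1 a).symm⟩
    · obtain ⟨a, rfl⟩ := ez x h; exact ⟨_, (f0 a).symm⟩
    · exact ⟨_, (h.trans f2).symm⟩
  · intro hf x z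
    have mz : ∀ z, f z ∈ X ↔ ∃ a, z = .inl (a, 1) := by
      intro z
      constructor
      · intro h
        obtain ⟨a, ha⟩ := ez _ h
        rw [f1] at ha
        exact ⟨a, hf ha⟩
      · rintro ⟨a, rfl⟩; rw [← f1]; exact em a
    rw [← not_iff_not]
    rcases x with ⟨a, x⟩ | x
    · fin_cases x <;> simp only [Fin.zero_eta, Fin.mk_one]
      · rw [← f0 a, n₀ _ (em a), f0, f1, hf.eq_iff, hf.eq_iff]
        rcases z with ⟨b, z⟩ | z
        · fin_cases z <;> simp [halfCone, eq_comm]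
        · simp [halfCone]
      · rw [← f1 a, n₁ _ (em a), f0, f1, f2, hf.eq_iff, hf.eq_iff, hf.eq_iff]
        rcases z with ⟨b, z⟩ | z
        · fin_cases z <;> simp [halfCone, eq_comm]
        · simp [halfCone]
    · rw [show f (.inr x) = q from rfl, n₂, mz, f2, hf.eq_iff]
      rcases z with ⟨b, z⟩ | z
      · fin_cases z <;> simp [halfCone]
      · simp [halfCone]

namespace PD

variable {V : Type*} [Fintype V] {G : SimpleGraph V} {r s : ℝ} {P : PD G r s}

/-- Crossing sets of twin-free vertices with equal vectors that differ at all differ by exchanging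
one vertex for another; knowing the vertex that leaves identifies the exchange. -/
lemma Same.swap_of_mem {i j m : V} (hs : P.Same i j) (h1 : (P.W i).card = 1) (hi : m ∈ P.R i)
    (hj : m ∉ P.R j) : G.Adj i j ∧ P.R i \ P.R j = {m} ∧
      ∃ p, p ≠ m ∧ P.Same m p ∧ P.R j \ P.R i = {p} := by
  obtain ⟨h, p, q, hpq, hs', e1, e2⟩ := hs.swap h1 (by rintro rfl; exact hj hi)
  have : m ∈ P.R i \ P.R j := mem_sdiff.2 ⟨hi, hj⟩
  rw [e1, mem_singleton] at this
  subst this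
  exact ⟨h, e1, p, hpq, hs'.symm, e2⟩

lemma mem_of_sdiff {A B : Finset V} {m x : V} (h : A \ B = {m}) (hx : x ∈ A) (hm : x ≠ m) :
    x ∈ B := by
  by_contra hn
  have : x ∈ A \ B := mem_sdiff.2 ⟨hx, hn⟩
  rw [h, mem_singleton] at this
  exact hm this

lemma Same.eq_of_R {i j : V} (hs : P.Same i j) (h1 : (P.W i).card = 1) (hR : P.R i = P.R j) :
    i = j := by
  by_contra hn
  obtain ⟨_, p, q, _, _, e1, _⟩ := hs.swap h1 hn
  rw [hR, sdiff_self] at e1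
  simp at e1

lemma eq_swap {A B : Finset V} {m p : V} (h : A \ B = {m}) (h' : B \ A = {p}) (x : V) :
    x ∈ B ↔ x = p ∨ (x ∈ A ∧ x ≠ m) := by
  have f1 := congrArg (x ∈ ·) h
  have f2 := congrArg (x ∈ ·) h'
  simp only [mem_sdiff, mem_singleton, eq_iff_iff] at f1 f2
  tauto

section pos
variable (hpos : ∀ i j, 0 < P.dot i j)
include hpos

/-- One-sided case in which the second vertex shares its vector with another vertex. -/
lemma Mx.iso_prism {i q z : V} (h : P.Mx i q) (hi : (P.W i).card = 1) (hq : (P.W q).card = 1)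
    (hall : ∀ j, P.Cross q j → P.Same i j) (h2 : 2 ≤ (P.R q).card) (hz : P.Same q z)
    (hzq : z ≠ q) : ∃ k, 3 ≤ k ∧ Nonempty (G ≃g prism k) := by
  have iq : i ∈ P.R q := P.mem_R.2 h.cross.symm
  obtain ⟨-, p, l, hpl, hpl', e1, e2⟩ := hz.swap hq hzq.symm
  have hz' := eq_swap e1 e2
  have hlq : l ∈ P.R q := by
    have : l ∈ P.R q \ P.R z := by rw [e1]; simp
    exact (mem_sdiff.1 this).1
  have hpq : p ∉ P.R q := by
    have : p ∈ P.R z \ P.R q := by rw [e2]; simp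
    exact (mem_sdiff.1 this).2
  have hpz : p ∈ P.R z := (hz' p).2 (Or.inl rfl)
  set Z := insert p (P.R q) with hZ
  have memZ : ∀ x, x ∈ Z ↔ x = p ∨ x ∈ P.R q := fun x => by simp [Z]
  have Zsame : ∀ x ∈ Z, P.Same i x := by
    intro x hx
    rcases (memZ x).1 hx with rfl | hx
    · exact (hall l (P.mem_R.1 hlq)).trans hpl'.symm
    · exact hall x (P.mem_R.1 hx)
  have W1 : ∀ x ∈ Z, (P.W x).card = 1 := fun x hx => by rw [← (Zsame x hx).W_card, hi]
  have W1' : ∀ x, P.Same q x → (P.W x).card = 1 := fun x hx => by rw [← hx.W_card, hq]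
  -- The vertex c x has the vector of q and crosses all of Z except x. For x = p it is q, for x = l
  -- it is z. For any other x, the vertex z crosses x but not l, and c x is the vertex exchanged for
  -- z when passing from R x to R l.
  have ex : ∀ x, ∃ c, x ∈ Z → P.Same q c ∧ P.R c = Z \ {x} := by
    intro x
    by_cases hx : x ∈ Z
    · suffices ∃ c, P.Same q c ∧ P.R c = Z \ {x} from this.imp fun c hc _ => hc
      rcases (memZ x).1 hx with rfl | hxq
      · refine ⟨q, Same.refl P q, ?_⟩
        rw [hZ, insert_sdiff_of_mem _ (mem_singleton_self _), sdiff_singleton_eq_erase,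
          erase_eq_of_notMem hpq]
      have main : ∀ c, P.Same q c → x ∉ P.R c → p ∈ P.R c → P.R c = Z \ {x} := by
        intro c hc hxc hpc
        obtain ⟨-, f1, p', -, -, f2⟩ := hc.swap_of_mem hq hxq hxc
        have : p ∈ P.R c \ P.R q := mem_sdiff.2 ⟨hpc, hpq⟩
        rw [f2, mem_singleton] at this
        subst this
        ext v
        rw [eq_swap f1 f2, mem_sdiff, memZ, mem_singleton]
        constructor
        · rintro (rfl | h0)
          · exact ⟨Or.inl rfl, fun h0 => hpq (h0 ▸ hxq)⟩
          · exact ⟨Or.inr h0.1, h0.2⟩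
        · rintro ⟨h0 | h0, h1⟩
          · exact Or.inl h0
          · exact Or.inr ⟨h0, h1⟩
      by_cases hxl : x = l
      · subst hxl
        exact ⟨z, hz, main z hz (fun h0 => ((hz' x).1 h0).elim (fun h0 => hpq (h0 ▸ hxq))
          fun h0 => h0.2 rfl) hpz⟩
      · have hxz : x ∈ P.R z := (hz' x).2 (Or.inr ⟨hxq, hxl⟩)
        have hlz : l ∉ P.R z := fun h0 => ((hz' l).1 h0).elim (fun h0 => hpq (h0 ▸ hlq))
          fun h0 => h0.2 rfl
        have hxl' : P.Same x l := (Zsame x hx).symm.trans (hall l (P.mem_R.1 hlq))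
        obtain ⟨-, f1, y, hy, hzy, f2⟩ := hxl'.swap_of_mem (W1 x hx) (mem_R_comm.1 hxz)
          (fun h0 => hlz (mem_R_comm.1 h0))
        have hyx : y ∉ P.R x := by
          have : y ∈ P.R l \ P.R x := by rw [f2]; simp
          exact (mem_sdiff.1 this).2
        have hxy : x ∉ P.R y := fun h0 => hyx (mem_R_comm.1 h0)
        refine ⟨y, hz.trans hzy, main y (hz.trans hzy) hxy ?_⟩
        obtain ⟨-, g1, -⟩ := hzy.swap_of_mem (W1' z hz) hxz hxy
        exact mem_of_sdiff g1 hpz fun h0 => hpq (h0 ▸ hxq)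
    · exact ⟨x, fun h0 => absurd h0 hx⟩
  choose c hc using ex
  have cinj : ∀ x ∈ Z, ∀ y ∈ Z, c x = c y → x = y := by
    intro x hx y hy hxy
    by_contra hn
    have h1 : x ∈ P.R (c y) := by rw [(hc y hy).2]; simp [hx, hn]
    rw [← hxy, (hc x hx).2] at h1
    simp at h1
  -- No further vertices have the vector of q: the crossing set of such a d differs from R q by one
  -- exchange, and comparing with c m' shows that the incoming vertex is p.
  have conly : ∀ d, P.Same q d → ∃ x ∈ Z, d = c x := by
    intro d hd
    have fin : ∀ x ∈ Z, P.R d = Z \ {x} → ∃ x ∈ Z, d = c x := fun x hx hR =>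
      ⟨x, hx, (hd.symm.trans (hc x hx).1).eq_of_R (W1' d hd) (by rw [hR, (hc x hx).2])⟩
    by_cases hdq : d = q
    · subst hdq
      have hp : p ∈ Z := (memZ p).2 (Or.inl rfl)
      refine fin p hp ?_
      rw [hZ, insert_sdiff_of_mem _ (mem_singleton_self _), sdiff_singleton_eq_erase,
          erase_eq_of_notMem hpq]
    · obtain ⟨-, p', m, hpm, -, f1, f2⟩ := hd.swap hq (Ne.symm hdq)
      have hd' := eq_swap f1 f2
      have hmq : m ∈ P.R q := by
        have : m ∈ P.R q \ P.R d := by rw [f1]; simp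
        exact (mem_sdiff.1 this).1
      have hmd : m ∉ P.R d := by
        have : m ∈ P.R q \ P.R d := by rw [f1]; simp
        exact (mem_sdiff.1 this).2
      obtain ⟨m', hm', hmm⟩ := exists_mem_ne (by omega : 1 < (P.R q).card) m
      have hmZ := (memZ m').2 (Or.inr hm')
      have hcm := hc m' hmZ
      by_cases hpd : p ∈ P.R d
      · have : p' = p := by
          have : p ∈ P.R d \ P.R q := mem_sdiff.2 ⟨hpd, hpq⟩
          rw [f2, mem_singleton] at this
          exact this.symm
        subst this
        refine fin m ((memZ m).2 (Or.inr hmq)) ?_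
        ext v
        rw [hd', mem_sdiff, memZ, mem_singleton]
        constructor
        · rintro (rfl | h0)
          · exact ⟨Or.inl rfl, fun h0 => hpq (h0 ▸ hmq)⟩
          · exact ⟨Or.inr h0.1, h0.2⟩
        · rintro ⟨h0 | h0, h1⟩
          · exact Or.inl h0
          · exact Or.inr ⟨h0, h1⟩
      · exfalso
        have k1 : m ∈ P.R (c m') := by
          rw [hcm.2, mem_sdiff, memZ, mem_singleton]; exact ⟨Or.inr hmq, hmm.symm⟩
        have k2 : p ∈ P.R (c m') := by
          rw [hcm.2, mem_sdiff, memZ, mem_singleton]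
          exact ⟨Or.inl rfl, fun h0 => hpq (h0 ▸ hm')⟩
        obtain ⟨-, g1, -⟩ := (hcm.1.symm.trans hd).swap_of_mem (W1' _ hcm.1) k1 hmd
        exact hpd (mem_of_sdiff g1 k2 fun h0 => hpq (h0 ▸ hmq))
  -- A v in R x with a vector other than that of q would lie in R x' for every x' in Z. Then p would
  -- be in R v ⊆ R q, which is false.
  have RZ : ∀ x ∈ Z, ∀ v, v ∈ P.R x ↔ ∃ y ∈ Z, y ≠ x ∧ v = c y := by
    intro x hx v
    constructor
    · intro hv
      have hvs : P.Same q v := by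
        by_contra hn
        have hsub : ∀ x' ∈ Z, v ∈ P.R x' := by
          intro x' hx'
          by_cases hxx : x = x'
          · exact hxx ▸ hv
          have k1 : c x' ∈ P.R x := by
            rw [mem_R_comm, (hc x' hx').2]; simp [hx, hxx]
          have k2 : c x' ∉ P.R x' := by
            rw [mem_R_comm, (hc x' hx').2]; simp
          obtain ⟨-, g1, -⟩ := ((Zsame x hx).symm.trans (Zsame x' hx')).swap_of_mem
            (W1 x hx) k1 k2
          refine mem_of_sdiff g1 hv ?_
          rintro rfl; exact hn (hc x' hx').1
        have iv := hsub i ((memZ i).2 (Or.inr iq))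
        have := (h.symm.ssub hpos (P.mem_R.1 iv) fun h0 => hn h0.symm).1
          (mem_R_comm.1 (hsub p ((memZ p).2 (Or.inl rfl))))
        exact hpq this
      obtain ⟨y, hy, rfl⟩ := conly v hvs
      refine ⟨y, hy, ?_, rfl⟩
      rintro rfl
      rw [mem_R_comm, (hc y hy).2] at hv; simp at hv
    · rintro ⟨y, hy, hyx, rfl⟩
      rw [mem_R_comm, (hc y hy).2]; simp [hx, hyx.symm]
  have cZ : ∀ x ∈ Z, c x ∉ Z := by
    intro x hx h0
    have k1 := (Zsame _ h0).trans (hc x hx).1.symm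
    exact h.cross.2 (P.cr_of_same k1)
  have n0 : ∀ x ∈ Z, ∀ v, ¬ G.Adj x v ↔ v = x ∨ ∃ y ∈ Z, y ≠ x ∧ v = c y := by
    intro x hx v
    rw [nadj_iff (P := P), RZ x hx, W_eq_singleton (W1 x hx), mem_singleton]
  have n1 : ∀ x ∈ Z, ∀ v, ¬ G.Adj (c x) v ↔ v = c x ∨ (v ∈ Z ∧ v ≠ x) := by
    intro x hx v
    rw [nadj_iff (P := P), (hc x hx).2, W_eq_singleton (W1' _ (hc x hx).1), mem_singleton]
    simp
  have cardZ : Z.card = (P.R q).card + 1 := by rw [hZ, card_insert_of_notMem hpq]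
  have iZ : i ∈ Z := (memZ i).2 (Or.inr iq)
  have Ri : P.R i = (Z.erase i).image c := by
    ext v; rw [RZ i iZ]; simp only [mem_image, mem_erase]
    exact ⟨fun ⟨y, h1, h2, h3⟩ => ⟨y, ⟨h2, h1⟩, h3.symm⟩,
      fun ⟨y, ⟨h2, h1⟩, h3⟩ => ⟨y, h1, h2, h3.symm⟩⟩
  have cardRi : (P.R i).card = (P.R q).card := by
    rw [Ri, card_image_of_injOn, card_erase_of_mem iZ, cardZ]; · omega
    · intro x hx y hy hxy
      exact cinj x (mem_erase.1 (mem_coe.1 hx)).2 y (mem_erase.1 (mem_coe.1 hy)).2 hxy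
  set S := Z ∪ Z.image c with hS
  have cardS : S.card = 2 * (P.R q).card + 2 := by
    rw [hS, card_union_of_disjoint, card_image_of_injOn, cardZ]
    · omega
    · intro x hx y hy hxy; exact cinj x hx y hy hxy
    · rw [disjoint_left]; intro x hx hx'
      obtain ⟨y, hy, rfl⟩ := mem_image.1 hx'
      exact cZ y hy hx
  have memS : ∀ v, v ∈ S ↔ v ∈ Z ∨ ∃ x ∈ Z, v = c x := by
    intro v; simp only [hS, mem_union, mem_image, eq_comm]
  have nS : ∀ x ∈ S, ∀ v, ¬ G.Adj x v → v ∈ S := by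
    intro x hx v hv
    rw [memS] at hx ⊢
    rcases hx with hx | ⟨x, hx, rfl⟩
    · rcases (n0 x hx v).1 hv with rfl | ⟨y, hy, -, rfl⟩
      exacts [Or.inl hx, Or.inr ⟨y, hy, rfl⟩]
    · rcases (n1 x hx v).1 hv with rfl | ⟨h0, -⟩
      exacts [Or.inr ⟨x, hx, rfl⟩, Or.inl h0]
  have qS : q ∈ S := by
    obtain ⟨x, hx, hqx⟩ := conly q (Same.refl P q)
    exact (memS q).2 (Or.inr ⟨x, hx, hqx⟩)
  have iS : i ∈ S := (memS i).2 (Or.inl iZ)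
  have adjS : ∀ τ, τ ∉ S → ∀ x ∈ S, G.Adj x τ := fun τ hτ x hx => by
    by_contra hn; exact hτ (nS x hx τ hn)
  have hRS : ∀ x ∈ S, P.R x ⊆ S := fun x hx v hv => nS x hx v (P.mem_R.1 hv).1
  have dot0 : ∀ τ, τ ∉ S → ∀ x ∈ S, (P.R x ∩ P.R τ).card = 0 := by
    intro τ hτ x hx
    rw [card_eq_zero, eq_empty_iff_forall_notMem]
    intro v hv
    rw [mem_inter] at hv
    exact (P.mem_R.1 hv.2).1 (adjS τ hτ v (hRS x hx hv.1)).symm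
  have dii := P.dot_self' i
  have dqq := P.dot_self' q
  have diq := dot_cross hpos h.cross
  have cc := card_cross hpos h.cross
  rw [hi, cardRi] at dii
  rw [hq] at dqq
  rw [cardRi] at diq
  -- A vertex outside S is adjacent to all of S and has equal inner products with i and q. So any
  -- two such vertices are parallel, and their crossing sets are empty.
  have dτ : ∀ τ, τ ∉ S → P.dot i τ = P.dot q τ := by
    intro τ hτ
    have a1 := dot_of_adj (P := P) (adjS τ hτ i iS)
    have a2 := dot_of_adj (P := P) (adjS τ hτ q qS)
    rw [dot0 τ hτ i iS, hi, cardRi] at a1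
    rw [dot0 τ hτ q qS, hq] at a2
    linarith
  have Rτ : ∀ τ, τ ∉ S → P.R τ = ∅ := by
    intro τ hτ
    rw [eq_empty_iff_forall_notMem]
    intro σ hσ
    have hσS : σ ∉ S := fun h0 => (P.mem_R.1 hσ).1 (adjS τ hτ σ h0).symm
    have k1 := dτ τ hτ
    have k2 := dτ σ hσS
    have k3 : P.dot i i + P.dot q q - 2 * P.dot i q ≠ 0 := fun h0 =>
      h.cross.2 (P.cr_of_same (P.same_of_dist h0.le))
    apply (P.mem_R.1 hσ).2
    have e1 : (P.a i - P.a q) * P.cr τ σ = 0 := by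
      unfold dot at k1 k2; unfold cr; linear_combination P.b σ * k1 - P.b τ * k2
    have e2 : (P.b i - P.b q) * P.cr τ σ = 0 := by
      unfold dot at k1 k2; unfold cr; linear_combination P.a τ * k2 - P.a σ * k1
    by_contra hn
    have f1 := (mul_eq_zero.1 e1).resolve_right hn
    have f2 := (mul_eq_zero.1 e2).resolve_right hn
    apply k3
    unfold dot
    linear_combination (P.a i - P.a q) * f1 + (P.b i - P.b q) * f2
  obtain ⟨t, ht⟩ := Nat.exists_eq_add_of_le (card_le_univ S)
  rw [cardS] at ht
  -- The determinant of i, q, τ shows that τ has no twin and that at least two vertices lie outside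
  -- S; these would have equal closed neighbourhoods.
  have key : ∀ τ, τ ∉ S → (P.W τ).card = 1 ∧ 2 ≤ t := by
    intro τ hτ
    have hW : (P.W τ).card ≤ t := by
      have : P.W τ ⊆ Sᶜ := by
        intro v hv
        rw [mem_compl]
        exact fun h0 => (P.mem_W.1 hv).1 (adjS τ hτ v h0).symm
      have := card_le_card this
      rw [card_compl, cardS, ht] at this
      omega
    have hW1 := P.W_pos τ
    have a1 := dot_of_adj (P := P) (adjS τ hτ i iS)
    have a2 := dot_of_adj (P := P) (adjS τ hτ q qS)
    rw [dot0 τ hτ i iS, hi, cardRi, Rτ τ hτ] at a1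
    rw [dot0 τ hτ q qS, hq, Rτ τ hτ] at a2
    have a3 := P.dot_self' τ
    rw [Rτ τ hτ] at a3
    unfold dot at a1 a2 a3 dii dqq diq
    have g := gram3 _ _ _ _ _ _ dii dqq a3 diq a1 a2
    rw [ht] at g
    generalize (P.R q).card = n at *
    generalize (P.W τ).card = u at *
    obtain ⟨e, rfl⟩ := Nat.exists_eq_add_of_le hW
    obtain ⟨κ, rfl⟩ := Nat.exists_eq_add_of_le hW1
    obtain ⟨m, rfl⟩ := Nat.exists_eq_add_of_le h2
    push_cast [card_empty] at g
    have g' : ((m : ℝ) + 1) * ((2 + m) * (e + 1 - 1) - 3 * (e + 1) - 5 + 2 * κ * (2 * (2 + m) + 1 + (e + 1))) = 0 := by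
      linear_combination g
    have g2 : ((2 + m : ℤ) * (e + 1 - 1) - 3 * (e + 1) - 5 + 2 * κ * (2 * (2 + m) + 1 + (e + 1))) = 0 := by
      have := (mul_eq_zero.1 g').resolve_left (by positivity)
      exact_mod_cast this
    rcases Nat.eq_zero_or_pos κ with rfl | hκ
    · refine ⟨rfl, ?_⟩
      by_contra hn
      have : e = 0 := by omega
      subst this
      norm_num at g2
    · exfalso
      have : (1 : ℤ) * (2 * (2 + m) + 1 + (e + 1)) ≤ κ * (2 * (2 + m) + 1 + (e + 1)) :=
        mul_le_mul_of_nonneg_right (by omega) (by positivity)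
      have : (0 : ℤ) ≤ m * e := by positivity
      nlinarith
  have full : ∀ v, v ∈ S := by
    by_contra hn
    push Not at hn
    obtain ⟨τ, hτ⟩ := hn
    obtain ⟨-, k2⟩ := key τ hτ
    have c2 : 1 < (Sᶜ : Finset V).card := by rw [card_compl, cardS, ht]; omega
    obtain ⟨σ, hσ, hστ⟩ := exists_mem_ne c2 τ
    rw [mem_compl] at hσ
    have dom : ∀ τ, τ ∉ S → ∀ v, v ≠ τ → G.Adj τ v := by
      intro τ hτ v hv
      by_contra hn
      rcases (nadj_iff (P := P)).1 hn with h0 | h0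
      · rw [W_eq_singleton (key τ hτ).1, mem_singleton] at h0; exact hv h0
      · rw [Rτ τ hτ] at h0; simp at h0
    refine P.not_closed_twins (dom τ hτ σ hστ) ?_ ?_
    · intro v hv
      simp only [mem_sdiff, mem_nb, mem_singleton] at hv ⊢
      exact ⟨dom σ hσ v hv.2, fun h0 => by subst h0; exact G.loopless.irrefl _ hv.1⟩
    · intro v hv
      simp only [mem_sdiff, mem_nb, mem_singleton] at hv ⊢
      exact ⟨dom τ hτ v hv.2, fun h0 => by subst h0; exact G.loopless.irrefl _ hv.1⟩
  refine ⟨Z.card, by omega, prism_iso Z c n0 n1 (fun v => (memS v).1 (full v)) ?_⟩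
  have := card_le_univ S
  omega

/-- One-sided case in which the second vertex is the only one with its vector. -/
lemma Mx.iso_halfCone {i q : V} (h : P.Mx i q) (hi : (P.W i).card = 1) (hq : (P.W q).card = 1)
    (hall : ∀ j, P.Cross q j → P.Same i j) (h2 : 2 ≤ (P.R q).card)
    (huq : ∀ z, P.Same q z → z = q) : Nonempty (G ≃g halfCone 7) := by
  have iq : i ∈ P.R q := P.mem_R.2 h.cross.symm
  have hX : ∀ x, x ∈ P.R q → P.Same i x := fun x hx => hall x (P.mem_R.1 hx)
  have hMx : ∀ x, x ∈ P.R q → P.Mx x q := fun x hx =>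
    h.of_same (hX x hx) (Same.refl P q) (P.mem_R.1 hx).symm
  have W1 : ∀ x, x ∈ P.R q → (P.W x).card = 1 := fun x hx => by rw [← (hX x hx).W_card, hi]
  have sXX : ∀ x ∈ P.R q, ∀ y ∈ P.R q, P.Same x y := fun x hx y hy => (hX x hx).symm.trans (hX y hy)
  -- If y crosses x but not l, then x is its only crossing neighbour. A second one m, together with
  -- another l' in R q that does not cross y, would lead through exchanges to R l ⊆ R l', hence to l
  -- = l'.
  have step : ∀ x ∈ P.R q, ∀ l ∈ P.R q, ∀ y, y ∈ P.R x → y ∉ P.R l → P.R y = {x} ∧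
      (P.R y).card + 2 ≤ (P.R q).card := by
    intro x hx l hl y hy hyl
    have hyq : ¬ P.Same y q := fun h0 => hyl (huq y h0.symm ▸ mem_R_comm.1 hl)
    have hss := (hMx x hx).symm.ssub hpos (P.mem_R.1 hy) hyq
    obtain ⟨e1, e2, e3, e4, e5, e6, e7, e8, e9⟩ :=
      (hMx x hx).symm.eqn hpos (P.mem_R.1 hy) hyq rfl rfl rfl rfl rfl rfl rfl
    have hcard : (P.R y).card + 2 ≤ (P.R q).card := by omega
    refine ⟨?_, hcard⟩
    rw [eq_singleton_iff_unique_mem]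
    refine ⟨mem_R_comm.1 hy, fun m hm => ?_⟩
    by_contra hmx
    have hmq : m ∈ P.R q := hss.1 hm
    obtain ⟨l', hl', hll⟩ : ∃ l' ∈ P.R q \ P.R y, l' ≠ l := by
      apply exists_mem_ne
      have := le_card_sdiff (P.R y) (P.R q)
      omega
    rw [mem_sdiff] at hl'
    have hyl' : y ∉ P.R l' := fun h0 => hl'.2 (mem_R_comm.1 h0)
    have hym := mem_R_comm.1 hm
    obtain ⟨-, a1, p, -, -, a2⟩ := (sXX x hx l hl).swap_of_mem (W1 x hx) hy hyl
    obtain ⟨-, b1, p', -, -, b2⟩ := (sXX m hmq l hl).swap_of_mem (W1 m hmq) hym hyl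
    obtain ⟨-, c1, -⟩ := (sXX x hx l' hl'.1).swap_of_mem (W1 x hx) hy hyl'
    obtain ⟨-, d1, -⟩ := (sXX m hmq l' hl'.1).swap_of_mem (W1 m hmq) hym hyl'
    have hp : p ∈ P.R l ∧ p ∉ P.R x := by
      have : p ∈ P.R l \ P.R x := by rw [a2]; simp
      exact mem_sdiff.1 this
    have hpp : p ≠ p' := by
      rintro rfl
      refine hmx ((sXX m hmq x hx).eq_of_R (W1 m hmq) ?_)
      ext v
      rw [eq_swap b2 b1, eq_swap a2 a1]
    have hpm : p ∈ P.R m := mem_of_sdiff b2 hp.1 hpp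
    have hsub : P.R l ⊆ P.R l' := by
      intro v hv
      have hvy : v ≠ y := by rintro rfl; exact hyl hv
      by_cases hvp : v = p
      · subst hvp; exact mem_of_sdiff d1 hpm hvy
      · exact mem_of_sdiff c1 (mem_of_sdiff a2 hv hvp) hvy
    exact hll ((sXX l' hl'.1 l hl).eq_of_R (W1 l' hl'.1) (eq_of_subset_of_card_le hsub
      (sXX l' hl'.1 l hl).R_card.le).symm)
  -- So every x in R q has R x = {q, y} with a vertex y of its own.
  have ex : ∀ x, ∃ y, x ∈ P.R q → P.R y = {x} ∧ (∀ v, v ∈ P.R x ↔ v = q ∨ v = y) ∧ y ≠ q ∧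
      3 ≤ (P.R q).card ∧ ∀ l ∈ P.R q, l ≠ x → P.R x \ P.R l = {y} := by
    intro x
    by_cases hx : x ∈ P.R q
    · obtain ⟨l, hl, hlx⟩ := exists_mem_ne (by omega : 1 < (P.R q).card) x
      obtain ⟨-, p, y, hpy, hpy', e1, e2⟩ := (sXX x hx l hl).swap (W1 x hx) hlx.symm
      have hy : y ∈ P.R x ∧ y ∉ P.R l := by
        have : y ∈ P.R x \ P.R l := by rw [e1]; simp
        exact mem_sdiff.1 this
      obtain ⟨s1, s2⟩ := step x hx l hl y hy.1 hy.2
      have hyq : y ≠ q := by rintro rfl; exact hy.2 (mem_R_comm.1 hl)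
      have hd : ∀ l ∈ P.R q, l ≠ x → P.R x \ P.R l = {y} := by
        intro m hm hmx
        refine ((sXX x hx m hm).swap_of_mem (W1 x hx) hy.1 ?_).2.1
        rw [mem_R_comm, s1, mem_singleton]; exact hmx
      have s4 : (P.R y).card = 1 := by rw [s1, card_singleton]
      refine ⟨y, fun _ => ⟨s1, fun v => ⟨fun hv => ?_, ?_⟩, hyq, by omega, hd⟩⟩
      · by_contra hn
        push Not at hn
        have hvs : ¬ P.Same v q := fun h0 => hn.1 (huq v h0.symm)
        have := (hMx x hx).symm.ssub hpos (P.mem_R.1 hv) hvs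
        refine this.2 fun m hm => ?_
        rw [mem_R_comm]
        by_cases hmx : m = x
        · exact hmx ▸ hv
        · exact mem_of_sdiff (hd m hm hmx) hv hn.2
      · rintro (rfl | rfl)
        exacts [mem_R_comm.1 hx, hy.1]
    · exact ⟨x, fun h0 => absurd h0 hx⟩
  choose y hy using ex
  obtain ⟨yi1, yi2, yi3, yi4', yi5⟩ := hy i iq
  have yinj : ∀ x ∈ P.R q, ∀ l ∈ P.R q, y x = y l → x = l := by
    intro x hx l hl hxl
    have := (hy x hx).1
    rw [hxl, (hy l hl).1] at this
    exact (singleton_injective this).symm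
  have Wy : ∀ x ∈ P.R q, P.W (y x) = {y x} := by
    intro x hx
    obtain ⟨s1, s2, s3, s4, s5⟩ := hy x hx
    rw [eq_singleton_iff_unique_mem]
    refine ⟨P.self_mem_W _, fun v hv => ?_⟩
    have k1 : v ∈ P.R x := by rw [mem_R_comm, ← R_of_W hv, s1]; simp
    rcases (s2 v).1 k1 with rfl | h0
    · have := congrArg card (R_of_W hv)
      rw [s1, card_singleton] at this; omega
    · exact h0
  have n0 : ∀ x ∈ P.R q, ∀ v, ¬ G.Adj (y x) v ↔ v = y x ∨ v = x := by
    intro x hx v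
    rw [nadj_iff (P := P), Wy x hx, (hy x hx).1, mem_singleton, mem_singleton]
  have n1 : ∀ x ∈ P.R q, ∀ v, ¬ G.Adj x v ↔ v = x ∨ v = q ∨ v = y x := by
    intro x hx v
    rw [nadj_iff (P := P), (hy x hx).2.1, W_eq_singleton (W1 x hx), mem_singleton]
  have n2 : ∀ v, ¬ G.Adj q v ↔ v = q ∨ v ∈ P.R q := by
    intro v
    rw [nadj_iff (P := P), W_eq_singleton hq, mem_singleton]
  have yX : ∀ x ∈ P.R q, y x ∉ P.R q := by
    intro x hx h0
    have := sXX x hx _ h0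
    refine (P.mem_R.1 (((hy x hx).2.1 (y x)).2 (Or.inr rfl))).2 (P.cr_of_same this)
  set S := insert q (P.R q ∪ (P.R q).image y) with hS
  have qS : q ∉ P.R q ∪ (P.R q).image y := by
    rw [mem_union, mem_image, not_or]
    refine ⟨fun h0 => (P.mem_R.1 h0).ne rfl, ?_⟩
    rintro ⟨x, hx, h0⟩
    exact (hy x hx).2.2.1 h0
  have cardS : S.card = 2 * (P.R q).card + 1 := by
    rw [hS, card_insert_of_notMem qS, card_union_of_disjoint, card_image_of_injOn]
    · omega
    · intro x hx l hl hxl; exact yinj x hx l hl hxl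
    · rw [disjoint_left]; intro x hx hx'
      obtain ⟨l, hl, rfl⟩ := mem_image.1 hx'
      exact yX l hl hx
  have memS : ∀ v, v ∈ S ↔ v ∈ P.R q ∨ (∃ x ∈ P.R q, v = y x) ∨ v = q := by
    intro v
    simp only [hS, mem_insert, mem_union, mem_image]
    constructor
    · rintro (h | h | ⟨x, hx, h⟩)
      exacts [Or.inr (Or.inr h), Or.inl h, Or.inr (Or.inl ⟨x, hx, h.symm⟩)]
    · rintro (h | ⟨x, hx, h⟩ | h)
      exacts [Or.inr (Or.inl h), Or.inr (Or.inr ⟨x, hx, h.symm⟩), Or.inl h]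
  have nS : ∀ x ∈ S, ∀ v, ¬ G.Adj x v → v ∈ S := by
    intro x hx v hv
    rw [memS] at hx ⊢
    rcases hx with hx | ⟨x, hx, rfl⟩ | rfl
    · rcases (n1 x hx v).1 hv with rfl | rfl | rfl
      exacts [Or.inl hx, Or.inr (Or.inr rfl), Or.inr (Or.inl ⟨x, hx, rfl⟩)]
    · rcases (n0 x hx v).1 hv with rfl | rfl
      exacts [Or.inr (Or.inl ⟨x, hx, rfl⟩), Or.inl hx]
    · rcases (n2 v).1 hv with rfl | h0
      exacts [Or.inr (Or.inr rfl), Or.inl h0]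
  have cRi : (P.R i).card = 2 := by
    have : P.R i = {q, y i} := by ext v; rw [yi2]; simp
    rw [this, card_pair yi3.symm]
  have ciy : P.Cross i (y i) := P.mem_R.1 ((yi2 _).2 (Or.inr rfl))
  have aqy : G.Adj q (y i) := by
    by_contra hn
    rcases (n0 i iq q).1 fun h0 => hn h0.symm with h0 | h0
    · exact yi3 h0.symm
    · exact h.cross.ne h0.symm
  have dii := P.dot_self' i
  have dqq := P.dot_self' q
  have dyy := P.dot_self' (y i)
  have diq := dot_cross hpos h.cross
  have diy := dot_cross hpos ciy
  have dqy := dot_of_adj (P := P) aqy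
  have cW : (P.W (y i)).card = 1 := by rw [Wy i iq, card_singleton]
  have cR : (P.R (y i)).card = 1 := by rw [yi1, card_singleton]
  have cI : (P.R q ∩ P.R (y i)).card = 1 := by rw [yi1, inter_singleton_of_mem iq, card_singleton]
  rw [hi, cRi] at dii
  rw [hq] at dqq
  rw [cW, cR] at dyy
  rw [cRi] at diq
  rw [cRi, cR] at diy
  rw [hq, cW, cR, cI] at dqy
  have yi4 : (P.R q).card ≠ 3 := by
    intro h3
    exact yi3 (huq _ (P.same_of_le aqy (by omega)))
  unfold dot at dii dqq dyy diq diy dqy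
  have g := gram3 _ _ _ _ _ _ dii dqq dyy diq diy dqy
  obtain ⟨t, ht⟩ := Nat.exists_eq_add_of_le (card_le_univ S)
  rw [cardS] at ht
  -- A vertex τ outside S would be adjacent to all of S. One determinant of the differences to y i
  -- gives (ρ - 4)(|W τ| + |R τ| - 2) = 1, hence ρ = 5; the second one then fails.
  have full : ∀ v, v ∈ S := by
    by_contra hn
    push Not at hn
    obtain ⟨τ, hτ⟩ := hn
    have adjS : ∀ x ∈ S, G.Adj x τ := fun x hx => by
      by_contra hn; exact hτ (nS x hx τ hn)
    have dot0 : ∀ x ∈ S, (P.R x ∩ P.R τ).card = 0 := by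
      intro x hx
      rw [card_eq_zero, eq_empty_iff_forall_notMem]
      intro v hv
      rw [mem_inter] at hv
      exact (P.mem_R.1 hv.2).1 (adjS v (nS x hx v (P.mem_R.1 hv.1).1)).symm
    have iS : i ∈ S := (memS i).2 (Or.inl iq)
    have qS' : q ∈ S := (memS q).2 (Or.inr (Or.inr rfl))
    have yS : y i ∈ S := (memS _).2 (Or.inr (Or.inl ⟨i, iq, rfl⟩))
    have a1 := dot_of_adj (P := P) (adjS i iS)
    have a2 := dot_of_adj (P := P) (adjS q qS')
    have a3 := dot_of_adj (P := P) (adjS _ yS)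
    have a4 := P.dot_self' τ
    rw [dot0 i iS, hi, cRi] at a1
    rw [dot0 q qS', hq] at a2
    rw [dot0 _ yS, cW, cR] at a3
    unfold dot at a1 a2 a3 a4
    have b := P.W_pos τ
    generalize hρ : (P.R q).card = ρ at *
    generalize (P.W τ).card = u at *
    generalize (P.R τ).card = u' at *
    generalize Fintype.card V = n at *
    have g11 : (P.a i - P.a (y i)) * (P.a i - P.a (y i)) +
        (P.b i - P.b (y i)) * (P.b i - P.b (y i)) = 1 := by
      linear_combination dii + dyy - 2 * diy
    have g12 : (P.a i - P.a (y i)) * (P.a q - P.a (y i)) +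
        (P.b i - P.b (y i)) * (P.b q - P.b (y i)) = -1 := by
      linear_combination diq - diy - dqy + dyy
    have g22 : (P.a q - P.a (y i)) * (P.a q - P.a (y i)) +
        (P.b q - P.b (y i)) * (P.b q - P.b (y i)) = ρ - 3 := by
      linear_combination dqq + dyy - 2 * dqy
    have g13 : (P.a i - P.a (y i)) * (P.a τ - P.a (y i)) +
        (P.b i - P.b (y i)) * (P.b τ - P.b (y i)) = 0 := by
      linear_combination a1 - diy - a3 + dyy
    have g23 : (P.a q - P.a (y i)) * (P.a τ - P.a (y i)) +
        (P.b q - P.b (y i)) * (P.b τ - P.b (y i)) = -1 := by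
      linear_combination a2 - dqy - a3 + dyy
    have g33 : (P.a τ - P.a (y i)) * (P.a τ - P.a (y i)) +
        (P.b τ - P.b (y i)) * (P.b τ - P.b (y i)) = u + u' - 2 := by
      linear_combination a4 + dyy - 2 * a3
    have g1y : (P.a i - P.a (y i)) * P.a (y i) + (P.b i - P.b (y i)) * P.b (y i) = -1 := by
      linear_combination diy - dyy
    have g2y : (P.a q - P.a (y i)) * P.a (y i) + (P.b q - P.b (y i)) * P.b (y i) = 2 - ρ := by
      linear_combination dqy - dyy
    have g3y : (P.a τ - P.a (y i)) * P.a (y i) + (P.b τ - P.b (y i)) * P.b (y i) = 2 - (u + u') := by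
      linear_combination a3 - dyy
    have k1 := gram3 _ _ _ _ _ _ g11 g22 g33 g12 g13 g23
    have k2 := det3_gram _ _ _ _ _ _ _ _ _ _ _ _ g11 g12 g1y
      (by linarith : (P.a q - P.a (y i)) * (P.a i - P.a (y i)) +
        (P.b q - P.b (y i)) * (P.b i - P.b (y i)) = -1) g22 g2y
      (by linarith : (P.a τ - P.a (y i)) * (P.a i - P.a (y i)) +
        (P.b τ - P.b (y i)) * (P.b i - P.b (y i)) = 0)
      (by linarith : (P.a τ - P.a (y i)) * (P.a q - P.a (y i)) +
        (P.b τ - P.b (y i)) * (P.b q - P.b (y i)) = -1) g3y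
    have f1 : ((ρ : ℤ) - 4) * (u + u' - 2) = 1 := by
      have : ((ρ : ℝ) - 4) * (u + u' - 2) = 1 := by linear_combination k1
      exact_mod_cast this
    have f2 := Int.eq_one_or_neg_one_of_mul_eq_one f1
    have f3 : (ρ : ℤ) = 5 := by omega
    have f4 : ρ = 5 := by omega
    rw [f3] at f1
    have f5 : (u' : ℤ) = 3 - u := by omega
    have f6 : (u' : ℝ) = 3 - u := by exact_mod_cast f5
    rw [f4, f6] at k2
    norm_num at k2
  have hV : Fintype.card V = 2 * (P.R q).card + 1 := by
    rw [← cardS, ← card_univ]; congr 1; exact (eq_univ_iff_forall.2 full).symm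
  -- With 2ρ + 1 vertices in total, the determinant of i, q and y i is (ρ - 7)(ρ - 1) = 0 up to a
  -- constant.
  have h7 : (P.R q).card = 7 := by
    rw [hV] at g
    push_cast at g
    generalize (P.R q).card = ρ at *
    have : ((ρ : ℝ) - 7) * (ρ - 1) = 0 := by linear_combination g
    rcases mul_eq_zero.1 this with h0 | h0
    · have : (ρ : ℝ) = (7 : ℕ) := by push_cast; linarith
      exact_mod_cast this
    · have : (ρ : ℝ) = (1 : ℕ) := by push_cast; linarith
      have : ρ = 1 := by exact_mod_cast this
      omega
  exact halfCone_iso (P.R q) h7 y q n0 n1 n2 (fun v => (memS v).1 (full v)) (by omega)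

/-- The classification when all inner products are positive. -/
theorem classify_pos {x y : V} (hxy : P.Cross x y) :
    (∃ k, 1 ≤ k ∧ Nonempty (G ≃g halfJoin 3 k)) ∨
      (∃ k l, 1 ≤ k ∧ 1 ≤ l ∧ Nonempty (G ≃g G8 k l)) ∨
      (∃ k, 3 ≤ k ∧ Nonempty (G ≃g prism k)) ∨ Nonempty (G ≃g halfCone 7) := by
  obtain ⟨⟨i, q⟩, hiq, hmax⟩ := exists_max_image (univ.filter fun z : V × V => P.Cross z.1 z.2)
    (fun z => (P.R z.1).card + (P.R z.2).card) ⟨(x, y), by simpa using hxy⟩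
  have h : P.Mx i q := ⟨by simpa using hiq, fun j k hjk => hmax (j, k) (by simpa using hjk)⟩
  have one : ∀ i q, P.Mx i q → (P.W i).card = 1 ∨ (P.W i).card = 2 := fun i q h => by
    have := P.W_pos i; have := W_le_two hpos h.cross; omega
  rcases one i q h with hi | hi
  swap
  · exact (h.iso_of_twin hpos hi).imp_right Or.inl
  rcases one q i h.symm with hq | hq
  swap
  · exact (h.symm.iso_of_twin hpos hq).imp_right Or.inl
  have fin : ∀ i q, P.Mx i q → (P.W i).card = 1 → (P.W q).card = 1 →
      (∀ j, P.Cross q j → P.Same i j) → 2 ≤ (P.R q).card →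
      (∃ k, 3 ≤ k ∧ Nonempty (G ≃g prism k)) ∨ Nonempty (G ≃g halfCone 7) := by
    intro i q h hi hq hall h2
    by_cases hz : ∃ z, P.Same q z ∧ z ≠ q
    · obtain ⟨z, hz, hzq⟩ := hz
      exact Or.inl (h.iso_prism hpos hi hq hall h2 hz hzq)
    · push Not at hz
      exact Or.inr (h.iso_halfCone hpos hi hq hall h2 hz)
  -- If R q = {i}, nesting shows that all crossing neighbours of i have the vector of q, so i and q
  -- may be exchanged. If R i also had one element, i and q would have equal vectors.
  have gen : ∀ i q, P.Mx i q → (P.W i).card = 1 → (P.W q).card = 1 →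
      (∀ j, P.Cross q j → P.Same i j) →
      (∃ k, 3 ≤ k ∧ Nonempty (G ≃g prism k)) ∨ Nonempty (G ≃g halfCone 7) := by
    intro i q h hi hq hall
    by_cases h2 : 2 ≤ (P.R q).card
    · exact fin i q h hi hq hall h2
    have hRq : P.R q = {i} := by
      refine (eq_of_subset_of_card_le (by simpa using h.cross.symm) ?_).symm
      rw [card_singleton]; omega
    have hall' : ∀ j, P.Cross i j → P.Same q j := by
      intro j hj
      by_contra hn
      have := (h.symm.ssub hpos hj fun h0 => hn h0.symm).2
      rw [hRq] at this
      exact this (by simpa using hj.symm)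
    refine fin q i h.symm hq hi hall' ?_
    by_contra hn
    have dii := P.dot_self' i
    have dqq := P.dot_self' q
    have diq := dot_cross hpos h.cross
    have : (P.R i).card = 1 := by
      have := card_pos.2 ⟨q, P.mem_R.2 h.cross⟩; omega
    have h1 : (P.R q).card = 1 := by rw [hRq, card_singleton]
    rw [hi, this] at dii
    rw [hq, h1] at dqq
    rw [this, h1] at diq
    exact h.cross.2 (P.cr_of_same (P.same_of_dist (by push_cast at *; linarith)))
  by_cases h1 : ∀ j, P.Cross q j → P.Same i j
  · exact Or.inr (Or.inr (gen i q h hi hq h1))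
  by_cases h2 : ∀ j, P.Cross i j → P.Same q j
  · exact Or.inr (Or.inr (gen q i h.symm hq hi h2))
  push Not at h1 h2
  exact (h.no_two_sided hpos hi hq (h1.imp fun j hj => ⟨hj.1, fun h0 => hj.2 h0.symm⟩)
    (h2.imp fun j hj => ⟨hj.1, fun h0 => hj.2 h0.symm⟩)).elim

end pos
end PD
end TwoEig
end

/-! ### An orthogonal pair: expansion and arithmetic. -/

section
open scoped Classical
namespace TwoEig
open Finset

-- With p = b + c = a + 1 + j the equation becomes (a + 2)(j - 1) + bc + (b + c)(σ - 2) = 0. The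
-- signs of j - 1 and σ - 2 leave few cases, most of which fix a product of two small numbers.
set_option maxHeartbeats 1000000 in
lemma orth_arith {p σ a b : ℕ} (ha : a + 1 ≤ p) (hb : b ≤ p) (hσ : 1 ≤ σ)
    (h : p * (a + b + σ) = (a + 2) ^ 2 + b ^ 2) :
    (p = 1 ∧ σ = 4 ∧ a = 0) ∨ (p = 2 ∧ σ = 3 ∧ a = 1 ∧ b = 1) ∨
      (σ = 2 ∧ a + 2 = p ∧ (b = 0 ∨ b = p)) ∨ (p = 5 ∧ σ = 2 ∧ a = 4 ∧ (b = 2 ∨ b = 3)) ∨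
      (p = 10 ∧ σ = 1 ∧ a = 9 ∧ (b = 3 ∨ b = 7)) ∨ (p = 4 ∧ σ = 1 ∧ a = 2 ∧ b = 2) ∨
      (p = 4 ∧ σ = 1 ∧ a = 0 ∧ (b = 0 ∨ b = 4)) := by
  obtain ⟨c, rfl⟩ := Nat.exists_eq_add_of_le hb
  obtain ⟨j, hj⟩ := Nat.exists_eq_add_of_le ha
  -- `b + c = a + 1 + j`
  have key : (a + 2 : ℤ) * (j - 1) + b * c + (b + c) * (σ - 2) = 0 := by
    have h' : ((b + c) * (a + b + σ) : ℤ) = (a + 2) ^ 2 + b ^ 2 := by exact_mod_cast h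
    have hj' : (b + c : ℤ) = a + 1 + j := by exact_mod_cast hj
    have : (j : ℤ) = b + c - a - 1 := by linarith
    rw [this]; linear_combination h'
  clear h
  have small : ∀ {x y n : ℕ}, x * y = n → 0 < n → x ≤ n ∧ y ≤ n := fun hxy hn =>
    ⟨Nat.le_of_dvd hn ⟨_, hxy.symm⟩, Nat.le_of_dvd hn ⟨_, (mul_comm _ _).trans hxy |>.symm⟩⟩
  have hjc : j = 0 ∨ j = 1 ∨ 2 ≤ j := by omega
  have hσc : σ = 1 ∨ σ = 2 ∨ 3 ≤ σ := by omega
  rcases hjc with rfl | rfl | hj2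
  · -- `a + 1 = p`
    rcases hσc with rfl | rfl | h3
    · -- `b c = 2 p + 1`
      have e : (b : ℤ) * c = 2 * (b + c) + 1 := by
        have hj' : (b + c : ℤ) = a + 1 := by exact_mod_cast hj
        push_cast at key; linear_combination key - hj'
      clear key
      have h2 : 2 < b ∧ 2 < c := by
        constructor <;> by_contra hn <;> push Not at hn
        · interval_cases b <;> push_cast at e <;> omega
        · interval_cases c <;> push_cast at e <;> omega
      obtain ⟨x, rfl⟩ := Nat.exists_eq_add_of_lt h2.1
      obtain ⟨y, rfl⟩ := Nat.exists_eq_add_of_lt h2.2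
      have e2 : (x + 1) * (y + 1) = 5 := by
        have : ((x : ℤ) + 1) * (y + 1) = 5 := by push_cast at e; linear_combination e
        exact_mod_cast this
      obtain ⟨b1, b2⟩ := small e2 (by norm_num)
      have hx : x ≤ 4 := by omega
      right; right; right; right; left
      interval_cases x <;> omega
    · have e : (b : ℤ) * c = b + c + 1 := by
        have hj' : (b + c : ℤ) = a + 1 := by exact_mod_cast hj
        push_cast at key; linear_combination key - hj'
      clear key
      have h2 : 1 < b ∧ 1 < c := by
        constructor <;> by_contra hn <;> push Not at hn
        · interval_cases b <;> push_cast at e <;> omega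
        · interval_cases c <;> push_cast at e <;> omega
      obtain ⟨x, rfl⟩ := Nat.exists_eq_add_of_lt h2.1
      obtain ⟨y, rfl⟩ := Nat.exists_eq_add_of_lt h2.2
      have e2 : (x + 1) * (y + 1) = 2 := by
        have : ((x : ℤ) + 1) * (y + 1) = 2 := by push_cast at e; linear_combination e
        exact_mod_cast this
      obtain ⟨b1, b2⟩ := small e2 (by norm_num)
      have hx : x ≤ 1 := by omega
      right; right; right; left
      interval_cases x <;> omega
    · obtain ⟨τ, rfl⟩ := Nat.exists_eq_add_of_le h3
      have e : b * c + (b + c) * τ = 1 := by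
        have hj' : (b + c : ℤ) = a + 1 := by exact_mod_cast hj
        have : (b : ℤ) * c + (b + c) * τ = 1 := by push_cast at key; linear_combination key - hj'
        exact_mod_cast this
      have hτ : τ = 0 ∨ τ = 1 ∨ 2 ≤ τ := by omega
      rcases hτ with rfl | rfl | hτ
      · have e' : b * c = 1 := by omega
        obtain rfl := Nat.eq_one_of_mul_eq_one_right e'
        obtain rfl := Nat.eq_one_of_mul_eq_one_left e'
        right; left; omega
      · have : b * c = 0 := by
          by_contra hn
          have := Nat.pos_of_ne_zero hn
          omega
        rw [this] at e
        left; omega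
      · have : (b + c) * 2 ≤ (b + c) * τ := Nat.mul_le_mul_left _ hτ
        exfalso; omega
  · rcases hσc with rfl | rfl | h3
    · have e : (b : ℤ) * c = b + c := by push_cast at key; linear_combination key
      by_cases hb0 : b = 0
      · subst hb0; push_cast at e; exfalso; omega
      by_cases hc0 : c = 0
      · subst hc0; push_cast at e; exfalso; omega
      obtain ⟨x, rfl⟩ := Nat.exists_eq_succ_of_ne_zero hb0
      obtain ⟨y, rfl⟩ := Nat.exists_eq_succ_of_ne_zero hc0
      have e2 : x * y = 1 := by
        have : (x : ℤ) * y = 1 := by push_cast at e; linear_combination e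
        exact_mod_cast this
      obtain rfl := Nat.eq_one_of_mul_eq_one_right e2
      obtain rfl := Nat.eq_one_of_mul_eq_one_left e2
      right; right; right; right; right; left; omega
    · have e : b * c = 0 := by
        have : (b : ℤ) * c = 0 := by push_cast at key; linear_combination key
        exact_mod_cast this
      right; right; left
      rcases mul_eq_zero.1 e with h0 | h0 <;> omega
    · exfalso
      obtain ⟨τ, rfl⟩ := Nat.exists_eq_add_of_le h3
      have h1 : (0 : ℤ) ≤ b * c := by positivity
      have h2 : (0 : ℤ) ≤ (b + c) * τ := by positivity
      have h4 : (0 : ℤ) < b + c := by omega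
      push_cast at key
      linarith
  · obtain ⟨i, rfl⟩ := Nat.exists_eq_add_of_le hj2
    have hj' : (b + c : ℤ) = a + 1 + (2 + i) := by exact_mod_cast hj
    rw [hj'] at key
    push_cast at key
    have h1 : (0 : ℤ) ≤ b * c := by positivity
    have h3 : (0 : ℤ) ≤ (a + 2) * i := by positivity
    rcases hσc with rfl | hσc
    · have e : ((a : ℤ) + 1) * i + b * c = 1 := by push_cast at key; linear_combination key
      have hi : i ≤ 1 := by
        by_contra hn
        have : (2 : ℤ) ≤ i := by omega
        nlinarith
      interval_cases i
      · have e2 : b * c = 1 := by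
          have : (b : ℤ) * c = 1 := by push_cast at e; linarith
          exact_mod_cast this
        obtain rfl := Nat.eq_one_of_mul_eq_one_right e2
        obtain rfl := Nat.eq_one_of_mul_eq_one_left e2
        exfalso; omega
      · have ha0 : a = 0 := by push_cast at e; omega
        subst ha0
        have e2 : b * c = 0 := by
          have : (b : ℤ) * c = 0 := by push_cast at e; linarith
          exact_mod_cast this
        right; right; right; right; right; right
        rcases mul_eq_zero.1 e2 with h0 | h0 <;> omega
    · exfalso
      have : (0 : ℤ) ≤ (a + 1 + (2 + i)) * (σ - 2) := mul_nonneg (by omega) (by omega)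
      linarith

/-- The case of distinct degrees, seen from the vertex of larger degree. -/
lemma orth_arith_lt {p q σ a b : ℕ} (hp : 1 ≤ p) (hpq : p < q) (hb : b + 1 ≤ q) (ha : a ≤ p)
    (hσ : 1 ≤ σ) (h : p * q * (a + b + σ) = q * a ^ 2 + p * (b + 2) ^ 2) :
    (σ = 2 ∧ b + 2 = q ∧ (a = 0 ∨ a = p)) ∨ (σ = 1 ∧ q = 4 ∧ b = 0 ∧ (a = 0 ∨ a = p)) ∨
      (σ = 1 ∧ p = 4 ∧ a = 2 ∧ b + 2 = q) := by
  obtain ⟨c, rfl⟩ := Nat.exists_eq_add_of_le ha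
  obtain ⟨j, rfl⟩ := Nat.exists_eq_add_of_le hb
  -- Here p = a + c and q = b + 1 + j. Thus q divides p(j - 1)², which rules out j = 0 and j = 2
  -- because p < q.
  have key : (b + 1 + j : ℤ) * (a * c) = (a + c) * ((b + 1 + j) * (3 - j - σ) + (j - 1) ^ 2) := by
    have h' : ((a + c) * (b + 1 + j) * (a + b + σ) : ℤ) =
        (b + 1 + j) * a ^ 2 + (a + c) * (b + 2) ^ 2 := by exact_mod_cast h
    linear_combination h'
  have hac : (0 : ℤ) ≤ a * c := by positivity
  have hpos : (0 : ℤ) < a + c := by omega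
  have hq : (0 : ℤ) < b + 1 + j := by omega
  have nn : 0 ≤ ((b + 1 + j : ℤ) * (3 - j - σ) + (j - 1) ^ 2) := by
    by_contra hn
    have := mul_neg_of_pos_of_neg hpos (not_le.1 hn)
    have := mul_nonneg hq.le hac
    linarith
  -- the remainder modulo `q` vanishes
  have dvd : (b + 1 + j : ℤ) ∣ (a + c) * (j - 1) ^ 2 :=
    ⟨a * c - (a + c) * (3 - j - σ), by linear_combination -key⟩
  have hjc : j = 0 ∨ j = 1 ∨ j = 2 ∨ 3 ≤ j := by omega
  rcases hjc with rfl | rfl | rfl | hj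
  · exfalso
    have h0 : (b + 1 : ℤ) ∣ a + c := by simpa using dvd
    have := Int.le_of_dvd hpos h0
    omega
  · have e : (a : ℤ) * c = (a + c) * (2 - σ) := by
      have : (b + 1 + 1 : ℤ) * (a * c - (a + c) * (2 - σ)) = 0 := by
        push_cast at key; linear_combination key
      rcases mul_eq_zero.1 this with h0 | h0
      · omega
      · linarith
    have hσ2 : σ ≤ 2 := by
      by_contra hn
      have : (a + c : ℤ) * (2 - σ) < 0 := mul_neg_of_pos_of_neg hpos (by omega)
      linarith
    interval_cases σ
    · right; right
      by_cases ha0 : a = 0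
      · subst ha0; push_cast at e; omega
      by_cases hc0 : c = 0
      · subst hc0; push_cast at e; omega
      obtain ⟨x, rfl⟩ := Nat.exists_eq_succ_of_ne_zero ha0
      obtain ⟨y, rfl⟩ := Nat.exists_eq_succ_of_ne_zero hc0
      have e2 : x * y = 1 := by
        have : (x : ℤ) * y = 1 := by push_cast at e; linear_combination e
        exact_mod_cast this
      obtain rfl := Nat.eq_one_of_mul_eq_one_right e2
      obtain rfl := Nat.eq_one_of_mul_eq_one_left e2
      omega
    · have : a * c = 0 := by
        have : (a : ℤ) * c = 0 := by push_cast at e; linarith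
        exact_mod_cast this
      rcases mul_eq_zero.1 this with h0 | h0 <;> omega
  · exfalso
    have := Int.le_of_dvd (by push_cast; linarith) dvd
    push_cast at this
    omega
  · obtain ⟨i, rfl⟩ := Nat.exists_eq_add_of_le hj
    push_cast at nn
    have hσ1 : σ = 1 := by
      by_contra hn
      obtain ⟨τ, rfl⟩ := Nat.exists_eq_add_of_le (show 2 ≤ σ by omega)
      have : (0 : ℤ) ≤ b * i := by positivity
      have : (0 : ℤ) ≤ i * i := by positivity
      have : (0 : ℤ) ≤ (b + 1 + (3 + i)) * τ := by positivity
      push_cast at nn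
      nlinarith
    subst hσ1
    have hb0 : b = 0 := by
      by_contra hn
      have : (1 : ℤ) ≤ b := by omega
      have : (0 : ℤ) ≤ b * i := by positivity
      push_cast at nn
      nlinarith
    subst hb0
    have hi0 : i = 0 := by
      push_cast at nn
      by_contra hn
      have : (1 : ℤ) ≤ i := by omega
      nlinarith
    subst hi0
    have : a * c = 0 := by
      have : (a : ℤ) * c = 0 := by push_cast at key; linarith
      exact_mod_cast this
    rcases mul_eq_zero.1 this with h0 | h0 <;> omega

namespace PD

variable {V : Type*} [Fintype V] {G : SimpleGraph V} {r s : ℝ} {P : PD G r s}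

/-- The vertices adjacent to all neighbours of `u`, and not adjacent to `u` or `v`. -/
noncomputable def Out (G : SimpleGraph V) (u v : V) : Finset V :=
  univ.filter fun w => ¬ G.Adj u w ∧ ¬ G.Adj v w ∧ nb G u ⊆ nb G w

lemma mem_Out {u v w : V} : w ∈ Out G u v ↔ ¬ G.Adj u w ∧ ¬ G.Adj v w ∧ nb G u ⊆ nb G w := by
  simp [Out]

section orth
variable {u v : V} (h : P.dot u v = 0)
include h

lemma orth_nadj : ¬ G.Adj u v := fun h0 => by
  rw [P.dot_adj h0] at h
  have : (0 : ℝ) ≤ cn G u v := by positivity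
  linarith

lemma orth_disj : Disjoint (nb G u) (nb G v) := by
  have := orth_nadj h
  rw [P.dot_nadj this] at h
  rw [disjoint_iff_inter_eq_empty, ← card_eq_zero]
  exact_mod_cast h

lemma orth_ndisj {w : V} (h1 : G.Adj u w) (h2 : G.Adj v w) : False :=
  disjoint_left.1 (orth_disj h) (mem_nb.2 h1) (mem_nb.2 h2)

/-- Parseval's identity in the orthogonal basis given by the vectors of u and v, cleared of
denominators. -/
lemma orth_expand (w z : V) : P.dot u u * P.dot v v * P.dot w z =
    P.dot v v * (P.dot w u * P.dot z u) + P.dot u u * (P.dot w v * P.dot z v) := by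
  unfold dot at *
  have h1 : (P.a u * P.b v - P.b u * P.a v) ^ 2 * (P.a w * P.a z + P.b w * P.b z) =
    P.dot v v * (P.dot w u * P.dot z u) + P.dot u u * (P.dot w v * P.dot z v) -
     (P.a u * P.a v + P.b u * P.b v) * (P.dot w u * P.dot z v + P.dot w v * P.dot z u) := by
    unfold dot; ring
  rw [h] at h1
  unfold dot at h1
  linear_combination h1 + (P.a u * P.a v + P.b u * P.b v) * (P.a w * P.a z + P.b w * P.b z) * h

/-- By `orth_expand`, deg w = cn(w, u)²/deg u + cn(w, v)²/deg v. Each cn is at most the degree below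
it, and the two add up to at most deg w, so all estimates are sharp: each common neighbourhood is
empty or full, and w has no other neighbours. -/
lemma orth_out {w : V} (h1 : ¬ G.Adj u w) (h2 : ¬ G.Adj v w) :
    (nb G u ⊆ nb G w ∨ Disjoint (nb G u) (nb G w)) ∧ nb G w ⊆ nb G u ∪ nb G v := by
  have e := orth_expand h w w
  have d1 : P.dot w u = cn G w u := P.dot_nadj fun h0 => h1 h0.symm
  have d2 : P.dot w v = cn G w v := P.dot_nadj fun h0 => h2 h0.symm
  rw [d1, d2, P.dot_self, P.dot_self, P.dot_self] at e
  have hle : cn G w u + cn G w v ≤ (nb G w).card := by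
    unfold cn
    rw [← card_union_of_disjoint]
    · exact card_le_card (union_subset inter_subset_left inter_subset_left)
    · exact disjoint_of_subset_left inter_subset_right
        (disjoint_of_subset_right inter_subset_right (orth_disj h))
  have hu : cn G w u ≤ (nb G u).card := card_le_card inter_subset_right
  have hv : cn G w v ≤ (nb G v).card := card_le_card inter_subset_right
  have pu := P.deg_pos u
  have pv := P.deg_pos v
  have e' : (nb G u).card * (nb G v).card * (nb G w).card =
      (nb G v).card * (cn G w u * cn G w u) + (nb G u).card * (cn G w v * cn G w v) := by
    exact_mod_cast e
  clear e d1 d2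
  obtain ⟨x, hx⟩ := Nat.exists_eq_add_of_le hle
  obtain ⟨y, hy⟩ := Nat.exists_eq_add_of_le hu
  obtain ⟨z, hz⟩ := Nat.exists_eq_add_of_le hv
  have e2 : (nb G u).card * (nb G v).card * x + (nb G v).card * (cn G w u * y) +
      (nb G u).card * (cn G w v * z) = 0 := by
    zify at *
    rw [hx] at e'
    linear_combination e' - ((nb G v).card * cn G w u : ℤ) * hy - ((nb G u).card * cn G w v : ℤ) * hz
  have x0 : x = 0 := by
    have : (nb G u).card * (nb G v).card * x = 0 := by omega
    rcases mul_eq_zero.1 this with h0 | h0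
    · rcases mul_eq_zero.1 h0 with h0 | h0 <;> omega
    · exact h0
  have y0 : cn G w u = 0 ∨ y = 0 := by
    have : (nb G v).card * (cn G w u * y) = 0 := by omega
    rcases mul_eq_zero.1 this with h0 | h0
    · omega
    · exact mul_eq_zero.1 h0
  constructor
  · rcases y0 with h0 | h0
    · right
      rw [disjoint_iff_inter_eq_empty, ← card_eq_zero, inter_comm]; exact h0
    · left
      have : nb G w ∩ nb G u = nb G u := eq_of_subset_of_card_le inter_subset_right (by
        unfold cn at hy; omega)
      rw [← this]; exact inter_subset_left
  · have : (nb G w ∩ nb G u) ∪ (nb G w ∩ nb G v) = nb G w := by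
      apply eq_of_subset_of_card_le (union_subset inter_subset_left inter_subset_left)
      rw [card_union_of_disjoint]
      · unfold cn at hx; omega
      · exact disjoint_of_subset_left inter_subset_right
          (disjoint_of_subset_right inter_subset_right (orth_disj h))
    rw [← inter_union_distrib_left] at this
    rw [← this]; exact inter_subset_right

/-- Outside N(u) ∪ N(v), all vertices i of N(u) have the same neighbours. -/
lemma orth_out_iff {i w : V} (hi : G.Adj u i) (h1 : ¬ G.Adj u w) (h2 : ¬ G.Adj v w) :
    G.Adj i w ↔ w ∈ Out G u v := by
  rw [mem_Out]
  constructor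
  · intro h0
    refine ⟨h1, h2, (orth_out h h1 h2).1.resolve_right fun hd => ?_⟩
    exact disjoint_left.1 hd (mem_nb.2 hi) (mem_nb.2 h0.symm)
  · rintro ⟨-, -, h0⟩
    exact (mem_nb.1 (h0 (mem_nb.2 hi))).symm

omit h in
lemma self_mem_Out (h : P.dot u v = 0) : u ∈ Out G u v :=
  mem_Out.2 ⟨G.loopless.irrefl u, fun h0 => orth_nadj h h0.symm, Subset.rfl⟩

omit h in
lemma orth_symm (h : P.dot u v = 0) : P.dot v u = 0 := by rw [P.dot_comm]; exact h

-- The vertex u belongs to `Out G u v` but not to `Out G v u`, which makes the inclusion of the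
-- intersection strict.
omit h in
lemma inter_lt (h : P.dot u v = 0) : (Out G u v ∩ Out G v u).card + 1 ≤ (Out G u v).card := by
  apply card_lt_card
  refine ⟨inter_subset_left, fun h0 => ?_⟩
  have h1 := (mem_inter.1 (h0 (self_mem_Out h))).2
  obtain ⟨w, hw⟩ := P.noiso v
  exact orth_ndisj h (mem_nb.1 ((mem_Out.1 h1).2.2 (mem_nb.2 hw))) hw

lemma orth_filter (S : Finset V) : S = (S ∩ nb G u) ∪ (S ∩ nb G v) ∪
    (S.filter fun w => ¬ G.Adj u w ∧ ¬ G.Adj v w) ∧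
    S.card = (S ∩ nb G u).card + (S ∩ nb G v).card +
      (S.filter fun w => ¬ G.Adj u w ∧ ¬ G.Adj v w).card := by
  have e : S = (S ∩ nb G u) ∪ (S ∩ nb G v) ∪ (S.filter fun w => ¬ G.Adj u w ∧ ¬ G.Adj v w) := by
    ext w; simp only [mem_union, mem_inter, mem_nb, mem_filter]; tauto
  refine ⟨e, ?_⟩
  conv_lhs => rw [e]
  rw [card_union_of_disjoint, card_union_of_disjoint]
  · exact disjoint_of_subset_left inter_subset_right
      (disjoint_of_subset_right inter_subset_right (orth_disj h))
  · rw [disjoint_left]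
    intro w hw hw'
    simp only [mem_union, mem_inter, mem_nb, mem_filter] at hw hw'
    tauto

lemma orth_deg {i : V} (hi : G.Adj u i) :
    (nb G i).card = cn G i u + cn G i v + (Out G u v).card := by
  rw [(orth_filter h (nb G i)).2]
  unfold cn
  congr 2
  ext w
  simp only [mem_filter, mem_nb]
  constructor
  · rintro ⟨h0, h1, h2⟩; exact (orth_out_iff h hi h1 h2).1 h0
  · intro h0
    have := mem_Out.1 h0
    exact ⟨(orth_out_iff h hi this.1 this.2.1).2 h0, this.1, this.2.1⟩

lemma orth_cn_same {i k : V} (hi : G.Adj u i) (hk : G.Adj u k) :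
    cn G i k = (nb G i ∩ nb G k ∩ nb G u).card + (nb G i ∩ nb G k ∩ nb G v).card +
      (Out G u v).card := by
  unfold cn
  rw [(orth_filter h (nb G i ∩ nb G k)).2]
  congr 2
  ext w
  simp only [mem_filter, mem_nb, mem_inter]
  constructor
  · rintro ⟨h0, h1, h2⟩; exact (orth_out_iff h hi h1 h2).1 h0.1
  · intro h0
    have := mem_Out.1 h0
    exact ⟨⟨(orth_out_iff h hi this.1 this.2.1).2 h0, (orth_out_iff h hk this.1 this.2.1).2 h0⟩,
      this.1, this.2.1⟩

lemma orth_cn_diff {i j : V} (hi : G.Adj u i) (hj : G.Adj v j) :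
    cn G i j = (nb G i ∩ nb G j ∩ nb G u).card + (nb G i ∩ nb G j ∩ nb G v).card +
      (Out G u v ∩ Out G v u).card := by
  unfold cn
  rw [(orth_filter h (nb G i ∩ nb G j)).2]
  congr 2
  ext w
  simp only [mem_filter, mem_nb, mem_inter]
  constructor
  · rintro ⟨h0, h1, h2⟩
    exact ⟨(orth_out_iff h hi h1 h2).1 h0.1, (orth_out_iff (orth_symm h) hj h2 h1).1 h0.2⟩
  · rintro ⟨h0, h0'⟩
    have := mem_Out.1 h0
    exact ⟨⟨(orth_out_iff h hi this.1 this.2.1).2 h0,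
      (orth_out_iff (orth_symm h) hj this.2.1 this.1).2 h0'⟩, this.1, this.2.1⟩

lemma orth_dot_left {i : V} (hi : G.Adj u i) : P.dot i u = cn G i u + 2 ∧ P.dot i v = cn G i v :=
  ⟨P.dot_adj hi.symm, P.dot_nadj fun h0 => orth_ndisj h hi h0.symm⟩

/-- `orth_expand` of i with itself. This is the equation behind `orth_arith` and `orth_arith_lt`. -/
lemma orth_eq {i : V} (hi : G.Adj u i) :
    (nb G u).card * (nb G v).card * (cn G i u + cn G i v + (Out G u v).card) =
      (nb G v).card * (cn G i u + 2) ^ 2 + (nb G u).card * cn G i v ^ 2 := by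
  have e := orth_expand h i i
  rw [P.dot_self, P.dot_self, P.dot_self, (orth_dot_left h hi).1, (orth_dot_left h hi).2,
    orth_deg h hi, ← sq, ← sq] at e
  exact_mod_cast e

lemma orth_pair_diff {i j : V} (hi : G.Adj u i) (hj : G.Adj v j) :
    (nb G u).card * (nb G v).card * (cn G i j + if G.Adj i j then 2 else 0) =
      (nb G v).card * ((cn G i u + 2) * cn G j u) +
        (nb G u).card * (cn G i v * (cn G j v + 2)) := by
  have e := orth_expand h i j
  rw [P.dot_self, P.dot_self, (orth_dot_left h hi).1, (orth_dot_left h hi).2,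
    (orth_dot_left (orth_symm h) hj).1, (orth_dot_left (orth_symm h) hj).2] at e
  have : P.dot i j = ((cn G i j + if G.Adj i j then 2 else 0 : ℕ) : ℝ) := by
    unfold dot; rw [P.gram]; push_cast; rfl
  rw [this] at e
  exact_mod_cast e

lemma orth_pair_same {i k : V} (hi : G.Adj u i) (hk : G.Adj u k) :
    (nb G u).card * (nb G v).card * (cn G i k + if G.Adj i k then 2 else 0) =
      (nb G v).card * ((cn G i u + 2) * (cn G k u + 2)) +
        (nb G u).card * (cn G i v * cn G k v) := by
  have e := orth_expand h i k
  rw [P.dot_self, P.dot_self, (orth_dot_left h hi).1, (orth_dot_left h hi).2,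
    (orth_dot_left h hk).1, (orth_dot_left h hk).2] at e
  have : P.dot i k = ((cn G i k + if G.Adj i k then 2 else 0 : ℕ) : ℝ) := by
    unfold dot; rw [P.gram]; push_cast; rfl
  rw [this] at e
  exact_mod_cast e

omit h in
lemma cn_lt {u i : V} (hi : G.Adj u i) : cn G i u + 1 ≤ (nb G u).card := by
  have : nb G i ∩ nb G u ⊆ (nb G u).erase i := by
    intro w hw
    simp only [mem_inter, mem_nb, mem_erase] at hw ⊢
    exact ⟨fun h0 => by subst h0; exact G.loopless.irrefl _ hw.1, hw.2⟩
  have := card_le_card this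
  rw [card_erase_of_mem (mem_nb.2 hi)] at this
  have h0 : 0 < (nb G u).card := card_pos.2 ⟨i, mem_nb.2 hi⟩
  unfold cn
  omega

omit h in
lemma cn_le (i v : V) : cn G i v ≤ (nb G v).card := card_le_card inter_subset_right

omit h in
/-- Double counting of the edges between two vertex sets. -/
lemma sum_cn (u v : V) : ∑ i ∈ nb G u, cn G i v = ∑ j ∈ nb G v, cn G j u := by
  have e : ∀ i j : V, cn G i j = ∑ w ∈ nb G j, if G.Adj i w then 1 else 0 := by
    intro i j
    rw [sum_boole, cn]; congr 1; ext w; simp [and_comm]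
  rw [sum_congr rfl fun i _ => e i v, sum_congr rfl fun j _ => e j u, sum_comm]
  simp_rw [G.adj_comm]

end orth
end PD
end TwoEig
end

/-! ### An orthogonal pair of equal degrees with an edge between the neighbourhoods. -/

section
open scoped Classical
namespace TwoEig
open Finset

lemma nb_inter_lt {V : Type*} [Fintype V] {G : SimpleGraph V} {i j u : V} (hi : G.Adj u i)
    (hij : G.Adj i j) : (nb G i ∩ nb G j ∩ nb G u).card + 1 ≤ cn G j u := by
  apply card_lt_card
  refine ⟨fun w => by simp only [mem_inter]; tauto, fun h0 => ?_⟩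
  have := h0 (mem_inter.2 ⟨mem_nb.2 hij.symm, mem_nb.2 hi⟩)
  simp at this

lemma subset_of_cn {V : Type*} [Fintype V] {G : SimpleGraph V} {i v : V}
    (h : cn G i v = (nb G v).card) : nb G v ⊆ nb G i := by
  have : nb G i ∩ nb G v = nb G v := eq_of_subset_of_card_le inter_subset_right h.ge
  rw [← this]; exact inter_subset_left

/-- The handshake lemma inside N(u): the sum counts ordered pairs of adjacent vertices of N(u). -/
lemma even_sum_cn {V : Type*} [Fintype V] (G : SimpleGraph V) (u : V) :
    Even (∑ i ∈ nb G u, cn G i u) := by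
  have e : ∀ i j : V, cn G i j = ∑ w ∈ nb G j, if G.Adj i w then 1 else 0 := by
    intro i j
    rw [sum_boole, cn]; simp only [Nat.cast_id]; congr 1; ext w; simp [and_comm]
  have h2 : ((∑ i ∈ nb G u, cn G i u : ℕ) : ZMod 2) = 0 := by
    rw [sum_congr rfl fun i _ => e i u, ← sum_product' (nb G u) (nb G u)]
    push_cast
    apply sum_involution (fun x _ => (x.2, x.1))
    · rintro ⟨x, y⟩ -
      simp only [G.adj_comm y x]
      exact CharTwo.add_self_eq_zero _
    · rintro ⟨x, y⟩ - h0 h1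
      simp only [Prod.mk.injEq] at h1
      rw [h1.1] at h0
      simp at h0
    · rintro ⟨x, y⟩ h0
      simp only [mem_product] at h0 ⊢
      exact h0.symm
    · rintro ⟨x, y⟩ -; rfl
  rwa [ZMod.natCast_eq_zero_iff_even] at h2

/-- Intersects the possibilities seen from the two ends of an edge ij between N(u) and N(v): a, b
count neighbours of i in N(u), N(v), and c, d those of j. The numbers σ, τ are the sizes of the two
`Out` sets, and γ that of their intersection. -/
lemma orth_combine {p σ τ γ a b c d : ℕ} (g1 : γ + 1 ≤ σ) (g2 : γ + 1 ≤ τ)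
    (s1 : (p = 1 ∧ σ = 4 ∧ a = 0 ∧ b = 1) ∨ (p = 2 ∧ σ = 3 ∧ a = 1 ∧ b = 1) ∨
      (σ = 2 ∧ a + 2 = p ∧ b = p ∧ 1 ≤ γ) ∨ (p = 5 ∧ σ = 2) ∨ (p = 10 ∧ σ = 1) ∨ (p = 4 ∧ σ = 1))
    (s2 : (p = 1 ∧ τ = 4 ∧ d = 0 ∧ c = 1) ∨ (p = 2 ∧ τ = 3 ∧ d = 1 ∧ c = 1) ∨
      (τ = 2 ∧ d + 2 = p ∧ c = p ∧ 1 ≤ γ) ∨ (p = 5 ∧ τ = 2) ∨ (p = 10 ∧ τ = 1) ∨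
      (p = 4 ∧ τ = 1)) :
    (p = 1 ∧ σ = 4 ∧ τ = 4 ∧ a = 0 ∧ b = 1 ∧ c = 1 ∧ d = 0) ∨
      (p = 2 ∧ σ = 3 ∧ τ = 3 ∧ a = 1 ∧ b = 1 ∧ c = 1 ∧ d = 1) ∨ (p = 2 ∧ b = 2 ∧ τ = 3) ∨
      (p = 2 ∧ c = 2 ∧ σ = 3) ∨ (σ = 2 ∧ a + 2 = p ∧ b = p ∧ c = p) ∨ (p = 5 ∧ σ = 2 ∧ τ = 2) ∨
      (p = 10 ∧ σ = 1 ∧ τ = 1) ∨ (p = 4 ∧ σ = 1 ∧ τ = 1) := by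
  rcases s1 with s1 | s1 | s1 | s1 | s1 | s1 <;> rcases s2 with s2 | s2 | s2 | s2 | s2 | s2 <;>
    first
    | (exfalso; omega)
    | (left; omega)
    | (right; left; omega)
    | (right; right; left; omega)
    | (right; right; right; left; omega)
    | (right; right; right; right; left; omega)
    | (right; right; right; right; right; left; omega)
    | (right; right; right; right; right; right; left; omega)
    | (right; right; right; right; right; right; right; omega)

namespace PD

variable {V : Type*} [Fintype V] {G : SimpleGraph V} {r s : ℝ} {P : PD G r s}

section orth
variable {u v : V} (h : P.dot u v = 0)
include h

lemma out_pos : 1 ≤ (Out G u v).card := card_pos.2 ⟨u, self_mem_Out h⟩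

section eqdeg
variable (hpq : (nb G u).card = (nb G v).card)
include hpq

lemma orth_opt {i : V} (hi : G.Adj u i) :
    let p := (nb G u).card; let σ := (Out G u v).card; let a := cn G i u; let b := cn G i v
    (p = 1 ∧ σ = 4 ∧ a = 0) ∨ (p = 2 ∧ σ = 3 ∧ a = 1 ∧ b = 1) ∨
      (σ = 2 ∧ a + 2 = p ∧ (b = 0 ∨ b = p)) ∨ (p = 5 ∧ σ = 2 ∧ a = 4 ∧ (b = 2 ∨ b = 3)) ∨
      (p = 10 ∧ σ = 1 ∧ a = 9 ∧ (b = 3 ∨ b = 7)) ∨ (p = 4 ∧ σ = 1 ∧ a = 2 ∧ b = 2) ∨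
      (p = 4 ∧ σ = 1 ∧ a = 0 ∧ (b = 0 ∨ b = 4)) := by
  apply orth_arith (cn_lt hi) (hpq ▸ cn_le i v) (out_pos h)
  have e := orth_eq h hi
  rw [← hpq] at e
  have := P.deg_pos u
  apply Nat.eq_of_mul_eq_mul_left this
  linarith

lemma orth_pair {i j : V} (hi : G.Adj u i) (hj : G.Adj v j) :
    (nb G u).card * (cn G i j + if G.Adj i j then 2 else 0) =
      (cn G i u + 2) * cn G j u + cn G i v * (cn G j v + 2) := by
  have e := orth_pair_diff h hi hj
  rw [← hpq] at e
  have := P.deg_pos u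
  apply Nat.eq_of_mul_eq_mul_left this
  linarith

lemma orth_pair' {i j : V} (hi : G.Adj u i) (hj : G.Adj u j) :
    (nb G u).card * (cn G i j + if G.Adj i j then 2 else 0) =
      (cn G i u + 2) * (cn G j u + 2) + cn G i v * cn G j v := by
  have e := orth_pair_same h hi hj
  rw [← hpq] at e
  have := P.deg_pos u
  apply Nat.eq_of_mul_eq_mul_left this
  linarith

/-- A vertex of `N(u)` adjacent to all of `N(v)`. -/
lemma orth_full {i j : V} (hi : G.Adj u i) (hj : G.Adj v j) (hij : G.Adj i j)
    (ha : cn G i u + 2 = (nb G u).card) (hb : cn G i v = (nb G u).card) :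
    (nb G i ∩ nb G j ∩ nb G u).card + (Out G u v ∩ Out G v u).card = cn G j u ∧
      1 ≤ (Out G u v ∩ Out G v u).card := by
  have e := orth_pair h hpq hi hj
  rw [if_pos hij, ha, hb, orth_cn_diff h hi hj] at e
  have s := subset_of_cn (hb.trans hpq)
  have e1 : (nb G i ∩ nb G j ∩ nb G v).card = cn G j v := by
    unfold cn; congr 1; ext w; simp only [mem_inter]
    have := @s w; tauto
  rw [e1, ← mul_add] at e
  have e2 := Nat.eq_of_mul_eq_mul_left (P.deg_pos u) e
  have := nb_inter_lt hi hij
  omega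

/-- When i sees all of N(v) and j all of N(u), the intersection has two elements; for an `Out` set
of size 2 this contradicts `inter_lt`. -/
lemma orth_full_full {i j : V} (hi : G.Adj u i) (hj : G.Adj v j) (hij : G.Adj i j)
    (ha : cn G i u + 2 = (nb G u).card) (hb : cn G i v = (nb G u).card)
    (ha' : cn G j u = (nb G u).card) : (Out G u v ∩ Out G v u).card = 2 := by
  have e := (orth_full h hpq hi hj hij ha hb).1
  have s := subset_of_cn ha'
  have e1 : (nb G i ∩ nb G j ∩ nb G u).card = cn G i u := by
    unfold cn; congr 1; ext w; simp only [mem_inter]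
    have := @s w; tauto
  omega

/-- Both neighbours of v are adjacent to i and to no other vertex of N(u), so they have equal closed
neighbourhoods. -/
lemma orth_two {i j : V} (hi : G.Adj u i) (hj : G.Adj v j) (hij : G.Adj i j)
    (hp : (nb G u).card = 2) (hb : cn G i v = 2) (hσ : (Out G v u).card = 3) : False := by
  have opt : ∀ k, G.Adj v k → cn G k v = 1 ∧ cn G k u = 1 := fun k hk => by
    have := orth_opt (orth_symm h) hpq.symm hk
    simp only at this
    omega
  have s := subset_of_cn (hb.trans (hp.symm.trans hpq))
  have nu : ∀ k, G.Adj v k → ∀ w, G.Adj u w → (G.Adj k w ↔ w = i) := fun k hk w hw => by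
    have e := (opt k hk).2
    rw [cn, card_eq_one] at e
    obtain ⟨x, hx⟩ := e
    have h1 : i ∈ nb G k ∩ nb G u := mem_inter.2
      ⟨mem_nb.2 (mem_nb.1 (s (mem_nb.2 hk))).symm, mem_nb.2 hi⟩
    have h2 : w ∈ nb G k ∩ nb G u ↔ w = x := by rw [hx, mem_singleton]
    rw [hx, mem_singleton] at h1
    simp only [mem_inter, mem_nb, hw, and_true] at h2
    rw [h2, h1]
  obtain ⟨k, hk⟩ : (nb G j ∩ nb G v).Nonempty := card_pos.1 (by
    have := (opt j hj).1; unfold cn at this; omega)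
  simp only [mem_inter, mem_nb] at hk
  have vv : ∀ w, G.Adj v w → w = j ∨ w = k := by
    intro w hw
    by_contra hn
    push Not at hn
    have : ({j, k, w} : Finset V) ⊆ nb G v := by
      intro x; simp only [mem_insert, mem_singleton, mem_nb]; rintro (rfl | rfl | rfl) <;> tauto
    have := card_le_card this
    rw [card_eq_three.2 ⟨j, k, w, hk.1.ne, hn.1.symm, hn.2.symm, rfl⟩] at this
    omega
  have key : ∀ x y, G.Adj v x → G.Adj v y → (∀ w, G.Adj v w → w = x ∨ w = y) →
      nb G x \ {y} ⊆ nb G y \ {x} := by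
    intro x y hx hy hxy w hw
    simp only [mem_sdiff, mem_nb, mem_singleton] at hw ⊢
    have hwx : w ≠ x := fun h0 => by subst h0; exact G.loopless.irrefl _ hw.1
    refine ⟨?_, hwx⟩
    by_cases h1 : G.Adj v w
    · exact absurd (hxy w h1) (by tauto)
    by_cases h2 : G.Adj u w
    · exact (nu y hy w h2).2 ((nu x hx w h2).1 hw.1)
    · exact (orth_out_iff (orth_symm h) hy h1 h2).2 ((orth_out_iff (orth_symm h) hx h1 h2).1 hw.1)
  exact P.not_closed_twins hk.1 (key j k hj hk.2 vv)
    (key k j hk.2 hj fun w hw => (vv w hw).symm)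

/-- For all i in N(u) and j in N(v) one has cn i v + cn j u = 10, so both numbers are constant.
Double counting makes them equal to 5, but only 3 and 7 are allowed. -/
lemma orth_ten (hp : (nb G u).card = 10) (hσ : (Out G u v).card = 1) (hσ' : (Out G v u).card = 1) :
    False := by
  have o1 : ∀ k, G.Adj u k → cn G k u = 9 ∧ (cn G k v = 3 ∨ cn G k v = 7) := fun k hk => by
    have := orth_opt h hpq hk
    simp only at this
    omega
  have o2 : ∀ k, G.Adj v k → cn G k v = 9 ∧ (cn G k u = 3 ∨ cn G k u = 7) := fun k hk => by
    have := orth_opt (orth_symm h) hpq.symm hk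
    simp only at this
    omega
  have pr : ∀ i j, G.Adj u i → G.Adj v j → cn G i v + cn G j u = 10 := fun i j hi hj => by
    have e := orth_pair h hpq hi hj
    rw [hp, (o1 i hi).1, (o2 j hj).1] at e
    have := (o1 i hi).2
    have := (o2 j hj).2
    omega
  obtain ⟨i, hi⟩ := P.noiso u
  obtain ⟨j, hj⟩ := P.noiso v
  have e := sum_cn (G := G) u v
  rw [sum_congr rfl fun k hk => show cn G k v = cn G i v by
      have := pr i j hi hj; have := pr k j (mem_nb.1 hk) hj; omega,
    sum_congr rfl fun k hk => show cn G k u = cn G j u by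
      have := pr i j hi hj; have := pr i k hi (mem_nb.1 hk); omega, sum_const, sum_const,
    ← hpq, hp] at e
  have := pr i j hi hj
  have := (o1 i hi).2
  simp only [smul_eq_mul] at e
  omega

/-- Let x be the number of k in N(u) with cn k u = 4, and y its analogue for v. By the handshake
lemma both are odd. Double counting the edges between N(u) and N(v) modulo 5 gives that 5 divides x
+ y, so x = y = 5, and then the count itself fails. -/
lemma orth_five (hp : (nb G u).card = 5) (hσ : (Out G u v).card = 2) (hσ' : (Out G v u).card = 2) :
    False := by
  have o1 : ∀ k, G.Adj u k → (cn G k u = 4 ∧ (cn G k v = 2 ∨ cn G k v = 3)) ∨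
      (cn G k u = 3 ∧ (cn G k v = 0 ∨ cn G k v = 5)) := fun k hk => by
    have := orth_opt h hpq hk
    simp only at this
    omega
  have o2 : ∀ k, G.Adj v k → (cn G k v = 4 ∧ (cn G k u = 2 ∨ cn G k u = 3)) ∨
      (cn G k v = 3 ∧ (cn G k u = 0 ∨ cn G k u = 5)) := fun k hk => by
    have := orth_opt (orth_symm h) hpq.symm hk
    simp only at this
    omega
  have pr : ∀ i j, G.Adj u i → G.Adj v j → cn G i u = 4 → cn G j v = 4 →
      cn G i v + cn G j u = 5 := fun i j hi hj h1 h2 => by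
    have e := orth_pair h hpq hi hj
    rw [hp, h1, h2] at e
    have := o1 i hi
    have := o2 j hj
    omega
  have par : ∀ w, (nb G w).card = 5 → (∀ k ∈ nb G w, cn G k w = 3 + if cn G k w = 4 then 1 else 0) →
      ((nb G w).filter fun k => cn G k w = 4).card % 2 = 1 := by
    intro w h5 hw
    have := even_sum_cn G w
    rw [sum_congr rfl hw, sum_add_distrib, sum_boole, sum_const, h5] at this
    simp only [smul_eq_mul, Nat.cast_id] at this
    have := Nat.even_iff.1 this
    omega
  have pu := par u hp fun k hk => by
    have := o1 k (mem_nb.1 hk); split_ifs <;> omega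
  have pv := par v (hpq ▸ hp) fun k hk => by
    have := o2 k (mem_nb.1 hk); split_ifs <;> omega
  have lu : ((nb G u).filter fun k => cn G k u = 4).card ≤ 5 := hp ▸ card_filter_le _ _
  have lv : ((nb G v).filter fun k => cn G k v = 4).card ≤ 5 := by
    rw [← hp, hpq]; exact card_filter_le _ _
  obtain ⟨i, hi⟩ := card_pos.1 (show 0 < ((nb G u).filter fun k => cn G k u = 4).card by omega)
  obtain ⟨j, hj⟩ := card_pos.1 (show 0 < ((nb G v).filter fun k => cn G k v = 4).card by omega)
  simp only [mem_filter, mem_nb] at hi hj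
  have e := sum_cn (G := G) u v
  rw [sum_congr rfl fun k hk => show cn G k v = cn G i v * (if cn G k u = 4 then 1 else 0) +
        5 * (if cn G k v = 5 then 1 else 0) by
      have := pr i j hi.1 hj.1 hi.2 hj.2
      have := pr k j (mem_nb.1 hk) hj.1
      have := o1 k (mem_nb.1 hk)
      by_cases h4 : cn G k u = 4
      · have h5 : cn G k v ≠ 5 := by omega
        rw [if_pos h4, if_neg h5]; omega
      · rw [if_neg h4]; split_ifs <;> omega,
    sum_congr rfl fun k hk => show cn G k u = cn G j u * (if cn G k v = 4 then 1 else 0) +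
        5 * (if cn G k u = 5 then 1 else 0) by
      have := pr i j hi.1 hj.1 hi.2 hj.2
      have := pr i k hi.1 (mem_nb.1 hk)
      have := o2 k (mem_nb.1 hk)
      by_cases h4 : cn G k v = 4
      · have h5 : cn G k u ≠ 5 := by omega
        rw [if_pos h4, if_neg h5]; omega
      · rw [if_neg h4]; split_ifs <;> omega,
    sum_add_distrib, sum_add_distrib, ← mul_sum, ← mul_sum, ← mul_sum, ← mul_sum, sum_boole,
    sum_boole, sum_boole, sum_boole] at e
  simp only [Nat.cast_id] at e
  have z1 : ((nb G u).filter fun k => cn G k u = 4).card = 5 →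
      ((nb G u).filter fun k => cn G k v = 5).card = 0 := fun h5 => by
    have := filter_card_eq (h5.trans hp.symm)
    rw [card_eq_zero, filter_eq_empty_iff]
    intro k hk
    have := this k hk
    have := o1 k (mem_nb.1 hk)
    omega
  have z2 : ((nb G v).filter fun k => cn G k v = 4).card = 5 →
      ((nb G v).filter fun k => cn G k u = 5).card = 0 := fun h5 => by
    have := filter_card_eq (h5.trans (hp.symm.trans hpq))
    rw [card_eq_zero, filter_eq_empty_iff]
    intro k hk
    have := this k hk
    have := o2 k (mem_nb.1 hk)
    omega
  have h1 := pr i j hi.1 hj.1 hi.2 hj.2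
  have h2 : cn G i v = 2 ∨ cn G i v = 3 := by have := o1 i hi.1; omega
  generalize ((nb G u).filter fun k => cn G k u = 4).card = x at *
  generalize ((nb G v).filter fun k => cn G k v = 4).card = y at *
  generalize ((nb G u).filter fun k => cn G k v = 5).card = x' at *
  generalize ((nb G v).filter fun k => cn G k u = 5).card = y' at *
  rcases h2 with h2 | h2
  · have h3 : cn G j u = 3 := by omega
    rw [h2, h3] at e; omega
  · have h3 : cn G j u = 2 := by omega
    rw [h2, h3] at e; omega

lemma orth_four_full (hp : (nb G u).card = 4)
    (hγ : (Out G u v ∩ Out G v u).card = 0) {k : V} (hk : G.Adj u k) (hky : 1 ≤ cn G k v) :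
    ¬ (cn G k u = 0 ∧ cn G k v = 4) := by
  intro e1
  obtain ⟨l, hl⟩ := card_pos.1 hky
  simp only [mem_inter, mem_nb] at hl
  have e := orth_pair h hpq hk hl.2
  have s := subset_of_cn (e1.2.trans (hp.symm.trans hpq))
  have e2 : (nb G k ∩ nb G l ∩ nb G v).card = cn G l v := by
    unfold cn; congr 1; ext w; simp only [mem_inter]
    have := @s w; tauto
  have e3 : (nb G k ∩ nb G l ∩ nb G u).card ≤ cn G k u :=
    card_le_card fun w => by simp only [mem_inter]; tauto
  rw [if_pos hl.1, hp, e1.1, e1.2, orth_cn_diff h hk hl.2, e2, hγ] at e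
  have := nb_inter_lt hk hl.1
  clear h hpq
  omega

lemma orth_four_eq (hp : (nb G u).card = 4) (hσ : (Out G u v).card = 1)
    (hγ : (Out G u v ∩ Out G v u).card = 0) {k : V} (hk : G.Adj u k) (hky : 1 ≤ cn G k v) :
    cn G k u = 2 ∧ cn G k v = 2 := by
  have o := orth_opt h hpq hk
  have := orth_four_full h hpq hp hγ hk hky
  simp only at o
  generalize cn G k u = a at *
  generalize cn G k v = b at *
  clear h hpq
  omega

-- Each vertex of N(u) has two neighbours in N(u) and two in N(v). For adjacent i, k in N(u) their
-- neighbourhoods in N(v) are complementary, so too few common neighbours remain for `orth_pair'`.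
set_option maxHeartbeats 1000000 in
lemma orth_four (hp : (nb G u).card = 4) (hσ : (Out G u v).card = 1) (hσ' : (Out G v u).card = 1)
    {i j : V} (hi : G.Adj u i) (hj : G.Adj v j) (hij : G.Adj i j) : False := by
  have hγ : (Out G u v ∩ Out G v u).card = 0 := by have := inter_lt h; omega
  have i1 : ∀ k l, G.Adj k l → G.Adj v l → 1 ≤ cn G k v := fun k l hk hl =>
    card_pos.2 ⟨l, by simp [hk, hl]⟩
  have all : ∀ k, G.Adj u k → cn G k u = 2 ∧ cn G k v = 2 := by
    intro k hk
    have hi2 := orth_four_eq h hpq hp hσ hγ hi (i1 i j hij hj)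
    by_contra hn
    have o := orth_opt h hpq hk
    simp only at o
    rw [hp, hσ] at o
    have hk0 : cn G k v = 0 := by
      by_contra h0
      exact hn (orth_four_eq h hpq hp hσ hγ hk (by omega))
    have hk1 : cn G k u = 0 := by omega
    have e := orth_pair' h hpq hi hk
    have l1 : (nb G i ∩ nb G k ∩ nb G u).card ≤ cn G k u :=
      card_le_card fun w => by simp only [mem_inter]; tauto
    have l2 : (nb G i ∩ nb G k ∩ nb G v).card ≤ cn G k v :=
      card_le_card fun w => by simp only [mem_inter]; tauto
    have nik : ¬ G.Adj i k := fun h0 => by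
      have : 0 < cn G k u := card_pos.2 ⟨i, by simp [hi, h0.symm]⟩
      omega
    rw [if_neg nik, hp, hi2.1, hi2.2, hk1, hk0, orth_cn_same h hi hk] at e
    omega
  have key : ∀ k, G.Adj v k → ¬ G.Adj i k → nb G i ∩ nb G u ⊆ nb G k := by
    intro k hk hik
    have e := orth_pair h hpq hi hk
    have l1 : (nb G i ∩ nb G k ∩ nb G u).card ≤ cn G k u :=
      card_le_card fun w => by simp only [mem_inter]; tauto
    have l2 : (nb G i ∩ nb G k ∩ nb G v).card ≤ cn G k v :=
      card_le_card fun w => by simp only [mem_inter]; tauto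
    have o := orth_opt (orth_symm h) hpq.symm hk
    have o' := orth_four_full (orth_symm h) hpq.symm (hpq ▸ hp) (by rw [inter_comm]; exact hγ) hk
    simp only at o
    rw [← hpq, hp, hσ'] at o
    have l3 : (nb G i ∩ nb G k ∩ nb G u).card ≤ cn G i u :=
      card_le_card fun w => by simp only [mem_inter]; tauto
    have l4 : (nb G i ∩ nb G k ∩ nb G v).card ≤ cn G i v :=
      card_le_card fun w => by simp only [mem_inter]; tauto
    rw [if_neg hik, hp, (all i hi).1, (all i hi).2, orth_cn_diff h hi hk, hγ] at e
    have hx : (nb G i ∩ nb G k ∩ nb G u).card = cn G i u := by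
      have a1 := (all i hi).1
      have a2 := (all i hi).2
      rw [a1] at l3 ⊢
      rw [a2] at l4
      omega
    have : nb G i ∩ nb G k ∩ nb G u = nb G i ∩ nb G u :=
      eq_of_subset_of_card_le (fun w => by simp only [mem_inter]; tauto) hx.ge
    rw [← this]
    intro w; simp only [mem_inter]; tauto
  obtain ⟨k, hk⟩ := card_pos.1 (show 0 < (nb G i ∩ nb G u).card by
    have := (all i hi).1; unfold cn at this; omega)
  have hk' := hk
  simp only [mem_inter, mem_nb] at hk
  have e := orth_pair' h hpq hi hk.2
  rw [if_pos hk.1, hp, (all i hi).1, (all i hi).2, (all k hk.2).1, (all k hk.2).2,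
    orth_cn_same h hi hk.2, hσ] at e
  have l1 := nb_inter_lt hk.2 hk.1.symm
  rw [inter_comm (nb G k), (all i hi).1] at l1
  -- `N(k) ∩ N(v)` is the complement of `N(i) ∩ N(v)` in `N(v)`
  have sub : nb G v \ nb G i ⊆ nb G k ∩ nb G v := by
    intro w hw
    simp only [mem_sdiff, mem_nb] at hw
    simp only [mem_inter, mem_nb]
    exact ⟨(mem_nb.1 (key w hw.1 hw.2 hk')).symm, hw.1⟩
  have c1 : (nb G v \ nb G i).card = 2 := by
    have h1 := card_sdiff_add_card_inter (nb G v) (nb G i)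
    have h2 := (all i hi).2
    unfold cn at h2
    rw [inter_comm, h2, ← hpq, hp] at h1
    omega
  have heq := eq_of_subset_of_card_le sub (by rw [c1]; exact (all k hk.2).2.le)
  have : nb G i ∩ nb G k ∩ nb G v = ∅ := by
    rw [inter_assoc, ← heq, eq_empty_iff_forall_notMem]
    intro w; simp only [mem_inter, mem_sdiff]; tauto
  rw [this, card_empty] at e
  omega

lemma orth_eqdeg_aux {i j : V} (hi : G.Adj u i) (hj : G.Adj v j) (hij : G.Adj i j) :
    ((nb G u).card = 1 ∧ (Out G u v).card = 4 ∧ cn G i u = 0 ∧ cn G i v = 1) ∨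
      ((nb G u).card = 2 ∧ (Out G u v).card = 3 ∧ cn G i u = 1 ∧ cn G i v = 1) ∨
      ((Out G u v).card = 2 ∧ cn G i u + 2 = (nb G u).card ∧ cn G i v = (nb G u).card ∧
        1 ≤ (Out G u v ∩ Out G v u).card) ∨
      ((nb G u).card = 5 ∧ (Out G u v).card = 2) ∨ ((nb G u).card = 10 ∧ (Out G u v).card = 1) ∨
      ((nb G u).card = 4 ∧ (Out G u v).card = 1) := by
  have bi : 1 ≤ cn G i v := card_pos.2 ⟨j, by simp [hij, hj]⟩
  have li := cn_le (G := G) i v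
  have o := orth_opt h hpq hi
  simp only at o
  rcases o with o | o | o | o | o | o | o
  · left; omega
  · right; left; omega
  · have hb : cn G i v = (nb G u).card := by omega
    exact Or.inr (Or.inr (Or.inl ⟨o.1, o.2.1, hb, (orth_full h hpq hi hj hij o.2.1 hb).2⟩))
  · exact Or.inr (Or.inr (Or.inr (Or.inl ⟨o.1, o.2.1⟩)))
  · exact Or.inr (Or.inr (Or.inr (Or.inr (Or.inl ⟨o.1, o.2.1⟩))))
  · exact Or.inr (Or.inr (Or.inr (Or.inr (Or.inr ⟨o.1, o.2.1⟩))))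
  · exact Or.inr (Or.inr (Or.inr (Or.inr (Or.inr ⟨o.1, o.2.1⟩))))

lemma orth_eqdeg {i j : V} (hi : G.Adj u i) (hj : G.Adj v j) (hij : G.Adj i j) :
    ((nb G u).card = 1 ∧ (Out G u v).card = 4 ∧ (Out G v u).card = 4 ∧
      (Out G u v ∩ Out G v u).card = 2) ∨
    ((nb G u).card = 2 ∧ (Out G u v).card = 3 ∧ (Out G v u).card = 3 ∧
      (Out G u v ∩ Out G v u).card = 1) := by
  have s1 := orth_eqdeg_aux h hpq hi hj hij
  have s2 := orth_eqdeg_aux (orth_symm h) hpq.symm hj hi hij.symm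
  have g1 := inter_lt h
  have g2 := inter_lt (orth_symm h)
  rw [inter_comm] at g2
  rw [inter_comm (Out G v u), ← hpq] at s2
  have pair := orth_pair h hpq hi hj
  rw [if_pos hij, orth_cn_diff h hi hj] at pair
  have x1 := nb_inter_lt hi hij
  have x2 := nb_inter_lt hj hij.symm
  rw [inter_comm (nb G j)] at x2
  rcases orth_combine g1 g2 s1 s2 with o | o | o | o | o | o | o | o
  · obtain ⟨o1, o2, o3, o4, o5, o6, o7⟩ := o
    rw [o1, o4, o5, o6, o7] at pair
    exact Or.inl ⟨o1, o2, o3, by omega⟩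
  · obtain ⟨o1, o2, o3, o4, o5, o6, o7⟩ := o
    rw [o1, o4, o5, o6, o7] at pair
    exact Or.inr ⟨o1, o2, o3, by omega⟩
  · exact (orth_two h hpq hi hj hij o.1 o.2.1 o.2.2).elim
  · exact (orth_two (orth_symm h) hpq.symm hj hi hij.symm (hpq ▸ o.1) o.2.1 o.2.2).elim
  · have := orth_full_full h hpq hi hj hij o.2.1 o.2.2.1 o.2.2.2
    omega
  · exact (orth_five h hpq o.1 o.2.1 o.2.2).elim
  · exact (orth_ten h hpq o.1 o.2.1 o.2.2).elim
  · exact (orth_four h hpq o.1 o.2.1 o.2.2 hi hj hij).elim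

end eqdeg
end orth
end PD
end TwoEig
end

/-! ### An orthogonal pair of different degrees. -/

section
open scoped Classical
namespace TwoEig
open Finset

/-- Two graphs whose adjacency only depends on types of the vertices are isomorphic if all types
occur equally often. -/
lemma iso_of_type {V W T : Type*} [Fintype V] [Fintype W] {G : SimpleGraph V} {H : SimpleGraph W}
    (c : V → T) (d : W → T) (B : T → T → Prop) (hG : ∀ x y, G.Adj x y ↔ B (c x) (c y))
    (hH : ∀ x y, H.Adj x y ↔ B (d x) (d y))
    (hc : ∀ t, (univ.filter fun x => c x = t).card = (univ.filter fun x => d x = t).card) :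
    Nonempty (G ≃g H) := by
  have e : ∀ t, Nonempty ({x // c x = t} ≃ {x // d x = t}) := fun t =>
    ⟨Fintype.equivOfCardEq (by rw [Fintype.card_subtype, Fintype.card_subtype]; exact hc t)⟩
  let E : V ≃ W := Equiv.ofFiberEquiv (f := c) (g := d) fun t => (e t).some
  have k : ∀ x, d (E x) = c x := fun x => Equiv.ofFiberEquiv_map _ x
  refine ⟨⟨E, ?_⟩⟩
  intro x y
  rw [hH, hG, k, k]

lemma iso_of_bij {V M : Type*} {G : SimpleGraph V} {H : SimpleGraph M}
    (f : M → V) (hi : Function.Injective f) (hf : Function.Surjective f)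
    (ha : ∀ x y, H.Adj x y ↔ G.Adj (f x) (f y)) : Nonempty (G ≃g H) :=
  ⟨RelIso.symm ⟨Equiv.ofBijective f ⟨hi, hf⟩, fun {x y} => (ha x y).symm⟩⟩

namespace PD

variable {V : Type*} [Fintype V] {G : SimpleGraph V} {r s : ℝ} {P : PD G r s}

section orth
variable {u v : V} (h : P.dot u v = 0)
include h

lemma out_or {w : V} (h1 : ¬ G.Adj u w) (h2 : ¬ G.Adj v w) : w ∈ Out G u v ∨ w ∈ Out G v u := by
  obtain ⟨z, hz⟩ := P.noiso w
  have := (orth_out h h1 h2).2 (mem_nb.2 hz)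
  rw [mem_union, mem_nb, mem_nb] at this
  rcases this with h0 | h0
  · exact Or.inl ((orth_out_iff h h0 h1 h2).1 hz.symm)
  · exact Or.inr ((orth_out_iff (orth_symm h) h0 h2 h1).1 hz.symm)

lemma out_nadj {w z : V} (h1 : ¬ G.Adj u w) (h2 : ¬ G.Adj v w) (h3 : ¬ G.Adj u z)
    (h4 : ¬ G.Adj v z) : ¬ G.Adj w z := fun h0 => by
  have := (orth_out h h1 h2).2 (mem_nb.2 h0)
  rw [mem_union, mem_nb, mem_nb] at this
  tauto

section lt
variable (hlt : (nb G u).card < (nb G v).card)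
include hlt

lemma orth_lt_opt {j : V} (hj : G.Adj v j) :
    let p := (nb G u).card; let q := (nb G v).card; let σ := (Out G v u).card
    let a := cn G j u; let b := cn G j v
    (σ = 2 ∧ b + 2 = q ∧ (a = 0 ∨ a = p)) ∨ (σ = 1 ∧ q = 4 ∧ b = 0 ∧ (a = 0 ∨ a = p)) ∨
      (σ = 1 ∧ p = 4 ∧ a = 2 ∧ b + 2 = q) := by
  apply orth_arith_lt (P.deg_pos u) hlt (cn_lt hj) (cn_le j u) (out_pos (orth_symm h))
  have e := orth_eq (orth_symm h) hj
  linarith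

/-- The other possibilities have |Out v u| = 1, so the two `Out` sets are disjoint, and then
`orth_pair_diff` for the edge ij has no solution. -/
lemma orth_lt_one {i j : V} (hi : G.Adj u i) (hj : G.Adj v j) (hij : G.Adj i j) :
    (Out G v u).card = 2 := by
  have o := orth_lt_opt h hlt hj
  simp only at o
  have bi : 1 ≤ cn G i v := card_pos.2 ⟨j, by simp [hij, hj]⟩
  have bj : 1 ≤ cn G j u := card_pos.2 ⟨i, by simp [hij.symm, hi]⟩
  have pair := orth_pair_diff h hi hj
  rw [if_pos hij, orth_cn_diff h hi hj] at pair
  have x1 := nb_inter_lt hi hij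
  have y1 : (nb G i ∩ nb G j ∩ nb G u).card ≤ cn G i u :=
    card_le_card fun w => by simp only [mem_inter]; tauto
  have y2 : (nb G i ∩ nb G j ∩ nb G v).card ≤ cn G j v :=
    card_le_card fun w => by simp only [mem_inter]; tauto
  have g := inter_lt (orth_symm h)
  rw [inter_comm] at g
  have pp := P.deg_pos u
  rcases o with o | ⟨o1, o2, o3, o4⟩ | ⟨o1, o2, o3, o4⟩
  · exact o.1
  · exfalso
    have o5 : cn G j u = (nb G u).card := by omega
    have e1 : (nb G i ∩ nb G j ∩ nb G u).card = cn G i u := by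
      have s := subset_of_cn o5
      unfold cn; congr 1; ext w; simp only [mem_inter]
      have := @s w; tauto
    have hγ : (Out G u v ∩ Out G v u).card = 0 := by omega
    rw [o2, o3, o5, e1, hγ, show (nb G i ∩ nb G j ∩ nb G v).card = 0 by omega] at pair
    have : (nb G u).card * cn G i v = 0 := by linarith
    rcases mul_eq_zero.1 this with h0 | h0 <;> omega
  · exfalso
    have hγ : (Out G u v ∩ Out G v u).card = 0 := by omega
    have e := orth_eq h hi
    have lb := cn_le (G := G) i v
    have la := cn_lt hi
    have ls := out_pos h
    have hev : ∃ k, cn G i u = 2 * k := by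
      rw [o2, o3, o4] at pair
      have : (nb G v).card * (2 * ((nb G i ∩ nb G j ∩ nb G u).card +
        (nb G i ∩ nb G j ∩ nb G v).card + (Out G u v ∩ Out G v u).card + 2)) =
        (nb G v).card * (cn G i u + 2 + 2 * cn G i v) := by linarith
      have := Nat.eq_of_mul_eq_mul_left (P.deg_pos v) this
      exact ⟨cn G i u / 2, by omega⟩
    obtain ⟨k, hk⟩ := hev
    have hk2 : k = 0 ∨ k = 1 := by omega
    -- `i` is adjacent to all of `N(v)`
    have hb : cn G i v = (nb G v).card := by
      rw [o2, hk] at e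
      obtain ⟨c, hc⟩ := Nat.exists_eq_add_of_le lb
      obtain ⟨t, ht⟩ := Nat.exists_eq_add_of_le ls
      rw [o2] at hlt
      rw [hc] at e hlt
      rw [ht] at e
      rcases hk2 with rfl | rfl
      · have : cn G i v * c + (cn G i v + c) * t = 0 := by linarith
        have : cn G i v * c = 0 := by omega
        rcases mul_eq_zero.1 this with h0 | h0 <;> omega
      · rcases Nat.eq_zero_or_pos t with rfl | ht0
        · have e2 : cn G i v * c = cn G i v + c := by linarith
          obtain ⟨b', hb'⟩ := Nat.exists_eq_add_of_le bi
          have hc0 : c ≠ 0 := by rintro rfl; omega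
          obtain ⟨c', hc'⟩ := Nat.exists_eq_succ_of_ne_zero hc0
          rw [hb', hc'] at e2 hlt
          have e3 : b' * c' = 1 := by
            have : (1 + b') * (c' + 1) = b' * c' + b' + c' + 1 := by ring
            simp only [Nat.succ_eq_add_one] at e2
            omega
          have := Nat.eq_one_of_mul_eq_one_right e3
          have := Nat.eq_one_of_mul_eq_one_left e3
          omega
        · obtain ⟨t', rfl⟩ := Nat.exists_eq_add_of_le ht0
          have : cn G i v * c + (cn G i v + c) * t' = 0 := by linarith
          have : cn G i v * c = 0 := by omega
          rcases mul_eq_zero.1 this with h0 | h0 <;> omega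
    have e1 : (nb G i ∩ nb G j ∩ nb G v).card = cn G j v := by
      have s := subset_of_cn hb
      unfold cn; congr 1; ext w; simp only [mem_inter]
      have := @s w; tauto
    rw [o2, o3, o4, hb, e1, hγ] at pair
    have : (nb G v).card * (2 * ((nb G i ∩ nb G j ∩ nb G u).card + cn G j v + 2)) =
        (nb G v).card * (cn G i u + 2 + 2 * (nb G v).card) := by linarith
    have := Nat.eq_of_mul_eq_mul_left (P.deg_pos v) this
    omega

/-- The graph in case of an edge between `N(u)` and `N(v)`. -/
lemma orth_lt_main {i j : V} (hi : G.Adj u i) (hj : G.Adj v j) (hij : G.Adj i j) :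
    (Out G u v ∩ Out G v u).card = 1 ∧ (∀ k, G.Adj v k → cn G k v + 2 = (nb G v).card) ∧
      (∀ k, G.Adj v k → (nb G i ∩ nb G v ∩ nb G k).card + 1 = cn G i v) ∧
      ∀ k, G.Adj v k → cn G k u = 0 ∨ cn G k u = (nb G u).card := by
  have hσ := orth_lt_one h hlt hi hj hij
  have o : ∀ k, G.Adj v k → cn G k v + 2 = (nb G v).card ∧
      (cn G k u = 0 ∨ cn G k u = (nb G u).card) := fun k hk => by
    have := orth_lt_opt h hlt hk
    simp only at this
    omega
  have g := inter_lt (orth_symm h)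
  rw [inter_comm] at g
  have pp := P.deg_pos u
  have pair : ∀ k, G.Adj v k → (nb G u).card * (cn G i k + if G.Adj i k then 2 else 0) =
      (cn G i u + 2) * cn G k u + (nb G u).card * cn G i v := fun k hk => by
    have e := orth_pair_diff h hi hk
    rw [(o k hk).1] at e
    apply Nat.eq_of_mul_eq_mul_left (P.deg_pos v)
    linarith
  have key : ∀ k, G.Adj v k →
      (nb G i ∩ nb G k ∩ nb G v).card + (Out G u v ∩ Out G v u).card = cn G i v := by
    intro k hk
    have e := pair k hk
    rw [orth_cn_diff h hi hk] at e
    rcases (o k hk).2 with h0 | h0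
    · have nik : ¬ G.Adj i k := fun h1 => by
        have : 0 < cn G k u := card_pos.2 ⟨i, by simp [hi, h1.symm]⟩
        omega
      have l1 : (nb G i ∩ nb G k ∩ nb G u).card ≤ cn G k u :=
        card_le_card fun w => by simp only [mem_inter]; tauto
      rw [if_neg nik, h0, show (nb G i ∩ nb G k ∩ nb G u).card = 0 by omega] at e
      have : (nb G u).card * ((nb G i ∩ nb G k ∩ nb G v).card + (Out G u v ∩ Out G v u).card) =
        (nb G u).card * cn G i v := by linarith
      exact Nat.eq_of_mul_eq_mul_left pp this
    · have s := subset_of_cn h0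
      have ik : G.Adj i k := (mem_nb.1 (s (mem_nb.2 hi))).symm
      have e1 : (nb G i ∩ nb G k ∩ nb G u).card = cn G i u := by
        unfold cn; congr 1; ext w; simp only [mem_inter]
        have := @s w; tauto
      rw [if_pos ik, e1, h0] at e
      have : (nb G u).card * (cn G i u + 2 + ((nb G i ∩ nb G k ∩ nb G v).card +
        (Out G u v ∩ Out G v u).card)) =
        (nb G u).card * (cn G i u + 2 + cn G i v) := by linarith
      have := Nat.eq_of_mul_eq_mul_left pp this
      omega
  have x2 := nb_inter_lt hj hij.symm
  rw [inter_comm (nb G j)] at x2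
  have hγ : (Out G u v ∩ Out G v u).card = 1 := by have := key j hj; omega
  refine ⟨hγ, fun k hk => (o k hk).1, fun k hk => ?_, fun k hk => (o k hk).2⟩
  rw [← key k hk, hγ, inter_right_comm]

end lt
end orth
end PD
end TwoEig
end

/-! ### An orthogonal pair without edges between the neighbourhoods. -/

section
open scoped Classical
namespace TwoEig
open Finset

/-- Types are distinguished by the types they are adjacent to (`sep`), so the sets S t are
automatically disjoint. -/
lemma iso_of_parts {V W T : Type*} [Fintype V] [Fintype W] [DecidableEq T] {G : SimpleGraph V}
    {H : SimpleGraph W} (S : T → Finset V) (d : W → T) (B : T → T → Prop)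
    (cover : ∀ x, ∃ t, x ∈ S t) (hG : ∀ s t, ∀ x ∈ S s, ∀ y ∈ S t, G.Adj x y ↔ B s t)
    (hH : ∀ x y, H.Adj x y ↔ B (d x) (d y))
    (hc : ∀ t, (S t).card = (univ.filter fun x => d x = t).card) (ne : ∀ t, ∃ x, d x = t)
    (sep : ∀ s t, (∀ t', B s t' ↔ B t t') → s = t) : Nonempty (G ≃g H) := by
  choose c hc' using cover
  have key : ∀ x t, x ∈ S t → c x = t := by
    intro x t hx
    refine sep _ _ fun t' => ?_
    obtain ⟨z, hz⟩ := ne t'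
    obtain ⟨y, hy⟩ := card_pos.1 (show 0 < (S t').card by
      rw [hc]; exact card_pos.2 ⟨z, by simpa using hz⟩)
    rw [← hG _ _ x (hc' x) y hy, ← hG _ _ x hx y hy]
  refine iso_of_type c d B (fun x y => hG _ _ x (hc' x) y (hc' y)) hH fun t => ?_
  refine Eq.trans ?_ ((hc t).trans (by congr))
  congr 1
  ext x
  simp only [mem_filter, mem_univ, true_and]
  exact ⟨fun h => h ▸ hc' x, key x t⟩

/-- The vertex set `C` induces a copy of `H` in `G`. -/
def Emb {V M : Type*} (H : SimpleGraph M) (G : SimpleGraph V) (C : Finset V) : Prop :=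
  ∃ f : M → V, Function.Injective f ∧ (∀ v, v ∈ C ↔ ∃ x, f x = v) ∧
    ∀ x y, H.Adj x y ↔ G.Adj (f x) (f y)

lemma sum_iso {V M N : Type*} {G : SimpleGraph V} {H : SimpleGraph M} {K : SimpleGraph N}
    {C D : Finset V} (hC : Emb H G C) (hD : Emb K G D) (hd : Disjoint C D)
    (hu : ∀ v, v ∈ C ∨ v ∈ D) (he : ∀ x ∈ C, ∀ y ∈ D, ¬ G.Adj x y) :
    Nonempty (G ≃g SimpleGraph.sum H K) := by
  obtain ⟨f, f1, f2, f3⟩ := hC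
  obtain ⟨g, g1, g2, g3⟩ := hD
  have mf : ∀ x, f x ∈ C := fun x => (f2 _).2 ⟨x, rfl⟩
  have mg : ∀ x, g x ∈ D := fun x => (g2 _).2 ⟨x, rfl⟩
  refine iso_of_bij (Sum.elim f g) (f1.sumElim g1 fun a b h0 =>
    disjoint_left.1 hd (mf a) (h0 ▸ mg b)) (fun v => ?_) ?_
  · rcases hu v with hv | hv
    · obtain ⟨x, hx⟩ := (f2 v).1 hv; exact ⟨.inl x, hx⟩
    · obtain ⟨x, hx⟩ := (g2 v).1 hv; exact ⟨.inr x, hx⟩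
  · rintro (x | x) (y | y)
    · simpa using f3 x y
    · simpa using he _ (mf x) _ (mg y)
    · simpa using fun h0 => he _ (mf y) _ (mg x) h0.symm
    · simpa using g3 x y

/-- Each vertex of C has one partner, its only other nonneighbour in C; a predicate holding for
exactly one of two partners chooses the first member of each class. -/
lemma cp_param {V : Type*} [Fintype V] {G : SimpleGraph V} {C : Finset V} (p : V → Prop)
    (hC : ∀ x ∈ C, (C.filter fun y => y ≠ x ∧ ¬ G.Adj x y).card = 1)
    (hp : ∀ x ∈ C, ∀ y ∈ C, y ≠ x → ¬ G.Adj x y → (p y ↔ ¬ p x)) :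
    ∃ (k : ℕ) (g : Fin k × Fin 2 → V), Function.Injective g ∧ (∀ v, v ∈ C ↔ ∃ x, g x = v) ∧
      C.card = k * 2 ∧ (∀ x y, G.Adj (g x) (g y) ↔ x.1 ≠ y.1) ∧ ∀ x, p (g x) ↔ x.2 = 0 := by
  have ex : ∀ x, ∃ y, x ∈ C → (C.filter fun y => y ≠ x ∧ ¬ G.Adj x y) = {y} := by
    intro x
    by_cases hx : x ∈ C
    · obtain ⟨y, hy⟩ := card_eq_one.1 (hC x hx); exact ⟨y, fun _ => hy⟩
    · exact ⟨x, fun h => absurd h hx⟩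
  choose tw htw using ex
  have ht : ∀ x ∈ C, ∀ y, (y ∈ C ∧ y ≠ x ∧ ¬ G.Adj x y) ↔ y = tw x := fun x hx y => by
    have := congrArg (y ∈ ·) (htw x hx)
    simpa using this
  have h1 : ∀ x ∈ C, tw x ∈ C ∧ tw x ≠ x ∧ ¬ G.Adj x (tw x) := fun x hx => (ht x hx _).2 rfl
  have h2 : ∀ x ∈ C, tw (tw x) = x := fun x hx =>
    ((ht _ (h1 x hx).1 x).1 ⟨hx, (h1 x hx).2.1.symm, fun h0 => (h1 x hx).2.2 h0.symm⟩).symm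
  have h3 : ∀ x ∈ C, (p (tw x) ↔ ¬ p x) := fun x hx =>
    hp x hx _ (h1 x hx).1 (h1 x hx).2.1 (h1 x hx).2.2
  obtain ⟨k, g, g1, g2, g3, g4⟩ := pair_param C tw p (fun x hx => (h1 x hx).1) h2 h3
  have mg : ∀ x, g x ∈ C := fun x => (g2 _).2 ⟨x, rfl⟩
  have two : ∀ c : Fin 2, c = 0 ∨ c = 1 := by decide
  have t0 : ∀ a, tw (g (a, 0)) = g (a, 1) := fun a => (g4 a).2.symm
  have t1 : ∀ a, tw (g (a, 1)) = g (a, 0) := fun a => by rw [(g4 a).2, h2 _ (mg _)]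
  refine ⟨k, g, g1, g2, g3, ?_, ?_⟩
  · rintro x y
    have e := ht (g x) (mg x) (g y)
    have hxy : ¬ G.Adj (g x) (g y) ↔ (y = x ∨ g y = tw (g x)) := by
      rw [← e]
      by_cases h0 : y = x
      · subst h0; simp
      · have : g y ≠ g x := fun h => h0 (g1 h)
        simp [h0, this, mg y]
    rw [← not_iff_not, hxy, not_not]
    obtain ⟨a, c⟩ := x
    obtain ⟨b, c'⟩ := y
    rcases two c with rfl | rfl <;> rcases two c' with rfl | rfl <;>
      simp [t0, t1, g1.eq_iff, eq_comm]
  · rintro ⟨a, c⟩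
    rcases two c with rfl | rfl
    · simpa using (g4 a).1
    · rw [(g4 a).2, h3 _ (mg _)]; simpa using (g4 a).1

lemma cp_emb {V : Type*} [Fintype V] {G : SimpleGraph V} {C : Finset V}
    (hC : ∀ x ∈ C, (C.filter fun y => y ≠ x ∧ ¬ G.Adj x y).card = 1) :
    ∃ k, C.card = k * 2 ∧ Emb (CP k) G C := by
  -- An arbitrary numbering of the vertices decides which of two partners comes first.
  let e := Fintype.equivFin V
  have key : ∀ x ∈ C, ∀ y ∈ C, y ≠ x → ¬ G.Adj x y →
      ((∀ z ∈ C, z ≠ x → ¬ G.Adj x z → e x < e z) ↔ e x < e y) := by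
    intro x hx y hy h1 h2
    refine ⟨fun h => h y hy h1 h2, fun h z hz h3 h4 => ?_⟩
    have : z = y := card_le_one.1 (hC x hx).le z (by simp [hz, h3, h4]) y (by simp [hy, h1, h2])
    rwa [this]
  obtain ⟨k, g, g1, g2, g3, g4, -⟩ := cp_param
    (fun x => ∀ y ∈ C, y ≠ x → ¬ G.Adj x y → e x < e y) hC (by
    intro x hx y hy h1 h2
    rw [key x hx y hy h1 h2, key y hy x hx h1.symm fun h0 => h2 h0.symm, not_lt]
    exact ⟨le_of_lt, fun h => lt_of_le_of_ne h fun h0 => h1 (e.injective h0)⟩)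
  exact ⟨k, g3, g, g1, g2, fun x y => by rw [CP_adj, g4]⟩

lemma star_emb {V : Type*} {G : SimpleGraph V} {D : Finset V} {c : V} (hD : D.card = 4)
    (h1 : ∀ x ∈ D, G.Adj c x) (h2 : ∀ x ∈ D, ∀ y ∈ D, ¬ G.Adj x y) :
    Emb (K 1 4) G (insert c D) := by
  let e := (D.equivFinOfCardEq hD).symm
  have he : ∀ a, (e a : V) ∈ D := fun a => (e a).2
  refine ⟨Sum.elim (fun _ => c) fun a => e a, ?_, ?_, ?_⟩
  · refine Function.Injective.sumElim (fun a b _ => Subsingleton.elim a b)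
      (fun a b h => e.injective (Subtype.ext h)) fun a b h => ?_
    exact G.loopless.irrefl c (by simpa [← h] using h1 _ (he b))
  · intro v
    rw [mem_insert]
    constructor
    · rintro (rfl | h)
      · exact ⟨.inl 0, rfl⟩
      · exact ⟨.inr (e.symm ⟨v, h⟩), by simp⟩
    · rintro ⟨x | x, rfl⟩
      · exact Or.inl rfl
      · exact Or.inr (he x)
  · rintro (x | x) (y | y)
    · simp [K]
    · simpa [K] using h1 _ (he y)
    · simpa [K] using (h1 _ (he x)).symm
    · simpa [K] using h2 _ (he x) _ (he y)

/-- `CP(h)` with a vertex `v` joined to all of it, a vertex `y` joined to all of it, and a vertex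
`w` joined to `y`, to one vertex of each class and to `α` further vertices of degree `1`. -/
def tail (α h : ℕ) : SimpleGraph ((Fin h × Fin 2) ⊕ (Fin 3 ⊕ Fin α)) where
  Adj x y := match x, y with
    | .inl a, .inl b => a.1 ≠ b.1
    | .inl a, .inr (.inl t) => t = 0 → a.2 = 0
    | .inr (.inl t), .inl a => t = 0 → a.2 = 0
    | .inr (.inl s), .inr (.inl t) => (s = 0 ∧ t = 1) ∨ (s = 1 ∧ t = 0)
    | .inr (.inl t), .inr (.inr _) => t = 0
    | .inr (.inr _), .inr (.inl t) => t = 0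
    | _, _ => False
  symm := ⟨fun x y h => by
    rcases x with x | x | x <;> rcases y with y | y | y <;> (simp_all [eq_comm]; try tauto)⟩
  loopless := ⟨fun x h => by
    rcases x with x | x | x
    · simp at h
    · rcases h with ⟨h1, h2⟩ | ⟨h1, h2⟩ <;> rw [h1] at h2 <;> exact absurd h2 (by decide)
    · exact h⟩

namespace PD

variable {V : Type*} [Fintype V] {G : SimpleGraph V} {r s : ℝ} {P : PD G r s}

section orth
variable {u v : V} (h : P.dot u v = 0)
include h

section noedge
variable (hE : ∀ i j, G.Adj u i → G.Adj v j → ¬ G.Adj i j)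
include hE

/-- For i in N(u) and j in N(v) the right side of `orth_pair_diff` vanishes, so i and j have no
common neighbours; but every vertex of the intersection would be one. -/
lemma noedge_inter : Out G u v ∩ Out G v u = ∅ := by
  obtain ⟨i, hi⟩ := P.noiso u
  obtain ⟨j, hj⟩ := P.noiso v
  have z1 : cn G i v = 0 := by
    rw [cn, card_eq_zero, eq_empty_iff_forall_notMem]
    intro w hw; simp only [mem_inter, mem_nb] at hw
    exact hE i w hi hw.2 hw.1
  have z2 : cn G j u = 0 := by
    rw [cn, card_eq_zero, eq_empty_iff_forall_notMem]
    intro w hw; simp only [mem_inter, mem_nb] at hw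
    exact hE w j hw.2 hj hw.1.symm
  have e := orth_pair_diff h hi hj
  rw [if_neg (hE i j hi hj), z1, z2, orth_cn_diff h hi hj] at e
  rw [← card_eq_zero]
  simp only [mul_zero, zero_mul, add_zero, mul_eq_zero] at e
  have := P.deg_pos u
  have := P.deg_pos v
  omega

/-- The case b = 0 of `orth_arith`: u is a leaf of a star with four leaves, a vertex of a cocktail
party graph, or the centre of such a star. -/
lemma noedge_arith {i : V} (hi : G.Adj u i) :
    ((nb G u).card = 1 ∧ (Out G u v).card = 4) ∨
      ((Out G u v).card = 2 ∧ cn G i u + 2 = (nb G u).card) ∨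
      ((nb G u).card = 4 ∧ (Out G u v).card = 1 ∧ cn G i u = 0) := by
  have z1 : cn G i v = 0 := by
    rw [cn, card_eq_zero, eq_empty_iff_forall_notMem]
    intro w hw; simp only [mem_inter, mem_nb] at hw
    exact hE i w hi hw.2 hw.1
  have e := orth_eq h hi
  have := orth_arith (b := 0) (cn_lt hi) (Nat.zero_le _) (out_pos h) (by
    rw [z1] at e
    apply Nat.eq_of_mul_eq_mul_left (P.deg_pos v)
    linarith)
  rcases this with o | o | o | o | o | o | o
  · exact Or.inl ⟨o.1, o.2.1⟩
  · omega
  · exact Or.inr (Or.inl ⟨o.1, o.2.1⟩)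
  · omega
  · omega
  · omega
  · exact Or.inr (Or.inr ⟨o.1, o.2.1, o.2.2.1⟩)

lemma noedge_comp : Emb (K 1 4) G (nb G u ∪ Out G u v) ∨
    ∃ k, 2 ≤ k ∧ Emb (CP k) G (nb G u ∪ Out G u v) := by
  obtain ⟨i, hi⟩ := P.noiso u
  have oo : ∀ x ∈ Out G u v, ∀ y ∈ Out G u v, ¬ G.Adj x y := fun x hx y hy =>
    out_nadj h (mem_Out.1 hx).1 (mem_Out.1 hx).2.1 (mem_Out.1 hy).1 (mem_Out.1 hy).2.1
  have ou : ∀ x ∈ Out G u v, ∀ y, G.Adj u y → G.Adj x y := fun x hx y hy =>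
    mem_nb.1 ((mem_Out.1 hx).2.2 (mem_nb.2 hy))
  rcases noedge_arith h hE hi with ⟨o1, o2⟩ | ⟨o1, o2⟩ | ⟨o1, o2, o3⟩
  · left
    have : nb G u = {i} := (eq_of_subset_of_card_le (by simpa using hi) (by simp [o1])).symm
    rw [this, singleton_union]
    exact star_emb o2 (fun x hx => (ou x hx i hi).symm) oo
  · right
    obtain ⟨k, k1, k2⟩ := cp_emb (G := G) (C := nb G u ∪ Out G u v) (by
      intro x hx
      rw [mem_union] at hx
      rcases hx with hx | hx
      · rw [mem_nb] at hx
        have hn := noedge_arith h hE hx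
        have e : ((nb G u ∪ Out G u v).filter fun y => y ≠ x ∧ ¬ G.Adj x y) =
            (nb G u \ nb G x).erase x := by
          ext y
          simp only [mem_filter, mem_union, mem_nb, mem_erase, mem_sdiff]
          constructor
          · rintro ⟨h1 | h1, h2, h3⟩
            · exact ⟨h2, h1, h3⟩
            · exact absurd (ou y h1 x hx).symm h3
          · rintro ⟨h1, h2, h3⟩; exact ⟨Or.inl h2, h1, h3⟩
        rw [e, card_erase_of_mem (by simp [hx])]
        have := card_sdiff_add_card_inter (nb G u) (nb G x)
        rw [inter_comm] at this
        change _ + cn G x u = _ at this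
        omega
      · have e : ((nb G u ∪ Out G u v).filter fun y => y ≠ x ∧ ¬ G.Adj x y) =
            (Out G u v).erase x := by
          ext y
          simp only [mem_filter, mem_union, mem_nb, mem_erase]
          constructor
          · rintro ⟨h1 | h1, h2, h3⟩
            · exact absurd (ou x hx y h1) h3
            · exact ⟨h2, h1⟩
          · rintro ⟨h1, h2⟩; exact ⟨Or.inr h2, h1, oo x hx y h2⟩
        rw [e, card_erase_of_mem hx, o1])
    refine ⟨k, ?_, k2⟩
    rw [card_union_of_disjoint, o1] at k1
    · omega
    · rw [disjoint_left]
      intro x hx hx'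
      exact (mem_Out.1 hx').1 (mem_nb.1 hx)
  · left
    have e1 : Out G u v = {u} :=
      (eq_of_subset_of_card_le (by simpa using self_mem_Out h) (by simp [o2])).symm
    rw [e1, union_comm, singleton_union]
    refine star_emb o1 (fun x hx => mem_nb.1 hx) fun x hx y hy hxy => ?_
    rcases noedge_arith h hE (mem_nb.1 hx) with o | o | o
    · omega
    · omega
    · have := o.2.2
      rw [cn, card_eq_zero, eq_empty_iff_forall_notMem] at this
      exact this y (by simpa [hxy] using hy)

lemma noedge_iso : Nonempty (G ≃g G3) ∨ (∃ k, 2 ≤ k ∧ Nonempty (G ≃g G4 k)) ∨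
    ∃ k l, 2 ≤ k ∧ 2 ≤ l ∧ Nonempty (G ≃g G5 k l) := by
  have hE' : ∀ i j, G.Adj v i → G.Adj u j → ¬ G.Adj i j := fun i j hi hj h0 =>
    hE j i hj hi h0.symm
  have hγ := noedge_inter h hE
  have mγ : ∀ x, x ∈ Out G u v → x ∈ Out G v u → False := fun x h1 h2 => by
    have := mem_inter.2 ⟨h1, h2⟩
    rw [hγ] at this
    simp at this
  have hd : Disjoint (nb G u ∪ Out G u v) (nb G v ∪ Out G v u) := by
    rw [disjoint_left]
    intro x hx hx'
    simp only [mem_union, mem_nb] at hx hx'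
    rcases hx with h1 | h1 <;> rcases hx' with h2 | h2
    · exact orth_ndisj h h1 h2
    · exact (mem_Out.1 h2).2.1 h1
    · exact (mem_Out.1 h1).2.1 h2
    · exact mγ x h1 h2
  have hu : ∀ w, w ∈ nb G u ∪ Out G u v ∨ w ∈ nb G v ∪ Out G v u := by
    intro w
    simp only [mem_union, mem_nb]
    by_cases h1 : G.Adj u w
    · tauto
    by_cases h2 : G.Adj v w
    · tauto
    have := out_or h h1 h2
    tauto
  have he : ∀ x ∈ nb G u ∪ Out G u v, ∀ y ∈ nb G v ∪ Out G v u, ¬ G.Adj x y := by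
    intro x hx y hy
    simp only [mem_union, mem_nb] at hx hy
    rcases hx with h1 | h1 <;> rcases hy with h2 | h2
    · exact hE x y h1 h2
    · have m := mem_Out.1 h2
      rw [orth_out_iff h h1 m.2.1 m.1]
      exact fun h0 => mγ y h0 h2
    · have m := mem_Out.1 h1
      rw [G.adj_comm, orth_out_iff (orth_symm h) h2 m.2.1 m.1]
      exact fun h0 => mγ x h1 h0
    · have m := mem_Out.1 h1
      have m' := mem_Out.1 h2
      exact out_nadj h m.1 m.2.1 m'.2.1 m'.1
  rcases noedge_comp h hE with h1 | ⟨k, hk, h1⟩ <;>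
    rcases noedge_comp (orth_symm h) hE' with h2 | ⟨l, hl, h2⟩
  · exact Or.inl (sum_iso h1 h2 hd hu he)
  · exact Or.inr (Or.inl ⟨l, hl, sum_iso h1 h2 hd hu he⟩)
  · exact Or.inr (Or.inl ⟨k, hk, sum_iso h2 h1 hd.symm (fun w => (hu w).symm)
      fun x hx y hy h0 => he y hy x hx h0.symm⟩)
  · exact Or.inr (Or.inr ⟨k, l, hk, hl, sum_iso h1 h2 hd hu he⟩)

end noedge

end orth
end PD
end TwoEig
end

/-! ### Identifying the orthogonal cases: `G12`, `G11`, and the parameters of the tails. -/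

section
open scoped Classical
namespace TwoEig
open Finset

instance : DecidableRel G11.Adj := fun i j => inferInstanceAs (Decidable (M11 i j = 1))
instance : DecidableRel G12.Adj := fun i j => inferInstanceAs (Decidable (M12 i j = 1))

namespace PD

variable {V : Type*} [Fintype V] {G : SimpleGraph V} {r s : ℝ} {P : PD G r s}

section orth
variable {u v : V} (h : P.dot u v = 0)
include h

lemma out_only {w : V} (hw : w ∈ Out G u v \ Out G v u) : ¬ G.Adj u w ∧ ¬ G.Adj v w ∧
    (∀ i, G.Adj u i → G.Adj w i) ∧ ∀ j, G.Adj v j → ¬ G.Adj w j := by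
  rw [mem_sdiff] at hw
  have m := mem_Out.1 hw.1
  refine ⟨m.1, m.2.1, fun i hi => mem_nb.1 (m.2.2 (mem_nb.2 hi)), fun j hj => ?_⟩
  rw [G.adj_comm, orth_out_iff (orth_symm h) hj m.2.1 m.1]
  exact hw.2

omit h in
lemma out_both {w : V} (hw : w ∈ Out G u v ∩ Out G v u) : ¬ G.Adj u w ∧ ¬ G.Adj v w ∧
    (∀ i, G.Adj u i → G.Adj w i) ∧ ∀ j, G.Adj v j → G.Adj w j := by
  rw [mem_inter] at hw
  have m := mem_Out.1 hw.1
  have m' := mem_Out.1 hw.2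
  exact ⟨m.1, m.2.1, fun i hi => mem_nb.1 (m.2.2 (mem_nb.2 hi)),
    fun j hj => mem_nb.1 (m'.2.2 (mem_nb.2 hj))⟩

lemma out_cover (w : V) : G.Adj u w ∨ G.Adj v w ∨ w ∈ Out G u v \ Out G v u ∨
    w ∈ Out G v u \ Out G u v ∨ w ∈ Out G u v ∩ Out G v u := by
  by_cases h1 : G.Adj u w
  · tauto
  by_cases h2 : G.Adj v w
  · tauto
  have := out_or h h1 h2
  simp only [mem_sdiff, mem_inter]
  tauto

lemma iso_G12 {i j : V} (hi : nb G u = {i}) (hj : nb G v = {j}) (hij : G.Adj i j)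
    (h1 : (Out G u v).card = 4) (h2 : (Out G v u).card = 4)
    (h3 : (Out G u v ∩ Out G v u).card = 2) : Nonempty (G ≃g G12) := by
  have ui : ∀ w, G.Adj u w ↔ w = i := fun w => by rw [← mem_nb, hi, mem_singleton]
  have vj : ∀ w, G.Adj v w ↔ w = j := fun w => by rw [← mem_nb, hj, mem_singleton]
  have c1 : (Out G u v \ Out G v u).card = 2 := by
    have := card_sdiff_add_card_inter (Out G u v) (Out G v u); omega
  have c2 : (Out G v u \ Out G u v).card = 2 := by
    have := card_sdiff_add_card_inter (Out G v u) (Out G u v); rw [inter_comm] at this; omega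
  -- The types are i, j, and the vertices seeing only i, only j, or both; u and v have types 2 and
  -- 3. The map `d` gives the types of the vertices of `G12`, and `e` a representative of each type.
  let S : Fin 5 → Finset V := ![{i}, {j}, Out G u v \ Out G v u, Out G v u \ Out G u v,
    Out G u v ∩ Out G v u]
  let d : Fin 8 → Fin 5 := ![2, 2, 3, 3, 4, 4, 0, 1]
  let e : Fin 5 → Fin 8 := ![6, 7, 0, 2, 4]
  have so : ∀ t : Fin 5, 2 ≤ t → ∀ w ∈ S t, ¬ G.Adj u w ∧ ¬ G.Adj v w ∧
      (G.Adj w i ↔ t ≠ 3) ∧ (G.Adj w j ↔ t ≠ 2) := by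
    have a1 := (ui i).2 rfl
    have a2 := (vj j).2 rfl
    intro t ht w hw
    fin_cases t
    · exact absurd ht (by decide)
    · exact absurd ht (by decide)
    · have m := out_only h hw
      exact ⟨m.1, m.2.1, iff_of_true (m.2.2.1 i a1) (by decide),
        iff_of_false (m.2.2.2 j a2) (by decide)⟩
    · have m := out_only (orth_symm h) hw
      exact ⟨m.2.1, m.1, iff_of_false (m.2.2.2 i a1) (by decide),
        iff_of_true (m.2.2.1 j a2) (by decide)⟩
    · have m := out_both hw
      exact ⟨m.1, m.2.1, iff_of_true (m.2.2.1 i a1) (by decide),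
        iff_of_true (m.2.2.2 j a2) (by decide)⟩
  have B0 : ∀ t : Fin 5, 2 ≤ t → ((G12.Adj (e t) (e 0) ↔ t ≠ 3) ∧ (G12.Adj (e t) (e 1) ↔ t ≠ 2)) := by
    decide
  have B1 : ∀ s t : Fin 5, 2 ≤ s → 2 ≤ t → ¬ G12.Adj (e s) (e t) := by decide
  have B2 : G12.Adj (e 0) (e 1) := by decide
  refine iso_of_parts S d (fun s t => G12.Adj (e s) (e t)) ?_ ?_ (by decide) ?_ (by decide) (by decide)
  · intro x
    rcases out_cover h x with h0 | h0 | h0 | h0 | h0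
    · exact ⟨0, by simpa [S] using (ui x).1 h0⟩
    · exact ⟨1, by simpa [S] using (vj x).1 h0⟩
    · exact ⟨2, h0⟩
    · exact ⟨3, h0⟩
    · exact ⟨4, h0⟩
  · have sym : ∀ s t, (∀ x ∈ S s, ∀ y ∈ S t, G.Adj x y ↔ G12.Adj (e s) (e t)) →
        ∀ x ∈ S t, ∀ y ∈ S s, G.Adj x y ↔ G12.Adj (e t) (e s) := fun s t hst x hx y hy => by
      rw [G.adj_comm, hst y hy x hx, G12.adj_comm]
    have m0 : ∀ t : Fin 5, 2 ≤ t → ∀ x ∈ S t, ∀ y ∈ S 0, G.Adj x y ↔ G12.Adj (e t) (e 0) := by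
      intro t ht x hx y hy
      obtain rfl := mem_singleton.1 hy
      rw [(so t ht x hx).2.2.1, (B0 t ht).1]
    have m1 : ∀ t : Fin 5, 2 ≤ t → ∀ x ∈ S t, ∀ y ∈ S 1, G.Adj x y ↔ G12.Adj (e t) (e 1) := by
      intro t ht x hx y hy
      obtain rfl := mem_singleton.1 hy
      rw [(so t ht x hx).2.2.2, (B0 t ht).2]
    have m01 : ∀ x ∈ S 0, ∀ y ∈ S 1, G.Adj x y ↔ G12.Adj (e 0) (e 1) := by
      intro x hx y hy
      obtain rfl := mem_singleton.1 hx
      obtain rfl := mem_singleton.1 hy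
      exact iff_of_true hij B2
    have low : ∀ t : Fin 5, t = 0 ∨ t = 1 ∨ 2 ≤ t := by decide
    intro s t
    rcases low s with rfl | rfl | hs <;> rcases low t with rfl | rfl | ht
    · intro x hx y hy
      obtain rfl := mem_singleton.1 hx
      obtain rfl := mem_singleton.1 hy
      simp
    · exact m01
    · exact sym _ _ (m0 t ht)
    · exact sym _ _ m01
    · intro x hx y hy
      obtain rfl := mem_singleton.1 hx
      obtain rfl := mem_singleton.1 hy
      simp
    · exact sym _ _ (m1 t ht)
    · exact m0 s hs
    · exact m1 s hs
    · intro x hx y hy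
      have a := so s hs x hx
      have b := so t ht y hy
      exact iff_of_false (out_nadj h a.1 a.2.1 b.1 b.2.1) (B1 s t hs ht)
  · intro t
    fin_cases t
    · exact (card_singleton _).trans (by decide)
    · exact (card_singleton _).trans (by decide)
    · exact c1.trans (by decide)
    · exact c2.trans (by decide)
    · exact h3.trans (by decide)

lemma iso_G11 (hp : (nb G u).card = 2) (hq : (nb G v).card = 2)
    (h1 : (Out G u v).card = 3) (h2 : (Out G v u).card = 3)
    (h3 : (Out G u v ∩ Out G v u).card = 1) : Nonempty (G ≃g G11) := by
  have o1 : ∀ {u v : V} (h : P.dot u v = 0), (nb G u).card = 2 → (nb G v).card = 2 →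
      (Out G u v).card = 3 → ∀ k, G.Adj u k → cn G k u = 1 ∧ cn G k v = 1 := by
    intro u v h hp hq h1 k hk
    have := orth_opt h (hp.trans hq.symm) hk
    simp only at this
    omega
  have ex : ∀ {u : V}, (nb G u).card = 2 → (∀ k, G.Adj u k → cn G k u = 1) →
      ∃ x y, G.Adj x y ∧ nb G u = {x, y} := by
    intro u hp ho
    obtain ⟨x, y, hxy, e⟩ := card_eq_two.1 hp
    refine ⟨x, y, ?_, e⟩
    have hx : G.Adj u x := by rw [← mem_nb, e]; simp
    obtain ⟨w, hw⟩ := card_pos.1 (show 0 < (nb G x ∩ nb G u).card by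
      have := ho x hx; unfold cn at this; omega)
    rw [mem_inter, mem_nb, e] at hw
    simp only [mem_insert, mem_singleton] at hw
    rcases hw with ⟨h0, rfl | rfl⟩
    · exact absurd h0 (G.loopless.irrefl _)
    · exact h0
  obtain ⟨i1, i2, hi, eu⟩ := ex hp fun k hk => (o1 h hp hq h1 k hk).1
  obtain ⟨j, j', hj, ev⟩ := ex hq fun k hk => (o1 (orth_symm h) hq hp h2 k hk).1
  have ui : ∀ w, G.Adj u w ↔ w = i1 ∨ w = i2 := fun w => by rw [← mem_nb, eu]; simp
  -- number the neighbours of `v` in such a way that `i1` is adjacent to `j1`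
  obtain ⟨j1, j2, hj, ev, h11⟩ : ∃ j1 j2, G.Adj j1 j2 ∧ nb G v = {j1, j2} ∧ G.Adj i1 j1 := by
    obtain ⟨w, hw⟩ := card_pos.1 (show 0 < (nb G i1 ∩ nb G v).card by
      have := (o1 h hp hq h1 i1 ((ui i1).2 (Or.inl rfl))).2; unfold cn at this; omega)
    rw [mem_inter, mem_nb, ev] at hw
    simp only [mem_insert, mem_singleton] at hw
    rcases hw with ⟨h0, rfl | rfl⟩
    · exact ⟨_, _, hj, ev, h0⟩
    · exact ⟨_, _, hj.symm, by rw [ev, pair_comm], h0⟩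
  have vj : ∀ w, G.Adj v w ↔ w = j1 ∨ w = j2 := fun w => by rw [← mem_nb, ev]; simp
  have h12 : ¬ G.Adj i1 j2 := fun h0 => by
    have := (o1 h hp hq h1 i1 ((ui i1).2 (Or.inl rfl))).2
    exact hj.ne (card_le_one.1 this.le j1 (by simp [h11, vj]) j2 (by simp [h0, vj]))
  have h21 : ¬ G.Adj i2 j1 := fun h0 => by
    have := (o1 (orth_symm h) hq hp h2 j1 ((vj j1).2 (Or.inl rfl))).2
    exact hi.ne (card_le_one.1 this.le i1 (by simp [h11.symm, ui]) i2 (by simp [h0.symm, ui]))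
  have h22 : G.Adj i2 j2 := by
    obtain ⟨w, hw⟩ := card_pos.1 (show 0 < (nb G i2 ∩ nb G v).card by
      have := (o1 h hp hq h1 i2 ((ui i2).2 (Or.inr rfl))).2; unfold cn at this; omega)
    rw [mem_inter, mem_nb, mem_nb, vj] at hw
    rcases hw with ⟨h0, rfl | rfl⟩
    · exact absurd h0 h21
    · exact h0
  have c1 : (Out G u v \ Out G v u).card = 2 := by
    have := card_sdiff_add_card_inter (Out G u v) (Out G v u); omega
  have c2 : (Out G v u \ Out G u v).card = 2 := by
    have := card_sdiff_add_card_inter (Out G v u) (Out G u v); rw [inter_comm] at this; omega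
  let S : Fin 7 → Finset V := ![{i1}, {i2}, {j1}, {j2}, Out G u v \ Out G v u,
    Out G v u \ Out G u v, Out G u v ∩ Out G v u]
  let d : Fin 9 → Fin 7 := ![4, 4, 5, 5, 6, 0, 1, 3, 2]
  let e : Fin 7 → Fin 9 := ![5, 6, 8, 7, 0, 2, 4]
  let g : Fin 7 → V := ![i1, i2, j1, j2, i1, i1, i1]
  have low : ∀ t : Fin 7, 4 ≤ t ∨ t = 0 ∨ t = 1 ∨ t = 2 ∨ t = 3 := by decide
  have sg : ∀ t, ¬ 4 ≤ t → S t = {g t} := by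
    intro t ht
    rcases low t with h0 | rfl | rfl | rfl | rfl
    · exact absurd h0 ht
    all_goals rfl
  have so : ∀ t : Fin 7, 4 ≤ t → ∀ w ∈ S t, ¬ G.Adj u w ∧ ¬ G.Adj v w ∧
      ∀ b, ¬ 4 ≤ b → (G.Adj w (g b) ↔ G11.Adj (e t) (e b)) := by
    have a1 := (ui i1).2 (Or.inl rfl)
    have a2 := (ui i2).2 (Or.inr rfl)
    have a3 := (vj j1).2 (Or.inl rfl)
    have a4 := (vj j2).2 (Or.inr rfl)
    intro t ht w hw
    have ht' : t = 4 ∨ t = 5 ∨ t = 6 := by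
      revert ht; clear hw; revert t; decide
    rcases ht' with rfl | rfl | rfl
    · have m := out_only h hw
      refine ⟨m.1, m.2.1, fun b hb => ?_⟩
      rcases low b with h0 | rfl | rfl | rfl | rfl
      · exact absurd h0 hb
      · exact iff_of_true (m.2.2.1 _ a1) (by decide)
      · exact iff_of_true (m.2.2.1 _ a2) (by decide)
      · exact iff_of_false (m.2.2.2 _ a3) (by decide)
      · exact iff_of_false (m.2.2.2 _ a4) (by decide)
    · have m := out_only (orth_symm h) hw
      refine ⟨m.2.1, m.1, fun b hb => ?_⟩
      rcases low b with h0 | rfl | rfl | rfl | rfl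
      · exact absurd h0 hb
      · exact iff_of_false (m.2.2.2 _ a1) (by decide)
      · exact iff_of_false (m.2.2.2 _ a2) (by decide)
      · exact iff_of_true (m.2.2.1 _ a3) (by decide)
      · exact iff_of_true (m.2.2.1 _ a4) (by decide)
    · have m := out_both hw
      refine ⟨m.1, m.2.1, fun b hb => ?_⟩
      rcases low b with h0 | rfl | rfl | rfl | rfl
      · exact absurd h0 hb
      · exact iff_of_true (m.2.2.1 _ a1) (by decide)
      · exact iff_of_true (m.2.2.1 _ a2) (by decide)
      · exact iff_of_true (m.2.2.2 _ a3) (by decide)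
      · exact iff_of_true (m.2.2.2 _ a4) (by decide)
  have gg : ∀ s t, ¬ 4 ≤ s → ¬ 4 ≤ t → (G.Adj (g s) (g t) ↔ G11.Adj (e s) (e t)) := by
    intro s t hs ht
    rcases low s with h0 | rfl | rfl | rfl | rfl
    · exact absurd h0 hs
    all_goals
      rcases low t with h0 | rfl | rfl | rfl | rfl
      · exact absurd h0 ht
      all_goals first
        | exact iff_of_true ‹_› (by decide)
        | exact iff_of_false ‹_› (by decide)
        | exact iff_of_true (G.adj_symm ‹_›) (by decide)
        | exact iff_of_false (fun h0 => absurd (G.adj_symm h0) ‹_›) (by decide)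
        | exact iff_of_false (G.loopless.irrefl _) (by decide)
  have B1 : ∀ s t : Fin 7, 4 ≤ s → 4 ≤ t → ¬ G11.Adj (e s) (e t) := by decide
  refine iso_of_parts S d (fun s t => G11.Adj (e s) (e t)) ?_ ?_ (by decide) ?_ (by decide) (by decide)
  · intro x
    rcases out_cover h x with h0 | h0 | h0 | h0 | h0
    · rcases (ui x).1 h0 with rfl | rfl
      · exact ⟨0, mem_singleton_self _⟩
      · exact ⟨1, mem_singleton_self _⟩
    · rcases (vj x).1 h0 with rfl | rfl
      · exact ⟨2, mem_singleton_self _⟩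
      · exact ⟨3, mem_singleton_self _⟩
    · exact ⟨4, h0⟩
    · exact ⟨5, h0⟩
    · exact ⟨6, h0⟩
  · intro s t x hx y hy
    by_cases hs : 4 ≤ s <;> by_cases ht : 4 ≤ t
    · have a := so s hs x hx
      have b := so t ht y hy
      exact iff_of_false (out_nadj h a.1 a.2.1 b.1 b.2.1) (B1 s t hs ht)
    · rw [sg t ht, mem_singleton] at hy
      rw [hy]
      exact (so s hs x hx).2.2 t ht
    · rw [sg s hs, mem_singleton] at hx
      rw [hx, G.adj_comm, G11.adj_comm]
      exact (so t ht y hy).2.2 s hs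
    · rw [sg t ht, mem_singleton] at hy
      rw [sg s hs, mem_singleton] at hx
      rw [hx, hy]
      exact gg s t hs ht
  · intro t
    rcases low t with h0 | rfl | rfl | rfl | rfl
    · have ht' : t = 4 ∨ t = 5 ∨ t = 6 := by revert h0; revert t; decide
      rcases ht' with rfl | rfl | rfl
      · exact c1.trans (by decide)
      · exact c2.trans (by decide)
      · exact h3.trans (by decide)
    all_goals exact (card_singleton _).trans (by decide)

/-- Here N(u) consists of two adjacent vertices. Every vertex of N(v) sees both or neither of them,
so their closed neighbourhoods agree. -/
lemma orth_lt_closed (hlt : (nb G u).card < (nb G v).card) {i j : V} (hi : G.Adj u i)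
    (hj : G.Adj v j) (hij : G.Adj i j) (hp : (nb G u).card = 2) (ha : cn G i u = 1) : False := by
  obtain ⟨-, -, -, h4⟩ := orth_lt_main h hlt hi hj hij
  obtain ⟨k, hk⟩ := card_pos.1 (show 0 < (nb G i ∩ nb G u).card by unfold cn at ha; omega)
  simp only [mem_inter, mem_nb] at hk
  have two : ∀ w, G.Adj u w → w = i ∨ w = k := by
    intro w hw
    by_contra hn
    push Not at hn
    have : ({i, k, w} : Finset V) ⊆ nb G u := by
      intro x; simp only [mem_insert, mem_singleton, mem_nb]; rintro (rfl | rfl | rfl) <;> tauto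
    have := card_le_card this
    rw [card_eq_three.2 ⟨i, k, w, hk.1.ne, hn.1.symm, hn.2.symm, rfl⟩] at this
    omega
  have key : ∀ x y, G.Adj u x → G.Adj u y → (∀ w, G.Adj u w → w = x ∨ w = y) →
      nb G x \ {y} ⊆ nb G y \ {x} := by
    intro x y hx hy hxy w hw
    simp only [mem_sdiff, mem_nb, mem_singleton] at hw ⊢
    have hwx : w ≠ x := fun h0 => by subst h0; exact G.loopless.irrefl _ hw.1
    refine ⟨?_, hwx⟩
    by_cases h1 : G.Adj u w
    · exact absurd (hxy w h1) (by tauto)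
    by_cases h2 : G.Adj v w
    · rcases h4 w h2 with h0 | h0
      · rw [cn, card_eq_zero, eq_empty_iff_forall_notMem] at h0
        exact absurd (mem_inter.2 ⟨mem_nb.2 hw.1.symm, mem_nb.2 hx⟩) (h0 x)
      · exact (mem_nb.1 (subset_of_cn h0 (mem_nb.2 hy))).symm
    · exact (orth_out_iff h hy h1 h2).2 ((orth_out_iff h hx h1 h2).1 hw.1)
  exact P.not_closed_twins hk.1 (key i k hi hk.2 two)
    (key k i hk.2 hi fun w hw => (two w hw).symm)

/-- By `orth_lt_main`, every vertex of N(v) has exactly one partner nonadjacent to it in N(v), and i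
sees exactly one vertex of each pair of partners. -/
lemma orth_lt_param (hlt : (nb G u).card < (nb G v).card) {i j : V} (hi : G.Adj u i)
    (hj : G.Adj v j) (hij : G.Adj i j) :
    ∃ (k : ℕ) (g : Fin k × Fin 2 → V), Function.Injective g ∧
      (∀ w, w ∈ nb G v ↔ ∃ x, g x = w) ∧ (nb G v).card = k * 2 ∧
      (∀ x y, G.Adj (g x) (g y) ↔ x.1 ≠ y.1) ∧ (∀ x, G.Adj i (g x) ↔ x.2 = 0) ∧
      cn G i v = k := by
  obtain ⟨-, h2, h3, -⟩ := orth_lt_main h hlt hi hj hij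
  have c1 : ∀ x ∈ nb G v, ((nb G v).filter fun y => y ≠ x ∧ ¬ G.Adj x y).card = 1 := by
    intro x hx
    have hx' := mem_nb.1 hx
    have e : ((nb G v).filter fun y => y ≠ x ∧ ¬ G.Adj x y) = (nb G v \ nb G x).erase x := by
      ext y; simp only [mem_filter, mem_erase, mem_sdiff, mem_nb]; tauto
    rw [e, card_erase_of_mem (by simp [hx'])]
    have := card_sdiff_add_card_inter (nb G v) (nb G x)
    rw [inter_comm] at this
    change _ + cn G x v = _ at this
    have := h2 x hx'
    omega
  have c2 : ∀ x, G.Adj v x → ∃ z, (nb G i ∩ nb G v) \ nb G x = {z} := fun x hx => by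
    rw [← card_eq_one]
    have := card_sdiff_add_card_inter (nb G i ∩ nb G v) (nb G x)
    have h3 := h3 x hx
    unfold cn at h3
    omega
  obtain ⟨k, g, g1, g2, g3, g4, g5⟩ := cp_param (G := G) (C := nb G v) (fun x => G.Adj i x) c1 (by
    intro x hx y hy hxy hn
    have hx' := mem_nb.1 hx
    obtain ⟨z, hz⟩ := c2 x hx'
    have mz : ∀ w, (G.Adj i w ∧ G.Adj v w ∧ ¬ G.Adj x w) ↔ w = z := fun w => by
      have := congrArg (w ∈ ·) hz
      simpa [and_assoc] using this
    constructor
    · intro hiy hix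
      have := (mz x).1 ⟨hix, hx', G.loopless.irrefl x⟩
      have := (mz y).1 ⟨hiy, mem_nb.1 hy, hn⟩
      exact hxy (by simp [*])
    · intro hix
      have hz' := (mz z).2 rfl
      have : z = y := by
        have hzx : z ≠ x := by rintro rfl; exact hix hz'.1
        exact card_le_one.1 (c1 x hx).le z (by simp [hz', hzx]) y (by
          rw [mem_filter]; exact ⟨hy, hxy, hn⟩)
      rw [← this]; exact hz'.1)
  refine ⟨k, g, g1, g2, g3, g4, g5, ?_⟩
  have : nb G i ∩ nb G v = univ.image fun a : Fin k => g (a, 0) := by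
    ext w
    simp only [mem_inter, mem_image, mem_univ, true_and]
    constructor
    · rintro ⟨hw1, hw2⟩
      obtain ⟨⟨a, c⟩, rfl⟩ := (g2 w).1 hw2
      have := (g5 _).1 (mem_nb.1 hw1)
      simp only at this
      subst this
      exact ⟨a, rfl⟩
    · rintro ⟨a, rfl⟩
      exact ⟨mem_nb.2 ((g5 _).2 rfl), (g2 _).2 ⟨_, rfl⟩⟩
  rw [cn, this, card_image_of_injective _ fun a b hab => (Prod.ext_iff.1 (g1 hab)).1, card_univ,
    Fintype.card_fin]

/-- Inserting deg v = 2k and cn i v = k into `orth_eq` leaves p(2a + k + 2σ) = 2(a + 2)². If i sees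
all other vertices of N(u), then a + 1 divides 2, and a = 1 is excluded by `orth_lt_closed`.
Otherwise p ≥ a + 2 and the left side is too large. -/
lemma orth_lt_num (hlt : (nb G u).card < (nb G v).card) {i j : V} (hi : G.Adj u i)
    (hj : G.Adj v j) (hij : G.Adj i j) : (nb G u).card = 1 ∧
      (((Out G u v).card = 3 ∧ (nb G v).card = 4) ∨ ((Out G u v).card = 2 ∧ (nb G v).card = 8)) := by
  obtain ⟨k, g, -, -, g3, -, -, g6⟩ := orth_lt_param h hlt hi hj hij
  have cl := orth_lt_closed h hlt hi hj hij
  have γ1 := (orth_lt_main h hlt hi hj hij).1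
  have g := inter_lt h
  have e := orth_eq h hi
  have la := cn_lt hi
  rw [g3, g6] at e
  rw [g3] at hlt ⊢
  generalize (nb G u).card = p at *
  generalize (Out G u v).card = σ at *
  generalize cn G i u = a at *
  have hk : 0 < k := by omega
  have e1 : p * (2 * a + k + 2 * σ) = 2 * (a + 2) ^ 2 := by
    apply Nat.eq_of_mul_eq_mul_left hk
    zify at e ⊢
    linear_combination e
  obtain ⟨J, rfl⟩ := Nat.exists_eq_add_of_le la
  obtain ⟨t, rfl⟩ := Nat.exists_eq_add_of_le (show 2 ≤ σ by omega)
  rcases Nat.eq_zero_or_pos J with rfl | hJ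
  · have e2 : (a + 1) * k + (a + 1) * (2 * t) = 2 * (a + 1) + 2 := by
      zify at e1 ⊢; linear_combination e1
    have e3 : (a + 1) ∣ 2 := by
      have : (a + 1) ∣ 2 * (a + 1) + 2 := ⟨k + 2 * t, by rw [← e2]; ring⟩
      exact (Nat.dvd_add_right ⟨2, by ring⟩).1 this
    have := Nat.le_of_dvd (by norm_num) e3
    have ha : a = 0 ∨ a = 1 := by omega
    rcases ha with rfl | rfl
    · omega
    · exact (cl rfl rfl).elim
  · exfalso
    have : (a + 1 + J) * (2 * a + k + 2 * (2 + t)) ≥ (a + 2) * (2 * a + 1 + 2 * 2) := by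
      apply Nat.mul_le_mul <;> omega
    rw [e1] at this
    nlinarith

end orth
end PD
end TwoEig
end

/-! ### The tails, and the end of the classification. -/

section
open scoped Classical
namespace TwoEig
open Finset

namespace PD

variable {V : Type*} [Fintype V] {G : SimpleGraph V} {r s : ℝ} {P : PD G r s}

section orth
variable {u v : V} (h : P.dot u v = 0)
include h

lemma iso_tail (hlt : (nb G u).card < (nb G v).card) {i j : V} (hi : G.Adj u i)
    (hj : G.Adj v j) (hij : G.Adj i j) (hp : (nb G u).card = 1) {α k : ℕ}
    (hα : (Out G u v).card = α + 1) (hk : (nb G v).card = k * 2) :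
    Nonempty (G ≃g tail α k) := by
  obtain ⟨k', g, g1, g2, g3, g4, g5, -⟩ := orth_lt_param h hlt hi hj hij
  obtain rfl : k' = k := by omega
  have γ1 := (orth_lt_main h hlt hi hj hij).1
  have hσ := orth_lt_one h hlt hi hj hij
  have eu : nb G u = {i} := (eq_of_subset_of_card_le (by simpa using hi) (by simp [hp])).symm
  have ui : ∀ w, G.Adj u w ↔ w = i := fun w => by rw [← mem_nb, eu, mem_singleton]
  have vi : ¬ G.Adj v i := fun h0 => orth_ndisj h hi h0
  obtain ⟨y, hy⟩ := card_eq_one.1 γ1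
  have my := out_both (show y ∈ Out G u v ∩ Out G v u by rw [hy]; simp)
  have mv : v ∈ Out G v u \ Out G u v := by
    rw [mem_sdiff]
    refine ⟨self_mem_Out (orth_symm h), fun h0 => ?_⟩
    exact vi (mem_nb.1 ((mem_Out.1 h0).2.2 (mem_nb.2 hi)))
  have ev : Out G v u \ Out G u v = {v} := by
    refine (eq_of_subset_of_card_le (by simpa using mv) ?_).symm
    have := card_sdiff_add_card_inter (Out G v u) (Out G u v)
    rw [inter_comm] at this
    rw [card_singleton]; omega
  have cl : (Out G u v \ Out G v u).card = α := by
    have := card_sdiff_add_card_inter (Out G u v) (Out G v u); omega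
  let e := ((Out G u v \ Out G v u).equivFinOfCardEq cl).symm
  have ml : ∀ a, (e a : V) ∈ Out G u v \ Out G v u := fun a => (e a).2
  have ol := fun a => out_only h (ml a)
  have mg : ∀ x, G.Adj v (g x) := fun x => mem_nb.1 ((g2 _).2 ⟨x, rfl⟩)
  have yi : G.Adj y i := my.2.2.1 i hi
  have yv : ¬ G.Adj y v := fun h0 => my.2.1 h0.symm
  have li : ∀ a, G.Adj (e a) i := fun a => (ol a).2.2.1 i hi
  have ly : ∀ a, ¬ G.Adj (e a) y := fun a =>
    out_nadj h (ol a).1 (ol a).2.1 my.1 my.2.1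
  have lv : ∀ a, ¬ G.Adj (e a) v := fun a h0 => (ol a).2.1 h0.symm
  have ll : ∀ a b, ¬ G.Adj (e a : V) (e b) := fun a b =>
    out_nadj h (ol a).1 (ol a).2.1 (ol b).1 (ol b).2.1
  have lg : ∀ a x, ¬ G.Adj (e a : V) (g x) := fun a x => (ol a).2.2.2 _ (mg x)
  have yg : ∀ x, G.Adj y (g x) := fun x => my.2.2.2 _ (mg x)
  -- The vertex i plays the role of w in `tail`; the α leaves are the vertices of `Out G u v`
  -- outside `Out G v u`, among them u.
  let m : Fin 3 → V := ![i, y, v]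
  have three : ∀ t : Fin 3, t = 0 ∨ t = 1 ∨ t = 2 := by decide
  have mgm : ∀ x t, G.Adj (g x) (m t) ↔ (t = 0 → x.2 = 0) := by
    intro x t
    rcases three t with rfl | rfl | rfl
    · rw [G.adj_comm]; exact (g5 x).trans (by simp)
    · exact iff_of_true (yg x).symm fun h0 => absurd h0 (by decide)
    · exact iff_of_true (mg x).symm fun h0 => absurd h0 (by decide)
  have mml : ∀ a t, G.Adj (e a : V) (m t) ↔ t = 0 := by
    intro a t
    rcases three t with rfl | rfl | rfl
    · exact iff_of_true (li a) rfl
    · exact iff_of_false (ly a) (by decide)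
    · exact iff_of_false (lv a) (by decide)
  have mm : ∀ t t', G.Adj (m t) (m t') ↔ (t = 0 ∧ t' = 1) ∨ (t = 1 ∧ t' = 0) := by
    intro t t'
    rcases three t with rfl | rfl | rfl <;> rcases three t' with rfl | rfl | rfl
    · exact iff_of_false (G.loopless.irrefl _) (by decide)
    · exact iff_of_true yi.symm (by decide)
    · exact iff_of_false (fun h0 => vi h0.symm) (by decide)
    · exact iff_of_true yi (by decide)
    · exact iff_of_false (G.loopless.irrefl _) (by decide)
    · exact iff_of_false yv (by decide)
    · exact iff_of_false vi (by decide)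
    · exact iff_of_false (fun h0 => yv h0.symm) (by decide)
    · exact iff_of_false (G.loopless.irrefl _) (by decide)
  have vm : ∀ t, ¬ G.Adj v (m t) := by
    intro t
    rcases three t with rfl | rfl | rfl
    · exact vi
    · exact my.2.1
    · exact G.loopless.irrefl v
  have im : Function.Injective m := by
    have iy : i ≠ y := fun h0 => by rw [h0] at yi; exact G.loopless.irrefl _ yi
    have iv : i ≠ v := fun h0 => orth_nadj h (h0 ▸ hi)
    have yv' : y ≠ v := fun h0 => vi (by rw [← h0]; exact yi)
    intro a b hab
    rcases three a with rfl | rfl | rfl <;> rcases three b with rfl | rfl | rfl <;>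
      first
      | rfl
      | exact absurd hab iy
      | exact absurd hab iv
      | exact absurd hab yv'
      | exact absurd hab.symm iy
      | exact absurd hab.symm iv
      | exact absurd hab.symm yv'
  refine iso_of_bij (Sum.elim g (Sum.elim m fun a => e a)) ?_ ?_ ?_
  · refine g1.sumElim (im.sumElim (fun a b hab => e.injective (Subtype.ext hab)) ?_) ?_
    · intro t a h0
      rcases three t with rfl | rfl | rfl
      · have h1 : i = e a := h0
        have := li a
        rw [← h1] at this
        exact G.loopless.irrefl i this
      · have h1 : y = e a := h0
        have := (mem_sdiff.1 (ml a)).2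
        rw [← h1] at this
        exact this (mem_inter.1 (show y ∈ Out G u v ∩ Out G v u by rw [hy]; simp)).2
      · have h1 : v = e a := h0
        have := (mem_sdiff.1 (ml a)).2
        rw [← h1] at this
        exact this (self_mem_Out (orth_symm h))
    · rintro x (t | a) h0
      · have h1 : g x = m t := h0
        exact vm t (h1 ▸ mg x)
      · have h1 : g x = e a := h0
        exact (ol a).2.1 (h1 ▸ mg x)
  · intro w
    rcases out_cover h w with h0 | h0 | h0 | h0 | h0
    · exact ⟨.inr (.inl 0), ((ui w).1 h0).symm⟩
    · obtain ⟨x, hx⟩ := (g2 w).1 (mem_nb.2 h0)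
      exact ⟨.inl x, hx⟩
    · exact ⟨.inr (.inr (e.symm ⟨w, h0⟩)), by simp⟩
    · rw [ev, mem_singleton] at h0
      exact ⟨.inr (.inl 2), h0.symm⟩
    · rw [hy, mem_singleton] at h0
      exact ⟨.inr (.inl 1), h0.symm⟩
  · rintro (x | t | a) (y' | t' | b)
    · exact (g4 x y').symm
    · exact (mgm x t').symm
    · exact iff_of_false id fun h0 => lg b x h0.symm
    · exact ((G.adj_comm _ _).trans (mgm y' t)).symm
    · exact (mm t t').symm
    · exact ((G.adj_comm _ _).trans (mml b t)).symm
    · exact iff_of_false id (lg a y')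
    · exact (mml a t').symm
    · exact iff_of_false id (ll a b)

lemma classify_orth : Nonempty (G ≃g G3) ∨ (∃ k, 2 ≤ k ∧ Nonempty (G ≃g G4 k)) ∨
    (∃ k l, 2 ≤ k ∧ 2 ≤ l ∧ Nonempty (G ≃g G5 k l)) ∨ Nonempty (G ≃g G11) ∨
    Nonempty (G ≃g G12) ∨ Nonempty (G ≃g tail 2 2) ∨ Nonempty (G ≃g tail 1 4) := by
  by_cases hE : ∀ i j, G.Adj u i → G.Adj v j → ¬ G.Adj i j
  · rcases noedge_iso h hE with h1 | h1 | h1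
    · exact Or.inl h1
    · exact Or.inr (Or.inl h1)
    · exact Or.inr (Or.inr (Or.inl h1))
  push Not at hE
  obtain ⟨i, j, hi, hj, hij⟩ := hE
  have lt : ∀ {u v i j : V} (h : P.dot u v = 0), (nb G u).card < (nb G v).card → G.Adj u i →
      G.Adj v j → G.Adj i j → Nonempty (G ≃g tail 2 2) ∨ Nonempty (G ≃g tail 1 4) := by
    intro u v i j h hlt hi hj hij
    obtain ⟨hp, ⟨h1, h2⟩ | ⟨h1, h2⟩⟩ := orth_lt_num h hlt hi hj hij
    · exact Or.inl (iso_tail h hlt hi hj hij hp h1 h2)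
    · exact Or.inr (iso_tail h hlt hi hj hij hp h1 h2)
  rcases lt_trichotomy (nb G u).card (nb G v).card with h0 | h0 | h0
  · exact Or.inr (Or.inr (Or.inr (Or.inr (Or.inr (lt h h0 hi hj hij)))))
  · rcases orth_eqdeg h h0 hi hj hij with ⟨o1, o2, o3, o4⟩ | ⟨o1, o2, o3, o4⟩
    · refine Or.inr (Or.inr (Or.inr (Or.inr (Or.inl ?_))))
      exact iso_G12 h (i := i) (j := j)
        (eq_of_subset_of_card_le (by simpa using hi) (by simp [o1])).symm
        (eq_of_subset_of_card_le (by simpa using hj) (by simp [← h0, o1])).symm hij o2 o3 o4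
    · exact Or.inr (Or.inr (Or.inr (Or.inl (iso_G11 h o1 (h0 ▸ o1) o2 o3 o4))))
  · exact Or.inr (Or.inr (Or.inr (Or.inr (Or.inr (lt (orth_symm h) h0 hj hi hij.symm)))))

end orth

/-- The graphs with two positive eigenvalues. -/
theorem classify (P : PD G r s) :
    (Nonempty (G ≃g G3) ∨ (∃ k, 2 ≤ k ∧ Nonempty (G ≃g G4 k)) ∨
    (∃ k l, 2 ≤ k ∧ 2 ≤ l ∧ Nonempty (G ≃g G5 k l)) ∨ Nonempty (G ≃g G11) ∨
    Nonempty (G ≃g G12) ∨ Nonempty (G ≃g tail 2 2) ∨ Nonempty (G ≃g tail 1 4)) ∨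
    (∃ k, 1 ≤ k ∧ Nonempty (G ≃g halfJoin 3 k)) ∨
    (∃ k l, 1 ≤ k ∧ 1 ≤ l ∧ Nonempty (G ≃g G8 k l)) ∨
    (∃ k, 3 ≤ k ∧ Nonempty (G ≃g prism k)) ∨ Nonempty (G ≃g halfCone 7) ∨
    ∀ x y z, ¬ G.Adj x y → ¬ G.Adj y z → ¬ G.Adj x z := by
  have nn : ∀ x y, 0 ≤ P.dot x y := fun x y => by
    unfold dot; rw [P.gram]; split_ifs <;> positivity
  by_cases h : ∃ u v, P.dot u v = 0
  · obtain ⟨u, v, h⟩ := h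
    exact Or.inl (classify_orth h)
  push Not at h
  have hpos : ∀ x y, 0 < P.dot x y := fun x y => lt_of_le_of_ne (nn x y) (h x y).symm
  right
  by_cases hc : ∃ x y, P.Cross x y
  · obtain ⟨x, y, hc⟩ := hc
    rcases classify_pos hpos hc with h1 | h1 | h1 | h1
    · exact Or.inl h1
    · exact Or.inr (Or.inl h1)
    · exact Or.inr (Or.inr (Or.inl h1))
    · exact Or.inr (Or.inr (Or.inr (Or.inl h1)))
  -- Without crossing pairs, nonadjacent vertices have equal neighbourhoods, so nonadjacency is
  -- transitive.
  · refine Or.inr (Or.inr (Or.inr (Or.inr ?_)))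
    push Not at hc
    have tw : ∀ x y, ¬ G.Adj x y → nb G x = nb G y := fun x y hxy =>
      P.nb_eq hxy (P.same_of_cr hxy (by
        by_contra h0
        exact hc x y ⟨hxy, h0⟩))
    intro x y z h1 h2 h3
    rw [← mem_nb, tw x y h1, mem_nb] at h3
    exact h2 h3

end PD
end TwoEig
end

/-! ### Spectra, eigenbases, and the number of positive eigenvalues. -/

section
open scoped Classical
namespace TwoEig
open Finset

/-- An orthonormal basis of eigenvectors `e k` with eigenvalues `l k`. -/
structure Eigenbasis {V : Type*} [Fintype V] (G : SimpleGraph V) (l : V → ℝ) (e : V → V → ℝ) :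
    Prop where
  spec : adjSpectrum G = univ.val.map l
  complete : ∀ i j, ∑ k, e k i * e k j = if i = j then 1 else 0
  orth : ∀ k m, ∑ i, e k i * e m i = if k = m then 1 else 0
  eig : ∀ k i, ∑ j ∈ nb G i, e k j = l k * e k i

lemma exists_eigenbasis {V : Type*} [Fintype V] (G : SimpleGraph V) :
    ∃ (l : V → ℝ) (e : V → V → ℝ), Eigenbasis G l e := by
  have hA : (G.adjMatrix ℝ).IsHermitian := by
    rw [Matrix.IsHermitian, Matrix.conjTranspose_eq_transpose_of_trivial]
    exact G.isSymm_adjMatrix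
  have o2 : ∀ k m, ∑ i, hA.eigenvectorBasis k i * hA.eigenvectorBasis m i = if k = m then 1 else 0 := by
    intro k m
    have := orthonormal_iff_ite.1 hA.eigenvectorBasis.orthonormal k m
    rw [← this, PiLp.inner_apply]
    simp [mul_comm]
  refine ⟨hA.eigenvalues, fun k i => hA.eigenvectorBasis k i, ?_, ?_, o2, ?_⟩
  · unfold adjSpectrum
    rw [hA.roots_charpoly_eq_eigenvalues]
    simp
  · let M : Matrix V V ℝ := Matrix.of fun k i => hA.eigenvectorBasis k i
    have h1 : M * M.transpose = 1 := by
      ext k m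
      rw [Matrix.mul_apply, Matrix.one_apply]
      simpa [M] using o2 k m
    -- The rows of the square matrix of eigenvectors are orthonormal, hence so are its columns.
    have h2 := mul_eq_one_comm.1 h1
    intro i j
    have := congrFun (congrFun h2 i) j
    rw [Matrix.mul_apply, Matrix.one_apply] at this
    simpa [M] using this
  · intro k i
    have := congrFun (hA.mulVec_eigenvectorBasis k) i
    rw [SimpleGraph.adjMatrix_mulVec_apply] at this
    simp only [Pi.smul_apply, smul_eq_mul] at this
    rw [← this]
    apply sum_congr _ fun _ _ => rfl
    ext; simp

lemma card_adjSpectrum {V : Type*} [Fintype V] (G : SimpleGraph V) :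
    (adjSpectrum G).card = Fintype.card V := by
  obtain ⟨l, e, h⟩ := exists_eigenbasis G
  rw [h.spec, Multiset.card_map]; rfl

lemma adjSpectrum_iso {V W : Type*} [Fintype V] [Fintype W] {G : SimpleGraph V}
    {H : SimpleGraph W} (f : G ≃g H) : adjSpectrum G = adjSpectrum H := by
  unfold adjSpectrum
  have : Matrix.reindex f.toEquiv f.toEquiv (G.adjMatrix ℝ) = H.adjMatrix ℝ := by
    ext i j
    have : G.Adj (f.toEquiv.symm i) (f.toEquiv.symm j) ↔ H.Adj i j := by
      rw [← f.map_rel_iff]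
      exact iff_of_eq (congrArg₂ _ (f.toEquiv.apply_symm_apply i) (f.toEquiv.apply_symm_apply j))
    rw [Matrix.reindex_apply, Matrix.submatrix_apply, SimpleGraph.adjMatrix_apply,
      SimpleGraph.adjMatrix_apply]
    exact if_congr this rfl rfl
  rw [← Matrix.charpoly_reindex f.toEquiv, this]

lemma adjSpectrum_sum {V W : Type*} [Fintype V] [Fintype W] (G : SimpleGraph V)
    (H : SimpleGraph W) : adjSpectrum (SimpleGraph.sum G H) = adjSpectrum G + adjSpectrum H := by
  unfold adjSpectrum
  rw [← Polynomial.roots_mul (mul_ne_zero (Matrix.charpoly_monic _).ne_zero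
    (Matrix.charpoly_monic _).ne_zero), ← Matrix.charpoly_fromBlocks_zero₁₂ _ 0]
  congr 1
  unfold Matrix.charpoly Matrix.charmatrix
  congr 1
  ext (i | i) (j | j) <;> simp [Matrix.diagonal_apply]

lemma adjSpectrum_bot (V : Type*) [Fintype V] :
    adjSpectrum (⊥ : SimpleGraph V) = Multiset.replicate (Fintype.card V) 0 := by
  unfold adjSpectrum
  have : @SimpleGraph.adjMatrix ℝ V ⊥ (fun _ _ => Classical.propDecidable _) _ _ = 0 := by
    ext; simp
  rw [this, Matrix.charpoly_zero, Polynomial.roots_X_pow]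
  simp [Multiset.nsmul_singleton]

/-- The vertices that are not isolated. -/
abbrev core {V : Type*} (H : SimpleGraph V) : SimpleGraph {v : V // ∃ w, H.Adj v w} :=
  H.comap Subtype.val

lemma core_noiso {V : Type*} (H : SimpleGraph V) (v : {v : V // ∃ w, H.Adj v w}) :
    ∃ w, (core H).Adj v w := by
  obtain ⟨v, w, hw⟩ := v
  exact ⟨⟨w, v, hw.symm⟩, hw⟩

lemma core_iso {V : Type*} (H : SimpleGraph V) : Nonempty
    (H ≃g SimpleGraph.sum (core H) (⊥ : SimpleGraph {v : V // ¬ ∃ w, H.Adj v w})) := by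
  refine iso_of_bij (Equiv.sumCompl fun v => ∃ w, H.Adj v w) (Equiv.injective _)
    (Equiv.surjective _) ?_
  rintro (x | x) (y | y)
  · simp
  · exact iff_of_false (by simp) fun h => y.2 ⟨_, h.symm⟩
  · exact iff_of_false (by simp) fun h => x.2 ⟨_, h⟩
  · exact iff_of_false (by simp) fun h => x.2 ⟨_, h⟩

namespace Eigenbasis

variable {V : Type*} [Fintype V] {G : SimpleGraph V} {l : V → ℝ} {e : V → V → ℝ}

lemma first (h : Eigenbasis G l e) (i j : V) :
    ∑ k, l k * e k i * e k j = if G.Adj i j then 1 else 0 := by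
  simp_rw [← h.eig, sum_mul]
  rw [sum_comm]
  simp_rw [h.complete]
  simp

lemma second (h : Eigenbasis G l e) (i j : V) :
    ∑ k, l k ^ 2 * e k i * e k j = (cn G i j : ℝ) := by
  have : ∀ k, l k ^ 2 * e k i * e k j = ∑ m ∈ nb G i, l k * e k m * e k j := fun k => by
    rw [← sum_mul, ← mul_sum, h.eig]; ring
  simp_rw [this]
  rw [sum_comm]
  simp_rw [h.first]
  rw [sum_boole, cn]
  congr 2
  ext w; simp [G.adj_comm]

/-- The spectral decomposition of A² + 2A, whose coefficients vanish at the eigenvalues 0 and -2. -/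
lemma gram (h : Eigenbasis G l e) (i j : V) : ∑ k, (l k ^ 2 + 2 * l k) * e k i * e k j =
    (cn G i j : ℝ) + if G.Adj i j then 2 else 0 := by
  have : ∀ k, (l k ^ 2 + 2 * l k) * e k i * e k j =
    l k ^ 2 * e k i * e k j + 2 * (l k * e k i * e k j) := fun k => by ring
  simp_rw [this]
  rw [sum_add_distrib, ← mul_sum, h.first, h.second]
  split_ifs <;> norm_num

lemma sum_eq (h : Eigenbasis G l e) (f : V → ℝ) : ∑ k, f k = ∑ i, ∑ k, f k * e k i * e k i := by
  rw [sum_comm]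
  refine sum_congr rfl fun k _ => ?_
  simp_rw [mul_assoc]
  rw [← mul_sum, h.orth, if_pos rfl, mul_one]

lemma sum_zero (h : Eigenbasis G l e) : ∑ k, l k = 0 := by
  rw [h.sum_eq]; simp [h.first]

lemma sum_sq (h : Eigenbasis G l e) : ∑ k, l k ^ 2 = ∑ i, ((nb G i).card : ℝ) := by
  rw [h.sum_eq]; simp [h.second, cn]

lemma ne_zero (h : Eigenbasis G l e) (k : V) : ∃ i, e k i ≠ 0 := by
  by_contra hn
  push Not at hn
  have := h.orth k k
  simp [hn] at this

lemma indep (h : Eigenbasis G l e) {k m : V} (hkm : k ≠ m) {c d : ℝ}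
    (h0 : ∀ i, c * e k i + d * e m i = 0) : c = 0 ∧ d = 0 := by
  constructor
  · have : ∑ i, (c * e k i + d * e m i) * e k i = 0 := by simp [h0]
    simp_rw [add_mul, mul_assoc] at this
    rw [sum_add_distrib, ← mul_sum, ← mul_sum, h.orth, h.orth] at this
    simpa [hkm.symm] using this
  · have : ∑ i, (c * e k i + d * e m i) * e m i = 0 := by simp [h0]
    simp_rw [add_mul, mul_assoc] at this
    rw [sum_add_distrib, ← mul_sum, ← mul_sum, h.orth, h.orth] at this
    simpa [hkm] using this

/-- The quadratic form of the adjacency matrix. -/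
lemma form (h : Eigenbasis G l e) {n : ℕ} (f : Fin n → V) (c : Fin n → ℝ) :
    ∑ k, l k * (∑ x, c x * e k (f x)) ^ 2 =
      ∑ x, ∑ y, c x * c y * if G.Adj (f x) (f y) then 1 else 0 := by
  simp_rw [← h.first, mul_sum, sq, sum_mul_sum, mul_sum]
  rw [sum_comm]
  refine sum_congr rfl fun x _ => ?_
  rw [sum_comm]
  exact sum_congr rfl fun y _ => sum_congr rfl fun k _ => by ring

lemma form_one (h : Eigenbasis G l e) {n : ℕ} (f : Fin n → V) (c : Fin n → ℝ) :
    ∑ k, (∑ x, c x * e k (f x)) ^ 2 = ∑ x, ∑ y, c x * c y * if f x = f y then 1 else 0 := by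
  simp_rw [← h.complete, mul_sum, sq, sum_mul_sum]
  rw [sum_comm]
  refine sum_congr rfl fun x _ => ?_
  rw [sum_comm]
  exact sum_congr rfl fun y _ => sum_congr rfl fun k _ => by ring

end Eigenbasis

/-- Nonadjacency is transitive. -/
def IsCM {V : Type*} (G : SimpleGraph V) : Prop :=
  ∀ x y z, ¬ G.Adj x y → ¬ G.Adj y z → ¬ G.Adj x z

/-- At most two eigenvalues differ from `-2` and `0`. -/
def AtMostTwo {V : Type*} [Fintype V] (G : SimpleGraph V) : Prop :=
  ((adjSpectrum G).filter fun x => x ≠ -2 ∧ x ≠ 0).card ≤ 2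

/-- The positive eigenvalues. -/
noncomputable def posSpec {V : Type*} [Fintype V] (G : SimpleGraph V) : Multiset ℝ :=
  (adjSpectrum G).filter fun x => 0 < x

section
variable {V : Type*} [Fintype V] {G : SimpleGraph V} {l : V → ℝ} {e : V → V → ℝ}

lemma Eigenbasis.card_filter (h : Eigenbasis G l e) (p : ℝ → Prop) [DecidablePred p] :
    ((adjSpectrum G).filter p).card = (univ.filter fun k => p (l k)).card := by
  rw [h.spec, Multiset.filter_map, Multiset.card_map]; rfl

lemma Eigenbasis.eq_of_pos (h : Eigenbasis G l e) (h2 : AtMostTwo G) {p q : V} (hpq : p ≠ q)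
    (hp : 0 < l p) (hq : 0 < l q) (k : V) (h1 : k ≠ p) (h3 : k ≠ q) : l k = -2 ∨ l k = 0 := by
  by_contra hn
  push Not at hn
  unfold AtMostTwo at h2
  rw [h.card_filter] at h2
  have : ({p, q, k} : Finset V) ⊆ univ.filter fun k => l k ≠ -2 ∧ l k ≠ 0 := by
    intro x
    simp only [mem_insert, mem_singleton, mem_filter, mem_univ, true_and]
    rintro (rfl | rfl | rfl)
    · exact ⟨by linarith, hp.ne'⟩
    · exact ⟨by linarith, hq.ne'⟩
    · exact hn
  have := card_le_card this
  rw [card_eq_three.2 ⟨p, q, k, hpq, h1.symm, h3.symm, rfl⟩] at this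
  omega

lemma Eigenbasis.posSpec_eq (h : Eigenbasis G l e) (h2 : AtMostTwo G) {p q : V} (hpq : p ≠ q)
    (hp : 0 < l p) (hq : 0 < l q) : posSpec G = {l p, l q} := by
  have : (univ.filter fun k => 0 < l k) = {p, q} := by
    ext k
    simp only [mem_filter, mem_univ, true_and, mem_insert, mem_singleton]
    constructor
    · intro hk
      by_contra hn
      push Not at hn
      rcases h.eq_of_pos h2 hpq hp hq k hn.1 hn.2 with h0 | h0 <;> linarith
    · rintro (rfl | rfl) <;> assumption
  have h3 : posSpec G = (univ.filter fun k => 0 < l k).val.map l := by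
    unfold posSpec; rw [h.spec, Multiset.filter_map]; rfl
  rw [h3, this, insert_val_of_notMem (by simpa using hpq)]
  simp

/-- Multiply the unit eigenvectors of the two positive eigenvalues by √(λ² + 2λ). As the trace is
zero, r + s is twice the multiplicity of -2. -/
lemma Eigenbasis.exists_PD (h : Eigenbasis G l e) (h2 : AtMostTwo G) (hi : ∀ v, ∃ w, G.Adj v w)
    {p q : V} (hpq : p ≠ q) (hp : 0 < l p) (hq : 0 < l q) : Nonempty (PD G (l p) (l q)) := by
  have sp : ∀ {x : ℝ}, 0 < x → √(x ^ 2 + 2 * x) * √(x ^ 2 + 2 * x) = x ^ 2 + 2 * x := fun hx =>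
    Real.mul_self_sqrt (by positivity)
  have sp0 : ∀ {x : ℝ}, 0 < x → √(x ^ 2 + 2 * x) ≠ 0 := fun hx => by positivity
  refine ⟨⟨fun i => √(l p ^ 2 + 2 * l p) * e p i, fun i => √(l q ^ 2 + 2 * l q) * e q i,
    ?_, ?_, ?_, ?_, ?_, hi, hp, hq, ?_⟩⟩
  · intro i j
    rw [← h.gram, sum_eq_add p q hpq (fun k _ hk => ?_) (by simp) (by simp)]
    · linear_combination e p i * e p j * sp hp + e q i * e q j * sp hq
    · rcases h.eq_of_pos h2 hpq hp hq k hk.1 hk.2 with h0 | h0 <;> rw [h0] <;> ring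
  · intro i; rw [← mul_sum, h.eig]; ring
  · intro i; rw [← mul_sum, h.eig]; ring
  · intro n f c
    have : ∀ x y, c x * c y * ((if G.Adj (f x) (f y) then 1 else 0) + (if f x = f y then 2 else 0))
        = c x * c y * (if G.Adj (f x) (f y) then 1 else 0) +
          2 * (c x * c y * if f x = f y then (1 : ℝ) else 0) := fun x y => by
      split_ifs <;> ring
    simp_rw [this, sum_add_distrib, ← mul_sum]
    rw [← h.form, ← h.form_one, mul_sum, ← sum_add_distrib]
    refine sum_nonneg fun k _ => ?_
    rw [← add_mul]
    refine mul_nonneg ?_ (sq_nonneg _)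
    by_cases h3 : k = p
    · subst h3; linarith
    by_cases h4 : k = q
    · subst h4; linarith
    rcases h.eq_of_pos h2 hpq hp hq k h3 h4 with h0 | h0 <;> linarith
  · refine ⟨(univ.filter fun k => l k = -2).card, ?_⟩
    have : ∀ k, l k = (if k = p then l p else 0) + (if k = q then l q else 0) +
        -2 * (if l k = -2 then 1 else 0) := by
      intro k
      by_cases h3 : k = p
      · subst h3; rw [if_pos rfl, if_neg hpq, if_neg (by linarith)]; ring
      by_cases h4 : k = q
      · subst h4; rw [if_neg h3, if_pos rfl, if_neg (by linarith)]; ring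
      rw [if_neg h3, if_neg h4]
      rcases h.eq_of_pos h2 hpq hp hq k h3 h4 with h0 | h0 <;> rw [h0] <;> norm_num
    have h0 := h.sum_zero
    rw [sum_congr rfl fun k _ => this k, sum_add_distrib, sum_add_distrib, ← mul_sum, sum_boole] at h0
    simp only [sum_ite_eq', mem_univ, if_true] at h0
    linarith
  · by_contra hn
    push Not at hn
    obtain ⟨i, hi0⟩ := h.ne_zero p
    have := (h.indep hpq (c := √(l q ^ 2 + 2 * l q) * e q i * √(l p ^ 2 + 2 * l p))
      (d := - (√(l p ^ 2 + 2 * l p) * e p i * √(l q ^ 2 + 2 * l q))) fun j => by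
      linear_combination - hn i j).2
    rw [neg_eq_zero] at this
    exact mul_ne_zero (mul_ne_zero (sp0 hp) hi0) (sp0 hq) this

/-- A graph that is not complete multipartite has two positive eigenvalues. -/
lemma Eigenbasis.two_pos (h : Eigenbasis G l e) (hi : ∀ v, ∃ w, G.Adj v w) (hc : ¬ IsCM G) :
    ∃ p q, p ≠ q ∧ 0 < l p ∧ 0 < l q := by
  unfold IsCM at hc
  push Not at hc
  obtain ⟨u, w, v, h1, h2, h3⟩ := hc
  obtain ⟨z, hz⟩ := hi w
  by_contra hn
  push Not at hn
  obtain ⟨k0, hk0⟩ : ∃ k0, ∀ k, k ≠ k0 → l k ≤ 0 := by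
    by_cases h0 : ∃ k, 0 < l k
    · obtain ⟨k, hk⟩ := h0; exact ⟨k, fun m hm => hn k m hm.symm hk⟩
    · push Not at h0; exact ⟨u, fun k _ => h0 k⟩
  -- On the plane spanned by the indicator vectors e_u + e_v and e_w + e_z/2 the form is 2c² + d² +
  -- εcd, where ε ≤ 2 counts the neighbours of z among u and v; it is positive definite. With at
  -- most one positive eigenvalue, some nonzero vector of this plane is orthogonal to its
  -- eigenvector, and there the form is at most 0.
  obtain ⟨c, d, hcd, h0⟩ : ∃ c d : ℝ, (c ≠ 0 ∨ d ≠ 0) ∧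
      c * (e k0 u + e k0 v) + d * (e k0 w + e k0 z / 2) = 0 := by
    by_cases h4 : e k0 u + e k0 v = 0
    · exact ⟨1, 0, by simp, by rw [h4]; ring⟩
    · exact ⟨-(e k0 w + e k0 z / 2), e k0 u + e k0 v, Or.inr h4, by ring⟩
  have hf := h.form ![u, v, w, z] ![c, c, d, d / 2]
  have neg : ∑ k, l k * (∑ x, ![c, c, d, d / 2] x * e k (![u, v, w, z] x)) ^ 2 ≤ 0 := by
    refine sum_nonpos fun k _ => ?_
    by_cases hk : k = k0
    · have : (∑ x, ![c, c, d, d / 2] x * e k (![u, v, w, z] x)) = 0 := by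
        rw [hk, ← h0]; simp [Fin.sum_univ_four]; ring
      rw [this]; simp
    · exact mul_nonpos_of_nonpos_of_nonneg (hk0 k hk) (sq_nonneg _)
  rw [hf] at neg
  have a1 : ¬ G.Adj w u := fun h0 => h1 h0.symm
  have a2 : ¬ G.Adj v w := fun h0 => h2 h0.symm
  simp only [Fin.sum_univ_four, Matrix.cons_val_zero, Matrix.cons_val_one, Matrix.cons_val,
    h1, h2, h3, h3.symm, hz, hz.symm, a1, a2, SimpleGraph.irrefl, if_true, if_false] at neg
  have pos : 0 < c ^ 2 + d ^ 2 := by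
    rcases hcd with h0 | h0 <;> positivity
  have c1 := G.adj_comm z u
  have c2 := G.adj_comm z v
  by_cases b1 : G.Adj u z <;> by_cases b2 : G.Adj v z <;>
    simp only [b1, b2, c1, c2, if_true, if_false] at neg <;> nlinarith [sq_nonneg (c + d / 2), sq_nonneg (2 * c + d), sq_nonneg c, sq_nonneg d]

/-- A complete multipartite graph has at most one positive eigenvalue. -/
lemma Eigenbasis.not_two_pos (h : Eigenbasis G l e) (hc : IsCM G) {p q : V} (hpq : p ≠ q)
    (hp : 0 < l p) (hq : 0 < l q) : False := by
  have tw : ∀ i j, ¬ G.Adj i j → nb G i = nb G j := fun i j hij => by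
    ext w
    rw [mem_nb, mem_nb, ← not_iff_not]
    exact ⟨hc j i w fun h0 => hij h0.symm, hc i j w hij⟩
  -- An eigenvector for λ > 0 is constant on classes, so λ plus the class size, times an entry, is
  -- the sum of all entries. Hence all entries have the same sign, and two such vectors are not
  -- orthogonal.
  have key : ∀ k, 0 < l k → ∀ i, (l k + ((nb G i)ᶜ.card : ℝ)) * e k i = ∑ j, e k j := by
    intro k hk i
    have h1 : ∑ j ∈ (nb G i)ᶜ, e k j = (nb G i)ᶜ.card * e k i := by
      rw [sum_congr rfl fun j hj => ?_, sum_const, nsmul_eq_mul]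
      have := tw i j (by simpa using hj)
      have e1 := h.eig k i
      have e2 := h.eig k j
      rw [this, e2] at e1
      exact mul_left_cancel₀ hk.ne' e1
    rw [← sum_add_sum_compl (nb G i), h1, h.eig]
    ring
  have d0 : ∀ k, 0 < l k → ∀ i, 0 < l k + ((nb G i)ᶜ.card : ℝ) := fun k hk i => by positivity
  have s0 : ∀ k, 0 < l k → ∑ j, e k j ≠ 0 := fun k hk h0 => by
    obtain ⟨i, hi⟩ := h.ne_zero k
    have := key k hk i
    rw [h0] at this
    exact mul_ne_zero (d0 k hk i).ne' hi this
  have o := h.orth p q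
  rw [if_neg hpq, sum_congr rfl fun i _ => show e p i * e q i = (∑ j, e p j) * (∑ j, e q j) *
    (1 / ((l p + ((nb G i)ᶜ.card : ℝ)) * (l q + ((nb G i)ᶜ.card : ℝ)))) by
      have d1 := (d0 p hp i).ne'
      have d2 := (d0 q hq i).ne'
      rw [← key p hp i, ← key q hq i]
      field_simp, ← mul_sum] at o
  refine mul_ne_zero (mul_ne_zero (s0 p hp) (s0 q hq)) (ne_of_gt ?_) o
  exact sum_pos (fun i _ => one_div_pos.2 (mul_pos (d0 p hp i) (d0 q hq i))) ⟨p, mem_univ p⟩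

end
end TwoEig
end

/-! ### Eigenvectors of the families and their 2 × 2 matrices. -/

section
open scoped Classical
namespace TwoEig
open Finset

/-- Two linearly independent eigenvectors for positive eigenvalues. -/
def EigPair {V : Type*} [Fintype V] (G : SimpleGraph V) (r s : ℝ) : Prop :=
  0 < r ∧ 0 < s ∧ ∃ a b : V → ℝ, (∀ i, ∑ j ∈ nb G i, a j = r * a i) ∧
    (∀ i, ∑ j ∈ nb G i, b j = s * b i) ∧ ∃ i j, a i * b j - b i * a j ≠ 0

lemma nb_iso_sum {V W : Type*} [Fintype V] [Fintype W] {G : SimpleGraph V} {H : SimpleGraph W}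
    (f : G ≃g H) (x : V → ℝ) (i : W) :
    ∑ j ∈ nb H i, x (f.symm j) = ∑ j ∈ nb G (f.symm i), x j := by
  refine sum_bij (fun j _ => f.symm j) (fun j hj => ?_) (fun _ _ _ _ h => f.symm.injective h)
    (fun j hj => ⟨f j, ?_, by simp⟩) fun _ _ => rfl
  · rw [mem_nb] at hj ⊢; exact f.symm.map_rel_iff.2 hj
  · rw [mem_nb] at hj ⊢
    have := f.map_rel_iff.2 hj
    simpa using this

lemma PD.eigPair {V W : Type*} [Fintype V] [Fintype W] {G : SimpleGraph V} {H : SimpleGraph W}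
    {r s : ℝ} (P : PD G r s) (h : Nonempty (G ≃g H)) : EigPair H r s := by
  obtain ⟨f⟩ := h
  refine ⟨P.rpos, P.spos, fun i => P.a (f.symm i), fun i => P.b (f.symm i), fun i => ?_,
    fun i => ?_, ?_⟩
  · rw [nb_iso_sum f P.a, P.eiga]
  · rw [nb_iso_sum f P.b, P.eigb]
  · obtain ⟨i, j, hij⟩ := P.nondeg
    exact ⟨f i, f j, by simpa using hij⟩

/-- The eigenvectors for eigenvalues other than `0` and `-2` are determined by two entries, and these form an
eigenvector of a `2 × 2` matrix. -/
def TwoBlock {V : Type*} [Fintype V] (G : SimpleGraph V) (c d : V → ℝ) (α β γ δ : ℝ) : Prop :=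
  ∀ θ : ℝ, θ ≠ 0 → θ + 2 ≠ 0 → ∀ x : V → ℝ, (∀ i, ∑ j ∈ nb G i, x j = θ * x i) →
    ∃ X Y, (∀ i, x i = c i * X + d i * Y) ∧ θ * X = α * X + β * Y ∧ θ * Y = γ * X + δ * Y

/-- The coordinates (X, Y) of the two independent eigenvectors are independent eigenvectors of the 2
× 2 matrix, which therefore has trace r + s and determinant rs. -/
lemma TwoBlock.data {V : Type*} [Fintype V] {G : SimpleGraph V} {c d : V → ℝ} {α β γ δ r s : ℝ}
    (h : TwoBlock G c d α β γ δ) (he : EigPair G r s) :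
    r + s = α + δ ∧ r * s = α * δ - β * γ := by
  obtain ⟨hr, hs, a, b, ha, hb, i, j, hij⟩ := he
  obtain ⟨X, Y, h1, h2, h3⟩ := h r hr.ne' (by positivity) a ha
  obtain ⟨X', Y', k1, k2, k3⟩ := h s hs.ne' (by positivity) b hb
  have hD : X * Y' - Y * X' ≠ 0 := fun h0 => hij (by
    rw [h1, h1, k1, k1]; linear_combination (c i * d j - d i * c j) * h0)
  constructor
  · apply mul_right_cancel₀ hD
    linear_combination Y' * h2 - X' * h3 + X * k3 - Y * k2
  · apply mul_right_cancel₀ hD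
    linear_combination s * Y' * h2 - s * X' * h3 + (α * X + β * Y) * k3 - (γ * X + δ * Y) * k2

/-- Two entries determine an eigenvector, so at most two eigenvalues differ from `-2` and `0`. -/
lemma TwoBlock.atMostTwo {V : Type*} [Fintype V] {G : SimpleGraph V} {c d : V → ℝ} {α β γ δ : ℝ}
    (hb : TwoBlock G c d α β γ δ) : AtMostTwo G := by
  obtain ⟨l, e, h⟩ := exists_eigenbasis G
  have key : ∀ k, l k ≠ -2 ∧ l k ≠ 0 → ∃ u v : ℝ, ∀ i, e k i = u * c i + v * d i := by
    intro k hk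
    obtain ⟨X, Y, h1, -⟩ := hb (l k) hk.2 (fun h0 => hk.1 (by linarith)) (e k) (h.eig k)
    exact ⟨X, Y, fun i => by rw [h1]; ring⟩
  unfold AtMostTwo
  rw [h.card_filter]
  by_contra hn
  obtain ⟨k, hk, m, hm, t, ht, hkm, hkt, hmt⟩ := two_lt_card.1 (not_le.1 hn)
  simp only [mem_filter, mem_univ, true_and] at hk hm ht
  obtain ⟨u, v, h1⟩ := key k hk
  obtain ⟨u', v', h2⟩ := key m hm
  obtain ⟨u'', v'', h3⟩ := key t ht
  -- The determinant times the vector e t is a combination of e k and e m, to which e t is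
  -- orthogonal. So the determinant is zero, and e k, e m would be dependent.
  have D : u * v' - u' * v = 0 := by
    have : ∑ i, ((u * v' - u' * v) * e t i) * e t i = 0 := by
      rw [sum_congr rfl fun i _ => show ((u * v' - u' * v) * e t i) * e t i =
        (u'' * v' - v'' * u') * (e k i * e t i) + (v'' * u - u'' * v) * (e m i * e t i) by
          conv_lhs => enter [1, 2]; rw [h3 i]
          rw [h1 i, h2 i]; ring, sum_add_distrib, ← mul_sum, ← mul_sum, h.orth, h.orth,
        if_neg hkt, if_neg hmt]
      ring
    simp_rw [mul_assoc] at this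
    rw [← mul_sum, h.orth, if_pos rfl, mul_one] at this
    exact this
  have i1 := h.indep hkm (c := u') (d := -u) fun i => by
    rw [h1, h2]; linear_combination - d i * D
  have i2 := h.indep hkm (c := v') (d := -v) fun i => by
    rw [h1, h2]; linear_combination c i * D
  obtain ⟨i, hi⟩ := h.ne_zero k
  rw [h1, neg_eq_zero.1 i1.2, neg_eq_zero.1 i2.2] at hi
  simp at hi
/-- The eigenvectors for eigenvalues other than `0` and `-2` are determined by one entry. -/
def OneBlock {V : Type*} [Fintype V] (G : SimpleGraph V) (c : V → ℝ) (α : ℝ) : Prop :=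
  ∀ θ : ℝ, θ ≠ 0 → θ + 2 ≠ 0 → ∀ x : V → ℝ, (∀ i, ∑ j ∈ nb G i, x j = θ * x i) →
    ∃ X, (∀ i, x i = c i * X) ∧ θ * X = α * X

lemma nb_sum {V : Type*} [Fintype V] (G : SimpleGraph V) (i : V) (x : V → ℝ) :
    ∑ j ∈ nb G i, x j = ∑ j, if G.Adj i j then x j else 0 := by
  rw [nb, sum_filter]

lemma OneBlock.sum {V W : Type*} [Fintype V] [Fintype W] {G : SimpleGraph V} {H : SimpleGraph W}
    {c : V → ℝ} {d : W → ℝ} {α β : ℝ} (h : OneBlock G c α) (h' : OneBlock H d β) :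
    TwoBlock (SimpleGraph.sum G H) (Sum.elim c 0) (Sum.elim 0 d) α 0 0 β := by
  intro θ hθ h2θ x hx
  obtain ⟨X, h1, h2⟩ := h θ hθ h2θ (fun i => x (.inl i)) fun i => by
    rw [← hx, nb_sum, nb_sum, Fintype.sum_sum_type]; simp
  obtain ⟨Y, k1, k2⟩ := h' θ hθ h2θ (fun i => x (.inr i)) fun i => by
    rw [← hx, nb_sum, nb_sum, Fintype.sum_sum_type]; simp
  exact ⟨X, Y, by rintro (i | i) <;> simp [h1, k1], by linarith, by linarith⟩

lemma cp_sum {k : ℕ} (x : Fin k × Fin 2 → ℝ) (a : Fin k) :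
    (∑ b : Fin k × Fin 2, if a ≠ b.1 then x b else 0) = ∑ b, x b - (x (a, 0) + x (a, 1)) := by
  have : ∀ b : Fin k × Fin 2, (if a ≠ b.1 then x b else 0) = x b - if a = b.1 then x b else 0 :=
    fun b => by split_ifs <;> simp_all
  rw [sum_congr rfl fun b _ => this b, sum_sub_distrib]
  congr 1
  rw [Fintype.sum_prod_type]
  simp [Fin.sum_univ_two, sum_ite_eq, sum_add_distrib]

lemma fin_two : ∀ c : Fin 2, c = 0 ∨ c = 1 := by decide

/-- The eigenvalue equation on a cocktail party graph whose two halves receive constants t and t'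
from outside. Adding the equations of a class determines the sum of its two entries, as θ ≠ -2; then
each entry is determined, as θ ≠ 0. -/
lemma cp_const {k : ℕ} {x : Fin k × Fin 2 → ℝ} {θ t : ℝ} {t' : ℝ} (hθ : θ ≠ 0) (h2θ : θ + 2 ≠ 0)
    (h0 : ∀ a, ∑ b, x b - (x (a, 0) + x (a, 1)) + t = θ * x (a, 0))
    (h1 : ∀ a, ∑ b, x b - (x (a, 0) + x (a, 1)) + t' = θ * x (a, 1)) :
    ∃ X Y, (∀ a, x (a, 0) = X) ∧ (∀ a, x (a, 1) = Y) ∧ ∑ b, x b = k * (X + Y) ∧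
      θ * X = (k - 1) * (X + Y) + t ∧ θ * Y = (k - 1) * (X + Y) + t' := by
  obtain ⟨P, hP⟩ : ∃ P, (θ + 2) * P = 2 * ∑ b, x b + t + t' :=
    ⟨(2 * ∑ b, x b + t + t') / (θ + 2), by field_simp⟩
  obtain ⟨X, hX⟩ : ∃ X, θ * X = ∑ b, x b - P + t := ⟨(∑ b, x b - P + t) / θ, by field_simp⟩
  obtain ⟨Y, hY⟩ : ∃ Y, θ * Y = ∑ b, x b - P + t' := ⟨(∑ b, x b - P + t') / θ, by field_simp⟩
  have p : ∀ a, x (a, 0) + x (a, 1) = P := fun a => by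
    apply mul_left_cancel₀ h2θ
    linear_combination - h0 a - h1 a - hP
  have e0 : ∀ a, x (a, 0) = X := fun a => by
    apply mul_left_cancel₀ hθ; rw [← h0, p, hX]
  have e1 : ∀ a, x (a, 1) = Y := fun a => by
    apply mul_left_cancel₀ hθ; rw [← h1, p, hY]
  have hS : ∑ b, x b = k * (X + Y) := by
    rw [Fintype.sum_prod_type]
    simp [Fin.sum_univ_two, e0, e1]; ring
  have hXY : X + Y = P := by
    apply mul_left_cancel₀ hθ; linear_combination hX + hY - hP
  exact ⟨X, Y, e0, e1, hS, by rw [hX, ← hXY, hS]; ring, by rw [hY, ← hXY, hS]; ring⟩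

lemma CP_block (k : ℕ) : OneBlock (CP k) 1 (2 * k - 2) := by
  intro θ hθ h2θ x hx
  have h : ∀ a c, ∑ b, x b - (x (a, 0) + x (a, 1)) + 0 = θ * x (a, c) := fun a c => by
    rw [← hx, nb_sum, ← cp_sum]; simp
  obtain ⟨X, Y, h0, h1, -, h3, h4⟩ := cp_const hθ h2θ (fun a => h a 0) fun a => h a 1
  obtain rfl : X = Y := mul_left_cancel₀ hθ (h3.trans h4.symm)
  refine ⟨X, fun ⟨a, c⟩ => ?_, by linarith⟩
  rcases fin_two c with rfl | rfl <;> simp [h0, h1]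

lemma star_block : OneBlock (K 1 4) (Sum.elim 2 1) 2 := by
  intro θ hθ h2θ x hx
  have h1 : ∀ j, x (.inl 0) = θ * x (.inr j) := fun j => by
    rw [← hx, nb_sum, Fintype.sum_sum_type]; simp [K]
  have h2 : ∑ j, x (.inr j) = θ * x (.inl 0) := by
    rw [← hx, nb_sum, Fintype.sum_sum_type]; simp [K]
  have h3 : ∀ j, x (.inr j) = x (.inr 0) := fun j =>
    mul_left_cancel₀ hθ ((h1 j).symm.trans (h1 0))
  simp_rw [h3] at h2
  simp only [sum_const, card_univ, Fintype.card_fin, nsmul_eq_mul] at h2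
  push_cast at h2
  have h4 : x (.inl 0) = 2 * x (.inr 0) := by
    apply mul_left_cancel₀ h2θ
    linear_combination - h2 + 2 * h1 0
  refine ⟨x (.inr 0), ?_, by rw [← h1 0, h4]⟩
  rintro (i | j)
  · rw [Subsingleton.elim i 0, h4]; simp
  · rw [h3 j]; simp

lemma G8_block (k l : ℕ) : TwoBlock (G8 k l) (Sum.elim (Sum.elim 1 0) 1) (Sum.elim (Sum.elim 0 1) 1)
    (2 * k - 1) 1 1 (2 * l - 1) := by
  intro θ hθ h2θ x hx
  have h : ∀ a c, ∑ b, x (.inl (.inl b)) - (x (.inl (.inl (a, 0))) + x (.inl (.inl (a, 1)))) +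
      x (.inr ()) = θ * x (.inl (.inl (a, c))) := fun a c => by
    rw [← hx, nb_sum, ← cp_sum (fun b => x (.inl (.inl b)))]
    simp [G8, G5, Fintype.sum_sum_type]
    exact sum_congr rfl fun b _ => by split_ifs <;> simp_all
  have h' : ∀ a c, ∑ b, x (.inl (.inr b)) - (x (.inl (.inr (a, 0))) + x (.inl (.inr (a, 1)))) +
      x (.inr ()) = θ * x (.inl (.inr (a, c))) := fun a c => by
    rw [← hx, nb_sum, ← cp_sum (fun b => x (.inl (.inr b)))]
    simp [G8, G5, Fintype.sum_sum_type]
    exact sum_congr rfl fun b _ => by split_ifs <;> simp_all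
  have hz : ∑ b, x (.inl (.inl b)) + ∑ b, x (.inl (.inr b)) = θ * x (.inr ()) := by
    rw [← hx, nb_sum]; simp [G8, Fintype.sum_sum_type]
  obtain ⟨X, X', h0, h1, h2, h3, h4⟩ := cp_const hθ h2θ (fun a => h a 0) fun a => h a 1
  obtain ⟨Y, Y', k0, k1, k2, k3, k4⟩ := cp_const hθ h2θ (fun a => h' a 0) fun a => h' a 1
  obtain rfl : X = X' := mul_left_cancel₀ hθ (h3.trans h4.symm)
  obtain rfl : Y = Y' := mul_left_cancel₀ hθ (k3.trans k4.symm)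
  have hz' : x (.inr ()) = X + Y := by
    apply mul_left_cancel₀ h2θ
    linear_combination - hz + h2 + k2 - h3 - k3
  refine ⟨X, Y, ?_, by linear_combination h3 + hz', by linear_combination k3 + hz'⟩
  rintro ((⟨a, c⟩ | ⟨a, c⟩) | ⟨⟩)
  · rcases fin_two c with rfl | rfl <;> simp [h0, h1]
  · rcases fin_two c with rfl | rfl <;> simp [k0, k1]
  · simp [hz']

lemma prism_block (k : ℕ) : TwoBlock (prism k) (fun i => if i.2 = 0 then 1 else 0)
    (fun i => if i.2 = 0 then 0 else 1) (k - 1) 1 1 (k - 1) := by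
  intro θ hθ h2θ x hx
  have key : ∀ a c c', c ≠ c' → ∑ b, x (b, c) - x (a, c) + x (a, c') = θ * x (a, c) := by
    intro a c c' hc
    have e : ∀ b, (if a ≠ b then x (b, c) else 0) = x (b, c) - if a = b then x (b, c) else 0 :=
      fun b => by split_ifs <;> simp_all
    rw [← hx, nb_sum, Fintype.sum_prod_type]
    have : ∀ b, (∑ d : Fin 2, if (prism k).Adj (a, c) (b, d) then x (b, d) else 0) =
        (if a ≠ b then x (b, c) else 0) + if a = b then x (b, c') else 0 := by
      intro b
      rcases fin_two c with rfl | rfl <;> rcases fin_two c' with rfl | rfl <;>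
        by_cases hab : a = b <;> simp_all [prism]
    simp_rw [this, e]
    rw [sum_add_distrib, sum_sub_distrib]
    simp
  obtain ⟨X, hX⟩ : ∃ X, (θ + 2) * θ * X = (θ + 1) * ∑ b, x (b, 0) + ∑ b, x (b, 1) :=
    ⟨((θ + 1) * ∑ b, x (b, 0) + ∑ b, x (b, 1)) / ((θ + 2) * θ), by field_simp⟩
  obtain ⟨Y, hY⟩ : ∃ Y, (θ + 2) * θ * Y = (θ + 1) * ∑ b, x (b, 1) + ∑ b, x (b, 0) :=
    ⟨((θ + 1) * ∑ b, x (b, 1) + ∑ b, x (b, 0)) / ((θ + 2) * θ), by field_simp⟩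
  have h0 : ∀ a, x (a, 0) = X := fun a => by
    apply mul_left_cancel₀ (mul_ne_zero h2θ hθ)
    linear_combination - hX - (θ + 1) * key a 0 1 (by decide) - key a 1 0 (by decide)
  have h1 : ∀ a, x (a, 1) = Y := fun a => by
    apply mul_left_cancel₀ (mul_ne_zero h2θ hθ)
    linear_combination - hY - (θ + 1) * key a 1 0 (by decide) - key a 0 1 (by decide)
  simp_rw [h0, h1] at hX hY
  simp only [sum_const, card_univ, Fintype.card_fin, nsmul_eq_mul] at hX hY
  refine ⟨X, Y, fun ⟨a, c⟩ => ?_, ?_, ?_⟩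
  · rcases fin_two c with rfl | rfl <;> simp [h0, h1]
  · apply mul_left_cancel₀ (mul_ne_zero h2θ hθ)
    linear_combination (θ + 1) * hX - hY
  · apply mul_left_cancel₀ (mul_ne_zero h2θ hθ)
    linear_combination (θ + 1) * hY - hX

lemma halfJoin_block (k : ℕ) : TwoBlock (halfJoin 3 k)
    (Sum.elim (fun i => if i.2 = 0 then 1 else 2) 0) (Sum.elim (fun i => if i.2 = 0 then 0 else -2) 1)
    6 (2 * k - 4) 3 (2 * k - 2) := by
  intro θ hθ h2θ x hx
  have h : ∀ a c, ∑ b, x (.inl b) - (x (.inl (a, 0)) + x (.inl (a, 1))) +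
      (if c = 0 then ∑ b, x (.inr b) else 0) = θ * x (.inl (a, c)) := fun a c => by
    rw [← hx, nb_sum, ← cp_sum (fun b => x (.inl b)), Fintype.sum_sum_type]
    rcases fin_two c with rfl | rfl <;> simp [halfJoin] <;>
      exact sum_congr rfl fun b _ => by split_ifs <;> simp_all
  have h' : ∀ a c, ∑ b, x (.inr b) - (x (.inr (a, 0)) + x (.inr (a, 1))) +
      ∑ a : Fin 3, x (.inl (a, 0)) = θ * x (.inr (a, c)) := fun a c => by
    rw [← hx, nb_sum, ← cp_sum (fun b => x (.inr b)), Fintype.sum_sum_type]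
    simp [halfJoin, Fintype.sum_prod_type, Fin.sum_univ_two, add_comm]
    exact sum_congr rfl fun b _ => by split_ifs <;> simp_all
  obtain ⟨X, X', h0, h1, h2, h3, h4⟩ := cp_const hθ h2θ (fun a => h a 0) fun a => h a 1
  obtain ⟨Y, Y', k0, k1, k2, k3, k4⟩ := cp_const hθ h2θ (fun a => h' a 0) fun a => h' a 1
  obtain rfl : Y = Y' := mul_left_cancel₀ hθ (k3.trans k4.symm)
  simp only [h0, sum_const, card_univ, Fintype.card_fin, nsmul_eq_mul] at k3
  rw [if_pos rfl, k2] at h3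
  rw [if_neg (by decide)] at h4
  push_cast at h3 h4 k3
  have hL : X' = 2 * X - 2 * Y := by
    apply mul_left_cancel₀ h2θ
    linear_combination h4 - 2 * h3 + 2 * k3
  subst hL
  refine ⟨X, Y, ?_, by linear_combination h3, by linear_combination k3⟩
  rintro (⟨a, c⟩ | ⟨a, c⟩)
  · rcases fin_two c with rfl | rfl
    · simp [h0]
    · simp [h1]; ring
  · rcases fin_two c with rfl | rfl <;> simp [k0, k1]

lemma halfCone_block : TwoBlock (halfCone 7)
    (Sum.elim (fun i => if i.2 = 0 then 1 else 0) 2)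
    (Sum.elim (fun i => if i.2 = 0 then 0 else 1) (-3 / 2)) 8 (9 / 2) 6 6 := by
  intro θ hθ h2θ x hx
  have h : ∀ a c, ∑ b, x (.inl b) - (x (.inl (a, 0)) + x (.inl (a, 1))) +
      (if c = 0 then x (.inr ()) else 0) = θ * x (.inl (a, c)) := fun a c => by
    rw [← hx, nb_sum, ← cp_sum (fun b => x (.inl b)), Fintype.sum_sum_type]
    rcases fin_two c with rfl | rfl <;> simp [halfCone] <;>
      exact sum_congr rfl fun b _ => by split_ifs <;> simp_all
  have hw : ∑ a : Fin 7, x (.inl (a, 0)) = θ * x (.inr ()) := by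
    rw [← hx, nb_sum, Fintype.sum_sum_type]
    simp [halfCone, Fintype.sum_prod_type, Fin.sum_univ_two]
  obtain ⟨X, Y, h0, h1, h2, h3, h4⟩ := cp_const hθ h2θ (fun a => h a 0) fun a => h a 1
  simp only [h0, sum_const, card_univ, Fintype.card_fin, nsmul_eq_mul] at hw
  rw [if_pos rfl] at h3
  rw [if_neg (by decide)] at h4
  push_cast at h3 h4 hw
  have hL : x (.inr ()) = 2 * X - 3 / 2 * Y := by
    apply mul_left_cancel₀ h2θ
    linear_combination - hw - 2 * h3 + 3 / 2 * h4
  refine ⟨X, Y, ?_, by linear_combination h3 + hL, by linear_combination h4⟩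
  rintro (⟨a, c⟩ | ⟨⟩)
  · rcases fin_two c with rfl | rfl <;> simp [h0, h1]
  · simp [hL]; ring

/-- The relation between h and α, satisfied by both tails of the classification, is what expresses
the entries on the cocktail party graph and at v by those at w and at the leaves. -/
lemma tail_block {α h : ℕ} (hα : h + 2 * α = 6) : TwoBlock (tail α h)
    (Sum.elim (fun _ => 2) (Sum.elim ![1, 2, 2] 0))
    (Sum.elim (fun i => if i.2 = 0 then -3 else -4) (Sum.elim ![0, -3, -4] 1))
    (2 * h + 2) (α - 3 - 3 * h) 1 0 := by
  intro θ hθ h2θ x hx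
  have hα' : (h : ℝ) + 2 * α = 6 := by exact_mod_cast hα
  have hcp : ∀ a c, ∑ b, x (.inl b) - (x (.inl (a, 0)) + x (.inl (a, 1))) +
      ((if c = 0 then x (.inr (.inl 0)) else 0) + x (.inr (.inl 1)) + x (.inr (.inl 2))) =
      θ * x (.inl (a, c)) := fun a c => by
    rw [← hx, nb_sum, ← cp_sum (fun b => x (.inl b)), Fintype.sum_sum_type]
    rcases fin_two c with rfl | rfl <;> simp [tail, Fin.sum_univ_three] <;>
      exact sum_congr rfl fun b _ => by split_ifs <;> simp_all
  have hw : ∑ a : Fin h, x (.inl (a, 0)) + x (.inr (.inl 1)) + ∑ a, x (.inr (.inr a)) =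
      θ * x (.inr (.inl 0)) := by
    rw [← hx, nb_sum, Fintype.sum_sum_type, Fintype.sum_sum_type]
    simp [tail, Fintype.sum_prod_type]; ring
  have hy : ∑ b, x (.inl b) + x (.inr (.inl 0)) = θ * x (.inr (.inl 1)) := by
    rw [← hx, nb_sum, Fintype.sum_sum_type, Fintype.sum_sum_type]
    simp [tail]
  have hv : ∑ b, x (.inl b) = θ * x (.inr (.inl 2)) := by
    rw [← hx, nb_sum, Fintype.sum_sum_type, Fintype.sum_sum_type]
    simp [tail]
  have hl : ∀ a, x (.inr (.inl 0)) = θ * x (.inr (.inr a)) := fun a => by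
    rw [← hx, nb_sum, Fintype.sum_sum_type, Fintype.sum_sum_type]
    simp [tail, Fin.sum_univ_three]
  obtain ⟨L, hL⟩ : ∃ L, θ * L = x (.inr (.inl 0)) := ⟨x (.inr (.inl 0)) / θ, by field_simp⟩
  have hl' : ∀ a, x (.inr (.inr a)) = L := fun a =>
    mul_left_cancel₀ hθ ((hl a).symm.trans hL.symm)
  obtain ⟨X, Y, h0, h1, h2, h3, h4⟩ := cp_const hθ h2θ (fun a => hcp a 0) fun a => hcp a 1
  rw [if_pos rfl] at h3
  rw [if_neg (by decide)] at h4
  simp only [h0, hl', sum_const, card_univ, Fintype.card_fin, nsmul_eq_mul] at hw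
  rw [h2] at hy hv
  generalize ew : x (.inr (.inl 0)) = w at *
  generalize ey : x (.inr (.inl 1)) = y at *
  generalize ev : x (.inr (.inl 2)) = v at *
  have y1 : y = v + L := by
    apply mul_left_cancel₀ hθ; linear_combination hv - hy - hL
  have x1 : Y = X - L := by
    apply mul_left_cancel₀ hθ; linear_combination h4 - h3 + hL
  subst y1 x1
  have e1 : X = 2 * w - 3 * L := by
    apply mul_left_cancel₀ h2θ
    linear_combination h3 + 2 * hw + 3 * hL - L * hα'
  have e2 : v = 2 * w - 4 * L := by
    apply mul_left_cancel₀ h2θ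
    linear_combination - hv + 2 * hw + 4 * hL - L * hα'
  subst e1 e2
  refine ⟨w, L, ?_, by linear_combination - hw, by linear_combination hL⟩
  rintro (⟨a, c⟩ | t | a)
  · rcases fin_two c with rfl | rfl
    · simp [h0]; ring
    · simp [h1]; ring
  · fin_cases t
    · simp [ew]
    · simp [ey]; ring
    · simp [ev]; ring
  · simp [hl']

lemma G12_block : TwoBlock G12 ![1, 1, 0, 0, 1, 1, 2, 1] ![0, 0, 1, 1, 1, 1, 1, 2] 2 1 1 2 := by
  intro θ hθ h2θ x hx
  have n0 : nb G12 0 = {6} := by ext j; rw [mem_nb]; revert j; decide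
  have n1 : nb G12 1 = {6} := by ext j; rw [mem_nb]; revert j; decide
  have n2 : nb G12 2 = {7} := by ext j; rw [mem_nb]; revert j; decide
  have n3 : nb G12 3 = {7} := by ext j; rw [mem_nb]; revert j; decide
  have n4 : nb G12 4 = {6, 7} := by ext j; rw [mem_nb]; revert j; decide
  have n5 : nb G12 5 = {6, 7} := by ext j; rw [mem_nb]; revert j; decide
  have n6 : nb G12 6 = {0, 1, 4, 5, 7} := by ext j; rw [mem_nb]; revert j; decide
  have n7 : nb G12 7 = {2, 3, 4, 5, 6} := by ext j; rw [mem_nb]; revert j; decide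
  have e0 := hx 0
  have e1 := hx 1
  have e2 := hx 2
  have e3 := hx 3
  have e4 := hx 4
  have e5 := hx 5
  have e6 := hx 6
  have e7 := hx 7
  simp [n0, n1, n2, n3, n4, n5, n6, n7] at e0 e1 e2 e3 e4 e5 e6 e7
  have c : ∀ {a b : ℝ}, θ * a = θ * b → a = b := fun h => mul_left_cancel₀ hθ h
  have c' : ∀ {a b : ℝ}, (θ + 2) * a = (θ + 2) * b → a = b := fun h =>
    mul_left_cancel₀ h2θ h
  have f1 : x 1 = x 0 := c (by linarith)
  have f3 : x 3 = x 2 := c (by linarith)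
  have f4 : x 4 = x 0 + x 2 := c (by linarith)
  have f5 : x 5 = x 0 + x 2 := c (by linarith)
  have f6 : x 6 = 2 * x 0 + x 2 := c' (by rw [f1, f4, f5] at e6; linarith)
  have f7 : x 7 = x 0 + 2 * x 2 := c' (by rw [f3, f4, f5] at e7; linarith)
  refine ⟨x 0, x 2, fun i => ?_, by linarith, by linarith⟩
  fin_cases i <;> simp [f1, f3, f4, f5, f6, f7]

lemma G11_block : TwoBlock G11 ![1, 1, 0, 0, 1, 3 / 2, 3 / 2, 1 / 2, 1 / 2]
    ![0, 0, 1, 1, 1, 1 / 2, 1 / 2, 3 / 2, 3 / 2] 3 1 1 3 := by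
  intro θ hθ h2θ x hx
  have n0 : nb G11 0 = {5, 6} := by ext j; rw [mem_nb]; revert j; decide
  have n1 : nb G11 1 = {5, 6} := by ext j; rw [mem_nb]; revert j; decide
  have n2 : nb G11 2 = {7, 8} := by ext j; rw [mem_nb]; revert j; decide
  have n3 : nb G11 3 = {7, 8} := by ext j; rw [mem_nb]; revert j; decide
  have n4 : nb G11 4 = {5, 6, 7, 8} := by ext j; rw [mem_nb]; revert j; decide
  have n5 : nb G11 5 = {0, 1, 4, 6, 8} := by ext j; rw [mem_nb]; revert j; decide
  have n6 : nb G11 6 = {0, 1, 4, 5, 7} := by ext j; rw [mem_nb]; revert j; decide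
  have n7 : nb G11 7 = {2, 3, 4, 6, 8} := by ext j; rw [mem_nb]; revert j; decide
  have n8 : nb G11 8 = {2, 3, 4, 5, 7} := by ext j; rw [mem_nb]; revert j; decide
  have e0 := hx 0
  have e1 := hx 1
  have e2 := hx 2
  have e3 := hx 3
  have e4 := hx 4
  have e5 := hx 5
  have e6 := hx 6
  have e7 := hx 7
  have e8 := hx 8
  simp [n0, n1, n2, n3, n4, n5, n6, n7, n8] at e0 e1 e2 e3 e4 e5 e6 e7 e8
  have c : ∀ {a b : ℝ}, θ * a = θ * b → a = b := fun h => mul_left_cancel₀ hθ h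
  have c' : ∀ {a b : ℝ}, (θ + 2) * a = (θ + 2) * b → a = b := fun h =>
    mul_left_cancel₀ h2θ h
  have f1 : x 1 = x 0 := c (by linarith)
  have f3 : x 3 = x 2 := c (by linarith)
  have f4 : x 4 = x 0 + x 2 := c (by linarith)
  have d1 : x 5 + x 8 = x 6 + x 7 := c (by linarith)
  have d2 : x 5 = x 6 := c' (by linarith)
  have d3 : x 8 = x 7 := by linarith
  have f5 : x 6 = 3 / 2 * x 0 + 1 / 2 * x 2 := c' (by rw [f1, f4] at e6; linarith)
  have f7 : x 7 = 1 / 2 * x 0 + 3 / 2 * x 2 := c' (by rw [f3, f4] at e7; linarith)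
  refine ⟨x 0, x 2, fun i => ?_, by linarith, by linarith⟩
  fin_cases i <;> simp [f1, f3, f4, d2, d3, f5, f7]

end TwoEig
end

/-! ### Comparing the families with two positive eigenvalues. -/

section
open scoped Classical
namespace TwoEig
open Finset

/-- The graphs with two positive eigenvalues `r, s`, together with the invariants `M, h`, where
`r + s = 2 (M - 1)` and `r s = (M - 1) ^ 2 - h`, and the number `n` of vertices. -/
inductive Fam {V : Type*} (G : SimpleGraph V) (M h n : ℤ) : Prop
  | g3 (f : Nonempty (G ≃g G3)) (hM : M = 3) (hh : h = 0) (hn : n = 10)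
  | g4 (k : ℕ) (hk : 2 ≤ k) (f : Nonempty (G ≃g G4 k)) (hM : M = k + 1) (hh : h = (k - 2) ^ 2)
    (hn : n = 2 * k + 5)
  | g5 (k l : ℕ) (hk : 2 ≤ k) (hl : 2 ≤ l) (f : Nonempty (G ≃g G5 k l)) (hM : M = k + l - 1)
    (hh : h = (k - l) ^ 2) (hn : n = 2 * k + 2 * l)
  | g11 (f : Nonempty (G ≃g G11)) (hM : M = 4) (hh : h = 1) (hn : n = 9)
  | g12 (f : Nonempty (G ≃g G12)) (hM : M = 3) (hh : h = 1) (hn : n = 8)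
  | tail22 (f : Nonempty (G ≃g tail 2 2)) (hM : M = 4) (hh : h = 2) (hn : n = 9)
  | tail14 (f : Nonempty (G ≃g tail 1 4)) (hM : M = 6) (hh : h = 11) (hn : n = 12)
  | halfJoin (k : ℕ) (hk : 1 ≤ k) (f : Nonempty (G ≃g halfJoin 3 k)) (hM : M = k + 3)
    (hh : h = (k - 1) ^ 2 + 3) (hn : n = 2 * k + 6)
  | g8 (k l : ℕ) (hk : 1 ≤ k) (hl : 1 ≤ l) (f : Nonempty (G ≃g G8 k l)) (hM : M = k + l)
    (hh : h = (k - l) ^ 2 + 1) (hn : n = 2 * k + 2 * l + 1)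
  | prism (k : ℕ) (hk : 3 ≤ k) (f : Nonempty (G ≃g prism k)) (hM : M = k) (hh : h = 1)
    (hn : n = 2 * k)
  | halfCone (f : Nonempty (G ≃g halfCone 7)) (hM : M = 8) (hh : h = 28) (hn : n = 15)

lemma card_iso {V W : Type*} [Fintype V] [Fintype W] {G : SimpleGraph V} {H : SimpleGraph W}
    (f : Nonempty (G ≃g H)) : Fintype.card V = Fintype.card W :=
  Fintype.card_congr f.some.toEquiv

lemma PD.fam {V : Type*} [Fintype V] {G : SimpleGraph V} {r s : ℝ} (P : PD G r s)
    (hc : ¬ IsCM G) : ∃ M h : ℤ, r + s = 2 * (M - 1) ∧ r * s = (M - 1) ^ 2 - h ∧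
      Fam G M h (Fintype.card V) := by
  have go : ∀ {M h : ℤ} {σ π : ℝ}, r + s = σ ∧ r * s = π → σ = 2 * (M - 1) →
      π = (M - 1) ^ 2 - h → Fam G M h (Fintype.card V) → ∃ M h : ℤ, r + s = 2 * (M - 1) ∧
      r * s = (M - 1) ^ 2 - h ∧ Fam G M h (Fintype.card V) :=
    fun h1 h2 h3 h4 => ⟨_, _, h1.1.trans h2, h1.2.trans h3, h4⟩
  rcases P.classify with (f | ⟨k, hk, f⟩ | ⟨k, l, hk, hl, f⟩ | f | f | f | f) | ⟨k, hk, f⟩ |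
    ⟨k, l, hk, hl, f⟩ | ⟨k, hk, f⟩ | f | f
  · refine go ((star_block.sum star_block).data (P.eigPair f)) ?_ ?_ (.g3 f rfl rfl ?_)
    · norm_num
    · norm_num
    · rw [card_iso f]; rfl
  · refine go ((star_block.sum (CP_block k)).data (P.eigPair f)) ?_ ?_ (.g4 k hk f rfl rfl ?_)
    · push_cast; ring
    · push_cast; ring
    · rw [card_iso f]; simp; ring
  · refine go (((CP_block k).sum (CP_block l)).data (P.eigPair f)) ?_ ?_ (.g5 k l hk hl f rfl rfl ?_)
    · push_cast; ring
    · push_cast; ring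
    · rw [card_iso f]; simp; ring
  · refine go (G11_block.data (P.eigPair f)) ?_ ?_ (.g11 f rfl rfl ?_)
    · norm_num
    · norm_num
    · rw [card_iso f]; rfl
  · refine go (G12_block.data (P.eigPair f)) ?_ ?_ (.g12 f rfl rfl ?_)
    · norm_num
    · norm_num
    · rw [card_iso f]; rfl
  · refine go ((tail_block (α := 2) (h := 2) rfl).data (P.eigPair f)) ?_ ?_ (.tail22 f rfl rfl ?_)
    · norm_num
    · norm_num
    · rw [card_iso f]; rfl
  · refine go ((tail_block (α := 1) (h := 4) rfl).data (P.eigPair f)) ?_ ?_ (.tail14 f rfl rfl ?_)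
    · norm_num
    · norm_num
    · rw [card_iso f]; rfl
  · refine go ((halfJoin_block k).data (P.eigPair f)) ?_ ?_ (.halfJoin k hk f rfl rfl ?_)
    · push_cast; ring
    · push_cast; ring
    · rw [card_iso f]; simp; ring
  · refine go ((G8_block k l).data (P.eigPair f)) ?_ ?_ (.g8 k l hk hl f rfl rfl ?_)
    · push_cast; ring
    · push_cast; ring
    · rw [card_iso f]; simp; ring
  · refine go ((prism_block k).data (P.eigPair f)) ?_ ?_ (.prism k hk f rfl rfl ?_)
    · push_cast; ring
    · push_cast; ring
    · rw [card_iso f]; simp; ring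
  · refine go (halfCone_block.data (P.eigPair f)) ?_ ?_ (.halfCone f rfl rfl ?_)
    · norm_num
    · norm_num
    · rw [card_iso f]; rfl
  · exact absurd f hc

/-- The exceptional graphs that are not complete multipartite. -/
def Exceptional {V : Type*} (G : SimpleGraph V) : Prop :=
  (∃ k : ℕ, 2 ≤ k ∧ (Nonempty (G ≃g G4 k) ∨ Nonempty (G ≃g G5 (k + 1) k) ∨
    Nonempty (G ≃g G8 k k))) ∨
  (Nonempty (G ≃g G3) ∨ Nonempty (G ≃g G5 4 2) ∨ Nonempty (G ≃g G11) ∨ Nonempty (G ≃g G12))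

/-- Squares below 36 are listed with their roots, which covers all constant values of h, the largest
being 28. -/
lemma sq_values (t : ℤ) : (t ^ 2 = 0 ∧ t = 0) ∨ (t ^ 2 = 1 ∧ (t = 1 ∨ t = -1)) ∨
    (t ^ 2 = 4 ∧ (t = 2 ∨ t = -2)) ∨ (t ^ 2 = 9 ∧ (t = 3 ∨ t = -3)) ∨
    (t ^ 2 = 16 ∧ (t = 4 ∨ t = -4)) ∨ (t ^ 2 = 25 ∧ (t = 5 ∨ t = -5)) ∨
    36 ≤ t ^ 2 ∧ (6 ≤ t ∨ t ≤ -6) := by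
  rcases le_or_gt 6 t with h | h
  · have : 36 ≤ t ^ 2 := by nlinarith
    tauto
  rcases le_or_gt t (-6) with h' | h'
  · have : 36 ≤ t ^ 2 := by nlinarith
    tauto
  interval_cases t <;> simp

/-- Both factors of (a - b)(a + b) = c divide c. -/
lemma sq_sub_sq {a b c : ℤ} (h : a ^ 2 = b ^ 2 + c) (hc : 0 < c) :
    -c ≤ a + b ∧ a + b ≤ c ∧ -c ≤ a - b ∧ a - b ≤ c := by
  have h0 : (a - b) * (a + b) = c := by linear_combination h
  have h1 := Int.le_of_dvd hc (Dvd.intro_left (a - b) h0)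
  have h2 := Int.le_of_dvd hc (Dvd.intro (a + b) h0)
  have h3 := Int.le_of_dvd hc ((neg_dvd).2 (Dvd.intro_left (a - b) h0))
  have h4 := Int.le_of_dvd hc ((neg_dvd).2 (Dvd.intro (a + b) h0))
  omega

lemma G5_swap (k l : ℕ) : Nonempty (G5 k l ≃g G5 l k) :=
  ⟨⟨Equiv.sumComm _ _, by rintro (x | x) (y | y) <;> simp [G5]⟩⟩

lemma G8_swap (k l : ℕ) : Nonempty (G8 k l ≃g G8 l k) :=
  ⟨⟨(Equiv.sumComm _ _).sumCongr (Equiv.refl _), by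
    rintro ((x | x) | x) ((y | y) | y) <;> simp [G8, G5]⟩⟩

/-- For members of different families, equal M and h amount to equations between squares that differ
by a small constant. Each is unsolvable, or makes G exceptional, or gives H more vertices than G.
Within a family, M and h determine the parameters up to exchanging the two summands. -/
lemma Fam.iso {V W : Type*} {G : SimpleGraph V} {H : SimpleGraph W} {M h n n' : ℤ}
    (hG : Fam G M h n) (hx : ¬ Exceptional G) (hH : Fam H M h n') (hn : n' ≤ n) :
    Nonempty (H ≃g G) := by
  have tr : ∀ {U : Type} {F : SimpleGraph U}, Nonempty (H ≃g F) → Nonempty (G ≃g F) →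
      Nonempty (H ≃g G) := fun f g => ⟨f.some.trans g.some.symm⟩
  cases hG with
  | g3 f => exact absurd (Or.inr (Or.inl f)) hx
  | g4 k hk f => exact absurd (Or.inl ⟨k, hk, Or.inl f⟩) hx
  | g11 f => exact absurd (Or.inr (Or.inr (Or.inr (Or.inl f)))) hx
  | g12 f => exact absurd (Or.inr (Or.inr (Or.inr (Or.inr f)))) hx
  | g5 k l hk hl f hM hh hn' =>
    have e1 : ¬ (k = l + 1) := fun e => hx (Or.inl ⟨l, hl, Or.inr (Or.inl (e ▸ f))⟩)
    have e2 : ¬ (l = k + 1) := fun e =>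
      hx (Or.inl ⟨k, hk, Or.inr (Or.inl (e ▸ ⟨f.some.trans (G5_swap _ _).some⟩))⟩)
    have e3 : ¬ (k = 4 ∧ l = 2) := by
      rintro ⟨rfl, rfl⟩; exact hx (Or.inr (Or.inr (Or.inl f)))
    have e4 : ¬ (k = 2 ∧ l = 4) := by
      rintro ⟨rfl, rfl⟩; exact hx (Or.inr (Or.inr (Or.inl ⟨f.some.trans (G5_swap _ _).some⟩)))
    have v := sq_values (k - l)
    cases hH with
    | g5 k' l' hk' hl' f' hM' hh' hn'' =>
      rcases sq_eq_sq_iff_eq_or_eq_neg.1 (hh.symm.trans hh') with e | e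
      · obtain rfl : k' = k := by omega
        obtain rfl : l' = l := by omega
        exact tr f' f
      · obtain rfl : k' = l := by omega
        obtain rfl : l' = k := by omega
        exact tr f' ⟨f.some.trans (G5_swap _ _).some⟩
    | g8 k' l' hk' hl' f' hM' hh' hn'' =>
      have := sq_sub_sq (c := 1) (hh.symm.trans hh') (by norm_num)
      have v' := sq_values (k' - l')
      omega
    | halfJoin k' hk' f' hM' hh' hn'' =>
      have := sq_sub_sq (c := 3) (hh.symm.trans hh') (by norm_num)
      have v' := sq_values (k' - 1)
      omega
    | _ => omega
  | g8 k l hk hl f hM hh hn' =>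
    have e1 : ¬ (k = l ∧ 2 ≤ l) := by
      rintro ⟨rfl, hl⟩; exact hx (Or.inl ⟨k, hl, Or.inr (Or.inr f)⟩)
    have v := sq_values (k - l)
    cases hH with
    | g8 k' l' hk' hl' f' hM' hh' hn'' =>
      rcases sq_eq_sq_iff_eq_or_eq_neg.1 (add_right_cancel (hh.symm.trans hh')) with e | e
      · obtain rfl : k' = k := by omega
        obtain rfl : l' = l := by omega
        exact tr f' f
      · obtain rfl : k' = l := by omega
        obtain rfl : l' = k := by omega
        exact tr f' ⟨f.some.trans (G8_swap _ _).some⟩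
    | halfJoin k' hk' f' hM' hh' hn'' =>
      have := sq_sub_sq (a := k - l) (b := k' - 1) (c := 2) (by linarith) (by norm_num)
      have v' := sq_values (k' - 1)
      omega
    | _ => omega
  | prism k hk f hM hh hn' =>
    cases hH with
    | prism k' hk' f' hM' hh' hn'' =>
      obtain rfl : k' = k := by omega
      exact tr f' f
    | halfJoin k' hk' f' hM' hh' hn'' => have v' := sq_values (k' - 1); omega
    | _ => omega
  | halfJoin k hk f hM hh hn' =>
    have v := sq_values (k - 1)
    cases hH with
    | halfJoin k' hk' f' hM' hh' hn'' =>
      obtain rfl : k' = k := by omega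
      exact tr f' f
    | _ => omega
  | halfCone f hM hh hn' =>
    cases hH with
    | halfCone f' => exact tr f' f
    | halfJoin k' hk' f' hM' hh' hn'' => have v' := sq_values (k' - 1); omega
    | _ => omega
  | tail22 f hM hh hn' =>
    cases hH with
    | tail22 f' => exact tr f' f
    | halfJoin k' hk' f' hM' hh' hn'' => have v' := sq_values (k' - 1); omega
    | g8 k' l' hk' hl' f' hM' hh' hn'' => have v' := sq_values (k' - l'); omega
    | _ => omega
  | tail14 f hM hh hn' =>
    cases hH with
    | tail14 f' => exact tr f' f
    | halfJoin k' hk' f' hM' hh' hn'' => have v' := sq_values (k' - 1); omega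
    | g8 k' l' hk' hl' f' hM' hh' hn'' => have v' := sq_values (k' - l'); omega
    | _ => omega

end TwoEig
end

/-! ### Cospectral graphs and their cores. -/

section
open scoped Classical
namespace TwoEig
open Finset

lemma sum_adjSpectrum {V : Type*} [Fintype V] (G : SimpleGraph V) : (adjSpectrum G).sum = 0 := by
  obtain ⟨l, e, h⟩ := exists_eigenbasis G
  rw [h.spec, ← h.sum_zero]; rfl

lemma two_valued (S : Multiset ℝ) (h : ∀ x ∈ S, x = -2 ∨ x = 0) :
    ∃ m c : ℕ, S = Multiset.replicate m (-2) + Multiset.replicate c 0 := by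
  induction S using Multiset.induction with
  | empty => exact ⟨0, 0, rfl⟩
  | cons a S ih =>
    obtain ⟨m, c, hS⟩ := ih fun x hx => h x (Multiset.mem_cons_of_mem hx)
    rcases h a (Multiset.mem_cons_self _ _) with rfl | rfl
    · exact ⟨m + 1, c, by rw [hS, Multiset.replicate_succ, Multiset.cons_add]⟩
    · exact ⟨m, c + 1, by rw [hS, Multiset.replicate_succ, Multiset.add_cons]⟩

lemma spectrum_shape {V : Type*} [Fintype V] {G : SimpleGraph V} {r s : ℝ} (h2 : AtMostTwo G)
    (hp : posSpec G = {r, s}) : ∃ m c : ℕ, adjSpectrum G =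
      {r, s} + (Multiset.replicate m (-2) + Multiset.replicate c 0) ∧ r + s = 2 * m ∧
      2 + m + c = Fintype.card V := by
  have hle : posSpec G = (adjSpectrum G).filter fun x => x ≠ -2 ∧ x ≠ 0 := by
    apply Multiset.eq_of_le_of_card_le
    · exact Multiset.monotone_filter_right _ fun x hx => ⟨by linarith, ne_of_gt hx⟩
    · rw [hp]; exact h2
  obtain ⟨m, c, hm⟩ := two_valued ((adjSpectrum G).filter fun x => ¬ 0 < x) fun x hx => by
    rw [Multiset.mem_filter] at hx
    by_contra hn
    push Not at hn
    have : x ∈ posSpec G := hle ▸ Multiset.mem_filter.2 ⟨hx.1, hn⟩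
    exact hx.2 (Multiset.mem_filter.1 this).2
  have hS : adjSpectrum G = {r, s} + (Multiset.replicate m (-2) + Multiset.replicate c 0) := by
    rw [← hm, ← hp]; exact (Multiset.filter_add_not _ _).symm
  refine ⟨m, c, hS, ?_, ?_⟩
  · have := sum_adjSpectrum G
    rw [hS] at this
    simp at this
    linarith
  · rw [← card_adjSpectrum G, hS]; simp; ring

/-- The trace fixes the multiplicity of -2, and the number of vertices that of 0. -/
lemma spectrum_eq {V W : Type*} [Fintype V] [Fintype W] {G : SimpleGraph V} {H : SimpleGraph W}
    {r s : ℝ} (h2 : AtMostTwo G) (h2' : AtMostTwo H) (hp : posSpec G = {r, s})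
    (hp' : posSpec H = {r, s}) (hc : Fintype.card V = Fintype.card W) :
    adjSpectrum G = adjSpectrum H := by
  obtain ⟨m, c, h, h3, h4⟩ := spectrum_shape h2 hp
  obtain ⟨m', c', h', h3', h4'⟩ := spectrum_shape h2' hp'
  have : (m : ℝ) = m' := by linarith
  obtain rfl : m = m' := by exact_mod_cast this
  obtain rfl : c = c' := by omega
  rw [h, h']

lemma filter_add_bot {V W : Type*} [Fintype V] [Fintype W] (G : SimpleGraph V) (p : ℝ → Prop) [DecidablePred p]
    (h0 : ¬ p 0) : (adjSpectrum (SimpleGraph.sum G (⊥ : SimpleGraph W))).filter p =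
      (adjSpectrum G).filter p := by
  rw [adjSpectrum_sum, adjSpectrum_bot, Multiset.filter_add]
  convert add_zero _
  rw [Multiset.filter_eq_nil]
  intro x hx
  rwa [Multiset.eq_of_mem_replicate hx]

lemma exists_PD {V : Type*} [Fintype V] {G : SimpleGraph V} (h2 : AtMostTwo G)
    (hi : ∀ v, ∃ w, G.Adj v w) (hc : ¬ IsCM G) :
    ∃ r s, posSpec G = {r, s} ∧ Nonempty (PD G r s) := by
  obtain ⟨l, e, h⟩ := exists_eigenbasis G
  obtain ⟨p, q, hpq, hp, hq⟩ := h.two_pos hi hc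
  exact ⟨l p, l q, h.posSpec_eq h2 hpq hp hq, h.exists_PD h2 hi hpq hp hq⟩

lemma IsCM.card_posSpec {V : Type*} [Fintype V] {G : SimpleGraph V} (hc : IsCM G) :
    (posSpec G).card ≤ 1 := by
  obtain ⟨l, e, h⟩ := exists_eigenbasis G
  unfold posSpec
  rw [h.card_filter]
  by_contra hn
  obtain ⟨p, hp, q, hq, hpq⟩ := one_lt_card.1 (not_le.1 hn)
  exact h.not_two_pos hc hpq (mem_filter.1 hp).2 (mem_filter.1 hq).2

lemma pair_sum_prod {r s r' s' : ℝ} (h : ({r, s} : Multiset ℝ) = {r', s'}) :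
    r + s = r' + s' ∧ r * s = r' * s' :=
  ⟨by simpa using congrArg Multiset.sum h, by simpa using congrArg Multiset.prod h⟩

lemma pair_of_sum_prod {r s r' s' : ℝ} (h : r + s = r' + s') (h' : r * s = r' * s') :
    ({r, s} : Multiset ℝ) = {r', s'} := by
  have : (r - r') * (r - s') = 0 := by linear_combination r * h - h'
  rcases mul_eq_zero.1 this with h0 | h0
  · obtain rfl : r = r' := by linarith
    obtain rfl : s = s' := by linarith
    rfl
  · obtain rfl : r = s' := by linarith
    obtain rfl : s = r' := by linarith
    exact Multiset.pair_comm _ _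

section
variable {V W : Type*} [Fintype V] [Fintype W] {G : SimpleGraph V} {H : SimpleGraph W}

lemma card_core_le (H : SimpleGraph W) : Fintype.card {v : W // ∃ w, H.Adj v w} ≤ Fintype.card W :=
  Fintype.card_subtype_le _

lemma iso_of_core (f : Nonempty (core H ≃g G)) (hc : Fintype.card V = Fintype.card W) :
    Nonempty (H ≃g G) := by
  obtain ⟨f⟩ := f
  have hb : Function.Bijective (Subtype.val : {v : W // ∃ w, H.Adj v w} → W) :=
    (Fintype.bijective_iff_injective_and_card _).2 ⟨Subtype.val_injective, by
      rw [← hc]; exact Fintype.card_congr f.toEquiv⟩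
  obtain ⟨g⟩ := iso_of_bij (G := H) (H := core H) Subtype.val hb.1 hb.2 fun _ _ => Iff.rfl
  exact ⟨g.trans f⟩

lemma adjSpectrum_core (H : SimpleGraph W) : ∃ c : ℕ,
    adjSpectrum H = adjSpectrum (core H) + Multiset.replicate c 0 := by
  obtain ⟨f⟩ := core_iso H
  exact ⟨_, by rw [adjSpectrum_iso f, adjSpectrum_sum, adjSpectrum_bot]⟩

lemma filter_core (H : SimpleGraph W) (p : ℝ → Prop) [DecidablePred p] (h0 : ¬ p 0) :
    (adjSpectrum (core H)).filter p = (adjSpectrum H).filter p := by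
  obtain ⟨f⟩ := core_iso H
  rw [adjSpectrum_iso f, filter_add_bot _ _ h0]

lemma filter_core_eq (hs : adjSpectrum H = adjSpectrum G) :
    AtMostTwo G = AtMostTwo (core H) ∧ posSpec (core H) = posSpec G := by
  constructor
  · unfold AtMostTwo
    rw [← hs, filter_core H _ (by simp)]
  · unfold posSpec
    rw [← hs, filter_core H _ (by simp)]

/-- The core of H has the nonzero eigenvalues of G, so it belongs to a family with the same
invariants and has at most as many vertices. Once it is isomorphic to G, the count leaves no
isolated vertices in H. -/
lemma iso_of_not_cm (h2 : AtMostTwo G) (hi : ∀ v, ∃ w, G.Adj v w) (hc : ¬ IsCM G)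
    (hx : ¬ Exceptional G) (hs : adjSpectrum H = adjSpectrum G) : Nonempty (H ≃g G) := by
  obtain ⟨e1, e2⟩ := filter_core_eq hs
  have hn : Fintype.card V = Fintype.card W := by
    rw [← card_adjSpectrum G, ← card_adjSpectrum H, hs]
  obtain ⟨r, s, hrs, ⟨P⟩⟩ := exists_PD h2 hi hc
  obtain ⟨r', s', hrs', ⟨P'⟩⟩ := exists_PD (e1 ▸ h2) (core_noiso H) fun h => by
    have := h.card_posSpec
    rw [e2, hrs] at this
    simp at this
  have hc' : ¬ IsCM (core H) := fun h => by
    have := h.card_posSpec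
    rw [e2, hrs] at this
    simp at this
  obtain ⟨k1, k2⟩ := pair_sum_prod (hrs'.symm.trans (e2.trans hrs))
  obtain ⟨M, h, a1, a2, F⟩ := P.fam hc
  obtain ⟨M', h', b1, b2, F'⟩ := P'.fam hc'
  obtain rfl : M' = M := by
    have : (M' : ℝ) = M := by linarith
    exact_mod_cast this
  obtain rfl : h' = h := by
    have : (h' : ℝ) = h := by linarith
    exact_mod_cast this
  refine iso_of_core (F.iso hx F' ?_) hn
  rw [hn]
  exact_mod_cast card_core_le H

lemma isDS_of_not_cm (h2 : AtMostTwo G) (hi : ∀ v, ∃ w, G.Adj v w) (hc : ¬ IsCM G)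
    (hx : ¬ Exceptional G) : IsDS G :=
  fun _ _ hs => iso_of_not_cm h2 hi hc hx hs

/-- A cospectral graph with an isolated vertex shows that `G` is not determined by its spectrum. -/
lemma not_isDS (hi : ∀ v, ∃ w, G.Adj v w) (hs : adjSpectrum H = adjSpectrum G)
    {v : W} (hv : ∀ w, ¬ H.Adj v w) : ¬ IsDS G := fun h => by
  obtain ⟨f⟩ := h _ (H.map (Fintype.equivFin W).toEmbedding) (by
    rw [← hs]
    exact (adjSpectrum_iso (SimpleGraph.Iso.map (Fintype.equivFin W) H)).symm)
  let g := (SimpleGraph.Iso.map (Fintype.equivFin W) H).trans f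
  obtain ⟨w, hw⟩ := hi (g v)
  refine hv (g.symm w) ?_
  rw [← g.map_rel_iff]
  simpa using hw

/-- Two graphs with the same positive eigenvalues, the smaller one padded by isolated vertices. -/
lemma not_isDS_of_posSpec {r s : ℝ} (hi : ∀ v, ∃ w, G.Adj v w) (h2 : AtMostTwo G)
    (h2' : AtMostTwo H) (hp : posSpec G = {r, s}) (hp' : posSpec H = {r, s})
    (hc : Fintype.card W < Fintype.card V) : ¬ IsDS G := by
  have hW : 0 < Fintype.card V - Fintype.card W := by omega
  refine not_isDS (H := SimpleGraph.sum H (⊥ : SimpleGraph (Fin (Fintype.card V - Fintype.card W))))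
    hi (spectrum_eq (r := r) (s := s) ?_ h2 ?_ hp ?_) (v := .inr ⟨0, hW⟩) ?_
  · unfold AtMostTwo
    rw [filter_add_bot _ _ (by simp)]
    exact h2'
  · unfold posSpec
    rw [filter_add_bot _ _ (by simp)]
    exact hp'
  · simp; omega
  · rintro (w | w) <;> simp

end
end TwoEig
end

/-! ### Smaller partners of the exceptional graphs. -/

section
open scoped Classical
namespace TwoEig
open Finset

lemma IsCM.of_iso {V W : Type*} {G : SimpleGraph V} {H : SimpleGraph W} (f : Nonempty (G ≃g H))
    (hG : IsCM G) : IsCM H := by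
  obtain ⟨f⟩ := f
  intro x y z h1 h2 h3
  refine hG (f.symm x) (f.symm y) (f.symm z) ?_ ?_ ?_
  · rwa [f.symm.map_rel_iff]
  · rwa [f.symm.map_rel_iff]
  · rwa [f.symm.map_rel_iff]

/-- Two graphs with the same data, the smaller one padded by isolated vertices. -/
lemma not_isDS_of_block {V U W : Type*} [Fintype V] [Fintype U] [Fintype W] {G : SimpleGraph V}
    {F : SimpleGraph U} {H : SimpleGraph W} {c d : U → ℝ} {c' d' : W → ℝ}
    {α β γ δ α' β' γ' δ' : ℝ} (hi : ∀ v, ∃ w, G.Adj v w) (h2 : AtMostTwo G)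
    (f : Nonempty (G ≃g F)) (hF : TwoBlock F c d α β γ δ) (hc : ¬ IsCM F)
    (hH : TwoBlock H c' d' α' β' γ' δ') (hi' : ∀ v, ∃ w, H.Adj v w) (hc' : ¬ IsCM H)
    (hσ : α' + δ' = α + δ) (hπ : α' * δ' - β' * γ' = α * δ - β * γ)
    (hn : Fintype.card W < Fintype.card U) : ¬ IsDS G := by
  obtain ⟨r, s, hp, ⟨P⟩⟩ := exists_PD h2 hi fun h => hc (h.of_iso f)
  obtain ⟨r', s', hp', ⟨P'⟩⟩ := exists_PD hH.atMostTwo hi' hc'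
  obtain ⟨a1, a2⟩ := hF.data (P.eigPair f)
  obtain ⟨b1, b2⟩ := hH.data (P'.eigPair ⟨SimpleGraph.Iso.refl⟩)
  refine not_isDS_of_posSpec hi h2 hH.atMostTwo hp ?_ (by rwa [card_iso f])
  rw [hp']
  exact pair_of_sum_prod (by rw [b1, a1, hσ]) (by rw [b2, a2, hπ])

lemma not_cm_sum {V W : Type*} {G : SimpleGraph V} {H : SimpleGraph W} {x y : V} (h : G.Adj x y)
    (w : W) : ¬ IsCM (SimpleGraph.sum G H) := fun hc =>
  hc (.inl x) (.inr w) (.inl y) (by simp) (by simp) (by simpa)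

lemma CP_edge {k : ℕ} (hk : 2 ≤ k) :
    (CP k).Adj ((⟨0, by omega⟩ : Fin k), 0) ((⟨1, by omega⟩ : Fin k), 0) := by
  simp

lemma CP_noiso {k : ℕ} (hk : 2 ≤ k) (v : Fin k × Fin 2) : ∃ w, (CP k).Adj v w := by
  have : Nontrivial (Fin k) := Fin.nontrivial_iff_two_le.2 hk
  obtain ⟨a, ha⟩ := exists_ne v.1
  exact ⟨(a, 0), by simpa using ha.symm⟩

lemma G5_noiso {k l : ℕ} (hk : 2 ≤ k) (hl : 2 ≤ l) (v) : ∃ w, (G5 k l).Adj v w := by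
  rcases v with v | v
  · obtain ⟨w, hw⟩ := CP_noiso hk v; exact ⟨.inl w, by simpa [G5] using hw⟩
  · obtain ⟨w, hw⟩ := CP_noiso hl v; exact ⟨.inr w, by simpa [G5] using hw⟩

lemma not_cm_G5 {k l : ℕ} (hk : 2 ≤ k) (hl : 1 ≤ l) : ¬ IsCM (G5 k l) :=
  not_cm_sum (CP_edge hk) (⟨0, by omega⟩, 0)

lemma not_cm_prism {k : ℕ} (hk : 3 ≤ k) : ¬ IsCM (prism k) := fun h =>
  h (⟨0, by omega⟩, 0) (⟨1, by omega⟩, 1) (⟨2, by omega⟩, 0) (by simp [prism]) (by simp [prism])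
    (by simp [prism])

lemma prism_noiso (k : ℕ) (v) : ∃ w, (prism k).Adj v w :=
  ⟨(v.1, v.2 + 1), Or.inl ⟨rfl, by simp⟩⟩

lemma halfJoin_noiso (v) : ∃ w, (halfJoin 3 2).Adj v w := by
  rcases v with v | v
  · exact ⟨.inl (v.1 + 1, 0), by simp [halfJoin]⟩
  · exact ⟨.inr (v.1 + 1, 0), by simp [halfJoin]⟩

lemma not_cm_halfJoin : ¬ IsCM (halfJoin 3 2) := fun h =>
  h (.inl (0, 0)) (.inl (0, 1)) (.inr (0, 0)) (by simp [halfJoin]) (by simp [halfJoin])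
    (by simp [halfJoin])

/-- The partners are CP(2) + CP(k) for `G4 k`, `prism (2 * k)` for both CP(k + 1) + CP(k) and `G8 k
k`, CP(2) + CP(2) for `G3`, `halfJoin 3 2` for CP(4) + CP(2), `prism 4` for `G11` and `prism 3` for
`G12`. Each has the same positive eigenvalues and fewer vertices. -/
lemma Exceptional.not_isDS {V : Type*} [Fintype V] {G : SimpleGraph V} (h2 : AtMostTwo G)
    (hi : ∀ v, ∃ w, G.Adj v w) (hx : Exceptional G) : ¬ IsDS G := by
  have star : (K 1 4).Adj (.inl 0) (.inr 0) := by simp [K]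
  rcases hx with ⟨k, hk, f | f | f⟩ | f | f | f | f
  · refine not_isDS_of_block hi h2 f (star_block.sum (CP_block k))
      (not_cm_sum star (⟨0, by omega⟩, 0)) ((CP_block 2).sum (CP_block k)) (G5_noiso le_rfl hk)
      (not_cm_G5 le_rfl (by omega)) (by norm_num) (by norm_num) (by simp)
  · refine not_isDS_of_block hi h2 f ((CP_block (k + 1)).sum (CP_block k))
      (not_cm_G5 (by omega) (by omega)) (prism_block (2 * k)) (prism_noiso _)
      (not_cm_prism (by omega)) (by push_cast; ring) (by push_cast; ring) (by simp; omega)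
  · refine not_isDS_of_block hi h2 f (G8_block k k) (fun h => h (.inl (.inl (⟨0, by omega⟩, 0)))
        (.inl (.inr (⟨0, by omega⟩, 0))) (.inl (.inl (⟨1, by omega⟩, 0))) (by simp [G8, G5])
        (by simp [G8, G5]) (by simp [G8, G5])) (prism_block (2 * k)) (prism_noiso _)
      (not_cm_prism (by omega)) (by push_cast; ring) (by push_cast; ring) (by simp; omega)
  · exact not_isDS_of_block hi h2 f (star_block.sum star_block)
      (not_cm_sum star (.inl 0)) ((CP_block 2).sum (CP_block 2)) (G5_noiso le_rfl le_rfl)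
      (not_cm_G5 le_rfl (by omega)) (by norm_num) (by norm_num) (by simp)
  · exact not_isDS_of_block hi h2 f ((CP_block 4).sum (CP_block 2))
      (not_cm_G5 (by omega) (by omega)) (halfJoin_block 2) halfJoin_noiso not_cm_halfJoin
      (by norm_num) (by norm_num) (by simp)
  · exact not_isDS_of_block hi h2 f G11_block (fun h => h 7 5 2 (by decide) (by decide) (by decide))
      (prism_block 4) (prism_noiso _) (not_cm_prism (by omega)) (by norm_num) (by norm_num) (by simp)
  · exact not_isDS_of_block hi h2 f G12_block (fun h => h 6 2 0 (by decide) (by decide) (by decide))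
      (prism_block 3) (prism_noiso _) (not_cm_prism (by omega)) (by norm_num) (by norm_num) (by simp)

end TwoEig
end

/-! ### Complete multipartite graphs: the classification. -/

section
open scoped Classical
namespace TwoEig
open Finset

/-- The graph `H` joined to `a` independent vertices. -/
def joinBot {W : Type*} (H : SimpleGraph W) (a : ℕ) : SimpleGraph (W ⊕ Fin a) :=
  SimpleGraph.sum H ⊥ ⊔ completeBipartiteGraph W (Fin a)

lemma bot_emb {V : Type*} {G : SimpleGraph V} {D : Finset V}
    (h : ∀ x ∈ D, ∀ y ∈ D, ¬ G.Adj x y) : Emb (⊥ : SimpleGraph (Fin D.card)) G D := by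
  refine ⟨fun i => D.equivFin.symm i, fun i j h0 => D.equivFin.symm.injective (Subtype.ext h0),
    fun v => ⟨fun hv => ⟨D.equivFin ⟨v, hv⟩, by simp⟩, ?_⟩, fun i j => ?_⟩
  · rintro ⟨i, rfl⟩; exact (D.equivFin.symm i).2
  · simpa using h _ (D.equivFin.symm i).2 _ (D.equivFin.symm j).2

lemma joinBot_iso {V M : Type*} [Fintype V] {G : SimpleGraph V} {H : SimpleGraph M} {C D : Finset V}
    (hC : Emb H G C) (hD : ∀ x ∈ D, ∀ y ∈ D, ¬ G.Adj x y) (hu : ∀ v, v ∈ C ∨ v ∈ D)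
    (he : ∀ x ∈ C, ∀ y ∈ D, G.Adj x y) : Nonempty (G ≃g joinBot H D.card) := by
  obtain ⟨f, f1, f2, f3⟩ := hC
  obtain ⟨g, g1, g2, g3⟩ := bot_emb hD
  have mf : ∀ x, f x ∈ C := fun x => (f2 _).2 ⟨x, rfl⟩
  have mg : ∀ x, g x ∈ D := fun x => (g2 _).2 ⟨x, rfl⟩
  refine iso_of_bij (Sum.elim f g) (f1.sumElim g1 fun a b h0 =>
    (he _ (mf a) _ (mg b)).ne h0) (fun v => ?_) ?_
  · rcases hu v with hv | hv
    · obtain ⟨x, hx⟩ := (f2 v).1 hv; exact ⟨.inl x, hx⟩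
    · obtain ⟨x, hx⟩ := (g2 v).1 hv; exact ⟨.inr x, hx⟩
  · rintro (x | x) (y | y)
    · simpa [joinBot] using f3 x y
    · simpa [joinBot] using he _ (mf x) _ (mg y)
    · simpa [joinBot] using (he _ (mf y) _ (mg x)).symm
    · simpa [joinBot] using g3 x y

section
variable {V : Type*} [Fintype V] {G : SimpleGraph V}

/-- A² + 2A has rank at most two, whatever the signs of the remaining eigenvalues. -/
lemma AtMostTwo.minor (h2 : AtMostTwo G) [Nonempty V] {B : V → V → ℝ}
    (hB : ∀ i j, B i j = (cn G i j : ℝ) + if G.Adj i j then 2 else 0) (i j k x y z : V) :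
    B i x * (B j y * B k z - B j z * B k y) - B i y * (B j x * B k z - B j z * B k x) +
      B i z * (B j x * B k y - B j y * B k x) = 0 := by
  obtain ⟨l, e, h⟩ := exists_eigenbasis G
  obtain ⟨p, q, α, β, hB'⟩ : ∃ p q, ∃ α β : ℝ, ∀ i j, B i j =
      α * e p i * e p j + β * e q i * e q j := by
    unfold AtMostTwo at h2
    rw [h.card_filter] at h2
    have out : ∀ k, k ∉ (univ.filter fun k => l k ≠ -2 ∧ l k ≠ 0) → l k ^ 2 + 2 * l k = 0 := by
      intro k hk
      have : l k = -2 ∨ l k = 0 := by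
        by_contra hn
        push Not at hn
        exact hk (by simpa using hn)
      rcases this with h0 | h0 <;> rw [h0] <;> norm_num
    obtain ⟨p, q, hpq⟩ : ∃ p q, (univ.filter fun k => l k ≠ -2 ∧ l k ≠ 0) ⊆ {p, q} := by
      rcases h0 : (univ.filter fun k => l k ≠ -2 ∧ l k ≠ 0).card with _ | _ | _ | n
      · rw [card_eq_zero] at h0
        exact ⟨Classical.arbitrary V, Classical.arbitrary V, by rw [h0]; exact empty_subset _⟩
      · obtain ⟨p, hp⟩ := card_eq_one.1 h0
        exact ⟨p, p, by rw [hp]; simp⟩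
      · obtain ⟨p, q, -, hp⟩ := card_eq_two.1 h0
        exact ⟨p, q, by rw [hp]⟩
      · omega
    refine ⟨p, q, l p ^ 2 + 2 * l p, if p = q then 0 else l q ^ 2 + 2 * l q, fun i j => ?_⟩
    have h0 : ∀ k, k ≠ p → k ≠ q → (l k ^ 2 + 2 * l k) * e k i * e k j = 0 := fun k h3 h4 => by
      rw [out k fun h5 => by simpa [h3, h4] using hpq h5]; ring
    rw [hB, ← h.gram]
    split_ifs with h3
    · subst h3
      rw [sum_eq_single p (fun k _ hk => h0 k hk hk) (by simp)]; ring
    · rw [sum_eq_add p q h3 (fun k _ hk => h0 k hk.1 hk.2) (by simp) (by simp)]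
  simp only [hB']
  ring

/-- The size of the class of `i`, minus `2`, in a complete multipartite graph. -/
noncomputable def defect (G : SimpleGraph V) (i : V) : ℤ := ((nb G i)ᶜ.card : ℤ) - 2

namespace IsCM

variable (hc : IsCM G)
include hc

lemma disj {i j : V} (h : G.Adj i j) : Disjoint (nb G i)ᶜ (nb G j)ᶜ := by
  rw [disjoint_left]
  intro x hx hy
  simp only [mem_compl, mem_nb] at hx hy
  exact hc i x j hx (fun h0 => hy h0.symm) h

lemma cn_add {i j : V} (h : G.Adj i j) :
    cn G i j + (nb G i)ᶜ.card + (nb G j)ᶜ.card = Fintype.card V := by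
  rw [add_assoc, ← card_union_of_disjoint (hc.disj h), ← compl_inter, cn]
  have := card_add_card_compl (nb G i ∩ nb G j)
  exact this

end IsCM

lemma defect_ge (i : V) : -1 ≤ defect G i := by
  have : 0 < (nb G i)ᶜ.card := card_pos.2 ⟨i, by simp⟩
  unfold defect; omega

end

/-- Here w is the number of vertices minus 2. If all four defects are nonzero, h1 and h2 multiply to
(w + c + d - a - b)(w + a + b - c - d) = (a + b)(c + d). In terms of s = a + b + 2 and t = c + d + 2
this forces s = t = 0, so all defects are -1, which h1 excludes. If cd = 0 but ab ≠ 0, then h1 makes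
w too small. -/
lemma four_defects {w a b c d : ℤ} (hw : a + b + c + d + 6 ≤ w) (ha : -1 ≤ a) (hb : -1 ≤ b)
    (hc : -1 ≤ c) (hd : -1 ≤ d)
    (h1 : a * b * (w + c + d - a - b) = c * d * (a + b))
    (h2 : c * d * (w + a + b - c - d) = a * b * (c + d))
    (h3 : a * c * (w + b + d - a - c) = b * d * (a + c))
    (h4 : a * d * (w + b + c - a - d) = b * c * (a + d)) : a = 0 ∨ b = 0 := by
  by_contra hn
  push Not at hn
  obtain ⟨na, nb⟩ := hn
  have hab : a * b ≠ 0 := mul_ne_zero na nb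
  by_cases hcd : c * d = 0
  · rw [hcd, zero_mul] at h1
    have h0 := (mul_eq_zero.1 h1).resolve_left hab
    omega
  · have hm : (a * b) * (c * d) * ((w + c + d - a - b) * (w + a + b - c - d) - (a + b) * (c + d)) = 0 := by
      linear_combination (c * d * (w + a + b - c - d)) * h1 + c * d * (a + b) * h2
    have h5 := (mul_eq_zero.1 hm).resolve_left (mul_ne_zero hab hcd)
    obtain ⟨s, hs⟩ : ∃ s, s = a + b + 2 := ⟨_, rfl⟩
    obtain ⟨t, ht⟩ : ∃ t, t = c + d + 2 := ⟨_, rfl⟩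
    have s0 : 0 ≤ s := by omega
    have t0 : 0 ≤ t := by omega
    obtain ⟨v, hv⟩ : ∃ v, w = s + t + 2 + v := ⟨w - s - t - 2, by ring⟩
    have v0 : 0 ≤ v := by omega
    have e : (s + t + 2 + v) ^ 2 = (s - t) ^ 2 + (s - 2) * (t - 2) := by
      subst hv; subst hs; subst ht; linear_combination h5
    have m1 := mul_nonneg s0 t0
    have m2 := mul_nonneg s0 v0
    have m3 := mul_nonneg t0 v0
    have z : s = 0 ∧ t = 0 ∧ v = 0 := by
      refine ⟨?_, ?_, ?_⟩ <;> nlinarith [sq_nonneg v]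
    obtain ⟨rfl, rfl, rfl⟩ := z
    obtain rfl : a = -1 := by omega
    obtain rfl : b = -1 := by omega
    obtain rfl : c = -1 := by omega
    obtain rfl : d = -1 := by omega
    omega

/-- The equation says that the reciprocals of a, b, c add up to -1. So one of them is -1, and the
other two are opposite. -/
lemma three_defects {a b c : ℤ} (ha : -1 ≤ a) (hb : -1 ≤ b) (hc : -1 ≤ c)
    (h : a * b * c + a * b + b * c + c * a = 0) (na : a ≠ 0) (nb : b ≠ 0) :
    (a = -1 ∧ b = -1 ∧ c = 1) ∨ (a = -1 ∧ b = 1 ∧ c = -1) ∨ (a = 1 ∧ b = -1 ∧ c = -1) := by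
  have nc : c ≠ 0 := by
    rintro rfl
    exact mul_ne_zero na nb (by linarith)
  have key : ∀ x y z : ℤ, x = -1 → x * y * z + x * y + y * z + z * x = 0 → y = - z := by
    rintro x y z rfl h0; linarith
  rcases eq_or_ne a (-1) with h1 | h1
  · have := key a b c h1 h; omega
  rcases eq_or_ne b (-1) with h2 | h2
  · have := key b c a h2 (by linarith); omega
  rcases eq_or_ne c (-1) with h3 | h3
  · have := key c a b h3 (by linarith); omega
  have a1 : 1 ≤ a := by omega
  have b1 : 1 ≤ b := by omega
  have c1 : 1 ≤ c := by omega
  have : 0 < a * b * c + a * b + b * c + c * a := by positivity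
  omega

section
variable {V : Type*} [Fintype V] {G : SimpleGraph V}

lemma IsCM.gram (hc : IsCM G) {B : V → V → ℝ}
    (hB : ∀ i j, B i j = (cn G i j : ℝ) + if G.Adj i j then 2 else 0) :
    (∀ i, B i i = Fintype.card V - 2 - defect G i) ∧ ∀ i j, G.Adj i j →
      B i j = Fintype.card V - 2 - defect G i - defect G j := by
  constructor
  · intro i
    have : cn G i i + (nb G i)ᶜ.card = Fintype.card V := by
      rw [cn, inter_self]; exact card_add_card_compl _
    rw [hB, if_neg (G.loopless.irrefl i), ← this, defect]
    push_cast; ring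
  · intro i j h
    rw [hB, if_pos h, ← hc.cn_add h, defect, defect]
    push_cast; ring

/-- The minor of A² + 2A with rows i, j, k and columns i, j, l. -/
lemma IsCM.minor4 (hc : IsCM G) (h2 : AtMostTwo G) {i j k l : V} (ij : G.Adj i j) (ik : G.Adj i k)
    (il : G.Adj i l) (jk : G.Adj j k) (jl : G.Adj j l) (kl : G.Adj k l) :
    defect G i * defect G j * ((Fintype.card V : ℤ) - 2 + defect G k + defect G l - defect G i
      - defect G j) = defect G k * defect G l * (defect G i + defect G j) := by
  have : Nonempty V := ⟨i⟩
  have m := h2.minor (B := fun i j => (cn G i j : ℝ) + if G.Adj i j then 2 else 0)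
    (fun _ _ => rfl) i j k i j l
  obtain ⟨g1, g2⟩ := hc.gram (fun _ _ => rfl)
  rw [g1, g1, g2 k l kl, g2 j l jl, g2 k j jk.symm, g2 i j ij, g2 j i ij.symm, g2 k i ik.symm,
    g2 i l il] at m
  have : (defect G i : ℝ) * defect G j * ((Fintype.card V : ℝ) - 2 + defect G k + defect G l
      - defect G i - defect G j) = defect G k * defect G l * (defect G i + defect G j) := by
    linear_combination m
  exact_mod_cast this

/-- The principal minor at i, j, k when their three classes make up the whole graph. -/
lemma IsCM.minor3 (hc : IsCM G) (h2 : AtMostTwo G) {i j k : V} (ij : G.Adj i j) (ik : G.Adj i k)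
    (jk : G.Adj j k) (hn : (Fintype.card V : ℤ) = defect G i + defect G j + defect G k + 6) :
    defect G i * defect G j * defect G k + defect G i * defect G j + defect G j * defect G k +
      defect G k * defect G i = 0 := by
  have : Nonempty V := ⟨i⟩
  have m := h2.minor (B := fun i j => (cn G i j : ℝ) + if G.Adj i j then 2 else 0)
    (fun _ _ => rfl) i j k i j k
  obtain ⟨g1, g2⟩ := hc.gram (fun _ _ => rfl)
  rw [g1, g1, g1, g2 j k jk, g2 k j jk.symm, g2 i j ij, g2 j i ij.symm, g2 k i ik.symm,
    g2 i k ik] at m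
  have e : (Fintype.card V : ℝ) = defect G i + defect G j + defect G k + 6 := by exact_mod_cast hn
  rw [e] at m
  have : (defect G i : ℝ) * defect G j * defect G k + defect G i * defect G j +
      defect G j * defect G k + defect G k * defect G i = 0 := by
    linear_combination m / 4
  exact_mod_cast this

/-- Two adjacent vertices in classes of sizes different from `2`. -/
lemma IsCM.exceptional_triangle (hc : IsCM G) (h2 : AtMostTwo G) {u v k : V} (uv : G.Adj u v)
    (uk : G.Adj u k) (vk : G.Adj v k) (hu : defect G u ≠ 0) (hv : defect G v ≠ 0) :
    (∀ l, ¬ (G.Adj u l ∧ G.Adj v l ∧ G.Adj k l)) ∧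
    ((defect G u = -1 ∧ defect G v = -1 ∧ defect G k = 1) ∨
      (defect G u = -1 ∧ defect G v = 1 ∧ defect G k = -1) ∨
      (defect G u = 1 ∧ defect G v = -1 ∧ defect G k = -1)) := by
  have hno : ∀ l, ¬ (G.Adj u l ∧ G.Adj v l ∧ G.Adj k l) := by
    rintro l ⟨ul, vl, kl⟩
    have hd : Disjoint ((nb G u)ᶜ ∪ (nb G v)ᶜ) ((nb G k)ᶜ ∪ (nb G l)ᶜ) := by
      simp only [disjoint_union_left, disjoint_union_right]
      exact ⟨⟨hc.disj uk, hc.disj vk⟩, hc.disj ul, hc.disj vl⟩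
    have hcard := card_le_univ (((nb G u)ᶜ ∪ (nb G v)ᶜ) ∪ ((nb G k)ᶜ ∪ (nb G l)ᶜ))
    rw [card_union_of_disjoint hd, card_union_of_disjoint (hc.disj uv),
      card_union_of_disjoint (hc.disj kl)] at hcard
    rcases four_defects (w := (Fintype.card V : ℤ) - 2) (by unfold defect; omega) (defect_ge u)
      (defect_ge v) (defect_ge k) (defect_ge l) (hc.minor4 h2 uv uk ul vk vl kl)
      (hc.minor4 h2 kl uk.symm vk.symm ul.symm vl.symm uv)
      (hc.minor4 h2 uk uv ul vk.symm kl vl)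
      (hc.minor4 h2 ul uv uk vl.symm kl.symm vk) with h0 | h0
    · exact hu h0
    · exact hv h0
  refine ⟨hno, three_defects (defect_ge u) (defect_ge v) (defect_ge k)
    (hc.minor3 h2 uv uk vk ?_) hu hv⟩
  have hd : Disjoint ((nb G u)ᶜ ∪ (nb G v)ᶜ) (nb G k)ᶜ := by
    rw [disjoint_union_left]; exact ⟨hc.disj uk, hc.disj vk⟩
  have hun : ((nb G u)ᶜ ∪ (nb G v)ᶜ) ∪ (nb G k)ᶜ = univ := by
    ext x
    have := hno x
    simp only [mem_union, mem_compl, mem_nb, mem_univ]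
    tauto
  have := congrArg card hun
  rw [card_union_of_disjoint hd, card_union_of_disjoint (hc.disj uv), card_univ] at this
  unfold defect
  omega

lemma IsCM.iso_K (hc : IsCM G) {u v : V} (huv : G.Adj u v)
    (hno : ∀ k, G.Adj u k → ¬ G.Adj v k) : ∃ l m : ℕ, 1 ≤ m ∧ m ≤ l ∧ Nonempty (G ≃g K l m) := by
  have key : ∀ {u v : V}, G.Adj u v → (∀ k, G.Adj u k → ¬ G.Adj v k) →
      Nonempty (G ≃g joinBot (⊥ : SimpleGraph (Fin (nb G u).card)) (nb G v).card) := by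
    intro u v huv hno
    have ind : ∀ {u v : V}, (∀ k, G.Adj u k → ¬ G.Adj v k) → ∀ x ∈ nb G u, ∀ y ∈ nb G u,
        ¬ G.Adj x y := fun hno x hx y hy => hc x _ y (fun h => hno x (mem_nb.1 hx) h.symm)
          (hno y (mem_nb.1 hy))
    refine joinBot_iso (bot_emb (ind hno)) (ind fun k h1 h2 => hno k h2 h1) (fun w => ?_)
      fun x hx y hy => ?_
    · rw [mem_nb, mem_nb]
      by_contra hn
      push Not at hn
      exact hc u w v hn.1 (fun h => hn.2 h.symm) huv
    · rw [mem_nb] at hx hy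
      by_contra hn
      exact hc v x y (hno x hx) hn hy
  have pos : ∀ {u v : V}, G.Adj u v → 1 ≤ (nb G u).card := fun h => card_pos.2 ⟨_, mem_nb.2 h⟩
  have eqv : ∀ l m, joinBot (⊥ : SimpleGraph (Fin l)) m = K l m := by
    intro l m
    ext (x | x) (y | y) <;> simp [joinBot, K]
  rcases le_total (nb G v).card (nb G u).card with h | h
  · exact ⟨_, _, pos huv.symm, h, eqv _ _ ▸ key huv hno⟩
  · exact ⟨_, _, pos huv, h, eqv _ _ ▸ key huv.symm fun k h1 h2 => hno k h2 h1⟩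

/-- The complete multipartite graphs with at most two eigenvalues other than `-2` and `0`. -/
lemma IsCM.classify [Nonempty V] (hc : IsCM G) (h2 : AtMostTwo G) (hi : ∀ v, ∃ w, G.Adj v w) :
    (∃ l m : ℕ, 1 ≤ m ∧ m ≤ l ∧ Nonempty (G ≃g K l m)) ∨
    (∃ q a : ℕ, 2 ≤ q ∧ 1 ≤ a ∧ Nonempty (G ≃g joinBot (CP q) a)) ∨
    Nonempty (G ≃g joinBot (⊤ : SimpleGraph (Fin 2)) 3) := by
  by_cases htri : ∃ x y z, G.Adj x y ∧ G.Adj x z ∧ G.Adj y z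
  swap
  · left
    push Not at htri
    obtain ⟨v, hv⟩ := hi (Classical.arbitrary V)
    exact hc.iso_K hv fun k h1 => htri _ _ _ hv h1
  obtain ⟨x, y, z, xy, xz, yz⟩ := htri
  -- As there are at least three classes, every edge lies in a triangle.
  have ext3 : ∀ u v, G.Adj u v → ∃ k, G.Adj u k ∧ G.Adj v k := by
    intro u v huv
    by_contra hn
    push Not at hn
    have two : ∀ w a b, G.Adj a b → G.Adj w a ∨ G.Adj w b := by
      intro w a b hab
      by_contra h0
      push Not at h0
      exact hc a w b (fun h => h0.1 h.symm) h0.2 hab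
    have u1 := two u x y xy
    have u2 := two u x z xz
    have u3 := two u y z yz
    have v1 := two v x y xy
    have v2 := two v x z xz
    have v3 := two v y z yz
    have n1 := hn x
    have n2 := hn y
    have n3 := hn z
    tauto
  right
  -- Two classes of sizes other than 2 occur only for the class sizes 1, 1, 3. Otherwise all classes
  -- but at most one have size 2.
  by_cases hbad : ∃ u v, G.Adj u v ∧ defect G u ≠ 0 ∧ defect G v ≠ 0
  · right
    obtain ⟨u, v, uv, hu, hv⟩ := hbad
    obtain ⟨k, uk, vk⟩ := ext3 u v uv
    obtain ⟨hno, hd⟩ := hc.exceptional_triangle h2 uv uk vk hu hv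
    have key : ∀ {a b c : V}, G.Adj a b → G.Adj a c → G.Adj b c → defect G a = -1 →
        defect G b = -1 → defect G c = 1 → (∀ l, ¬ (G.Adj a l ∧ G.Adj b l ∧ G.Adj c l)) →
        Nonempty (G ≃g joinBot (⊤ : SimpleGraph (Fin 2)) 3) := by
      intro a b c ab ac bc ha hb hc' hno
      have single : ∀ {a : V}, defect G a = -1 → ∀ w, w ≠ a → G.Adj a w := by
        intro a ha w hw
        have h1 : (nb G a)ᶜ.card = 1 := by unfold defect at ha; omega
        by_contra hn
        exact hw (card_le_one.1 h1.le w (by simpa using hn) a (by simp))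
      have h3 : (nb G c)ᶜ.card = 3 := by unfold defect at hc'; omega
      rw [← h3]
      refine joinBot_iso (C := {a, b}) ⟨![a, b], ?_, ?_, ?_⟩ ?_ ?_ ?_
      · intro i j hij
        fin_cases i <;> fin_cases j <;> simp_all [ab.ne, ab.ne']
      · intro v; simp [eq_comm]
      · intro i j
        fin_cases i <;> fin_cases j <;> simp [ab, ab.symm]
      · intro x hx y hy
        simp only [mem_compl, mem_nb] at hx hy
        exact hc x c y (fun h => hx h.symm) hy
      · intro w
        have := hno w
        by_cases wa : w = a
        · simp [wa]
        by_cases wb : w = b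
        · simp [wb]
        right
        simp only [mem_compl, mem_nb]
        exact fun h => this ⟨single ha w wa, single hb w wb, h⟩
      · intro x hx w hw
        simp only [mem_compl, mem_nb] at hw
        simp only [mem_insert, mem_singleton] at hx
        rcases hx with rfl | rfl
        · exact single ha w fun h => hw (h ▸ ac.symm)
        · exact single hb w fun h => hw (h ▸ bc.symm)
    rcases hd with ⟨d1, d2, d3⟩ | ⟨d1, d2, d3⟩ | ⟨d1, d2, d3⟩
    · exact key uv uk vk d1 d2 d3 hno
    · exact key uk uv vk.symm d1 d3 d2 fun l hl => hno l ⟨hl.1, hl.2.2, hl.2.1⟩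
    · exact key vk uv.symm uk.symm d2 d3 d1 fun l hl => hno l ⟨hl.2.2, hl.1, hl.2.1⟩
  · left
    push Not at hbad
    obtain ⟨u, hu⟩ : ∃ u, ∀ v, G.Adj u v → defect G v = 0 := by
      by_cases h0 : ∃ u, defect G u ≠ 0
      · obtain ⟨u, hu⟩ := h0
        exact ⟨u, fun v huv => hbad u v huv hu⟩
      · push Not at h0
        exact ⟨x, fun v _ => h0 v⟩
    obtain ⟨q, hq, hE⟩ := cp_emb (G := G) (C := nb G u) (by
      intro v hv
      have h0 : (nb G v)ᶜ.card = 2 := by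
        have := hu v (mem_nb.1 hv)
        unfold defect at this
        omega
      have : ((nb G u).filter fun y => y ≠ v ∧ ¬ G.Adj v y) = (nb G v)ᶜ.erase v := by
        ext y
        simp only [mem_filter, mem_nb, mem_erase, mem_compl, and_iff_right_iff_imp]
        rintro ⟨-, h1⟩
        by_contra h3
        exact hc u y v h3 (fun h => h1 h.symm) (mem_nb.1 hv)
      rw [this, card_erase_of_mem (by simp), h0])
    refine ⟨q, (nb G u)ᶜ.card, ?_, card_pos.2 ⟨u, by simp⟩, joinBot_iso hE ?_ (fun w => ?_) ?_⟩
    · obtain ⟨v, hv⟩ := hi u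
      obtain ⟨k, uk, vk⟩ := ext3 u v hv
      obtain ⟨f, -, h4, h5⟩ := hE
      obtain ⟨i, hi⟩ := (h4 v).1 (mem_nb.2 hv)
      obtain ⟨j, hj⟩ := (h4 k).1 (mem_nb.2 uk)
      rw [← hi, ← hj, ← h5, CP_adj] at vk
      have h6 := i.1.2
      have h7 := j.1.2
      have : i.1.1 ≠ j.1.1 := fun h => vk (Fin.ext h)
      omega
    · intro a ha b hb
      simp only [mem_compl, mem_nb] at ha hb
      exact hc a u b (fun h => ha h.symm) hb
    · rw [mem_compl]; exact em _
    · intro a ha b hb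
      simp only [mem_compl, mem_nb] at ha hb
      by_contra hn
      exact hc u b a hb (fun h => hn h.symm) ha

end
end TwoEig
end

/-! ### Complete multipartite graphs: spectra and comparison. -/

open scoped Classical
namespace TwoEig
open Finset

/-- `R` is a positive eigenvalue. -/
def PosEig {V : Type*} [Fintype V] (G : SimpleGraph V) (R : ℝ) : Prop :=
  0 < R ∧ ∃ x : V → ℝ, (∀ i, ∑ j ∈ nb G i, x j = R * x i) ∧ ∃ i, x i ≠ 0

/-- The sum of the squares of the eigenvalues. -/
noncomputable def sqSum {V : Type*} [Fintype V] (G : SimpleGraph V) : ℝ :=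
  ((adjSpectrum G).map fun x => x ^ 2).sum

lemma sqSum_eq {V : Type*} [Fintype V] (G : SimpleGraph V) : sqSum G = ∑ i, ∑ _j ∈ nb G i, 1 := by
  obtain ⟨l, e, h⟩ := exists_eigenbasis G
  have := h.sum_sq
  unfold sqSum
  rw [h.spec, Multiset.map_map]
  simp only [sum_const, nsmul_eq_mul, mul_one]
  rw [← this]
  rfl

lemma PosEig.of_mem {V : Type*} [Fintype V] {G : SimpleGraph V} {R : ℝ} (h : R ∈ posSpec G) :
    PosEig G R := by
  obtain ⟨l, e, hb⟩ := exists_eigenbasis G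
  unfold posSpec at h
  rw [Multiset.mem_filter, hb.spec, Multiset.mem_map] at h
  obtain ⟨⟨k, -, rfl⟩, hR⟩ := h
  exact ⟨hR, e k, hb.eig k, hb.ne_zero k⟩

lemma PosEig.iso {V W : Type*} [Fintype V] [Fintype W] {G : SimpleGraph V} {H : SimpleGraph W}
    {R : ℝ} (h : PosEig G R) (f : Nonempty (G ≃g H)) : PosEig H R := by
  obtain ⟨f⟩ := f
  obtain ⟨hR, x, hx, i, hi⟩ := h
  exact ⟨hR, fun i => x (f.symm i), fun i => by rw [nb_iso_sum f x, hx], f i, by simpa using hi⟩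

lemma posSpec_ne {V : Type*} [Fintype V] {G : SimpleGraph V} {u v : V} (h : G.Adj u v) :
    ∃ R, R ∈ posSpec G := by
  obtain ⟨l, e, hb⟩ := exists_eigenbasis G
  by_contra hn
  push Not at hn
  have le : ∀ k, l k ≤ 0 := fun k => not_lt.1 fun h0 => hn (l k) (Multiset.mem_filter.2
    ⟨by rw [hb.spec]; exact Multiset.mem_map_of_mem l (mem_univ_val k), h0⟩)
  have z := (sum_eq_zero_iff_of_nonpos fun k _ => le k).1 hb.sum_zero
  have := hb.first u v
  rw [if_pos h, sum_eq_zero fun k _ => by rw [z k (mem_univ k)]; ring] at this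
  norm_num at this

lemma K_eig {l m : ℕ} {θ : ℝ} (hθ : θ ≠ 0) {x : Fin l ⊕ Fin m → ℝ}
    (hx : ∀ i, ∑ j ∈ nb (K l m) i, x j = θ * x i) (h0 : ∃ i, x i ≠ 0) : θ ^ 2 = l * m := by
  have h1 : ∀ i, ∑ j, x (.inr j) = θ * x (.inl i) := fun i => by
    rw [← hx, nb_sum, Fintype.sum_sum_type]; simp [K]
  have h2 : ∀ j, ∑ i, x (.inl i) = θ * x (.inr j) := fun i => by
    rw [← hx, nb_sum, Fintype.sum_sum_type]; simp [K]
  have s1 : l * ∑ j, x (.inr j) = θ * ∑ i, x (.inl i) := by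
    rw [mul_sum univ _ θ, ← sum_congr rfl fun i _ => h1 i]; simp
  have s2 : m * ∑ i, x (.inl i) = θ * ∑ j, x (.inr j) := by
    rw [mul_sum univ _ θ, ← sum_congr rfl fun i _ => h2 i]; simp
  have hS : ∑ i, x (.inl i) ≠ 0 := by
    intro hS
    rw [hS, mul_zero] at s2
    have hT := (mul_eq_zero.1 s2.symm).resolve_left hθ
    obtain ⟨i | i, hi⟩ := h0
    · exact hi ((mul_eq_zero.1 ((h1 i).symm.trans hT)).resolve_left hθ)
    · exact hi ((mul_eq_zero.1 ((h2 i).symm.trans hS)).resolve_left hθ)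
  apply mul_right_cancel₀ hS
  linear_combination - θ * s1 - l * s2

lemma K_sqSum (l m : ℕ) : sqSum (K l m) = 2 * (l * m) := by
  rw [sqSum_eq]
  simp_rw [nb_sum, Fintype.sum_sum_type]
  simp [K]; ring

lemma three_valued {t : ℝ} (S : Multiset ℝ) (h : ∀ x ∈ S, x = t ∨ x = -t ∨ x = 0) :
    ∃ a b c : ℕ, S = Multiset.replicate a t + Multiset.replicate b (-t) +
      Multiset.replicate c 0 := by
  induction S using Multiset.induction with
  | empty => exact ⟨0, 0, 0, rfl⟩
  | cons x S ih =>
    obtain ⟨a, b, c, hS⟩ := ih fun x hx => h x (Multiset.mem_cons_of_mem hx)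
    rcases h x (Multiset.mem_cons_self _ _) with rfl | rfl | rfl
    · exact ⟨a + 1, b, c, by rw [hS, Multiset.replicate_succ, Multiset.cons_add, Multiset.cons_add]⟩
    · exact ⟨a, b + 1, c, by rw [hS, Multiset.replicate_succ, Multiset.add_cons, Multiset.cons_add]⟩
    · exact ⟨a, b, c + 1, by rw [hS, Multiset.replicate_succ, Multiset.add_cons]⟩

/-- Every nonzero eigenvalue has the square lm. The zero trace balances the signs, and the sum of
squares 2lm leaves one eigenvalue of each sign. -/
lemma K_spectrum {l m : ℕ} (hl : 1 ≤ l) (hm : 1 ≤ m) : adjSpectrum (K l m) =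
    {√(l * m), -√(l * m)} + Multiset.replicate (l + m - 2) 0 := by
  have hlm : (0 : ℝ) < l * m := by
    have : 0 < l * m := by positivity
    exact_mod_cast this
  have ht : √(l * m : ℝ) ^ 2 = l * m := Real.sq_sqrt hlm.le
  have ht0 : √(l * m : ℝ) ≠ 0 := by positivity
  generalize √(l * m : ℝ) = t at *
  obtain ⟨a, b, c, h⟩ := three_valued (t := t) (adjSpectrum (K l m)) fun x hx => by
    obtain ⟨v, e, hb⟩ := exists_eigenbasis (K l m)
    rw [hb.spec, Multiset.mem_map] at hx
    obtain ⟨k, -, rfl⟩ := hx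
    by_cases h0 : v k = 0
    · exact Or.inr (Or.inr h0)
    · have := K_eig h0 (hb.eig k) (hb.ne_zero k)
      rw [← ht, sq_eq_sq_iff_eq_or_eq_neg] at this
      tauto
  have h1 := sum_adjSpectrum (K l m)
  have h2 := K_sqSum l m
  have h3 := card_adjSpectrum (K l m)
  unfold sqSum at h2
  rw [h] at h1 h2 h3
  simp [ht] at h1 h2 h3
  have hab : (a : ℝ) = b := by
    apply mul_right_cancel₀ ht0; linarith
  have hab' : (a : ℝ) + b = 2 := by
    apply mul_right_cancel₀ hlm.ne'; linarith
  obtain rfl : a = b := by exact_mod_cast hab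
  obtain rfl : a = 1 := by
    have : (a : ℝ) = 1 := by linarith
    exact_mod_cast this
  obtain rfl : c = l + m - 2 := by omega
  rw [h]; rfl

/-- With c = lm/d, the graph `K d c` has the same nonzero eigenvalues, and fewer vertices because (l
- d)(d - m) > 0. -/
lemma K_not_isDS {V : Type*} [Fintype V] {G : SimpleGraph V} (hi : ∀ v, ∃ w, G.Adj v w) {l m d : ℕ}
    (hm : 1 ≤ m) (hd : d ∣ l * m) (h1 : m < d) (h2 : d < l) (f : Nonempty (G ≃g K l m)) :
    ¬ IsDS G := by
  obtain ⟨c, hc⟩ := hd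
  have c1 : 1 ≤ c := by
    rcases Nat.eq_zero_or_pos c with rfl | h
    · rw [mul_zero] at hc
      have : 0 < l * m := Nat.mul_pos (by omega) hm
      omega
    · exact h
  have hlt : d + c < l + m := by
    by_contra hn
    push Not at hn
    have h3 := Nat.mul_le_mul_left d hn
    zify at h1 h2 hc h3
    nlinarith
  have e : (l : ℝ) * m = d * c := by exact_mod_cast hc
  have hp : 0 < l + m - (d + c) := by omega
  refine not_isDS (H := SimpleGraph.sum (K d c) (⊥ : SimpleGraph (Fin (l + m - (d + c))))) hi ?_
    (v := .inr ⟨0, hp⟩) (by rintro (w | w) <;> simp)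
  rw [adjSpectrum_iso f.some, adjSpectrum_sum, adjSpectrum_bot, K_spectrum (by omega) c1,
    K_spectrum (by omega) hm, add_assoc, ← Multiset.replicate_add, e, Fintype.card_fin]
  congr 2
  omega

lemma joinBot_sum_inl {W : Type*} [Fintype W] (H : SimpleGraph W) (a : ℕ) (x : W ⊕ Fin a → ℝ)
    (i : W) : ∑ j ∈ nb (joinBot H a) (.inl i), x j =
      ∑ j ∈ nb H i, x (.inl j) + ∑ j, x (.inr j) := by
  rw [nb_sum, nb_sum, Fintype.sum_sum_type]
  simp [joinBot]

lemma joinBot_sum_inr {W : Type*} [Fintype W] (H : SimpleGraph W) (a : ℕ) (x : W ⊕ Fin a → ℝ)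
    (i : Fin a) : ∑ j ∈ nb (joinBot H a) (.inr i), x j = ∑ j, x (.inl j) := by
  rw [nb_sum, Fintype.sum_sum_type]
  simp [joinBot]

lemma nb_CP_sum {q : ℕ} (x : Fin q × Fin 2 → ℝ) (i : Fin q × Fin 2) :
    ∑ j ∈ nb (CP q) i, x j = ∑ b, x b - (x (i.1, 0) + x (i.1, 1)) := by
  rw [nb_sum, ← cp_sum]; simp

lemma CP_join_root {q a : ℕ} {R : ℝ} (h : PosEig (joinBot (CP q) a) R) :
    R ^ 2 = (2 * q - 2) * R + 2 * q * a := by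
  obtain ⟨hR, x, hx, h0⟩ := h
  have h1 : ∀ c d, ∑ b, x (.inl b) - (x (.inl (c, 0)) + x (.inl (c, 1))) + ∑ j, x (.inr j) =
      R * x (.inl (c, d)) := fun c d => by
    rw [← hx, joinBot_sum_inl, nb_CP_sum fun b => x (.inl b)]
  have h2 : ∀ j, ∑ b, x (.inl b) = R * x (.inr j) := fun j => by rw [← hx, joinBot_sum_inr]
  obtain ⟨X, Y, a0, a1, a2, a3, a4⟩ := cp_const hR.ne' (by positivity) (fun c => h1 c 0)
    fun c => h1 c 1
  obtain rfl : X = Y := mul_left_cancel₀ hR.ne' (a3.trans a4.symm)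
  have h3 : R * ∑ j, x (.inr j) = a * (2 * q * X) := by
    rw [mul_sum, ← sum_congr rfl fun j _ => h2 j, a2]
    simp only [sum_const, card_univ, Fintype.card_fin, nsmul_eq_mul]; ring
  have hX : X ≠ 0 := by
    rintro rfl
    obtain ⟨⟨c, d⟩ | j, hi⟩ := h0
    · rcases fin_two d with rfl | rfl
      · exact hi (a0 c)
      · exact hi (a1 c)
    · have := h2 j
      rw [a2] at this
      simp only [add_zero, mul_zero] at this
      exact hi ((mul_eq_zero.1 this.symm).resolve_left hR.ne')
  apply mul_right_cancel₀ hX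
  linear_combination R * a3 + h3

lemma CP_join_sqSum (q a : ℕ) :
    sqSum (joinBot (CP q) a) = 2 * (q * (2 * q - 2) + 2 * q * a) := by
  rw [sqSum_eq, Fintype.sum_sum_type]
  simp_rw [joinBot_sum_inl _ _ fun _ => (1 : ℝ), joinBot_sum_inr _ _ fun _ => (1 : ℝ),
    nb_CP_sum fun _ => (1 : ℝ)]
  simp; ring

lemma edge_join_root {R : ℝ} (h : PosEig (joinBot (⊤ : SimpleGraph (Fin 2)) 3) R) : R = 3 := by
  obtain ⟨hR, x, hx, h0⟩ := h
  have n0 : nb (⊤ : SimpleGraph (Fin 2)) 0 = {1} := by ext j; fin_cases j <;> simp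
  have n1 : nb (⊤ : SimpleGraph (Fin 2)) 1 = {0} := by ext j; fin_cases j <;> simp
  have h1 := hx (.inl 0)
  have h2 := hx (.inl 1)
  have h3 : ∀ j, x (.inl 0) + x (.inl 1) = R * x (.inr j) := fun j => by
    rw [← hx, joinBot_sum_inr, Fin.sum_univ_two]
  rw [joinBot_sum_inl, n0, sum_singleton, Fin.sum_univ_three] at h1
  rw [joinBot_sum_inl, n1, sum_singleton, Fin.sum_univ_three] at h2
  have e : x (.inl 1) = x (.inl 0) := by
    apply mul_left_cancel₀ (show R + 1 ≠ 0 by positivity); linarith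
  rw [e] at h1 h3
  have hX : x (.inl 0) ≠ 0 := by
    intro hX
    obtain ⟨i | j, hi⟩ := h0
    · rcases fin_two i with rfl | rfl
      · exact hi hX
      · exact hi (e.trans hX)
    · have := h3 j
      rw [hX, add_zero] at this
      exact hi ((mul_eq_zero.1 this.symm).resolve_left hR.ne')
  have : (R - 3) * (R + 2) = 0 := by
    apply mul_right_cancel₀ hX
    linear_combination - R * h1 - h3 0 - h3 1 - h3 2
  rcases mul_eq_zero.1 this with h4 | h4 <;> linarith

lemma edge_join_sqSum : sqSum (joinBot (⊤ : SimpleGraph (Fin 2)) 3) = 14 := by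
  have n0 : nb (⊤ : SimpleGraph (Fin 2)) 0 = {1} := by ext j; fin_cases j <;> simp
  have n1 : nb (⊤ : SimpleGraph (Fin 2)) 1 = {0} := by ext j; fin_cases j <;> simp
  rw [sqSum_eq, Fintype.sum_sum_type]
  simp_rw [joinBot_sum_inl _ _ fun _ => (1 : ℝ), joinBot_sum_inr _ _ fun _ => (1 : ℝ)]
  simp [Fin.sum_univ_two, n0, n1]; norm_num

/-- The complete multipartite graphs together with their positive eigenvalue `R` and the sum `e` of
the squares of their eigenvalues. -/
inductive CMFam {V : Type*} (G : SimpleGraph V) (R e : ℝ) : Prop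
  | bip (l m : ℕ) (hm : 1 ≤ m) (hl : m ≤ l) (f : Nonempty (G ≃g K l m)) (hR : R ^ 2 = l * m)
    (he : e = 2 * (l * m))
  | cp (q a : ℕ) (hq : 2 ≤ q) (ha : 1 ≤ a) (f : Nonempty (G ≃g joinBot (CP q) a))
    (hR : R ^ 2 = (2 * q - 2) * R + 2 * q * a) (he : e = 2 * (q * (2 * q - 2) + 2 * q * a))
  | edge (f : Nonempty (G ≃g joinBot (⊤ : SimpleGraph (Fin 2)) 3)) (hR : R = 3) (he : e = 14)

lemma sqSum_iso {V W : Type*} [Fintype V] [Fintype W] {G : SimpleGraph V} {H : SimpleGraph W}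
    (f : Nonempty (G ≃g H)) : sqSum G = sqSum H := by
  unfold sqSum; rw [adjSpectrum_iso f.some]

lemma IsCM.fam {V : Type*} [Fintype V] [Nonempty V] {G : SimpleGraph V} (hc : IsCM G)
    (h2 : AtMostTwo G) (hi : ∀ v, ∃ w, G.Adj v w) {R : ℝ} (hR : R ∈ posSpec G) :
    CMFam G R (sqSum G) := by
  have hP := PosEig.of_mem hR
  rcases hc.classify h2 hi with ⟨l, m, hm, hl, f⟩ | ⟨q, a, hq, ha, f⟩ | f
  · obtain ⟨r0, x, hx, hx0⟩ := hP.iso f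
    exact .bip l m hm hl f (K_eig r0.ne' hx hx0) ((sqSum_iso f).trans (K_sqSum l m))
  · exact .cp q a hq ha f (CP_join_root (hP.iso f)) ((sqSum_iso f).trans (CP_join_sqSum q a))
  · exact .edge f (edge_join_root (hP.iso f)) ((sqSum_iso f).trans edge_join_sqSum)

/-- The exceptional complete bipartite graphs. -/
def ExceptionalK {V : Type*} (G : SimpleGraph V) : Prop :=
  ∃ l m : ℕ, 1 ≤ m ∧ m ≤ l ∧ (∃ d : ℕ, d ∣ l * m ∧ m < d ∧ d < l) ∧ Nonempty (G ≃g K l m)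

/-- For m' < m the sum l' + m' would exceed l + m; for m' > m the number l' is a divisor strictly
between m and l. -/
lemma K_params {l m l' m' : ℕ} (hm : 1 ≤ m) (hl : m ≤ l) (hl' : m' ≤ l')
    (hx : ¬ ∃ d : ℕ, d ∣ l * m ∧ m < d ∧ d < l) (h : l * m = l' * m')
    (hc : l' + m' ≤ l + m) : l' = l ∧ m' = m := by
  rcases lt_trichotomy m' m with h1 | rfl | h1
  · exfalso
    zify at *
    nlinarith
  · exact ⟨(Nat.eq_of_mul_eq_mul_right hm h).symm, rfl⟩
  · exfalso
    refine hx ⟨l', ⟨m', h⟩, by omega, ?_⟩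
    by_contra hn
    push Not at hn
    have : l * m < l' * m' := by nlinarith
    omega

/-- Eliminating a and a' gives (q - q')(R + 1 - q - q') = 0, and R exceeds both 2q - 1 and 2q' - 1.
-/
lemma CP_join_params {R : ℝ} (hR0 : 0 < R) {q a q' a' : ℕ} (hq : 2 ≤ q) (hq' : 2 ≤ q')
    (ha : 1 ≤ a) (ha' : 1 ≤ a')
    (hR : R ^ 2 = (2 * q - 2) * R + 2 * q * a) (hR' : R ^ 2 = (2 * q' - 2) * R + 2 * q' * a')
    (he : (q : ℝ) * (2 * q - 2) + 2 * q * a = q' * (2 * q' - 2) + 2 * q' * a') :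
    q' = q ∧ a' = a := by
  have big : ∀ {q a : ℕ}, 2 ≤ q → 1 ≤ a → R ^ 2 = (2 * q - 2) * R + 2 * q * a →
      2 * (q : ℝ) - 1 < R := by
    intro q a hq ha h
    have hq : (2 : ℝ) ≤ q := by exact_mod_cast hq
    have ha : (1 : ℝ) ≤ a := by exact_mod_cast ha
    by_contra hn
    push Not at hn
    nlinarith
  have b := big hq ha hR
  have b' := big hq' ha' hR'
  have h1 : ((q : ℝ) - q') * (R + 1 - q - q') = 0 := by
    linear_combination (hR' - hR - he) / 2
  have h2 : (q : ℝ) - q' = 0 := (mul_eq_zero.1 h1).resolve_right (by linarith)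
  obtain rfl : q' = q := by
    have : (q' : ℝ) = q := by linarith
    exact_mod_cast this
  refine ⟨rfl, ?_⟩
  have h3 : (a' : ℝ) = a := by
    apply mul_left_cancel₀ (show (2 * q' : ℝ) ≠ 0 by positivity); linarith
  exact_mod_cast h3

lemma CMFam.iso {V W : Type*} [Fintype V] [Fintype W] {G : SimpleGraph V} {H : SimpleGraph W}
    {R e : ℝ} (hR0 : 0 < R) (hG : CMFam G R e) (hx : ¬ ExceptionalK G) (hH : CMFam H R e)
    (hn : Fintype.card W ≤ Fintype.card V) : Nonempty (H ≃g G) := by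
  have tr : ∀ {U : Type} {F : SimpleGraph U}, Nonempty (H ≃g F) → Nonempty (G ≃g F) →
      Nonempty (H ≃g G) := fun f g => ⟨f.some.trans g.some.symm⟩
  -- For a bipartite graph R² is half the sum of squares. Equating this with the value for the other
  -- family forces R = q, which violates the quadratic equation.
  have bip_cp : ∀ {l m q a : ℕ}, 2 ≤ q → 1 ≤ a → R ^ 2 = l * m → e = 2 * (l * m) →
      R ^ 2 = (2 * q - 2) * R + 2 * q * a → e = 2 * (q * (2 * q - 2) + 2 * q * a) → False := by
    intro l m q a hq ha h1 h2 h3 h4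
    have hq : (2 : ℝ) ≤ q := by exact_mod_cast hq
    have ha : (1 : ℝ) ≤ a := by exact_mod_cast ha
    have h5 : (2 * q - 2) * (R - q) = 0 := by linarith
    have h6 : R = q := by
      have := (mul_eq_zero.1 h5).resolve_left (by linarith)
      linarith
    subst h6
    nlinarith
  have bip_edge : ∀ {l m : ℕ}, R ^ 2 = l * m → e = 2 * (l * m) → R = 3 → e = 14 → False := by
    intro l m h1 h2 h3 h4
    rw [h3] at h1
    linarith
  -- The equation asks for 14 to be divisible by 4.
  have cp_edge : ∀ {q a : ℕ}, e = 2 * (q * (2 * q - 2) + 2 * q * a) → e = 14 → False := by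
    intro q a h1 h2
    have : (2 * (q * (2 * q - 2) + 2 * q * a) : ℤ) = 14 := by exact_mod_cast h1.symm.trans h2
    have h4 : 4 * ((q : ℤ) * (q - 1) + q * a) = 14 := by linarith
    omega
  cases hG with
  | bip l m hm hl f hR he =>
    cases hH with
    | bip l' m' hm' hl' f' hR' he' =>
      rw [card_iso f, card_iso f'] at hn
      obtain ⟨rfl, rfl⟩ := K_params hm hl hl' (fun h => hx ⟨l, m, hm, hl, h, f⟩)
        (by exact_mod_cast hR.symm.trans hR') (by simpa using hn)
      exact tr f' f
    | cp q a hq ha f' hR' he' => exact (bip_cp hq ha hR he hR' he').elim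
    | edge f' hR' he' => exact (bip_edge hR he hR' he').elim
  | cp q a hq ha f hR he =>
    cases hH with
    | bip l m hm hl f' hR' he' => exact (bip_cp hq ha hR' he' hR he).elim
    | cp q' a' hq' ha' f' hR' he' =>
      obtain ⟨rfl, rfl⟩ := CP_join_params hR0 hq hq' ha ha' hR hR' (by linarith)
      exact tr f' f
    | edge f' hR' he' => exact (cp_edge he he').elim
  | edge f hR he =>
    cases hH with
    | bip l m hm hl f' hR' he' => exact (bip_edge hR' he' hR he).elim
    | cp q' a' hq' ha' f' hR' he' => exact (cp_edge he' he).elim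
    | edge f' => exact tr f' f

/-- The core of H has at most one positive eigenvalue, like G, so it is complete multipartite too.
It shares the positive eigenvalue and the sum of squared eigenvalues with G and has at most as many
vertices, which identifies it. -/
lemma IsCM.iso_of_cospectral {V W : Type*} [Fintype V] [Fintype W] {G : SimpleGraph V}
    {H : SimpleGraph W} (hc : IsCM G) (h2 : AtMostTwo G) (hi : ∀ v, ∃ w, G.Adj v w)
    (hx : ¬ ExceptionalK G) (hs : adjSpectrum H = adjSpectrum G) : Nonempty (H ≃g G) := by
  have hn : Fintype.card V = Fintype.card W := by
    rw [← card_adjSpectrum G, ← card_adjSpectrum H, hs]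
  obtain ⟨e1, e2⟩ := filter_core_eq hs
  have h2' : AtMostTwo (core H) := e1.mp h2
  rcases isEmpty_or_nonempty V with hV | hV
  · have : IsEmpty W := Fintype.card_eq_zero_iff.1 (by rw [← hn, Fintype.card_eq_zero])
    exact ⟨⟨Equiv.equivOfIsEmpty _ _, fun {a} => isEmptyElim a⟩⟩
  obtain ⟨v, hv⟩ := hi (Classical.arbitrary V)
  obtain ⟨R, hR⟩ := posSpec_ne hv
  have hR' : R ∈ posSpec (core H) := by rw [e2]; exact hR
  have hc' : IsCM (core H) := by
    by_contra hn
    obtain ⟨r, s, hp, -⟩ := exists_PD h2' (core_noiso H) hn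
    have := hc.card_posSpec
    rw [← e2, hp] at this
    simp at this
  obtain ⟨-, x, -, i, -⟩ := PosEig.of_mem hR'
  have : Nonempty {v // ∃ w, H.Adj v w} := ⟨i⟩
  have F := hc.fam h2 hi hR
  have F' := hc'.fam h2' (core_noiso H) hR'
  have he : sqSum (core H) = sqSum G := by
    obtain ⟨c, h0⟩ := adjSpectrum_core H
    unfold sqSum
    rw [← hs, h0]
    simp
  rw [he] at F'
  exact iso_of_core (F.iso (PosEig.of_mem hR).1 hx F' (hn ▸ card_core_le H)) hn

end TwoEig

/-! ### The theorem, assembled from the two cases. -/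

theorem mainTheorem5 {V : Type*} [Fintype V] (G : SimpleGraph V) (hG : TwoEig.InH' G) :
    ¬ TwoEig.IsDS G ↔
      (∃ l m : ℕ, 1 ≤ m ∧ m ≤ l ∧ (∃ d : ℕ, d ∣ l * m ∧ m < d ∧ d < l) ∧
        Nonempty (G ≃g TwoEig.K l m)) ∨
      (∃ k : ℕ, 2 ≤ k ∧
        (Nonempty (G ≃g TwoEig.G4 k) ∨ Nonempty (G ≃g TwoEig.G5 (k + 1) k) ∨
          Nonempty (G ≃g TwoEig.G8 k k))) ∨
      (Nonempty (G ≃g TwoEig.G3) ∨ Nonempty (G ≃g TwoEig.G5 4 2) ∨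
        Nonempty (G ≃g TwoEig.G11) ∨ Nonempty (G ≃g TwoEig.G12)) := by
  have h2 : TwoEig.AtMostTwo G := by
    unfold TwoEig.AtMostTwo
    convert hG.1
  constructor
  · intro h
    by_contra hn
    by_cases hc : TwoEig.IsCM G
    · exact h fun _ _ hs => hc.iso_of_cospectral h2 hG.2 (fun hx => hn (Or.inl hx)) hs
    · exact h (TwoEig.isDS_of_not_cm h2 hG.2 hc fun hx => hn (Or.inr hx))
  · rintro (⟨l, m, hm, -, ⟨d, hd, h3, h4⟩, f⟩ | hx)
    · exact TwoEig.K_not_isDS hG.2 hm hd h3 h4 f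
    · exact TwoEig.Exceptional.not_isDS h2 hG.2 hx
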